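/- **Setting.** Let $\varepsilon_{\max}\in(0,\infty]$ and let $G(t;\varepsilon)=(G_1,G_2)(t;\varepsilon)$, $t\in\mathbb R$, $\varepsilon\in[0,\varepsilon_{\max})$, be a family of plane curves such that the derivatives $\partial_t^i\partial_\varepsilon^m G$, $i\le 3$, $m\le 1$, exist and are continuous, $\partial_tG_1>0$ and $\partial_t^2G_2\,\partial_tG_1-\partial_tG_2\,\partial_t^2G_1>0$. Put $g=(g_1,g_2)=G(\cdot;0)$ and $\Xi_\varepsilon=\{x: \exists t,\ x_1=G_1(t;\varepsilon),\ x_2>G_2(t;\varepsilon)\}$. For $\varepsilon_1<\varepsilon_2$ assume $\Xi_{\varepsilon_2}\subset\Xi_{\varepsilon_1}$ and that the curve $G(\cdot;\varepsilon_1)$ does not meet $\overline{\Xi_{\varepsilon_2}}$. For every $\varepsilon\in(0,\varepsilon_{\max})$ and $t$ assume that exactly two tangents to $G(\cdot;\varepsilon)$ pass through $g(t)$, with tangency points $w_R(t)=G(t_R;\varepsilon)$ and $w_L(t)=G(t_L;\varepsilon)$, $t_R<t_L$; that each of these two lines meets $g$ at exactly two points; that their slopes $\kappa_R(t;\varepsilon),\kappa_L(t;\varepsilon)$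 satisfy $\partial_\varepsilon\kappa_R\ne0$, $\partial_\varepsilon\kappa_L\neq 0$; and that, with $\lambda_R,\lambda_L$ defined by $w_R'=\lambda_R(g-w_R)$, $w_L'=\lambda_L(g-w_L)$, one has for every $t_0$ $$(1+|w_R(t)-g(t)|)\,e^{-\int_t^{t_0}\lambda_R}\to0\ (t\to-\infty),\qquad (1+|w_L(t)-g(t)|)\,e^{\int_{t_0}^{t}\lambda_L}\to0\ (t\to+\infty).$$ Let $f\in C^2(\mathbb R)$, $\gamma=(g_1,g_2,f)$, $\kappa_2=g_2'/g_1'$, $\kappa_3=f'/g_1'$, and assume that $\mathrm{tors}=\kappa_3'/\kappa_2'$ is piecewise monotone with finitely many pieces and that for all $\varepsilon\in(0,\varepsilon_{\max})$ and $v$ $$\int_{-\infty}^v f'(\tau)e^{-\int_\tau^v\lambda_R}d\tau>-\infty,\qquad \int_v^{\infty} f'(\tau)e^{\int_v^\tau\lambda_L}d\tau<+\infty .$$ **Tangent domains.** For $-\infty\le p\le q\le\infty$ let $\Omega_R(p,q;\varepsilon)=\bigcup_{t\in[p,q]\cap\mathbb R}[g(t),w_R(t)]$, and let $\Omega_L(p,q;\varepsilon)$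 be the same with $w_L$. A standard candidate on $\Omega_R(p,q;\varepsilon)$ is a function $$B(x)=f(t)+(x_1-g_1(t))\big(\kappa_3(t)+(\kappa_R(t)-\kappa_2(t))\beta(t)\big),\quad x\in[g(t),w_R(t)],$$ where $(\kappa_2-\kappa_R)\beta'+\kappa_2'\beta=\kappa_3'$ on $[p,q]\cap\mathbb R$, $\beta'\le0$, $\beta'<0$ in the interior, and, if $p=-\infty$, the constant of integration at $-\infty$ vanishes, i.e. $e^{-\int_r^t\kappa_2'/(\kappa_2-\kappa_R)}F(r)\to0$ as $r\to-\infty$, where $F=\frac{\kappa_2-\kappa_R}{\kappa_2'}\beta'=\mathrm{tors}-\beta$ is called the force of the candidate. On $\Omega_L$ replace $\kappa_R$ by $\kappa_L$, require $\beta'\ge0$, $\beta'>0$ in the interior, and, if $q=+\infty$, $e^{\int_t^r\kappa_2'/(\kappa_2-\kappa_L)}F(r)\to0$ as $r\to+\infty$. **Monotone force flows.** Let $0<\varepsilon_1<\varepsilon_2<\varepsilon_{\max}$, let $u_-\le u_+$ be functions from $[\varepsilon_1,\varepsilon_2]$ to $[-\infty,\infty]$ with $u_-$ non-increasing, $u_-<+\infty$,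 $u_+$ non-decreasing, $u_+>-\infty$. A function $\mathfrak F(u;\varepsilon)$, continuous on $\{\varepsilon\in[\varepsilon_1,\varepsilon_2],\ u\in[u_-(\varepsilon),u_+(\varepsilon)]\cap\mathbb R\}$, is a right monotone force flow if $\mathfrak F(\cdot;\varepsilon)$ is the force of a standard candidate on $\Omega_R(u_-(\varepsilon),u_+(\varepsilon);\varepsilon)$; $\mathfrak F(u_+(\varepsilon);\varepsilon)=0$ whenever $u_+(\varepsilon)$ is finite; and $\mathfrak F(v;\eta)>\mathfrak F(v;\eta')$ whenever $\varepsilon_1<\eta<\eta'<\varepsilon_2$ and $v\in(u_-(\eta),u_+(\eta)]\cap\mathbb R$. A left one is defined in the same way with $\Omega_L$, with $\mathfrak F(u_-(\varepsilon);\varepsilon)=0$ when $u_-(\varepsilon)$ is finite, and with $v\in[u_-(\eta),u_+(\eta))\cap\mathbb R$. **Chords.** For $a<b$ let $$D_L(a,b)=\frac{\det(\gamma'(a),\gamma'(b),\gamma''(a))}{\det(g'(a),g'(b))},\qquad D_R(a,b)=\frac{\det(\gamma'(b),\gamma'(a),\gamma''(b))}{\det(g'(b),g'(a))}.$$ A chordal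 domain with top chord $[g(a),g(b)]$ is the union $\Omega_{ch}$ of the chords $[g(t),g(s(t))]$, $t\in[a,p]$, where $a<p\le s(p)$, $s$ is continuous and strictly decreasing on $[a,p]$, $s(a)=b$, every pair $(t,s(t))$ satisfies the cup equation $\det(\gamma'(t),\gamma'(s),\gamma(s)-\gamma(t))=0$, and $D_L(t,s(t))<0$, $D_R(t,s(t))<0$ for $t\in(a,p)$. Its standard candidate is linear on each chord with the values $f(t)$, $f(s(t))$ at the endpoints. Let $F_R(t;a,b;\varepsilon)=\mathrm{tors}(t)-\beta(t)$, $t\ge b$, where $(\kappa_2-\kappa_R)\beta'+\kappa_2'\beta=\kappa_3'$ and $F_R(b;a,b;\varepsilon)=\frac{D_R(a,b)}{g_1'(b)\kappa_2'(b)}$; let $F_L(t;a,b;\varepsilon)=\mathrm{tors}(t)-\beta(t)$, $t\le a$, where $(\kappa_2-\kappa_L)\beta'+\kappa_2'\beta=\kappa_3'$ and $F_L(a;a,b;\varepsilon)=\frac{D_L(a,b)}{g_1'(a)\kappa_2'(a)}$. Let $t^R(a,b;\varepsilon)$ be the supremum of the reals $v\ge b$ such that $F_R(\cdot;a,b;\varepsilon)$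 is the force of a standard candidate on $\Omega_R(b,v;\varepsilon)$, and $t^L(a,b;\varepsilon)$ the infimum of the reals $v\le a$ such that $F_L(\cdot;a,b;\varepsilon)$ is the force of a standard candidate on $\Omega_L(v,a;\varepsilon)$. **Linearity domains.** The angle $\Omega_{ang}(u;\varepsilon)$ is the triangle with vertices $g(u),w_R(u),w_L(u)$ minus $\Xi_\varepsilon$; a standard candidate on it is an affine function $B$ with $B(g(u))=f(u)$ for which $\gamma'(u)$ is parallel to the graph of $B$. The right trolleybus $\Omega_{tr,R}(a,b;\varepsilon)$, where $a<b$ and the chord $[g(a),g(b)]$ does not meet $\Xi_\varepsilon$, is the part of $\Omega_R(a,b;\varepsilon)$ on and above the line through $g(a),g(b)$; the left trolleybus $\Omega_{tr,L}(a,b;\varepsilon)$ is the same with $\Omega_L$. Their standard candidates have as graph the plane through $\gamma(a)$ spanned by $\gamma'(a)$ and $\gamma'(b)$. Given intervals $\mathfrak a_i=[\mathfrak a_i^l,\mathfrak a_i^r]$, $1\le i\le k$, $k\geq 1$, possibly points, with $\mathfrak a_i^r<\mathfrak a_{i+1}^l$, whose union has more than one point and for which the chords $[g(\mathfrak a_i^r),g(\mathfrak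 a_{i+1}^l)]$ do not meet $\Xi_\varepsilon$, the multibirdie $\Omega_{Mbird}(\{\mathfrak a_i\};\varepsilon)$ is the part of $\Omega_R(\mathfrak a_1^l,\infty;\varepsilon)\cap\Omega_L(-\infty,\mathfrak a_k^r;\varepsilon)$ on and above all these chords. A standard candidate on it is a function whose graph lies, for all $a\ne b$ in $\bigcup\mathfrak a_i$, in the plane through $\gamma(a)$ spanned by $\gamma'(a)$ and $\gamma'(b)$. **Proposition.** Let $0<\eta_1<\eta_3<\varepsilon_{\max}$, and let $\Omega_{Mbird}(\{\mathfrak a_i\}_{i=1}^k;\eta_1)$ be a multibirdie. Let $\mathfrak F_R$ and $\mathfrak F_L$ be right and left monotone force flows on $[\eta_1,\eta_3]$ with boundary functions $u^R_\pm$, $u^L_\pm$, such that $\mathfrak a_1^l\in(u_-^R(\eta_1),u_+^R(\eta_1)]$ and $\mathfrak a_k^r\in[u_-^L(\eta_1),u_+^L(\eta_1))$. For each $i<k$ let a chordal domain $\Omega_{ch,i}$ with top chord $[g(\mathfrak a_i^r),g(\mathfrak a_{i+1}^l)]$ be given. Suppose that a continuous function $B$ coincides with standard candidates on $\Omega_R(u_-^R(\eta_1),\mathfrak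 a_1^l;\eta_1)$ with force $\mathfrak F_R(\cdot;\eta_1)$, on $\Omega_{Mbird}(\{\mathfrak a_i\};\eta_1)$, on $\Omega_L(\mathfrak a_k^r,u_+^L(\eta_1);\eta_1)$ with force $\mathfrak F_L(\cdot;\eta_1)$, and on every $\Omega_{ch,i}$. Then there are $\eta_2\in(\eta_1,\eta_3)$ and, for $1\le i<k$, strictly increasing $a_i:[\eta_1,\eta_2]\to\mathbb R$ and strictly decreasing $b_i:[\eta_1,\eta_2]\to\mathbb R$ such that $a_i(\eta_1)=\mathfrak a_i^r$, $b_i(\eta_1)=\mathfrak a_{i+1}^l$, each $[g(a_i(\varepsilon)),g(b_i(\varepsilon))]$ is a chord of $\Omega_{ch,i}$ other than the bottom one, and the following holds. 1. For every $\varepsilon\in(\eta_1,\eta_2]$ there are $j\in\{1,\dots,k\}$ and a real number $u\in(b_{j-1}(\varepsilon),a_j(\varepsilon)]$, where $b_0=u_-^R$ and $a_k=u_+^L$, with the following properties. - Put $\mathfrak F_{R,0}=\mathfrak F_R$, $\mathfrak F_{L,k}=\mathfrak F_L$, $\mathfrak F_{R,i}(\cdot;\varepsilon)=F_R(\cdot;a_i(\varepsilon),b_i(\varepsilon);\varepsilon)$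 and $\mathfrak F_{L,i}(\cdot;\varepsilon)=F_L(\cdot;a_i(\varepsilon),b_i(\varepsilon);\varepsilon)$ for $1\le i<k$. Then $u\le u_+^R(\varepsilon)$ if $j=1$ and $u\le t^R(a_{j-1}(\varepsilon),b_{j-1}(\varepsilon);\varepsilon)$ if $j>1$; $u\ge u_-^L(\varepsilon)$ if $j=k$ and $u\ge t^L(a_j(\varepsilon),b_j(\varepsilon);\varepsilon)$ if $j<k$; and $u$ solves the balance equation $\mathfrak F_{R,j-1}(u;\varepsilon)=\mathfrak F_{L,j}(u;\varepsilon)$. - There is a continuous function $B_\varepsilon$ on $$\bigcup_{i=0}^{j-2}\Omega_R(b_i,a_{i+1})\cup\bigcup_{i=1}^{j-1}\Omega_{tr,R}(a_i,b_i)\cup\Omega_R(b_{j-1},u)\cup\Omega_{ang}(u)\cup\Omega_L(u,a_j)\cup\bigcup_{i=j}^{k-1}\Omega_{tr,L}(a_i,b_i)\cup\bigcup_{i=j}^{k-1}\Omega_L(b_i,a_{i+1})\cup\bigcup_{i=1}^{k-1}\Omega_{ch}([a_i,b_i],*)$$ (all $a_i,b_i$ and domains taken at $\varepsilon$; $\Omega_{ch}([a_i,b_i],*)$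 is the part of $\Omega_{ch,i}$ formed by the chord $[g(a_i),g(b_i)]$ and the chords below it, and is a chordal domain) that coincides with a standard candidate on each of these subdomains. Its force coincides with $\mathfrak F_R(\cdot;\varepsilon)$ on a right neighbourhood of $u_-^R(\varepsilon)$ and with $\mathfrak F_L(\cdot;\varepsilon)$ on a left neighbourhood of $u_+^L(\varepsilon)$. 2. For $1\le i<k$ the functions $\mathfrak F_{R,i}$ and $\mathfrak F_{L,i}$ are right and left monotone force flows on $[\eta_1,\eta_2]$, with boundary functions $b_i(\varepsilon),\,t^R(a_i(\varepsilon),b_i(\varepsilon);\varepsilon)$ and $t^L(a_i(\varepsilon),b_i(\varepsilon);\varepsilon),\,a_i(\varepsilon)$ respectively. -/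

import Mathlib

open Set Filter Topology

noncomputable section

/-- `φ(t, ε)` is `C^{3,1}` on `ℝ × E`: the partial derivatives `P i = ∂ₜⁱ φ` and
`Q i = ∂ₜⁱ ∂_ε φ`, `i ≤ 3`, exist and are continuous (one-sided in `ε` at endpoints of `E`). -/
def IsC31 (φ : ℝ → ℝ → ℝ) (E : Set ℝ) : Prop :=
  ∃ P Q : ℕ → ℝ → ℝ → ℝ, P 0 = φ ∧
    (∀ i < 3, ∀ ε ∈ E, ∀ t, HasDerivAt (fun τ => P i τ ε) (P (i + 1) t ε) t) ∧
    (∀ i < 3, ∀ ε ∈ E, ∀ t, HasDerivAt (fun τ => Q i τ ε) (Q (i + 1) t ε) t) ∧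
    (∀ i ≤ 3, ∀ ε ∈ E, ∀ t, HasDerivWithinAt (fun e => P i t e) (Q i t ε) E ε) ∧
    (∀ i ≤ 3, ContinuousOn (fun q : ℝ × ℝ => P i q.1 q.2) (univ ×ˢ E)) ∧
    (∀ i ≤ 3, ContinuousOn (fun q : ℝ × ℝ => Q i q.1 q.2) (univ ×ˢ E))

/-- The real points of the closed interval with extended endpoints `p`, `q`. -/
def eIcc (p q : EReal) : Set ℝ := {t | p ≤ (t : EReal) ∧ (t : EReal) ≤ q}

/-- The raw data of a family of curves `t ↦ (G₁ t ε, G₂ t ε)`, `ε ∈ [0, epsMax)`, together with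
the parameters `tR t ε`, `tL t ε` of the points where the tangents drawn from the point `t` of the
curve `ε = 0` touch the curve with index `ε`. All laws are in `CurveFamily.IsAdmissible`, where
`tR` and `tL` are determined uniquely by the curves. -/
structure CurveFamily where
  G₁ : ℝ → ℝ → ℝ
  G₂ : ℝ → ℝ → ℝ
  epsMax : EReal
  tR : ℝ → ℝ → ℝ
  tL : ℝ → ℝ → ℝ

namespace CurveFamily

/-! ### The domain -/

/-- The parameter interval `[0, epsMax)`. -/
def params (D : CurveFamily) : Set ℝ := {ε | 0 ≤ ε ∧ (ε : EReal) < D.epsMax}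

/-- The parameter interval `(0, epsMax)`. -/
def posParams (D : CurveFamily) : Set ℝ := {ε | 0 < ε ∧ (ε : EReal) < D.epsMax}

/-- The point of the curve with index `ε`. -/
def pt (D : CurveFamily) (t ε : ℝ) : ℝ × ℝ := (D.G₁ t ε, D.G₂ t ε)

/-- The fixed boundary `g = (g₁, g₂)`. -/
def g₁ (D : CurveFamily) (t : ℝ) : ℝ := D.G₁ t 0

def g₂ (D : CurveFamily) (t : ℝ) : ℝ := D.G₂ t 0

def g (D : CurveFamily) (t : ℝ) : ℝ × ℝ := (D.g₁ t, D.g₂ t)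

/-- The strict epigraph of the curve with index `ε`. -/
def Xi (D : CurveFamily) (ε : ℝ) : Set (ℝ × ℝ) :=
  {x | ∃ t : ℝ, x.1 = D.G₁ t ε ∧ D.G₂ t ε < x.2}

/-- The line through `g t` and the point `s` of the curve `ε` is tangent to that curve at `s`. -/
def IsTangency (D : CurveFamily) (ε t s : ℝ) : Prop :=
  (D.g₂ t - D.G₂ s ε) * deriv (fun τ => D.G₁ τ ε) s
    - (D.g₁ t - D.G₁ s ε) * deriv (fun τ => D.G₂ τ ε) s = 0

/-- The tangency points. -/
def wR (D : CurveFamily) (t ε : ℝ) : ℝ × ℝ := D.pt (D.tR t ε) ε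

def wL (D : CurveFamily) (t ε : ℝ) : ℝ × ℝ := D.pt (D.tL t ε) ε

/-- The set of parameters `τ` such that `g τ` lies on the line through `g t` and `w`. -/
def lineHits (D : CurveFamily) (t : ℝ) (w : ℝ × ℝ) : Set ℝ :=
  {τ | (D.g₂ τ - D.g₂ t) * (w.1 - D.g₁ t) = (D.g₁ τ - D.g₁ t) * (w.2 - D.g₂ t)}

/-- The slopes of the right and left tangents. -/
def κR (D : CurveFamily) (t ε : ℝ) : ℝ := ((D.wR t ε).2 - D.g₂ t) / ((D.wR t ε).1 - D.g₁ t)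

def κL (D : CurveFamily) (t ε : ℝ) : ℝ := ((D.wL t ε).2 - D.g₂ t) / ((D.wL t ε).1 - D.g₁ t)

/-- The scalar `λ` in `λ (g - w) = w'` (read off from the first coordinate). -/
def lamR (D : CurveFamily) (t ε : ℝ) : ℝ :=
  deriv (fun τ => (D.wR τ ε).1) t / (D.g₁ t - (D.wR t ε).1)

def lamL (D : CurveFamily) (t ε : ℝ) : ℝ :=
  deriv (fun τ => (D.wL τ ε).1) t / (D.g₁ t - (D.wL t ε).1)

/-- The Euclidean distance in the plane. -/
def edist2 (x y : ℝ × ℝ) : ℝ := Real.sqrt ((x.1 - y.1) ^ 2 + (x.2 - y.2) ^ 2)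

/-- The standing assumptions on the family of domains between the curve `ε = 0` and the
curve with index `ε`. -/
structure IsAdmissible (D : CurveFamily) : Prop where
  smooth₁ : IsC31 D.G₁ D.params
  smooth₂ : IsC31 D.G₂ D.params
  epsMax_pos : 0 < D.epsMax
  deriv_pos : ∀ ε ∈ D.params, ∀ t, 0 < deriv (fun τ => D.G₁ τ ε) t
  convex : ∀ ε ∈ D.params, ∀ t,
    0 < deriv (deriv (fun τ => D.G₂ τ ε)) t * deriv (fun τ => D.G₁ τ ε) t
      - deriv (fun τ => D.G₂ τ ε) t * deriv (deriv (fun τ => D.G₁ τ ε)) t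
  nested : ∀ ε₁ ∈ D.params, ∀ ε₂ ∈ D.params, ε₁ < ε₂ → D.Xi ε₂ ⊆ D.Xi ε₁
  separated : ∀ ε₁ ∈ D.params, ∀ ε₂ ∈ D.params, ε₁ < ε₂ → ∀ t, D.pt t ε₁ ∉ closure (D.Xi ε₂)
  tR_lt_tL : ∀ ε ∈ D.posParams, ∀ t, D.tR t ε < D.tL t ε
  tangency : ∀ ε ∈ D.posParams, ∀ t s, D.IsTangency ε t s ↔ s = D.tR t ε ∨ s = D.tL t ε
  hitsR : ∀ ε ∈ D.posParams, ∀ t, (D.lineHits t (D.wR t ε)).ncard = 2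
  hitsL : ∀ ε ∈ D.posParams, ∀ t, (D.lineHits t (D.wL t ε)).ncard = 2
  κR_deriv : ∀ ε ∈ D.posParams, ∀ t, deriv (fun e => D.κR t e) ε ≠ 0
  κL_deriv : ∀ ε ∈ D.posParams, ∀ t, deriv (fun e => D.κL t e) ε ≠ 0
  decayR : ∀ ε ∈ D.posParams, ∀ t₀ : ℝ,
    Tendsto (fun t => (1 + edist2 (D.wR t ε) (D.g t)) * Real.exp (-∫ τ in t..t₀, D.lamR τ ε))
      atBot (𝓝 0)
  decayL : ∀ ε ∈ D.posParams, ∀ t₀ : ℝ,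
    Tendsto (fun t => (1 + edist2 (D.wL t ε) (D.g t)) * Real.exp (∫ τ in t₀..t, D.lamL τ ε))
      atTop (𝓝 0)

/-! ### The boundary value `f` -/

def κ₂ (D : CurveFamily) (t : ℝ) : ℝ := deriv D.g₂ t / deriv D.g₁ t

def κ₃ (D : CurveFamily) (f : ℝ → ℝ) (t : ℝ) : ℝ := deriv f t / deriv D.g₁ t

def tors (D : CurveFamily) (f : ℝ → ℝ) (t : ℝ) : ℝ := deriv (D.κ₃ f) t / deriv D.κ₂ t

/-- The standing assumptions on `f`: it is `C²`, the function `tors` is piecewise monotone with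
finitely many pieces, and the two improper integrals
`∫_{-∞}^v f'(τ) exp(-∫_τ^v lamR) dτ > -∞` and `∫_v^∞ f'(τ) exp(∫_v^τ lamL) dτ < +∞`
(the negative, respectively the positive, part of the integrand is integrable). -/
structure IsRegular (D : CurveFamily) (f : ℝ → ℝ) : Prop where
  smooth : ContDiff ℝ 2 f
  pieces : ∃ S : Finset ℝ, ∀ J : Set ℝ, J.OrdConnected → Disjoint J (S : Set ℝ) →
    MonotoneOn (D.tors f) J ∨ AntitoneOn (D.tors f) J
  sumR : ∀ ε ∈ D.posParams, ∀ v : ℝ, MeasureTheory.IntegrableOn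
    (fun τ => min (deriv f τ * Real.exp (-∫ s in τ..v, D.lamR s ε)) 0) (Iic v)
  sumL : ∀ ε ∈ D.posParams, ∀ v : ℝ, MeasureTheory.IntegrableOn
    (fun τ => max (deriv f τ * Real.exp (∫ s in v..τ, D.lamL s ε)) 0) (Ici v)

/-! ### Subdomains -/

/-- The right and left tangent domains over the interval with endpoints `p`, `q`. -/
def OmR (D : CurveFamily) (p q : EReal) (ε : ℝ) : Set (ℝ × ℝ) :=
  ⋃ t ∈ eIcc p q, segment ℝ (D.g t) (D.wR t ε)

def OmL (D : CurveFamily) (p q : EReal) (ε : ℝ) : Set (ℝ × ℝ) :=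
  ⋃ t ∈ eIcc p q, segment ℝ (D.g t) (D.wL t ε)

/-- The angle: the closed curvilinear triangle bounded by both tangents from `g u` and the arc of
the free boundary between the tangency points. -/
def OmAng (D : CurveFamily) (u ε : ℝ) : Set (ℝ × ℝ) :=
  convexHull ℝ {D.g u, D.wR u ε, D.wL u ε} \ D.Xi ε

/-- The closed half-plane above the line through `g a` and `g b`. -/
def aboveChord (D : CurveFamily) (a b : ℝ) : Set (ℝ × ℝ) :=
  {x | D.g₂ a + (D.g₂ b - D.g₂ a) / (D.g₁ b - D.g₁ a) * (x.1 - D.g₁ a) ≤ x.2}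

/-- The right (left) trolleybus: the domain bounded by the right (left) tangents from `g a` and
`g b`, by the chord `[g a, g b]` and by the free boundary, i.e. the part of the tangent domain over
`[a, b]` above the chord. -/
def OmTrR (D : CurveFamily) (a b ε : ℝ) : Set (ℝ × ℝ) := D.OmR a b ε ∩ D.aboveChord a b

def OmTrL (D : CurveFamily) (a b ε : ℝ) : Set (ℝ × ℝ) := D.OmL a b ε ∩ D.aboveChord a b

/-- The chordal domain foliated by the chords `[g t, g (s t)]`, `t ∈ [a, p]`. -/
def OmCh (D : CurveFamily) (a p : ℝ) (s : ℝ → ℝ) : Set (ℝ × ℝ) :=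
  ⋃ t ∈ Icc a p, segment ℝ (D.g t) (D.g (s t))

/-- The multibirdie over the intervals `[l i, r i]`, `1 ≤ i ≤ k`: the points on the right of the
right tangent from `g (l 1)`, on the left of the left tangent from `g (r k)`, and above all
the chords `[g (r i), g (l (i + 1))]`. -/
def OmMbird (D : CurveFamily) (k : ℕ) (l r : ℕ → ℝ) (ε : ℝ) : Set (ℝ × ℝ) :=
  (D.OmR (l 1) ⊤ ε ∩ D.OmL ⊥ (r k) ε) ∩
    {x | ∀ i, 1 ≤ i → i < k → x ∈ D.aboveChord (r i) (l (i + 1))}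

/-- The intervals `[l i, r i]`, `1 ≤ i ≤ k`, may be points, they are disjoint, contain at least two
points together, and the chords between neighbours lie in the domain. -/
structure IsMultibirdie (D : CurveFamily) (k : ℕ) (l r : ℕ → ℝ) (ε : ℝ) : Prop where
  one_le : 1 ≤ k
  le : ∀ i, 1 ≤ i → i ≤ k → l i ≤ r i
  lt : ∀ i, 1 ≤ i → i < k → r i < l (i + 1)
  nontrivial : 2 ≤ k ∨ l 1 < r 1
  chord : ∀ i, 1 ≤ i → i < k → Disjoint (segment ℝ (D.g (r i)) (D.g (l (i + 1)))) (D.Xi ε)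

/-! ### Tangent domains: standard candidates and forces -/

/-- The force `(κ₂ - κ) β₂' / κ₂'` of a fence with slopes `κ`, where `β'` stands for `β₂'`. -/
def force (D : CurveFamily) (κ β' : ℝ → ℝ) (t : ℝ) : ℝ :=
  (D.κ₂ t - κ t) / deriv D.κ₂ t * β' t

/-- The value at a point `x` of the extremal segment starting from `g t` of the candidate on a
fence with slopes `κ`, where `β` is the derivative in `x₂` of the candidate. -/
def fenceVal (D : CurveFamily) (f κ β : ℝ → ℝ) (t : ℝ) (x : ℝ × ℝ) : ℝ :=
  f t + (x.1 - D.g₁ t) * (D.κ₃ f t + (κ t - D.κ₂ t) * β t)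

/-- `β` (with derivative `β'`) generates a standard candidate on the right tangent domain over the
interval with endpoints `p`, `q`: it solves the linear equation `(κ₂ - κ) β' + κ₂' β = κ₃'`,
`β' ≤ 0`, and `β' < 0` in the interior. If the interval reaches `-∞`, then the constant of
integration at `-∞` is zero: the solution with initial force `F(r)` at `r` has the homogeneous
part `exp(-∫_r^t κ₂'/(κ₂ - κ)) F(r)`, which is required to vanish as `r → -∞`. -/
structure IsStdR (D : CurveFamily) (f : ℝ → ℝ) (ε : ℝ) (p q : EReal) (β β' : ℝ → ℝ) : Prop where
  hasDeriv : ∀ t ∈ eIcc p q, HasDerivWithinAt β (β' t) (eIcc p q) t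
  ode : ∀ t ∈ eIcc p q,
    (D.κ₂ t - D.κR t ε) * β' t + deriv D.κ₂ t * β t = deriv (D.κ₃ f) t
  nonpos : ∀ t ∈ eIcc p q, β' t ≤ 0
  neg : ∀ t ∈ interior (eIcc p q), β' t < 0
  infinite : p = ⊥ → ∀ t ∈ eIcc p q, Tendsto
    (fun r => Real.exp (-∫ τ in r..t, deriv D.κ₂ τ / (D.κ₂ τ - D.κR τ ε))
      * D.force (fun τ => D.κR τ ε) β' r) atBot (𝓝 0)

/-- The mirror notion for left tangents: `β' ≥ 0`, and zero constant of integration at `+∞`. -/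
structure IsStdL (D : CurveFamily) (f : ℝ → ℝ) (ε : ℝ) (p q : EReal) (β β' : ℝ → ℝ) : Prop where
  hasDeriv : ∀ t ∈ eIcc p q, HasDerivWithinAt β (β' t) (eIcc p q) t
  ode : ∀ t ∈ eIcc p q,
    (D.κ₂ t - D.κL t ε) * β' t + deriv D.κ₂ t * β t = deriv (D.κ₃ f) t
  nonneg : ∀ t ∈ eIcc p q, 0 ≤ β' t
  pos : ∀ t ∈ interior (eIcc p q), 0 < β' t
  infinite : q = ⊤ → ∀ t ∈ eIcc p q, Tendsto
    (fun r => Real.exp (∫ τ in t..r, deriv D.κ₂ τ / (D.κ₂ τ - D.κL τ ε))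
      * D.force (fun τ => D.κL τ ε) β' r) atTop (𝓝 0)

/-- `B` coincides on the right tangent domain with a standard candidate whose force is `F`. -/
def HasForceR (D : CurveFamily) (f : ℝ → ℝ) (ε : ℝ) (p q : EReal) (B : ℝ × ℝ → ℝ) (F : ℝ → ℝ) :
    Prop :=
  ∃ β β' : ℝ → ℝ, D.IsStdR f ε p q β β' ∧
    (∀ t ∈ eIcc p q, F t = D.force (fun τ => D.κR τ ε) β' t) ∧
    ∀ t ∈ eIcc p q, ∀ x ∈ segment ℝ (D.g t) (D.wR t ε),
      B x = D.fenceVal f (fun τ => D.κR τ ε) β t x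

def HasForceL (D : CurveFamily) (f : ℝ → ℝ) (ε : ℝ) (p q : EReal) (B : ℝ × ℝ → ℝ) (F : ℝ → ℝ) :
    Prop :=
  ∃ β β' : ℝ → ℝ, D.IsStdL f ε p q β β' ∧
    (∀ t ∈ eIcc p q, F t = D.force (fun τ => D.κL τ ε) β' t) ∧
    ∀ t ∈ eIcc p q, ∀ x ∈ segment ℝ (D.g t) (D.wL t ε),
      B x = D.fenceVal f (fun τ => D.κL τ ε) β t x

/-- `B` coincides on the tangent domain with some standard candidate. -/
def StdOnR (D : CurveFamily) (f : ℝ → ℝ) (ε : ℝ) (p q : EReal) (B : ℝ × ℝ → ℝ) : Prop :=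
  ∃ F : ℝ → ℝ, D.HasForceR f ε p q B F

def StdOnL (D : CurveFamily) (f : ℝ → ℝ) (ε : ℝ) (p q : EReal) (B : ℝ × ℝ → ℝ) : Prop :=
  ∃ F : ℝ → ℝ, D.HasForceL f ε p q B F

/-! ### Monotone force flows -/

structure IsRightFlow (D : CurveFamily) (f : ℝ → ℝ) (ε₁ ε₂ : ℝ) (um up : ℝ → EReal)
    (F : ℝ → ℝ → ℝ) : Prop where
  params : 0 < ε₁ ∧ ε₁ < ε₂ ∧ (ε₂ : EReal) < D.epsMax
  um_ne_top : ∀ ε ∈ Icc ε₁ ε₂, um ε ≠ ⊤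
  up_ne_bot : ∀ ε ∈ Icc ε₁ ε₂, up ε ≠ ⊥
  um_anti : AntitoneOn um (Icc ε₁ ε₂)
  up_mono : MonotoneOn up (Icc ε₁ ε₂)
  um_le_up : ∀ ε ∈ Icc ε₁ ε₂, um ε ≤ up ε
  cont : ContinuousOn (fun q : ℝ × ℝ => F q.1 q.2)
    {q | q.2 ∈ Icc ε₁ ε₂ ∧ q.1 ∈ eIcc (um q.2) (up q.2)}
  isForce : ∀ ε ∈ Icc ε₁ ε₂, ∃ β β' : ℝ → ℝ, D.IsStdR f ε (um ε) (up ε) β β' ∧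
    ∀ u ∈ eIcc (um ε) (up ε), F u ε = D.force (fun τ => D.κR τ ε) β' u
  zero : ∀ ε ∈ Icc ε₁ ε₂, ∀ v : ℝ, up ε = v → F v ε = 0
  mono : ∀ η₁ η₂ : ℝ, ε₁ < η₁ → η₁ < η₂ → η₂ < ε₂ →
    ∀ v : ℝ, um η₁ < v → v ≤ up η₁ → F v η₂ < F v η₁

structure IsLeftFlow (D : CurveFamily) (f : ℝ → ℝ) (ε₁ ε₂ : ℝ) (um up : ℝ → EReal)
    (F : ℝ → ℝ → ℝ) : Prop where
  params : 0 < ε₁ ∧ ε₁ < ε₂ ∧ (ε₂ : EReal) < D.epsMax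
  um_ne_top : ∀ ε ∈ Icc ε₁ ε₂, um ε ≠ ⊤
  up_ne_bot : ∀ ε ∈ Icc ε₁ ε₂, up ε ≠ ⊥
  um_anti : AntitoneOn um (Icc ε₁ ε₂)
  up_mono : MonotoneOn up (Icc ε₁ ε₂)
  um_le_up : ∀ ε ∈ Icc ε₁ ε₂, um ε ≤ up ε
  cont : ContinuousOn (fun q : ℝ × ℝ => F q.1 q.2)
    {q | q.2 ∈ Icc ε₁ ε₂ ∧ q.1 ∈ eIcc (um q.2) (up q.2)}
  isForce : ∀ ε ∈ Icc ε₁ ε₂, ∃ β β' : ℝ → ℝ, D.IsStdL f ε (um ε) (up ε) β β' ∧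
    ∀ u ∈ eIcc (um ε) (up ε), F u ε = D.force (fun τ => D.κL τ ε) β' u
  zero : ∀ ε ∈ Icc ε₁ ε₂, ∀ v : ℝ, um ε = v → F v ε = 0
  mono : ∀ η₁ η₂ : ℝ, ε₁ < η₁ → η₁ < η₂ → η₂ < ε₂ →
    ∀ v : ℝ, um η₁ ≤ v → v < up η₁ → F v η₂ < F v η₁

/-! ### Chords, differentials, chordal domains -/

/-- The determinant in the cup equation, with rows `γ'(t)`, `γ'(s)`, `γ(s) - γ(t)`,
where `γ = (g₁, g₂, f)`. -/
def cupDet (D : CurveFamily) (f : ℝ → ℝ) (t s : ℝ) : ℝ :=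
  Matrix.det !![deriv D.g₁ t, deriv D.g₂ t, deriv f t;
    deriv D.g₁ s, deriv D.g₂ s, deriv f s;
    D.g₁ s - D.g₁ t, D.g₂ s - D.g₂ t, f s - f t]

/-- `det (γ'(x), γ'(y), γ''(x)) / det (g'(x), g'(y))`. -/
def diffQuot (D : CurveFamily) (f : ℝ → ℝ) (x y : ℝ) : ℝ :=
  Matrix.det !![deriv D.g₁ x, deriv D.g₂ x, deriv f x;
    deriv D.g₁ y, deriv D.g₂ y, deriv f y;
    deriv (deriv D.g₁) x, deriv (deriv D.g₂) x, deriv (deriv f) x] /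
  Matrix.det !![deriv D.g₁ x, deriv D.g₂ x; deriv D.g₁ y, deriv D.g₂ y]

/-- The left and right differentials of a chord `[g a, g b]`, `a < b`. -/
def DL (D : CurveFamily) (f : ℝ → ℝ) (a b : ℝ) : ℝ := D.diffQuot f a b

def DR (D : CurveFamily) (f : ℝ → ℝ) (a b : ℝ) : ℝ := D.diffQuot f b a

/-- The chords `[g t, g (s t)]`, `t ∈ [a, p]`, form a chordal domain with top chord
`[g a, g (s a)]` and bottom chord `[g p, g (s p)]` (a single point if `p` is the origin of a cup).
The negativity of the differentials makes `s` continuously differentiable inside. -/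
structure IsChordal (D : CurveFamily) (f : ℝ → ℝ) (a p : ℝ) (s : ℝ → ℝ) : Prop where
  lt : a < p
  le : p ≤ s p
  anti : StrictAntiOn s (Icc a p)
  cont : ContinuousOn s (Icc a p)
  cup : ∀ t ∈ Icc a p, D.cupDet f t (s t) = 0
  DL_neg : ∀ t ∈ Ioo a p, D.DL f t (s t) < 0
  DR_neg : ∀ t ∈ Ioo a p, D.DR f t (s t) < 0

/-- `B` coincides with the standard candidate on the chordal domain. -/
def StdOnCh (D : CurveFamily) (f : ℝ → ℝ) (a p : ℝ) (s : ℝ → ℝ) (B : ℝ × ℝ → ℝ) : Prop :=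
  D.IsChordal f a p s ∧ ∀ t ∈ Icc a p, ∀ α ∈ Icc (0 : ℝ) 1,
    B (α • D.g t + (1 - α) • D.g (s t)) = α * f t + (1 - α) * f (s t)

/-- The forces of the chord `[g a, g b]` at its own endpoints. -/
def chordForceR (D : CurveFamily) (f : ℝ → ℝ) (a b : ℝ) : ℝ :=
  D.DR f a b / (deriv D.g₁ b * deriv D.κ₂ b)

def chordForceL (D : CurveFamily) (f : ℝ → ℝ) (a b : ℝ) : ℝ :=
  D.DL f a b / (deriv D.g₁ a * deriv D.κ₂ a)

/-- The solution of `(κ₂ - κ) β' + κ₂' β = κ₃'` with `β t₀ = c`. -/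
def betaSol (D : CurveFamily) (f κ : ℝ → ℝ) (t₀ c t : ℝ) : ℝ :=
  Real.exp (-∫ τ in t₀..t, deriv D.κ₂ τ / (D.κ₂ τ - κ τ)) *
    ((∫ τ in t₀..t, Real.exp (∫ σ in t₀..τ, deriv D.κ₂ σ / (D.κ₂ σ - κ σ)) *
      (deriv (D.κ₃ f) τ / (D.κ₂ τ - κ τ))) + c)

/-- The right and left forces of the chord `[g a, g b]` at a point `t ≥ b`, respectively `t ≤ a`.
By the linear equation the force `(κ₂ - κ) β' / κ₂'` equals `tors - β`. -/
def FR (D : CurveFamily) (f : ℝ → ℝ) (a b ε t : ℝ) : ℝ :=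
  D.tors f t -
    D.betaSol f (fun τ => D.κR τ ε) b (D.tors f b - D.chordForceR f a b) t

def FL (D : CurveFamily) (f : ℝ → ℝ) (a b ε t : ℝ) : ℝ :=
  D.tors f t -
    D.betaSol f (fun τ => D.κL τ ε) a (D.tors f a - D.chordForceL f a b) t

/-- The endpoints of the right and left tails of the chord `[g a, g b]`. -/
def tailR (D : CurveFamily) (f : ℝ → ℝ) (a b ε : ℝ) : EReal :=
  sSup {τ : EReal | ∃ v : ℝ, τ = v ∧ b ≤ v ∧ ∃ β β' : ℝ → ℝ, D.IsStdR f ε b v β β' ∧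
    D.force (fun t => D.κR t ε) β' b = D.chordForceR f a b}

def tailL (D : CurveFamily) (f : ℝ → ℝ) (a b ε : ℝ) : EReal :=
  sInf {τ : EReal | ∃ v : ℝ, τ = v ∧ v ≤ a ∧ ∃ β β' : ℝ → ℝ, D.IsStdL f ε v a β β' ∧
    D.force (fun t => D.κL t ε) β' a = D.chordForceL f a b}

/-! ### Linearity domains: standard candidates -/

/-- The point `(x, y)` lies in the plane through `γ(a)` spanned by `γ'(a)` and `γ'(b)`. -/
def LinEq (D : CurveFamily) (f : ℝ → ℝ) (a b : ℝ) (x : ℝ × ℝ) (y : ℝ) : Prop :=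
  Matrix.det !![deriv D.g₁ a, deriv D.g₂ a, deriv f a;
    deriv D.g₁ b, deriv D.g₂ b, deriv f b;
    x.1 - D.g₁ a, x.2 - D.g₂ a, y - f a] = 0

/-- `B` coincides with a standard candidate on the angle: it is affine, equals `f u` at `g u`, and
`γ'(u)` is parallel to its graph. -/
def StdOnAng (D : CurveFamily) (f : ℝ → ℝ) (u ε : ℝ) (B : ℝ × ℝ → ℝ) : Prop :=
  ∃ β₁ β₂ : ℝ, β₁ * deriv D.g₁ u + β₂ * deriv D.g₂ u = deriv f u ∧
    ∀ x ∈ D.OmAng u ε, B x = f u + β₁ * (x.1 - D.g₁ u) + β₂ * (x.2 - D.g₂ u)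

/-- `B` coincides with the standard candidate on the right (left) trolleybus. -/
def StdOnTrR (D : CurveFamily) (f : ℝ → ℝ) (a b ε : ℝ) (B : ℝ × ℝ → ℝ) : Prop :=
  a < b ∧ Disjoint (segment ℝ (D.g a) (D.g b)) (D.Xi ε) ∧
    ∀ x ∈ D.OmTrR a b ε, D.LinEq f a b x (B x)

def StdOnTrL (D : CurveFamily) (f : ℝ → ℝ) (a b ε : ℝ) (B : ℝ × ℝ → ℝ) : Prop :=
  a < b ∧ Disjoint (segment ℝ (D.g a) (D.g b)) (D.Xi ε) ∧
    ∀ x ∈ D.OmTrL a b ε, D.LinEq f a b x (B x)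

/-- `B` coincides with the standard candidate on the multibirdie; in its definition `a ≠ b` are
arbitrary points of the union of the intervals `[l i, r i]`. -/
def StdOnMbird (D : CurveFamily) (f : ℝ → ℝ) (k : ℕ) (l r : ℕ → ℝ) (ε : ℝ) (B : ℝ × ℝ → ℝ) :
    Prop :=
  ∀ a b : ℝ, (∃ i, 1 ≤ i ∧ i ≤ k ∧ a ∈ Icc (l i) (r i)) →
    (∃ i, 1 ≤ i ∧ i ≤ k ∧ b ∈ Icc (l i) (r i)) → a ≠ b →
    ∀ x ∈ D.OmMbird k l r ε, D.LinEq f a b x (B x)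

/-! ### The disintegrated foliation -/

/-- The endpoints `b_i`, `0 ≤ i < k`, where `b_0 = um`. -/
def bExt (um : ℝ → EReal) (b : ℕ → ℝ → ℝ) (i : ℕ) (ε : ℝ) : EReal :=
  if i = 0 then um ε else (b i ε : EReal)

/-- The endpoints `a_i`, `1 ≤ i ≤ k`, where `a_k = up`. -/
def aExt (k : ℕ) (up : ℝ → EReal) (a : ℕ → ℝ → ℝ) (i : ℕ) (ε : ℝ) : EReal :=
  if i = k then up ε else (a i ε : EReal)

/-- The domain of the foliation: right tangent domains and right trolleybuses, then one angle at
`u`, then left trolleybuses and left tangent domains, and the chordal domains below. -/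
def folDomain (D : CurveFamily) (k j : ℕ) (um up : ℝ → EReal) (a b : ℕ → ℝ → ℝ)
    (p : ℕ → ℝ) (s : ℕ → ℝ → ℝ) (u ε : ℝ) : Set (ℝ × ℝ) :=
  (⋃ i ∈ {i : ℕ | i + 1 < j}, D.OmR (bExt um b i ε) (aExt k up a (i + 1) ε) ε) ∪
  (⋃ i ∈ {i : ℕ | 1 ≤ i ∧ i < j}, D.OmTrR (a i ε) (b i ε) ε) ∪
  D.OmR (bExt um b (j - 1) ε) u ε ∪
  D.OmAng u ε ∪
  D.OmL u (aExt k up a j ε) ε ∪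
  (⋃ i ∈ {i : ℕ | j ≤ i ∧ i < k}, D.OmTrL (a i ε) (b i ε) ε) ∪
  (⋃ i ∈ {i : ℕ | j ≤ i ∧ i < k}, D.OmL (bExt um b i ε) (aExt k up a (i + 1) ε) ε) ∪
  (⋃ i ∈ {i : ℕ | 1 ≤ i ∧ i < k}, D.OmCh (a i ε) (p i) (s i))

/-- `B` is continuous on the domain of the foliation and coincides with the standard candidate on
each of its subdomains. -/
structure IsFolCandidate (D : CurveFamily) (f : ℝ → ℝ) (k j : ℕ) (um up : ℝ → EReal)
    (a b : ℕ → ℝ → ℝ) (p : ℕ → ℝ) (s : ℕ → ℝ → ℝ) (u ε : ℝ) (B : ℝ × ℝ → ℝ) : Prop where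
  cont : ContinuousOn B (D.folDomain k j um up a b p s u ε)
  right : ∀ i, i + 1 < j → D.StdOnR f ε (bExt um b i ε) (aExt k up a (i + 1) ε) B
  trR : ∀ i, 1 ≤ i → i < j → D.StdOnTrR f (a i ε) (b i ε) ε B
  rightAng : D.StdOnR f ε (bExt um b (j - 1) ε) u B
  ang : D.StdOnAng f u ε B
  leftAng : D.StdOnL f ε u (aExt k up a j ε) B
  trL : ∀ i, j ≤ i → i < k → D.StdOnTrL f (a i ε) (b i ε) ε B
  left : ∀ i, j ≤ i → i < k → D.StdOnL f ε (bExt um b i ε) (aExt k up a (i + 1) ε) B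
  chordal : ∀ i, 1 ≤ i → i < k → D.StdOnCh f (a i ε) (p i) (s i) B

end CurveFamily

end

/-!
Write a function on a tangent segment `[g t, w t]` as `f t + (x₁ - g₁ t) (κ₃ t + (κ - κ₂ t) β t)`.
For right tangents `β` has to solve the *relaxation equation* `β' = q (tors - β)` with the rate `q
= κ₂' / (κ₂ - κ_R) > 0`, and the sign conditions on `β'` say that `β` lies above `tors`; the force
is `tors - β`. Reflection of the line takes left tangents to right tangents, so that a left
candidate is a solution of `β' = q (β - tors)` above `tors`. A chord `[g a, g b]` whose ends
satisfy the cup equation lies in a plane containing `γ'(a)` and `γ'(b)`, and `chordβ a b`, the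
derivative of this plane in `x₂`, plays the role of `β` for the chord. The signs of `D_L` and `D_R`
say that `chordβ` lies above `tors` at both ends. Differentiating the cup equation shows that along
a chordal domain `chordβ` itself satisfies a relaxation equation with respect to each end of the
chord, with a rate that can be compared with `q`, because the chords pass under the curves of the
family (`IsChordal.exists_hasDerivAt`, `IsRelaxChord.of_hasDerivAt`). Hence a solution can cross
`chordβ` along a chordal domain in one direction only.

Being affine, the candidate on the multibirdie for `ε = η₁` has one derivative `b` in `x₂`; so `b`
is the value of `chordβ` at all top chords, of `tors` on the nondegenerate intervals, and of the
slopes with which the two flows start (`isBirdieSystem_of_candidate`). For `ε > η₁` the solution `Y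
0` of the right flow exceeds `b` at the first interval, by the monotonicity of the flow. By the one
way crossing there is exactly one chord under the first top chord at whose left end `Y 0` agrees
with `chordβ` (`IsRelaxChord.exists_descent`). The solution `Y 1` that starts at the right end of
this chord with the value `chordβ` again exceeds `b` at the second interval and grows with `ε`,
since larger parameters mean slower relaxation (`RelaxCoeff.lt_of_lt`, `isBase_of_descent`), and so
on through all the chords (`IsRelaxChain.exists_chain`). In the same way the left flow gives
solutions `Z k`, …, `Z 1` and a second chord under each top chord.

Of the two chords under each top chord the lower one is taken, which keeps continuity and strict
monotonicity in `ε`. Where both are above `tors`, the difference `Z - Y` increases. Therefore, if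
one of the chords is determined by the left flow, so are all later ones (`IsBalanceSystem.step`).
At the interval between the last chord determined by the right flow and the first one determined by
the left flow `Z - Y` changes its sign, and its zero is the vertex `u` of the angle
(`IsBalanceSystem.exists_balance`). All neighbouring pieces have the same slopes on their common
boundaries, and the candidates fit together.

Continuity of the union is a question about the plane: the tangent segments form a *fan*, in which
a function is continuous when it is continuous along each segment with its parameter
(`IsFan.continuousOn`), and the finitely many pieces are closed relative to their union
(`exists_continuousOn_glue`). These facts are combined in `IsUnfolding.exists_glue`,
`exists_isFolCandidate` and `IsBirdieSystem.exists_unfolding`. The statement about the flows of the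
chords follows from the comparison of solutions that start on descending chords
(`isRightFlow_of_descent`, `isLeftFlow_of_descent`).
-/

noncomputable section

/-! ### Regularity of the curves -/

namespace IsC31

variable {φ : ℝ → ℝ → ℝ} {E : Set ℝ} {ε : ℝ}

lemma hasDerivAt (h : IsC31 φ E) (hε : ε ∈ E) (t : ℝ) :
    HasDerivAt (fun τ => φ τ ε) (deriv (fun τ => φ τ ε) t) t := by
  obtain ⟨P, Q, rfl, h1, -⟩ := h
  exact (h1 0 (by norm_num) ε hε t).differentiableAt.hasDerivAt

lemma exists_deriv (h : IsC31 φ E) : ∃ P : ℕ → ℝ → ℝ → ℝ,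
    (∀ i < 3, ∀ ε ∈ E, ∀ t, HasDerivAt (fun τ => P i τ ε) (P (i + 1) t ε) t) ∧
    (∀ i ≤ 3, ContinuousOn (fun q : ℝ × ℝ => P i q.1 q.2) (univ ×ˢ E)) ∧ P 0 = φ ∧
    (∀ ε ∈ E, deriv (fun τ => φ τ ε) = fun τ => P 1 τ ε) ∧
    ∀ ε ∈ E, deriv (deriv (fun τ => φ τ ε)) = fun τ => P 2 τ ε := by
  obtain ⟨P, Q, rfl, h1, -, -, h4, -⟩ := h
  have hd : ∀ ε ∈ E, deriv (fun τ => P 0 τ ε) = fun τ => P 1 τ ε := fun ε hε =>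
    funext fun t => (h1 0 (by norm_num) ε hε t).deriv
  refine ⟨P, h1, h4, rfl, hd, fun ε hε => ?_⟩
  rw [hd ε hε]
  exact funext fun t => (h1 1 (by norm_num) ε hε t).deriv

lemma hasDerivAt_deriv (h : IsC31 φ E) (hε : ε ∈ E) (t : ℝ) :
    HasDerivAt (deriv fun τ => φ τ ε) (deriv (deriv fun τ => φ τ ε) t) t := by
  obtain ⟨P, h1, -, -, h3, -⟩ := h.exists_deriv
  rw [h3 ε hε]
  exact (h1 1 (by norm_num) ε hε t).differentiableAt.hasDerivAt

lemma continuous_deriv_deriv (h : IsC31 φ E) (hε : ε ∈ E) :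
    Continuous (deriv (deriv fun τ => φ τ ε)) := by
  obtain ⟨P, h1, -, -, -, h4⟩ := h.exists_deriv
  rw [h4 ε hε]
  exact continuous_iff_continuousAt.2 fun t => (h1 2 (by norm_num) ε hε t).continuousAt

lemma continuousOn (h : IsC31 φ E) :
    ContinuousOn (fun q : ℝ × ℝ => φ q.1 q.2) (univ ×ˢ E) := by
  obtain ⟨P, -, h2, rfl, -⟩ := h.exists_deriv
  exact h2 0 (by norm_num)

lemma continuousOn_deriv (h : IsC31 φ E) :
    ContinuousOn (fun q : ℝ × ℝ => deriv (fun τ => φ τ q.2) q.1) (univ ×ˢ E) := by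
  obtain ⟨P, -, h2, -, h3, -⟩ := h.exists_deriv
  refine (h2 1 (by norm_num)).congr fun q hq => ?_
  simp only [h3 q.2 hq.2]

end IsC31

namespace CurveFamily

variable {D : CurveFamily} {ε ε' s σ t t' : ℝ}

/-- The slope of the curve with index `ε` at its point with parameter `s`. -/
def slopeAt (D : CurveFamily) (s ε : ℝ) : ℝ :=
  deriv (fun τ => D.G₂ τ ε) s / deriv (fun τ => D.G₁ τ ε) s

/-- The height of the point `x` over the line tangent to the curve with index `ε` at its point with
parameter `s`. -/
def hgt (D : CurveFamily) (ε s : ℝ) (x : ℝ × ℝ) : ℝ :=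
  x.2 - D.G₂ s ε - D.slopeAt s ε * (x.1 - D.G₁ s ε)

namespace IsAdmissible

lemma zero_mem (hD : D.IsAdmissible) : (0 : ℝ) ∈ D.params := ⟨le_rfl, by
  simpa using hD.epsMax_pos⟩

end IsAdmissible

lemma params_of_posParams (h : ε ∈ D.posParams) : ε ∈ D.params := ⟨h.1.le, h.2⟩

namespace IsAdmissible

/-! ### Support lines -/

lemma G₁_strictMono (hD : D.IsAdmissible) (hε : ε ∈ D.params) :
    StrictMono fun s => D.G₁ s ε :=
  strictMono_of_deriv_pos (hD.deriv_pos ε hε)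

lemma hasDerivAt_slopeAt (hD : D.IsAdmissible) (hε : ε ∈ D.params) (s : ℝ) :
    HasDerivAt (fun s => D.slopeAt s ε)
      ((deriv (deriv (fun τ => D.G₂ τ ε)) s * deriv (fun τ => D.G₁ τ ε) s
      - deriv (fun τ => D.G₂ τ ε) s * deriv (deriv (fun τ => D.G₁ τ ε)) s) /
        deriv (fun τ => D.G₁ τ ε) s ^ 2) s :=
  (hD.smooth₂.hasDerivAt_deriv hε s).div (hD.smooth₁.hasDerivAt_deriv hε s)
    (hD.deriv_pos ε hε s).ne'

lemma deriv_slopeAt_pos (hD : D.IsAdmissible) (hε : ε ∈ D.params) (s : ℝ) :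
    0 < deriv (fun s => D.slopeAt s ε) s := by
  rw [(hD.hasDerivAt_slopeAt hε s).deriv]
  exact div_pos (hD.convex ε hε s) (pow_pos (hD.deriv_pos ε hε s) 2)

lemma slopeAt_strictMono (hD : D.IsAdmissible) (hε : ε ∈ D.params) :
    StrictMono fun s => D.slopeAt s ε :=
  strictMono_of_deriv_pos (hD.deriv_slopeAt_pos hε)

lemma continuous_G₁ (hD : D.IsAdmissible) (hε : ε ∈ D.params) : Continuous fun s => D.G₁ s ε :=
  continuous_iff_continuousAt.2 fun s => (hD.smooth₁.hasDerivAt hε s).continuousAt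

lemma continuous_G₂ (hD : D.IsAdmissible) (hε : ε ∈ D.params) : Continuous fun s => D.G₂ s ε :=
  continuous_iff_continuousAt.2 fun s => (hD.smooth₂.hasDerivAt hε s).continuousAt

lemma deriv_G₂ (hD : D.IsAdmissible) (hε : ε ∈ D.params) (s : ℝ) :
    deriv (fun τ => D.G₂ τ ε) s = D.slopeAt s ε * deriv (fun τ => D.G₁ τ ε) s :=
  (div_mul_cancel₀ _ (hD.deriv_pos ε hε s).ne').symm

/-- The curve lies strictly above its tangents. -/
lemma hgt_pt_pos (hD : D.IsAdmissible) (hε : ε ∈ D.params) (h : s ≠ σ) :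
    0 < D.hgt ε σ (D.pt s ε) := by
  have hder : ∀ s, HasDerivAt (fun s => D.hgt ε σ (D.pt s ε))
      (deriv (fun τ => D.G₁ τ ε) s * (D.slopeAt s ε - D.slopeAt σ ε)) s := fun s => by
    have := ((hD.smooth₂.hasDerivAt hε s).sub_const (D.G₂ σ ε)).sub
      (((hD.smooth₁.hasDerivAt hε s).sub_const (D.G₁ σ ε)).const_mul (D.slopeAt σ ε))
    refine this.congr_deriv ?_
    rw [hD.deriv_G₂ hε]
    ring
  have hc : Continuous fun s => D.hgt ε σ (D.pt s ε) :=
    continuous_iff_continuousAt.2 fun s => (hder s).continuousAt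
  have h0 : D.hgt ε σ (D.pt σ ε) = 0 := by simp [hgt, pt]
  rcases h.lt_or_gt with h | h
  · have : StrictAntiOn (fun s => D.hgt ε σ (D.pt s ε)) (Iic σ) := by
      refine strictAntiOn_of_deriv_neg (convex_Iic σ) hc.continuousOn fun x hx => ?_
      rw [interior_Iic] at hx
      rw [(hder x).deriv]
      exact mul_neg_of_pos_of_neg (hD.deriv_pos ε hε x)
        (sub_neg.2 (hD.slopeAt_strictMono hε hx))
    simpa [h0] using this h.le self_mem_Iic h
  · have : StrictMonoOn (fun s => D.hgt ε σ (D.pt s ε)) (Ici σ) := by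
      refine strictMonoOn_of_deriv_pos (convex_Ici σ) hc.continuousOn fun x hx => ?_
      rw [interior_Ici] at hx
      rw [(hder x).deriv]
      exact mul_pos (hD.deriv_pos ε hε x) (sub_pos.2 (hD.slopeAt_strictMono hε hx))
    simpa [h0] using this self_mem_Ici h.le h

lemma hgt_pt_nonneg (hD : D.IsAdmissible) (hε : ε ∈ D.params) (s σ : ℝ) :
    0 ≤ D.hgt ε σ (D.pt s ε) := by
  rcases eq_or_ne s σ with rfl | h
  · simp [hgt, pt]
  · exact (hD.hgt_pt_pos hε h).le

/-- To the right of a tangency point, the height over the tangent decreases when the tangency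
point moves towards the vertical of the given point. -/
lemma hgt_lt_hgt (hD : D.IsAdmissible) (hε : ε ∈ D.params) (h : s < σ) {x : ℝ × ℝ}
    (hx : D.G₁ σ ε ≤ x.1) : D.hgt ε σ x < D.hgt ε s x := by
  have h1 := hD.hgt_pt_pos hε h.ne'
  have h2 := mul_nonneg (sub_nonneg.2 (hD.slopeAt_strictMono hε h).le) (sub_nonneg.2 hx)
  simp only [hgt, pt] at *
  linarith

lemma hgt_lt_hgt' (hD : D.IsAdmissible) (hε : ε ∈ D.params) (h : s < σ) {x : ℝ × ℝ}
    (hx : x.1 ≤ D.G₁ s ε) : D.hgt ε s x < D.hgt ε σ x := by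
  have h1 := hD.hgt_pt_pos hε h.ne
  have h2 := mul_nonneg (sub_nonneg.2 (hD.slopeAt_strictMono hε h).le) (sub_nonneg.2 hx)
  simp only [hgt, pt] at *
  linarith

/-- A curve of the family lies strictly above the curves with smaller indices. -/
lemma pt_mem_Xi (hD : D.IsAdmissible) (hε : ε ∈ D.params) (hε' : ε' ∈ D.params) (h : ε < ε')
    (s : ℝ) : D.pt s ε' ∈ D.Xi ε := by
  have key : ∀ η > 0, ∃ t, D.G₁ s ε' = D.G₁ t ε ∧ D.G₂ t ε < D.G₂ s ε' + η := fun η hη =>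
    hD.nested ε hε ε' hε' h (show (D.G₁ s ε', D.G₂ s ε' + η) ∈ D.Xi ε' from
      ⟨s, rfl, by simpa using hη⟩)
  obtain ⟨t, ht, -⟩ := key 1 one_pos
  have hle : D.G₂ t ε ≤ D.G₂ s ε' := le_of_forall_pos_lt_add fun η hη => by
    obtain ⟨t', ht', h'⟩ := key η hη
    obtain rfl := (hD.G₁_strictMono hε).injective (ht.symm.trans ht')
    exact h'
  refine ⟨t, ht, lt_of_le_of_ne hle fun heq => hD.separated ε hε ε' hε' h t ?_⟩
  rw [show D.pt t ε = D.pt s ε' from Prod.ext ht.symm heq]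
  refine mem_closure_of_tendsto (f := fun η : ℝ => (D.G₁ s ε', D.G₂ s ε' + η)) (b := 𝓝[>] 0) ?_
    (eventually_mem_nhdsWithin.mono fun η hη => ⟨s, rfl, by simpa using hη⟩)
  have : Tendsto (fun η : ℝ => (D.G₁ s ε', D.G₂ s ε' + η)) (𝓝 0) (𝓝 (D.G₁ s ε', D.G₂ s ε' + 0)) :=
    (by fun_prop : Continuous fun η : ℝ => (D.G₁ s ε', D.G₂ s ε' + η)).tendsto 0
  rw [add_zero] at this
  exact this.mono_left nhdsWithin_le_nhds

lemma hgt_pos_of_mem_Xi (hD : D.IsAdmissible) (hε : ε ∈ D.params) {x : ℝ × ℝ} (hx : x ∈ D.Xi ε)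
    (σ : ℝ) : 0 < D.hgt ε σ x := by
  obtain ⟨s, h1, h2⟩ := hx
  have := hD.hgt_pt_nonneg hε s σ
  simp only [hgt, pt, h1] at *
  linarith

end IsAdmissible

/-! ### Tangents from the fixed boundary -/

namespace IsAdmissible

lemma isTangency_iff (hD : D.IsAdmissible) (hε : ε ∈ D.params) :
    D.IsTangency ε t s ↔ D.hgt ε s (D.g t) = 0 := by
  have h := hD.deriv_pos ε hε s
  rw [IsTangency, hD.deriv_G₂ hε, hgt,
    show (D.g₂ t - D.G₂ s ε) * deriv (fun τ => D.G₁ τ ε) s -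
      (D.g₁ t - D.G₁ s ε) * (D.slopeAt s ε * deriv (fun τ => D.G₁ τ ε) s) =
      deriv (fun τ => D.G₁ τ ε) s *
        ((D.g t).2 - D.G₂ s ε - D.slopeAt s ε * ((D.g t).1 - D.G₁ s ε)) by simp only [g]; ring,
    mul_eq_zero, or_iff_right h.ne']

lemma hgt_tR (hD : D.IsAdmissible) (hε : ε ∈ D.posParams) (t : ℝ) :
    D.hgt ε (D.tR t ε) (D.g t) = 0 :=
  (hD.isTangency_iff (params_of_posParams hε)).1 ((hD.tangency ε hε t _).2 (.inl rfl))

lemma hgt_tL (hD : D.IsAdmissible) (hε : ε ∈ D.posParams) (t : ℝ) :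
    D.hgt ε (D.tL t ε) (D.g t) = 0 :=
  (hD.isTangency_iff (params_of_posParams hε)).1 ((hD.tangency ε hε t _).2 (.inr rfl))

lemma g_ne_pt (hD : D.IsAdmissible) (hε : ε ∈ D.posParams) (s t : ℝ) : D.g t ≠ D.pt s ε := by
  intro h
  obtain ⟨τ, h1, h2⟩ := hD.pt_mem_Xi hD.zero_mem (params_of_posParams hε) hε.1 s
  rw [← h] at h1 h2
  obtain rfl := (hD.G₁_strictMono hD.zero_mem).injective h1
  exact lt_irrefl _ h2

lemma G₁_ne (hD : D.IsAdmissible) (hε : ε ∈ D.posParams) (hs : D.hgt ε s (D.g t) = 0) :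
    D.G₁ s ε ≠ D.g₁ t := fun h => hD.g_ne_pt hε s t <| by
  simp only [hgt, g, h, sub_self, mul_zero, sub_zero, sub_eq_zero] at hs
  exact Prod.ext h.symm hs

/-- The two tangency points lie on different sides of the vertical line through `g t`: on each side
the height of `g t` over the tangent is strictly monotone in the tangency parameter. -/
lemma G₁_tR_lt_and (hD : D.IsAdmissible) (hε : ε ∈ D.posParams) (t : ℝ) :
    D.G₁ (D.tR t ε) ε < D.g₁ t ∧ D.g₁ t < D.G₁ (D.tL t ε) ε := by
  have hp := params_of_posParams hε
  have hlt := hD.tR_lt_tL ε hε t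
  have h1 := hD.hgt_tR hε t
  have h2 := hD.hgt_tL hε t
  have hm := hD.G₁_strictMono hp hlt
  rcases (hD.G₁_ne hε h1).lt_or_gt with h | h
  · refine ⟨h, ?_⟩
    rcases (hD.G₁_ne hε h2).lt_or_gt with h' | h'
    · have := hD.hgt_lt_hgt hp hlt (x := D.g t) h'.le
      linarith
    · exact h'
  · have := hD.hgt_lt_hgt' hp hlt (x := D.g t) h.le
    linarith

lemma wR_lt (hD : D.IsAdmissible) (hε : ε ∈ D.posParams) (t : ℝ) : (D.wR t ε).1 < D.g₁ t :=
  (hD.G₁_tR_lt_and hε t).1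

lemma lt_wL (hD : D.IsAdmissible) (hε : ε ∈ D.posParams) (t : ℝ) : D.g₁ t < (D.wL t ε).1 :=
  (hD.G₁_tR_lt_and hε t).2

lemma κR_eq (hD : D.IsAdmissible) (hε : ε ∈ D.posParams) (t : ℝ) :
    D.κR t ε = D.slopeAt (D.tR t ε) ε := by
  have h := hD.hgt_tR hε t
  have h' := hD.wR_lt hε t
  rw [κR, div_eq_iff (by linarith)]
  simp only [hgt, wR, pt, g] at *
  linarith

lemma κL_eq (hD : D.IsAdmissible) (hε : ε ∈ D.posParams) (t : ℝ) :
    D.κL t ε = D.slopeAt (D.tL t ε) ε := by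
  have h := hD.hgt_tL hε t
  have h' := hD.lt_wL hε t
  rw [κL, div_eq_iff (by linarith)]
  simp only [hgt, wL, pt, g] at *
  linarith

lemma hgt_tR_eq (hD : D.IsAdmissible) (hε : ε ∈ D.posParams) (t : ℝ) (x : ℝ × ℝ) :
    D.hgt ε (D.tR t ε) x = x.2 - D.g₂ t - D.κR t ε * (x.1 - D.g₁ t) := by
  have h := hD.hgt_tR hε t
  rw [hD.κR_eq hε]
  simp only [hgt, g] at *
  linarith

lemma hgt_tL_eq (hD : D.IsAdmissible) (hε : ε ∈ D.posParams) (t : ℝ) (x : ℝ × ℝ) :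
    D.hgt ε (D.tL t ε) x = x.2 - D.g₂ t - D.κL t ε * (x.1 - D.g₁ t) := by
  have h := hD.hgt_tL hε t
  rw [hD.κL_eq hε]
  simp only [hgt, g] at *
  linarith

/-- The fixed boundary lies strictly above its tangents. -/
lemma g_above_tangent (hD : D.IsAdmissible) (h : t ≠ t') :
    D.g₂ t' + D.κ₂ t' * (D.g₁ t - D.g₁ t') < D.g₂ t := by
  have := hD.hgt_pt_pos hD.zero_mem h
  simp only [hgt, pt] at this
  change D.G₂ t' 0 + D.slopeAt t' 0 * (D.G₁ t 0 - D.G₁ t' 0) < D.G₂ t 0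
  linarith

lemma pt_above_tangent (hD : D.IsAdmissible) (hε : ε ∈ D.posParams) (s t : ℝ) :
    D.g₂ t + D.κ₂ t * (D.G₁ s ε - D.g₁ t) < D.G₂ s ε := by
  have := hD.hgt_pos_of_mem_Xi hD.zero_mem
    (hD.pt_mem_Xi hD.zero_mem (params_of_posParams hε) hε.1 s) t
  simp only [hgt, pt] at this
  change D.G₂ t 0 + D.slopeAt t 0 * (D.G₁ s ε - D.G₁ t 0) < D.G₂ s ε
  linarith

lemma κR_lt_κ₂ (hD : D.IsAdmissible) (hε : ε ∈ D.posParams) (t : ℝ) : D.κR t ε < D.κ₂ t := by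
  have h := hD.pt_above_tangent hε (D.tR t ε) t
  have h' := hD.wR_lt hε t
  rw [κR, div_lt_iff_of_neg (by linarith)]
  simp only [wR, pt]
  linarith

lemma κ₂_lt_κL (hD : D.IsAdmissible) (hε : ε ∈ D.posParams) (t : ℝ) : D.κ₂ t < D.κL t ε := by
  have h := hD.pt_above_tangent hε (D.tL t ε) t
  have h' := hD.lt_wL hε t
  rw [κL, lt_div_iff₀ (by linarith)]
  simp only [wL, pt]
  linarith

lemma g₁_strictMono (hD : D.IsAdmissible) : StrictMono D.g₁ := hD.G₁_strictMono hD.zero_mem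

lemma hgt_tR_pos (hD : D.IsAdmissible) (hε : ε ∈ D.posParams) (h : t < t') :
    0 < D.hgt ε (D.tR t ε) (D.g t') := by
  have h1 := hD.g_above_tangent h.ne'
  have h2 := mul_pos (sub_pos.2 (hD.κR_lt_κ₂ hε t)) (sub_pos.2 (hD.g₁_strictMono h))
  rw [hD.hgt_tR_eq hε]
  simp only [g]
  linarith

lemma hgt_tL_pos (hD : D.IsAdmissible) (hε : ε ∈ D.posParams) (h : t' < t) :
    0 < D.hgt ε (D.tL t ε) (D.g t') := by
  have h1 := hD.g_above_tangent h.ne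
  have h2 := mul_pos (sub_pos.2 (hD.κ₂_lt_κL hε t)) (sub_pos.2 (hD.g₁_strictMono h))
  rw [hD.hgt_tL_eq hε]
  simp only [g]
  linarith

/-- Left of the vertical line through `g t`, the tangency parameters before `tR` are the ones whose
tangents pass below `g t`. -/
lemma lt_tR_of_hgt_pos (hD : D.IsAdmissible) (hε : ε ∈ D.posParams)
    (hs : D.G₁ s ε < D.g₁ t) (h : 0 < D.hgt ε s (D.g t)) : s < D.tR t ε := by
  by_contra! hle
  rcases hle.eq_or_lt with rfl | hlt
  · exact h.ne' (hD.hgt_tR hε t)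
  · have := hD.hgt_lt_hgt (params_of_posParams hε) hlt (x := D.g t) hs.le
    rw [hD.hgt_tR hε] at this
    exact lt_asymm h this

lemma tR_lt_of_hgt_neg (hD : D.IsAdmissible) (hε : ε ∈ D.posParams)
    (h : D.hgt ε s (D.g t) < 0) : D.tR t ε < s := by
  by_contra! hle
  rcases hle.eq_or_lt with rfl | hlt
  · exact h.ne (hD.hgt_tR hε t)
  · have := hD.hgt_lt_hgt (params_of_posParams hε) hlt (x := D.g t) (hD.wR_lt hε t).le
    rw [hD.hgt_tR hε] at this
    exact lt_asymm h this

lemma tL_lt_of_hgt_pos (hD : D.IsAdmissible) (hε : ε ∈ D.posParams)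
    (hs : D.g₁ t < D.G₁ s ε) (h : 0 < D.hgt ε s (D.g t)) : D.tL t ε < s := by
  by_contra! hle
  rcases hle.eq_or_lt with rfl | hlt
  · exact h.ne' (hD.hgt_tL hε t)
  · have := hD.hgt_lt_hgt' (params_of_posParams hε) hlt (x := D.g t) hs.le
    rw [hD.hgt_tL hε] at this
    exact lt_asymm h this

lemma lt_tL_of_hgt_neg (hD : D.IsAdmissible) (hε : ε ∈ D.posParams)
    (h : D.hgt ε s (D.g t) < 0) : s < D.tL t ε := by
  by_contra! hle
  rcases hle.eq_or_lt with rfl | hlt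
  · exact h.ne (hD.hgt_tL hε t)
  · have := hD.hgt_lt_hgt' (params_of_posParams hε) hlt (x := D.g t) (hD.lt_wL hε t).le
    rw [hD.hgt_tL hε] at this
    exact lt_asymm h this

lemma tR_strictMono (hD : D.IsAdmissible) (hε : ε ∈ D.posParams) :
    StrictMono fun t => D.tR t ε := fun _ _ h =>
  hD.lt_tR_of_hgt_pos hε ((hD.wR_lt hε _).trans (hD.g₁_strictMono h)) (hD.hgt_tR_pos hε h)

lemma tL_strictMono (hD : D.IsAdmissible) (hε : ε ∈ D.posParams) :
    StrictMono fun t => D.tL t ε := fun _ _ h =>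
  hD.tL_lt_of_hgt_pos hε ((hD.g₁_strictMono h).trans (hD.lt_wL hε _)) (hD.hgt_tL_pos hε h)

/-- The right tangents turn clockwise as the index grows. -/
lemma κR_lt_κR (hD : D.IsAdmissible) (hε : ε ∈ D.posParams) (hε' : ε' ∈ D.posParams) (h : ε < ε')
    (t : ℝ) : D.κR t ε' < D.κR t ε := by
  have h1 := hD.hgt_pos_of_mem_Xi (params_of_posParams hε)
    (hD.pt_mem_Xi (params_of_posParams hε) (params_of_posParams hε') h (D.tR t ε')) (D.tR t ε)
  rw [hD.hgt_tR_eq hε] at h1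
  have h' := hD.wR_lt hε' t
  nth_rewrite 1 [κR]
  rw [div_lt_iff_of_neg (by linarith)]
  simp only [wR, pt] at *
  linarith

lemma κL_lt_κL (hD : D.IsAdmissible) (hε : ε ∈ D.posParams) (hε' : ε' ∈ D.posParams) (h : ε < ε')
    (t : ℝ) : D.κL t ε < D.κL t ε' := by
  have h1 := hD.hgt_pos_of_mem_Xi (params_of_posParams hε)
    (hD.pt_mem_Xi (params_of_posParams hε) (params_of_posParams hε') h (D.tL t ε')) (D.tL t ε)
  rw [hD.hgt_tL_eq hε] at h1
  have h' := hD.lt_wL hε' t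
  nth_rewrite 2 [κL]
  rw [lt_div_iff₀ (by linarith)]
  simp only [wL, pt] at *
  linarith

/-! ### Continuity of the tangency parameters -/

lemma continuous_g₁ (hD : D.IsAdmissible) : Continuous D.g₁ := hD.continuous_G₁ hD.zero_mem

lemma continuous_g₂ (hD : D.IsAdmissible) : Continuous D.g₂ := hD.continuous_G₂ hD.zero_mem

lemma continuous_g (hD : D.IsAdmissible) : Continuous D.g :=
  hD.continuous_g₁.prodMk hD.continuous_g₂

lemma continuousOn_slopeAt (hD : D.IsAdmissible) :
    ContinuousOn (fun q : ℝ × ℝ => D.slopeAt q.1 q.2) (univ ×ˢ D.params) :=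
  hD.smooth₂.continuousOn_deriv.div hD.smooth₁.continuousOn_deriv fun q hq =>
    (hD.deriv_pos q.2 hq.2 q.1).ne'

lemma continuousOn_hgt (hD : D.IsAdmissible) (s : ℝ) :
    ContinuousOn (fun q : ℝ × ℝ => D.hgt q.2 s (D.g q.1)) (univ ×ˢ D.posParams) := by
  have hm : MapsTo (fun q : ℝ × ℝ => (s, q.2)) (univ ×ˢ D.posParams) (univ ×ˢ D.params) :=
    fun q hq => ⟨trivial, params_of_posParams hq.2⟩
  have hc : ContinuousOn (fun q : ℝ × ℝ => (s, q.2)) (univ ×ˢ D.posParams) := by fun_prop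
  have h1 := hD.smooth₁.continuousOn.comp hc hm
  have h2 := hD.smooth₂.continuousOn.comp hc hm
  have h3 := hD.continuousOn_slopeAt.comp hc hm
  have h4 : ContinuousOn (fun q : ℝ × ℝ => D.g q.1) (univ ×ˢ D.posParams) :=
    (hD.continuous_g.comp continuous_fst).continuousOn
  exact (h4.snd.sub h2).sub (h3.mul (h4.fst.sub h1))

lemma continuousOn_G₁_right (hD : D.IsAdmissible) (s : ℝ) :
    ContinuousOn (fun q : ℝ × ℝ => D.G₁ s q.2) (univ ×ˢ D.posParams) :=
  hD.smooth₁.continuousOn.comp (f := fun q : ℝ × ℝ => (s, q.2)) (by fun_prop)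
    fun q hq => ⟨trivial, params_of_posParams hq.2⟩

lemma continuousOn_tR (hD : D.IsAdmissible) :
    ContinuousOn (fun q : ℝ × ℝ => D.tR q.1 q.2) (univ ×ˢ D.posParams) := by
  rintro ⟨t, ε⟩ ⟨-, hε⟩
  have hmem : ∀ᶠ q : ℝ × ℝ in 𝓝[univ ×ˢ D.posParams] (t, ε), q.2 ∈ D.posParams :=
    eventually_mem_nhdsWithin.mono fun q hq => hq.2
  have hp := params_of_posParams hε
  have hg : ContinuousWithinAt (fun q : ℝ × ℝ => D.g₁ q.1) (univ ×ˢ D.posParams) (t, ε) :=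
    (hD.continuous_g₁.comp continuous_fst).continuousWithinAt
  refine tendsto_order.2 ⟨fun s hs => ?_, fun s hs => ?_⟩
  · have h1 : D.G₁ s ε < D.g₁ t := (hD.G₁_strictMono hp hs).trans (hD.wR_lt hε t)
    have h2 := hD.hgt_lt_hgt hp hs (x := D.g t) (hD.wR_lt hε t).le
    rw [hD.hgt_tR hε] at h2
    filter_upwards [hmem, (hD.continuousOn_G₁_right s (t, ε) ⟨trivial, hε⟩).eventually_lt hg h1,
      (hD.continuousOn_hgt s (t, ε) ⟨trivial, hε⟩).eventually_const_lt h2] with q hq h3 h4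
    exact hD.lt_tR_of_hgt_pos hq h3 h4
  · obtain ⟨s', hs', hs'', hs1⟩ : ∃ s', D.tR t ε < s' ∧ s' < s ∧ D.G₁ s' ε < D.g₁ t := by
      have h1 : ∀ᶠ s' in 𝓝[>] (D.tR t ε), D.G₁ s' ε < D.g₁ t :=
        nhdsWithin_le_nhds ((hD.continuous_G₁ hp).tendsto _ |>.eventually_lt_const
          (hD.wR_lt hε t))
      have h2 : ∀ᶠ s' in 𝓝[>] (D.tR t ε), s' ∈ Ioo (D.tR t ε) s := Ioo_mem_nhdsGT hs
      obtain ⟨s', h⟩ := (h1.and h2).exists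
      exact ⟨s', h.2.1, h.2.2, h.1⟩
    have h2 := hD.hgt_lt_hgt hp hs' (x := D.g t) hs1.le
    rw [hD.hgt_tR hε] at h2
    filter_upwards [hmem,
      (hD.continuousOn_hgt s' (t, ε) ⟨trivial, hε⟩).eventually_lt_const h2] with q hq h4
    exact (hD.tR_lt_of_hgt_neg hq h4).trans hs''

lemma continuousOn_tL (hD : D.IsAdmissible) :
    ContinuousOn (fun q : ℝ × ℝ => D.tL q.1 q.2) (univ ×ˢ D.posParams) := by
  rintro ⟨t, ε⟩ ⟨-, hε⟩
  have hmem : ∀ᶠ q : ℝ × ℝ in 𝓝[univ ×ˢ D.posParams] (t, ε), q.2 ∈ D.posParams :=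
    eventually_mem_nhdsWithin.mono fun q hq => hq.2
  have hp := params_of_posParams hε
  have hg : ContinuousWithinAt (fun q : ℝ × ℝ => D.g₁ q.1) (univ ×ˢ D.posParams) (t, ε) :=
    (hD.continuous_g₁.comp continuous_fst).continuousWithinAt
  refine tendsto_order.2 ⟨fun s hs => ?_, fun s hs => ?_⟩
  · obtain ⟨s', hs', hs'', hs1⟩ : ∃ s', s' < D.tL t ε ∧ s < s' ∧ D.g₁ t < D.G₁ s' ε := by
      have h1 : ∀ᶠ s' in 𝓝[<] (D.tL t ε), D.g₁ t < D.G₁ s' ε :=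
        nhdsWithin_le_nhds ((hD.continuous_G₁ hp).tendsto _ |>.eventually_const_lt
          (hD.lt_wL hε t))
      have h2 : ∀ᶠ s' in 𝓝[<] (D.tL t ε), s' ∈ Ioo s (D.tL t ε) := Ioo_mem_nhdsLT hs
      obtain ⟨s', h⟩ := (h1.and h2).exists
      exact ⟨s', h.2.2, h.2.1, h.1⟩
    have h2 := hD.hgt_lt_hgt' hp hs' (x := D.g t) hs1.le
    rw [hD.hgt_tL hε] at h2
    filter_upwards [hmem,
      (hD.continuousOn_hgt s' (t, ε) ⟨trivial, hε⟩).eventually_lt_const h2] with q hq h4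
    exact hs''.trans (hD.lt_tL_of_hgt_neg hq h4)
  · have h1 : D.g₁ t < D.G₁ s ε := (hD.lt_wL hε t).trans (hD.G₁_strictMono hp hs)
    have h2 := hD.hgt_lt_hgt' hp hs (x := D.g t) (hD.lt_wL hε t).le
    rw [hD.hgt_tL hε] at h2
    filter_upwards [hmem, hg.eventually_lt (hD.continuousOn_G₁_right s (t, ε) ⟨trivial, hε⟩) h1,
      (hD.continuousOn_hgt s (t, ε) ⟨trivial, hε⟩).eventually_const_lt h2] with q hq h3 h4
    exact hD.tL_lt_of_hgt_pos hq h3 h4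

lemma continuousOn_κR (hD : D.IsAdmissible) :
    ContinuousOn (fun q : ℝ × ℝ => D.κR q.1 q.2) (univ ×ˢ D.posParams) :=
  (hD.continuousOn_slopeAt.comp (hD.continuousOn_tR.prodMk continuousOn_snd)
    fun _ hq => ⟨trivial, params_of_posParams hq.2⟩).congr fun q hq => hD.κR_eq hq.2 q.1

lemma continuousOn_κL (hD : D.IsAdmissible) :
    ContinuousOn (fun q : ℝ × ℝ => D.κL q.1 q.2) (univ ×ˢ D.posParams) :=
  (hD.continuousOn_slopeAt.comp (hD.continuousOn_tL.prodMk continuousOn_snd)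
    fun _ hq => ⟨trivial, params_of_posParams hq.2⟩).congr fun q hq => hD.κL_eq hq.2 q.1

lemma continuous_wR (hD : D.IsAdmissible) (hε : ε ∈ D.posParams) :
    Continuous fun t => D.wR t ε := by
  have h : Continuous fun t => D.tR t ε := continuousOn_univ.1 <|
    hD.continuousOn_tR.comp (f := fun t : ℝ => (t, ε)) (by fun_prop) fun t _ => ⟨trivial, hε⟩
  have hp := params_of_posParams hε
  exact ((hD.continuous_G₁ hp).comp h).prodMk ((hD.continuous_G₂ hp).comp h)

lemma continuous_wL (hD : D.IsAdmissible) (hε : ε ∈ D.posParams) :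
    Continuous fun t => D.wL t ε := by
  have h : Continuous fun t => D.tL t ε := continuousOn_univ.1 <|
    hD.continuousOn_tL.comp (f := fun t : ℝ => (t, ε)) (by fun_prop) fun t _ => ⟨trivial, hε⟩
  have hp := params_of_posParams hε
  exact ((hD.continuous_G₁ hp).comp h).prodMk ((hD.continuous_G₂ hp).comp h)

/-- A right tangency point is also the left tangency point for an earlier boundary point, namely for
the second intersection of the tangent with the fixed boundary. -/
lemma exists_wL_eq_wR (hD : D.IsAdmissible) (hε : ε ∈ D.posParams) (t : ℝ) :
    ∃ t' < t, D.wL t' ε = D.wR t ε := by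
  have hw := hD.wR_lt hε t
  have hhit : ∀ τ, τ ∈ D.lineHits t (D.wR t ε) ↔ D.hgt ε (D.tR t ε) (D.g τ) = 0 := fun τ => by
    rw [hD.hgt_tR_eq hε, lineHits, mem_ofPred_eq, κR]
    have : (D.wR t ε).1 - D.g₁ t ≠ 0 := by linarith
    simp only [g]
    rw [sub_eq_zero, div_mul_eq_mul_div, eq_div_iff this, mul_comm ((D.wR t ε).2 - _)]
  obtain ⟨x, y, hxy, hset⟩ := ncard_eq_two.1 (hD.hitsR ε hε t)
  obtain ⟨τ, hτ, hne⟩ : ∃ τ, D.hgt ε (D.tR t ε) (D.g τ) = 0 ∧ τ ≠ t := by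
    by_cases hx : x = t
    · exact ⟨y, (hhit y).1 (by simp [hset]), fun h => hxy (hx.trans h.symm)⟩
    · exact ⟨x, (hhit x).1 (by simp [hset]), hx⟩
  have hlt : τ < t := by
    by_contra! hle
    exact (hD.hgt_tR_pos hε (lt_of_le_of_ne hle (Ne.symm hne))).ne' hτ
  refine ⟨τ, hlt, ?_⟩
  rcases (hD.tangency ε hε τ _).1 ((hD.isTangency_iff (params_of_posParams hε)).2 hτ) with h | h
  · exact absurd (hD.tR_strictMono hε hlt) (by simp [h])
  · rw [wL, wR, ← h]

lemma exists_wR_eq_wL (hD : D.IsAdmissible) (hε : ε ∈ D.posParams) (t : ℝ) :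
    ∃ t' > t, D.wR t' ε = D.wL t ε := by
  have hw := hD.lt_wL hε t
  have hhit : ∀ τ, τ ∈ D.lineHits t (D.wL t ε) ↔ D.hgt ε (D.tL t ε) (D.g τ) = 0 := fun τ => by
    rw [hD.hgt_tL_eq hε, lineHits, mem_ofPred_eq, κL]
    have : (D.wL t ε).1 - D.g₁ t ≠ 0 := by linarith
    simp only [g]
    rw [sub_eq_zero, div_mul_eq_mul_div, eq_div_iff this, mul_comm ((D.wL t ε).2 - _)]
  obtain ⟨x, y, hxy, hset⟩ := ncard_eq_two.1 (hD.hitsL ε hε t)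
  obtain ⟨τ, hτ, hne⟩ : ∃ τ, D.hgt ε (D.tL t ε) (D.g τ) = 0 ∧ τ ≠ t := by
    by_cases hx : x = t
    · exact ⟨y, (hhit y).1 (by simp [hset]), fun h => hxy (hx.trans h.symm)⟩
    · exact ⟨x, (hhit x).1 (by simp [hset]), hx⟩
  have hlt : t < τ := by
    by_contra! hle
    exact (hD.hgt_tL_pos hε (lt_of_le_of_ne hle hne)).ne' hτ
  refine ⟨τ, hlt, ?_⟩
  rcases (hD.tangency ε hε τ _).1 ((hD.isTangency_iff (params_of_posParams hε)).2 hτ) with h | h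
  · rw [wL, wR, ← h]
  · exact absurd (hD.tL_strictMono hε hlt) (by simp [h])

end IsAdmissible

end CurveFamily

/-! ### Relaxation equations -/

/-- `y` solves the relaxation equation `y' = q (T - y)` on the line. -/
def IsRelax (T q y : ℝ → ℝ) : Prop := ∀ t, HasDerivAt y (q t * (T t - y t)) t

/-- A relaxation equation `y' = q(t, ε) (T - y)` with a continuous positive rate that does not
increase with the parameter `ε`. -/
structure RelaxCoeff (T : ℝ → ℝ) (q : ℝ → ℝ → ℝ) : Prop where
  contT : Continuous T
  contq : Continuous fun x : ℝ × ℝ => q x.1 x.2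
  pos : ∀ t ε, 0 < q t ε
  anti : ∀ t, Antitone (q t)

/-- The integrated rate. -/
def relaxExp (q : ℝ → ℝ → ℝ) (t ε : ℝ) : ℝ := ∫ τ in (0 : ℝ)..t, q τ ε

/-- The inhomogeneous part of the solution. -/
def relaxInt (T : ℝ → ℝ) (q : ℝ → ℝ → ℝ) (t ε : ℝ) : ℝ :=
  ∫ τ in (0 : ℝ)..t, Real.exp (relaxExp q τ ε) * (q τ ε * T τ)

/-- The solution of the relaxation equation with constant of integration `C`. -/
def relaxSol (T : ℝ → ℝ) (q : ℝ → ℝ → ℝ) (ε C t : ℝ) : ℝ :=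
  Real.exp (-relaxExp q t ε) * (relaxInt T q t ε + C)

/-- The constant of integration of the solution with value `v` at `t`. -/
def relaxConst (T : ℝ → ℝ) (q : ℝ → ℝ → ℝ) (ε t v : ℝ) : ℝ :=
  Real.exp (relaxExp q t ε) * v - relaxInt T q t ε

section Relax

variable {T : ℝ → ℝ} {q : ℝ → ℝ → ℝ} {ε C t a b : ℝ} {y z : ℝ → ℝ}

lemma IsRelax.continuous {q : ℝ → ℝ} (h : IsRelax T q y) : Continuous y :=
  continuous_iff_continuousAt.2 fun t => (h t).continuousAt

lemma relaxSol_relaxConst (T : ℝ → ℝ) (q : ℝ → ℝ → ℝ) (ε t v : ℝ) :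
    relaxSol T q ε (relaxConst T q ε t v) t = v := by
  rw [relaxSol, relaxConst, add_sub_cancel, ← mul_assoc, ← Real.exp_add, neg_add_cancel,
    Real.exp_zero, one_mul]

namespace RelaxCoeff

lemma continuous_rate (h : RelaxCoeff T q) (ε : ℝ) : Continuous fun t => q t ε :=
  h.contq.comp (by fun_prop : Continuous fun t : ℝ => (t, ε))

lemma hasDerivAt_relaxExp (h : RelaxCoeff T q) (t ε : ℝ) :
    HasDerivAt (fun t => relaxExp q t ε) (q t ε) t :=
  (h.continuous_rate ε).integral_hasStrictDerivAt 0 t |>.hasDerivAt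

lemma continuous_relaxExp (h : RelaxCoeff T q) :
    Continuous fun x : ℝ × ℝ => relaxExp q x.1 x.2 :=
  intervalIntegral.continuous_parametric_intervalIntegral_of_continuous
    (f := fun (x : ℝ × ℝ) τ => q τ x.2) (s := fun x => x.1) (a₀ := 0)
    (h.contq.comp (by fun_prop : Continuous fun x : (ℝ × ℝ) × ℝ => (x.2, x.1.2))) continuous_fst

lemma continuous_integrand (h : RelaxCoeff T q) :
    Continuous fun x : ℝ × ℝ => Real.exp (relaxExp q x.1 x.2) * (q x.1 x.2 * T x.1) :=
  h.continuous_relaxExp.rexp.mul (h.contq.mul (h.contT.comp continuous_fst))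

lemma continuous_relaxInt (h : RelaxCoeff T q) :
    Continuous fun x : ℝ × ℝ => relaxInt T q x.1 x.2 :=
  intervalIntegral.continuous_parametric_intervalIntegral_of_continuous
    (f := fun (x : ℝ × ℝ) τ => Real.exp (relaxExp q τ x.2) * (q τ x.2 * T τ)) (s := fun x => x.1)
    (a₀ := 0)
    (h.continuous_integrand.comp (by fun_prop : Continuous fun x : (ℝ × ℝ) × ℝ => (x.2, x.1.2)))
    continuous_fst

lemma continuous_relaxSol (h : RelaxCoeff T q) :
    Continuous fun x : ℝ × ℝ × ℝ => relaxSol T q x.1 x.2.1 x.2.2 := by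
  have hm : Continuous fun x : ℝ × ℝ × ℝ => (x.2.2, x.1) := by fun_prop
  exact (h.continuous_relaxExp.comp hm).neg.rexp.mul
    ((h.continuous_relaxInt.comp hm).add (by fun_prop))

lemma continuousOn_relaxConst (h : RelaxCoeff T q) {S : Set ℝ} {t v : ℝ → ℝ}
    (ht : ContinuousOn t S) (hv : ContinuousOn v S) :
    ContinuousOn (fun ε => relaxConst T q ε (t ε) (v ε)) S := by
  have hp : ContinuousOn (fun ε => (t ε, ε)) S := ht.prodMk continuousOn_id
  exact ((h.continuous_relaxExp.comp_continuousOn hp).rexp.mul hv).sub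
    (h.continuous_relaxInt.comp_continuousOn hp)

lemma continuousOn_relaxSol (h : RelaxCoeff T q) {X : Type*} [TopologicalSpace X] {S : Set X}
    {e C t : X → ℝ} (he : ContinuousOn e S) (hC : ContinuousOn C S) (ht : ContinuousOn t S) :
    ContinuousOn (fun x => relaxSol T q (e x) (C x) (t x)) S := by
  have hp : ContinuousOn (fun x => (e x, C x, t x)) S := he.prodMk (hC.prodMk ht)
  exact h.continuous_relaxSol.comp_continuousOn
    (g := fun x : ℝ × ℝ × ℝ => relaxSol T q x.1 x.2.1 x.2.2) hp

lemma isRelax_relaxSol (h : RelaxCoeff T q) (ε C : ℝ) :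
    IsRelax T (fun t => q t ε) (relaxSol T q ε C) := fun t => by
  have h1 := (h.hasDerivAt_relaxExp t ε).neg.exp
  have hc : Continuous fun τ => Real.exp (relaxExp q τ ε) * (q τ ε * T τ) :=
    h.continuous_integrand.comp (by fun_prop : Continuous fun t : ℝ => (t, ε))
  have h2 : HasDerivAt (fun t => relaxInt T q t ε) _ t :=
    (hc.integral_hasStrictDerivAt 0 t).hasDerivAt
  refine (h1.mul (h2.add_const C)).congr_deriv ?_
  have : Real.exp (-relaxExp q t ε) * (Real.exp (relaxExp q t ε) * (q t ε * T t)) =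
      q t ε * T t := by
    rw [← mul_assoc, ← Real.exp_add, neg_add_cancel, Real.exp_zero, one_mul]
  simp only [this, relaxSol, Pi.neg_apply]
  ring

/-- Comparison with a subsolution: the difference multiplied by the integrating factor
increases. -/
lemma lt_of_subsolution (h : RelaxCoeff T q) {y' : ℝ → ℝ} (hab : a ≤ b)
    (hy : ContinuousOn y (Icc a b)) (hy' : ∀ t ∈ Ioo a b, HasDerivAt y (y' t) t)
    (hle : ∀ t ∈ Ioo a b, y' t ≤ q t ε * (T t - y t)) (hz : IsRelax T (fun t => q t ε) z)
    (hlt : y a < z a) : y b < z b := by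
  have hE := fun t => h.hasDerivAt_relaxExp t ε
  have hEc : Continuous fun t => relaxExp q t ε :=
    continuous_iff_continuousAt.2 fun t => (hE t).continuousAt
  have hder : ∀ t ∈ Ioo a b, HasDerivAt (fun t => (z t - y t) * Real.exp (relaxExp q t ε))
      ((q t ε * (T t - y t) - y' t) * Real.exp (relaxExp q t ε)) t := fun t ht => by
    refine (((hz t).sub (hy' t ht)).mul (hE t).exp).congr_deriv ?_
    simp only [Pi.sub_apply]
    ring
  have hmono : MonotoneOn (fun t => (z t - y t) * Real.exp (relaxExp q t ε)) (Icc a b) := by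
    refine monotoneOn_of_deriv_nonneg (convex_Icc a b)
      ((hz.continuous.continuousOn.sub hy).mul hEc.rexp.continuousOn) (fun t ht => ?_)
      fun t ht => ?_
    · rw [interior_Icc] at ht
      exact (hder t ht).differentiableAt.differentiableWithinAt
    · rw [interior_Icc] at ht
      rw [(hder t ht).deriv]
      exact mul_nonneg (sub_nonneg.2 (hle t ht)) (Real.exp_pos _).le
  have := hmono (left_mem_Icc.2 hab) (right_mem_Icc.2 hab) hab
  have h0 : 0 < (z a - y a) * Real.exp (relaxExp q a ε) :=
    mul_pos (sub_pos.2 hlt) (Real.exp_pos _)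
  exact sub_pos.1 (pos_of_mul_pos_left (h0.trans_le this) (Real.exp_pos _).le)

/-- Solutions that lie above `T` decrease more slowly for larger parameters. -/
lemma lt_of_lt (h : RelaxCoeff T q) {ε' : ℝ} (hε : ε ≤ ε') (hab : a ≤ b)
    (hy : IsRelax T (fun t => q t ε) y) (hz : IsRelax T (fun t => q t ε') z)
    (hT : ∀ t ∈ Ioo a b, T t ≤ y t) (hlt : y a < z a) : y b < z b :=
  h.lt_of_subsolution hab hy.continuous.continuousOn (fun t _ => hy t)
    (fun t ht => mul_le_mul_of_nonpos_right (h.anti t hε) (sub_nonpos.2 (hT t ht))) hz hlt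

lemma const_lt (h : RelaxCoeff T q) {c : ℝ} (hab : a ≤ b) (hT : ∀ t ∈ Ioo a b, T t = c)
    (hz : IsRelax T (fun t => q t ε) z) (hlt : c < z a) : c < z b :=
  h.lt_of_subsolution hab continuousOn_const (fun t _ => hasDerivAt_const t c)
    (fun t ht => by simp [hT t ht]) hz hlt

/-- A solution on an order-connected set is determined by one of its values. -/
lemma eqOn (h : RelaxCoeff T q) {S : Set ℝ} (hS : S.OrdConnected)
    (hy : ∀ t ∈ S, HasDerivWithinAt y (q t ε * (T t - y t)) S t)
    (hz : ∀ t ∈ S, HasDerivWithinAt z (q t ε * (T t - z t)) S t) (ha : a ∈ S) (hyz : y a = z a) :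
    EqOn y z S := fun t ht => by
  have hder : ∀ t ∈ S, HasDerivWithinAt (fun t => (z t - y t) * Real.exp (relaxExp q t ε))
      0 S t := fun t ht => by
    refine (((hz t ht).sub (hy t ht)).mul
      (h.hasDerivAt_relaxExp t ε).exp.hasDerivWithinAt).congr_deriv ?_
    simp only [Pi.sub_apply]
    ring
  have := hS.convex.norm_image_sub_le_of_norm_hasDerivWithin_le (C := 0) hder
    (fun x _ => by simp) ha ht
  rw [zero_mul, norm_le_zero_iff, hyz, sub_self, zero_mul, sub_zero, mul_eq_zero,
    or_iff_left (Real.exp_pos _).ne', sub_eq_zero] at this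
  exact this.symm

lemma eq_const (h : RelaxCoeff T q) {c : ℝ} (hab : a ≤ b) (hT : ∀ t ∈ Icc a b, a < b → T t = c)
    (hz : IsRelax T (fun t => q t ε) z) (hlt : z a = c) : z b = c := by
  rcases hab.eq_or_lt with rfl | hab'
  · exact hlt
  · exact h.eqOn ordConnected_Icc (fun t _ => (hz t).hasDerivWithinAt)
      (z := fun _ => c)
      (fun t ht => by simpa [hT t ht hab'] using hasDerivWithinAt_const t (Icc a b) c)
      (left_mem_Icc.2 hab) hlt (right_mem_Icc.2 hab)

lemma strictAntiOn (h : RelaxCoeff T q) (hy : IsRelax T (fun t => q t ε) y)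
    (hT : ∀ t ∈ Ioo a b, T t < y t) : StrictAntiOn y (Icc a b) := by
  refine strictAntiOn_of_deriv_neg (convex_Icc a b) hy.continuous.continuousOn fun t ht => ?_
  rw [interior_Icc] at ht
  rw [(hy t).deriv]
  exact mul_neg_of_pos_of_neg (h.pos t ε) (sub_neg.2 (hT t ht))

end RelaxCoeff

end Relax

/-! ### Chains of chords -/

/-- An abstract family of chords `[A c, B c]`, `c ∈ [c₀, c₁)`, shrinking as `c` grows, with values
`β c` at both ends that are not below `T`. By `crossA` a solution of a relaxation equation can meet
`β` at the ends `A c` only from above; by `crossB` a solution which is above `β` at an end `B c'`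
stays strictly above it at the ends of the larger chords. -/
structure IsRelaxChord (T : ℝ → ℝ) (q : ℝ → ℝ → ℝ) (c₀ c₁ : ℝ) (A B β : ℝ → ℝ) : Prop where
  lt : c₀ < c₁
  contA : ContinuousOn A (Ico c₀ c₁)
  contB : ContinuousOn B (Ico c₀ c₁)
  contβ : ContinuousOn β (Ico c₀ c₁)
  monoA : StrictMonoOn A (Ico c₀ c₁)
  antiB : StrictAntiOn B (Ico c₀ c₁)
  forceA : ∀ c ∈ Ioo c₀ c₁, T (A c) < β c
  forceB : ∀ c ∈ Ioo c₀ c₁, T (B c) < β c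
  forceA₀ : T (A c₀) ≤ β c₀
  forceB₀ : T (B c₀) ≤ β c₀
  crossA : ∀ ε y, IsRelax T (fun t => q t ε) y → ∀ c ∈ Ico c₀ c₁, ∀ c' ∈ Ico c₀ c₁, c < c' →
    y (A c) ≤ β c → y (A c') < β c'
  crossB : ∀ ε y, IsRelax T (fun t => q t ε) y → ∀ c ∈ Ico c₀ c₁, ∀ c' ∈ Ico c₀ c₁, c < c' →
    β c' ≤ y (B c') → β c < y (B c)

/-- Solutions with constants of integration `C ε` have at `l` the value `b` for `ε = η₁`, and
their value at `l` grows with `ε`. -/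
structure IsBase (T : ℝ → ℝ) (q : ℝ → ℝ → ℝ) (l b η₁ η : ℝ) (C : ℝ → ℝ) : Prop where
  cont : ContinuousOn C (Icc η₁ η)
  mono : StrictMonoOn (fun ε => relaxSol T q ε (C ε) l) (Icc η₁ η)
  init : relaxSol T q η₁ (C η₁) l = b

/-- The chord with parameter `c ε` moves continuously and monotonically down from the top chord. -/
structure IsDescent (c₀ c₁ η₁ η : ℝ) (c : ℝ → ℝ) : Prop where
  cont : ContinuousOn c (Icc η₁ η)
  mono : StrictMonoOn c (Icc η₁ η)
  init : c η₁ = c₀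
  mem : ∀ ε ∈ Icc η₁ η, c ε ∈ Ico c₀ c₁

lemma IsBase.mono_right {T : ℝ → ℝ} {q : ℝ → ℝ → ℝ} {l b η₁ η η' : ℝ} {C : ℝ → ℝ}
    (h : IsBase T q l b η₁ η C) (hη : η' ≤ η) : IsBase T q l b η₁ η' C :=
  have hs := Icc_subset_Icc_right hη
  ⟨h.cont.mono hs, h.mono.mono hs, h.init⟩

namespace IsDescent

variable {c₀ c₁ η₁ η η' : ℝ} {c d : ℝ → ℝ}

lemma mono_right (h : IsDescent c₀ c₁ η₁ η c) (hη : η' ≤ η) : IsDescent c₀ c₁ η₁ η' c :=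
  have hs := Icc_subset_Icc_right hη
  ⟨h.cont.mono hs, h.mono.mono hs, h.init, fun ε hε => h.mem ε (hs hε)⟩

lemma mem_Ioo (h : IsDescent c₀ c₁ η₁ η c) {ε : ℝ} (hε : ε ∈ Ioc η₁ η) : c ε ∈ Ioo c₀ c₁ :=
  ⟨h.init ▸ h.mono (left_mem_Icc.2 (hε.1.le.trans hε.2)) (Ioc_subset_Icc_self hε) hε.1,
    (h.mem ε (Ioc_subset_Icc_self hε)).2⟩

lemma max (h : IsDescent c₀ c₁ η₁ η c) (h' : IsDescent c₀ c₁ η₁ η d) :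
    IsDescent c₀ c₁ η₁ η fun ε => max (c ε) (d ε) where
  cont := h.cont.sup h'.cont
  mono := fun x hx y hy hxy => max_lt_max (h.mono hx hy hxy) (h'.mono hx hy hxy)
  init := by simp [h.init, h'.init]
  mem := fun ε hε => ⟨(h.mem ε hε).1.trans (le_max_left _ _),
    max_lt (h.mem ε hε).2 (h'.mem ε hε).2⟩

end IsDescent

namespace IsRelaxChord

variable {T : ℝ → ℝ} {q : ℝ → ℝ → ℝ} {c₀ c₁ η₁ η : ℝ} {A B β : ℝ → ℝ} {C : ℝ → ℝ}

lemma forceA_le (h : IsRelaxChord T q c₀ c₁ A B β) {c : ℝ} (hc : c ∈ Ico c₀ c₁) :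
    T (A c) ≤ β c := by
  rcases hc.1.eq_or_lt with rfl | h'
  · exact h.forceA₀
  · exact (h.forceA c ⟨h', hc.2⟩).le

lemma forceB_le (h : IsRelaxChord T q c₀ c₁ A B β) {c : ℝ} (hc : c ∈ Ico c₀ c₁) :
    T (B c) ≤ β c := by
  rcases hc.1.eq_or_lt with rfl | h'
  · exact h.forceB₀
  · exact (h.forceB c ⟨h', hc.2⟩).le

/-- The ends `A c'`, `c' ≤ c`, fill the segment from `A c₀` to `A c`. -/
lemma exists_A (h : IsRelaxChord T q c₀ c₁ A B β) {c t : ℝ} (hc : c ∈ Ico c₀ c₁)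
    (ht : t ∈ Icc (A c₀) (A c)) : ∃ c' ∈ Icc c₀ c, A c' = t :=
  intermediate_value_Icc hc.1 (h.contA.mono (Icc_subset_Ico_right hc.2)) ht

lemma exists_B (h : IsRelaxChord T q c₀ c₁ A B β) {c t : ℝ} (hc : c ∈ Ico c₀ c₁)
    (ht : t ∈ Icc (B c) (B c₀)) : ∃ c' ∈ Icc c₀ c, B c' = t :=
  intermediate_value_Icc' hc.1 (h.contB.mono (Icc_subset_Ico_right hc.2)) ht

/-- A solution that meets `β` at the end `A c` is above `T` before. -/
lemma lt_of_mem_A (h : IsRelaxChord T q c₀ c₁ A B β) {ε c t : ℝ} {y : ℝ → ℝ}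
    (hy : IsRelax T (fun t => q t ε) y) (hc : c ∈ Ico c₀ c₁) (hyc : β c ≤ y (A c))
    (ht : t ∈ Ico (A c₀) (A c)) : T t < y t := by
  obtain ⟨c', hc', rfl⟩ := h.exists_A hc (Ico_subset_Icc_self ht)
  have hm : c' ∈ Ico c₀ c₁ := ⟨hc'.1, hc'.2.trans_lt hc.2⟩
  have hlt : c' < c := lt_of_le_of_ne hc'.2 fun e => ht.2.ne (e ▸ rfl)
  by_contra! hle
  exact hyc.not_gt (h.crossA ε y hy c' hm c hc hlt (hle.trans (h.forceA_le hm)))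

lemma lt_of_mem_B (h : IsRelaxChord T q c₀ c₁ A B β) {ε c t : ℝ} {y : ℝ → ℝ}
    (hy : IsRelax T (fun t => q t ε) y) (hc : c ∈ Ico c₀ c₁) (hyc : β c ≤ y (B c))
    (ht : t ∈ Ioc (B c) (B c₀)) : T t < y t := by
  obtain ⟨c', hc', rfl⟩ := h.exists_B hc (Ioc_subset_Icc_self ht)
  have hm : c' ∈ Ico c₀ c₁ := ⟨hc'.1, hc'.2.trans_lt hc.2⟩
  have hlt : c' < c := lt_of_le_of_ne hc'.2 fun e => ht.1.ne (e ▸ rfl)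
  exact (h.forceB_le hm).trans_lt (h.crossB ε y hy c' hm c hc hlt hyc)

/-- The chord at whose left end the solution takes the value of the chord: it moves down
as the parameter grows. -/
lemma exists_descent (h : IsRelaxChord T q c₀ c₁ A B β) (hq : RelaxCoeff T q) (hη : η₁ < η)
    (hb : IsBase T q (A c₀) (β c₀) η₁ η C) :
    ∃ η' ∈ Ioc η₁ η, ∃ c, IsDescent c₀ c₁ η₁ η' c ∧
      ∀ ε ∈ Icc η₁ η', relaxSol T q ε (C ε) (A (c ε)) = β (c ε) := by
  set y : ℝ → ℝ → ℝ := fun ε => relaxSol T q ε (C ε) with hydef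
  have hy : ∀ ε, IsRelax T (fun t => q t ε) (y ε) := fun ε => hq.isRelax_relaxSol ε (C ε)
  have hcont : ∀ t, ContinuousOn (fun ε => y ε t) (Icc η₁ η) := fun t =>
    hq.continuousOn_relaxSol continuousOn_id hb.cont continuousOn_const
  obtain ⟨c₂, hc₂⟩ := exists_between h.lt
  have h₀ : c₀ ∈ Ico c₀ c₁ := ⟨le_rfl, h.lt⟩
  have h₂ : c₂ ∈ Ico c₀ c₁ := ⟨hc₂.1.le, hc₂.2⟩
  have hlt := h.crossA η₁ (y η₁) (hy η₁) c₀ h₀ c₂ h₂ hc₂.1 hb.init.le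
  have hev : ∀ᶠ ε in 𝓝[>] η₁, y ε (A c₂) < β c₂ := by
    have := ((hcont (A c₂)) η₁ (left_mem_Icc.2 hη.le)).eventually_lt_const hlt
    rw [nhdsWithin_Icc_eq_nhdsGE hη] at this
    exact nhdsWithin_mono _ Ioi_subset_Ici_self this
  obtain ⟨u, hu, hu'⟩ := (mem_nhdsGT_iff_exists_Ioc_subset).1 hev
  refine ⟨min u η, ⟨lt_min hu hη, min_le_right _ _⟩, ?_⟩
  set η' := min u η
  have hsub : Icc η₁ η' ⊆ Icc η₁ η := Icc_subset_Icc_right (min_le_right _ _)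
  have h₁' : η₁ ∈ Icc η₁ η' := left_mem_Icc.2 (le_min (le_of_lt hu) hη.le)
  have hgt : ∀ ε ∈ Icc η₁ η', β c₀ ≤ y ε (A c₀) := fun ε hε => by
    rw [← hb.init]
    exact hb.mono.monotoneOn (hsub h₁') (hsub hε) hε.1
  have hex : ∀ ε, ∃ c, ε ∈ Icc η₁ η' → c ∈ Ico c₀ c₂ ∧ y ε (A c) = β c := fun ε => by
    by_cases hε : ε ∈ Icc η₁ η'
    · have hneg : y ε (A c₂) < β c₂ := by
        rcases hε.1.eq_or_lt with rfl | h1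
        · exact hlt
        · exact hu' ⟨h1, hε.2.trans (min_le_left _ _)⟩
      have hs : Icc c₀ c₂ ⊆ Ico c₀ c₁ := Icc_subset_Ico_right hc₂.2
      obtain ⟨c, hc, hc0⟩ := intermediate_value_Icc' hc₂.1.le
        (((hy ε).continuous.comp_continuousOn (h.contA.mono hs)).sub (h.contβ.mono hs))
        (show (0 : ℝ) ∈ _ from ⟨(sub_neg.2 hneg).le, sub_nonneg.2 (hgt ε hε)⟩)
      have hc0' := sub_eq_zero.1 hc0
      exact ⟨c, fun _ => ⟨⟨hc.1, lt_of_le_of_ne hc.2 fun e => by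
        subst e; exact hneg.ne hc0'⟩, hc0'⟩⟩
    · exact ⟨0, fun h => absurd h hε⟩
  choose c hc using hex
  have hmem : ∀ ε ∈ Icc η₁ η', c ε ∈ Ico c₀ c₁ := fun ε hε =>
    ⟨(hc ε hε).1.1, (hc ε hε).1.2.trans hc₂.2⟩
  have hlo : ∀ ε ∈ Icc η₁ η', ∀ x ∈ Ico c₀ c₁, β x < y ε (A x) → x < c ε := fun ε hε x hx hlt => by
    by_contra! hle
    rcases hle.eq_or_lt with rfl | h'
    · exact hlt.ne' (hc ε hε).2
    · exact lt_asymm hlt (h.crossA ε _ (hy ε) _ (hmem ε hε) x hx h' (hc ε hε).2.le)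
  have hhi : ∀ ε ∈ Icc η₁ η', ∀ x ∈ Ico c₀ c₁, y ε (A x) < β x → c ε < x := fun ε hε x hx hlt => by
    by_contra! hle
    rcases hle.eq_or_lt with rfl | h'
    · exact hlt.ne (hc ε hε).2
    · exact (h.crossA ε _ (hy ε) x hx _ (hmem ε hε) h' hlt.le).ne (hc ε hε).2
  have hlo' : ∀ ε ∈ Icc η₁ η', ∀ x ∈ Ico c₀ c₁, x < c ε → β x < y ε (A x) := fun ε hε x hx hlt => by
    by_contra! hle
    exact (h.crossA ε _ (hy ε) x hx _ (hmem ε hε) hlt hle).ne (hc ε hε).2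
  have hhi' : ∀ ε ∈ Icc η₁ η', ∀ x ∈ Ico c₀ c₁, c ε < x → y ε (A x) < β x := fun ε hε x hx hlt =>
    h.crossA ε _ (hy ε) _ (hmem ε hε) x hx hlt (hc ε hε).2.le
  refine ⟨c, ⟨fun ε hε => tendsto_order.2 ⟨fun x hx => ?_, fun x hx => ?_⟩,
    fun ε hε ε' hε' hlt' => ?_, ?_, hmem⟩, fun ε hε => (hc ε hε).2⟩
  · rcases lt_or_ge x c₀ with hx0 | hx0
    · exact eventually_mem_nhdsWithin.mono fun e he => hx0.trans_le (hmem e he).1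
    · have hx' : x ∈ Ico c₀ c₁ := ⟨hx0, hx.trans (hmem ε hε).2⟩
      filter_upwards [eventually_mem_nhdsWithin,
        (((hcont (A x)).mono hsub) ε hε).eventually_const_lt (hlo' ε hε x hx' hx)] with e he hlt
      exact hlo e he x hx' hlt
  · obtain ⟨x', hx1, hx2⟩ : ∃ x', c ε < x' ∧ x' < min x c₁ :=
      exists_between (lt_min hx (hmem ε hε).2)
    have hx' : x' ∈ Ico c₀ c₁ :=
      ⟨(hmem ε hε).1.trans hx1.le, hx2.trans_le (min_le_right _ _)⟩
    filter_upwards [eventually_mem_nhdsWithin, (((hcont (A x')).mono hsub) ε hε).eventually_lt_const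
      (hhi' ε hε x' hx' hx1)] with e he hlt
    exact (hhi e he x' hx' hlt).trans (hx2.trans_le (min_le_left _ _))
  · have hA : A c₀ ≤ A (c ε) := h.monoA.monotoneOn h₀ (hmem ε hε) (hmem ε hε).1
    refine hlo ε' hε' _ (hmem ε hε) ?_
    rw [← (hc ε hε).2]
    exact hq.lt_of_lt hlt'.le hA (hy ε) (hy ε')
      (fun t ht => (h.lt_of_mem_A (hy ε) (hmem ε hε) (hc ε hε).2.ge ⟨ht.1.le, ht.2⟩).le)
      (hb.mono (hsub hε) (hsub hε') hlt')
  · by_contra hne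
    have hgt' : c₀ < c η₁ := lt_of_le_of_ne (hmem η₁ h₁').1 (Ne.symm hne)
    exact (hlo' η₁ h₁' c₀ h₀ hgt').ne' hb.init

/-- Solutions starting at the right ends of descending chords with the value of the chord. -/
lemma isBase_of_descent (h : IsRelaxChord T q c₀ c₁ A B β) (hq : RelaxCoeff T q)
    {c : ℝ → ℝ} (hc : IsDescent c₀ c₁ η₁ η c) :
    IsBase T q (B c₀) (β c₀) η₁ η fun ε => relaxConst T q ε (B (c ε)) (β (c ε)) := by
  set C : ℝ → ℝ := fun ε => relaxConst T q ε (B (c ε)) (β (c ε)) with hC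
  have hval : ∀ ε, relaxSol T q ε (C ε) (B (c ε)) = β (c ε) := fun ε => relaxSol_relaxConst ..
  have hy : ∀ ε, IsRelax T (fun t => q t ε) (relaxSol T q ε (C ε)) :=
    fun ε => hq.isRelax_relaxSol ε (C ε)
  have h₀ : c₀ ∈ Ico c₀ c₁ := ⟨le_rfl, h.lt⟩
  have hBc : ContinuousOn (fun ε => B (c ε)) (Icc η₁ η) := h.contB.comp hc.cont hc.mem
  have hβc : ContinuousOn (fun ε => β (c ε)) (Icc η₁ η) := h.contβ.comp hc.cont hc.mem
  refine ⟨?_, fun ε hε ε' hε' hlt => ?_, ?_⟩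
  · exact hq.continuousOn_relaxConst hBc hβc
  · have hB : B (c ε) ≤ B c₀ := h.antiB.antitoneOn h₀ (hc.mem ε hε) (hc.mem ε hε).1
    refine hq.lt_of_lt hlt.le hB (hy ε) (hy ε')
      (fun t ht => (h.lt_of_mem_B (hy ε) (hc.mem ε hε) (hval ε).ge ⟨ht.1, ht.2.le⟩).le) ?_
    rw [hval]
    exact h.crossB ε' _ (hy ε') _ (hc.mem ε hε) _ (hc.mem ε' hε') (hc.mono hε hε' hlt)
      (hval ε').ge
  · have := hval η₁
    rwa [hc.init] at this

end IsRelaxChord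

/-- Intervals `[l i, r i]`, `1 ≤ i ≤ k`, on which `T` has the value `b` unless they are points, and
families of chords whose top chords join the neighbouring intervals. -/
structure IsRelaxChain (T : ℝ → ℝ) (q : ℝ → ℝ → ℝ) (k : ℕ) (l r : ℕ → ℝ) (b : ℝ)
    (c₀ c₁ : ℕ → ℝ) (A B β : ℕ → ℝ → ℝ) : Prop where
  coeff : RelaxCoeff T q
  le : ∀ i, 1 ≤ i → i ≤ k → l i ≤ r i
  flat : ∀ i, 1 ≤ i → i ≤ k → ∀ t ∈ Icc (l i) (r i), l i < r i → T t = b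
  chord : ∀ i, 1 ≤ i → i < k → IsRelaxChord T q (c₀ i) (c₁ i) (A i) (B i) (β i)
  topA : ∀ i, 1 ≤ i → i < k → A i (c₀ i) = r i
  topB : ∀ i, 1 ≤ i → i < k → B i (c₀ i) = l (i + 1)
  topβ : ∀ i, 1 ≤ i → i < k → β i (c₀ i) = b

namespace IsRelaxChain

variable {T : ℝ → ℝ} {q : ℝ → ℝ → ℝ} {k : ℕ} {l r : ℕ → ℝ} {b : ℝ} {c₀ c₁ : ℕ → ℝ}
  {A B β : ℕ → ℝ → ℝ} {η₁ η : ℝ} {C : ℝ → ℝ}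

lemma isBase_right (h : IsRelaxChain T q k l r b c₀ c₁ A B β) {i : ℕ} (hi : 1 ≤ i) (hik : i ≤ k)
    (hη : η₁ ≤ η) (hb : IsBase T q (l i) b η₁ η C) : IsBase T q (r i) b η₁ η C := by
  have hy := fun ε => h.coeff.isRelax_relaxSol ε (C ε)
  have hflat : ∀ t ∈ Ioo (l i) (r i), T t = b := fun t ht =>
    h.flat i hi hik t (Ioo_subset_Icc_self ht) (ht.1.trans ht.2)
  refine ⟨hb.cont, fun ε hε ε' hε' hlt => ?_, h.coeff.eq_const (h.le i hi hik)
    (h.flat i hi hik) (hy η₁) hb.init⟩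
  refine h.coeff.lt_of_lt hlt.le (h.le i hi hik) (hy ε) (hy ε') (fun t ht => ?_)
    (hb.mono hε hε' hlt)
  rw [hflat t ht]
  rcases hε.1.eq_or_lt with rfl | h'
  · exact (h.coeff.eq_const ht.1.le (fun s hs _ => h.flat i hi hik s ⟨hs.1, hs.2.trans ht.2.le⟩
      (ht.1.trans ht.2)) (hy _) hb.init).ge
  · exact (h.coeff.const_lt ht.1.le (fun s hs => hflat s ⟨hs.1, hs.2.trans ht.2⟩) (hy ε)
      (hb.init ▸ hb.mono (left_mem_Icc.2 hη) hε h')).le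

/-- The chain of chords and solutions: each solution starts at the right end of a chord with the
value of this chord, and determines the next chord. -/
lemma exists_chain (h : IsRelaxChain T q k l r b c₀ c₁ A B β) (hη : η₁ < η)
    (hb : IsBase T q (l 1) b η₁ η C) (n : ℕ) (hn : n < k) :
    ∃ η' ∈ Ioc η₁ η, ∃ (Cs cs : ℕ → ℝ → ℝ), Cs 0 = C ∧
      (∀ i ≤ n, IsBase T q (l (i + 1)) b η₁ η' (Cs i)) ∧
      ∀ i, 1 ≤ i → i ≤ n → IsDescent (c₀ i) (c₁ i) η₁ η' (cs i) ∧
        (∀ ε ∈ Icc η₁ η', relaxSol T q ε (Cs (i - 1) ε) (A i (cs i ε)) = β i (cs i ε)) ∧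
        Cs i = fun ε => relaxConst T q ε (B i (cs i ε)) (β i (cs i ε)) := by
  induction n with
  | zero =>
    refine ⟨η, ⟨hη, le_rfl⟩, fun _ => C, fun _ => C, rfl, fun i hi => ?_, fun i h1 h2 => ?_⟩
    · obtain rfl : i = 0 := by omega
      exact hb
    · omega
  | succ n ih =>
    obtain ⟨η', hη', Cs, cs, h0, h1, h2⟩ := ih (by omega)
    have hch := h.chord (n + 1) (by omega) hn
    have hbase := h.isBase_right (by omega) hn.le hη'.1.le (h1 n le_rfl)
    rw [← h.topA (n + 1) (by omega) hn, ← h.topβ (n + 1) (by omega) hn] at hbase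
    obtain ⟨η'', hη'', c, hc, hroot⟩ := hch.exists_descent h.coeff hη'.1 hbase
    have hnew := hch.isBase_of_descent h.coeff hc
    rw [h.topB (n + 1) (by omega) hn, h.topβ (n + 1) (by omega) hn] at hnew
    refine ⟨η'', ⟨hη''.1, hη''.2.trans hη'.2⟩,
      Function.update Cs (n + 1) (fun ε => relaxConst T q ε (B (n + 1) (c ε)) (β (n + 1) (c ε))),
      Function.update cs (n + 1) c, ?_, fun i hi => ?_, fun i hi hin => ?_⟩
    · rw [Function.update_of_ne (by omega), h0]
    · rcases Nat.lt_or_ge i (n + 1) with hlt | hge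
      · rw [Function.update_of_ne hlt.ne]
        exact (h1 i (by omega)).mono_right hη''.2
      · obtain rfl : i = n + 1 := by omega
        rw [Function.update_self]
        exact hnew
    · rcases Nat.lt_or_ge i (n + 1) with hlt | hge
      · rw [Function.update_of_ne hlt.ne, Function.update_of_ne hlt.ne,
          Function.update_of_ne (by omega)]
        obtain ⟨h3, h4, h5⟩ := h2 i hi (by omega)
        exact ⟨h3.mono_right hη''.2, fun ε hε => h4 ε ⟨hε.1, hε.2.trans hη''.2⟩, h5⟩
      · obtain rfl : i = n + 1 := by omega
        rw [Function.update_self, Function.update_self, Function.update_of_ne (by omega)]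
        exact ⟨hc, hroot, rfl⟩

end IsRelaxChain

/-! ### The balance point -/

/-- `z` solves the equation `z' = q (z - T)`, the mirror image of a relaxation equation. -/
def IsRise (T q z : ℝ → ℝ) : Prop := ∀ t, HasDerivAt z (q t * (z t - T t)) t

lemma IsRise.continuous {T q z : ℝ → ℝ} (h : IsRise T q z) : Continuous z :=
  continuous_iff_continuousAt.2 fun t => (h t).continuousAt

lemma IsRelax.isRise {T q y : ℝ → ℝ} (h : IsRelax (fun t => T (-t)) (fun t => q (-t)) y) :
    IsRise T q fun t => y (-t) := fun t => by
  refine ((h (-t)).comp t (hasDerivAt_neg t)).congr_deriv ?_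
  simp only [neg_neg]
  ring

lemma IsRise.isRelax {T q y : ℝ → ℝ} (h : IsRise T q y) :
    IsRelax (fun t => T (-t)) (fun t => q (-t)) fun t => y (-t) := fun t => by
  refine ((h (-t)).comp t (hasDerivAt_neg t)).congr_deriv ?_
  ring

/-- Where both solutions lie above `T`, a relaxation decreases and its mirror image increases. -/
lemma IsRelax.monotoneOn_sub {T qR qL y z : ℝ → ℝ} {a b : ℝ} (hy : IsRelax T qR y)
    (hz : IsRise T qL z) (hqR : ∀ t, 0 < qR t) (hqL : ∀ t, 0 < qL t)
    (hTy : ∀ t ∈ Ioo a b, T t ≤ y t) (hTz : ∀ t ∈ Ioo a b, T t ≤ z t) :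
    MonotoneOn (fun t => z t - y t) (Icc a b) := by
  refine monotoneOn_of_deriv_nonneg (convex_Icc a b) (hz.continuous.sub hy.continuous).continuousOn
    (fun t _ => ((hz t).sub (hy t)).differentiableAt.differentiableWithinAt) fun t ht => ?_
  rw [interior_Icc] at ht
  have hd : HasDerivAt (fun t => z t - y t) _ t := (hz t).sub (hy t)
  rw [hd.deriv]
  nlinarith [mul_nonneg (hqL t).le (sub_nonneg.2 (hTz t ht)),
    mul_nonneg (hqR t).le (sub_nonneg.2 (hTy t ht))]

/-- The first point where a continuous function is nonnegative. -/
lemma exists_first_zero {d : ℝ → ℝ} {a b : ℝ} (hd : Continuous d) (ha : d a ≤ 0)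
    (hex : ∃ t ∈ Icc a b, 0 ≤ d t) : ∃ u ∈ Icc a b, d u = 0 ∧ ∀ t ∈ Ico a u, d t < 0 := by
  obtain ⟨t₀, ht₀, h0⟩ := hex
  have hcl : IsClosed (Icc a b ∩ d ⁻¹' Ici 0) := isClosed_Icc.inter (isClosed_Ici.preimage hd)
  have hbdd : BddBelow (Icc a b ∩ d ⁻¹' Ici 0) := ⟨a, fun t ht => ht.1.1⟩
  have hu := hcl.csInf_mem ⟨t₀, ht₀, h0⟩ hbdd
  set u := sInf (Icc a b ∩ d ⁻¹' Ici 0)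
  have hneg : ∀ t ∈ Ico a u, d t < 0 := fun t ht => by
    by_contra! hle
    exact ht.2.not_ge (csInf_le hbdd ⟨⟨ht.1, ht.2.le.trans hu.1.2⟩, hle⟩)
  refine ⟨u, hu.1, le_antisymm ?_ hu.2, hneg⟩
  rcases hu.1.1.eq_or_lt with h | h
  · rwa [← h]
  · refine ContinuousWithinAt.closure_le (s := Ico a u) ?_ hd.continuousWithinAt
      continuousWithinAt_const fun t ht => (hneg t ht).le
    rw [closure_Ico h.ne]
    exact right_mem_Icc.2 h.le

lemma exists_last_zero {d : ℝ → ℝ} {a b : ℝ} (hd : Continuous d) (hb : 0 ≤ d b)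
    (hex : ∃ t ∈ Icc a b, d t ≤ 0) : ∃ u ∈ Icc a b, d u = 0 ∧ ∀ t ∈ Ioc u b, 0 < d t := by
  obtain ⟨t₀, ht₀, h0⟩ := hex
  obtain ⟨u, hu, hu0, h⟩ := exists_first_zero (d := fun t => -d (-t)) (a := -b) (b := -a)
    (hd.comp continuous_neg).neg (by simpa using hb)
    ⟨-t₀, ⟨neg_le_neg ht₀.2, neg_le_neg ht₀.1⟩, by simpa using h0⟩
  refine ⟨-u, ⟨by linarith [hu.2], by linarith [hu.1]⟩, by simpa using hu0, fun t ht => ?_⟩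
  have := h (-t) ⟨neg_le_neg ht.2, by linarith [ht.1]⟩
  simpa using this

/-- Solutions `Y (i - 1)` of a relaxation equation and `Z i` of a mirrored one, `1 ≤ i ≤ k`, around
the intervals `[l i, r i]`, together with the chords `cR i` and `cL i` at which the values of
neighbouring solutions of the same kind agree with the value of the chord. -/
structure IsBalanceSystem (T qR qL : ℝ → ℝ) (k : ℕ) (l r : ℕ → ℝ) (c₀ c₁ : ℕ → ℝ)
    (A B β : ℕ → ℝ → ℝ) (Y Z : ℕ → ℝ → ℝ) (cR cL : ℕ → ℝ) (x y : ℝ) : Prop where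
  qR_pos : ∀ t, 0 < qR t
  qL_pos : ∀ t, 0 < qL t
  le : ∀ i, 1 ≤ i → i ≤ k → l i ≤ r i
  topA : ∀ i, 1 ≤ i → i < k → A i (c₀ i) = r i
  topB : ∀ i, 1 ≤ i → i < k → B i (c₀ i) = l (i + 1)
  monoA : ∀ i, 1 ≤ i → i < k → StrictMonoOn (A i) (Ico (c₀ i) (c₁ i))
  antiB : ∀ i, 1 ≤ i → i < k → StrictAntiOn (B i) (Ico (c₀ i) (c₁ i))
  memR : ∀ i, 1 ≤ i → i < k → cR i ∈ Ico (c₀ i) (c₁ i)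
  memL : ∀ i, 1 ≤ i → i < k → cL i ∈ Ico (c₀ i) (c₁ i)
  relax : ∀ i < k, IsRelax T qR (Y i)
  rise : ∀ i, 1 ≤ i → i ≤ k → IsRise T qL (Z i)
  YA : ∀ i, 1 ≤ i → i < k → Y (i - 1) (A i (cR i)) = β i (cR i)
  YB : ∀ i, 1 ≤ i → i < k → Y i (B i (cR i)) = β i (cR i)
  ZA : ∀ i, 1 ≤ i → i < k → Z i (A i (cL i)) = β i (cL i)
  ZB : ∀ i, 1 ≤ i → i < k → Z (i + 1) (B i (cL i)) = β i (cL i)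
  signY : ∀ i, 1 ≤ i → i < k → ∀ c ∈ Ico (c₀ i) (cR i), β i c < Y (i - 1) (A i c)
  signZA : ∀ i, 1 ≤ i → i < k → ∀ c ∈ Ico (c₀ i) (cL i), β i c < Z i (A i c)
  signZB : ∀ i, 1 ≤ i → i < k → ∀ c ∈ Ico (c₀ i) (cL i), β i c < Z (i + 1) (B i c)
  signYB : ∀ i, 1 ≤ i → i < k → ∀ c ∈ Ico (c₀ i) (cR i), β i c < Y i (B i c)
  midY : ∀ i, 1 ≤ i → i ≤ k → ∀ t ∈ Icc (l i) (r i), T t < Y (i - 1) t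
  midZ : ∀ i, 1 ≤ i → i ≤ k → ∀ t ∈ Icc (l i) (r i), T t < Z i t
  rightY : ∀ i, 1 ≤ i → i < k → ∀ t ∈ Icc (r i) (A i (cR i)), T t < Y (i - 1) t
  leftY : ∀ i, 1 ≤ i → i < k → ∀ t ∈ Icc (B i (cR i)) (l (i + 1)), T t < Y i t
  rightZ : ∀ i, 1 ≤ i → i < k → ∀ t ∈ Icc (r i) (A i (cL i)), T t < Z i t
  leftZ : ∀ i, 1 ≤ i → i < k → ∀ t ∈ Icc (B i (cL i)) (l (i + 1)), T t < Z (i + 1) t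
  one_le : 1 ≤ k
  x_lt : x < l 1
  lt_y : r k < y
  endY : ∀ t ∈ Icc x (l 1), T t < Y 0 t
  endZ : ∀ t ∈ Icc (r k) y, T t < Z k t
  endx : Z 1 (l 1) < Y 0 x
  endy : Y (k - 1) (r k) < Z k y

namespace IsBalanceSystem

variable {T qR qL : ℝ → ℝ} {k : ℕ} {l r : ℕ → ℝ} {c₀ c₁ : ℕ → ℝ}
    {A B β : ℕ → ℝ → ℝ} {Y Z : ℕ → ℝ → ℝ} {cR cL : ℕ → ℝ} {x y : ℝ}

lemma r_le_A (h : IsBalanceSystem T qR qL k l r c₀ c₁ A B β Y Z cR cL x y) {i : ℕ} (hi : 1 ≤ i)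
    (hik : i < k) {c : ℝ} (hc : c ∈ Ico (c₀ i) (c₁ i)) : r i ≤ A i c := by
  rw [← h.topA i hi hik]
  exact (h.monoA i hi hik).monotoneOn ⟨le_rfl, hc.1.trans_lt hc.2⟩ hc hc.1

lemma B_le_l (h : IsBalanceSystem T qR qL k l r c₀ c₁ A B β Y Z cR cL x y) {i : ℕ} (hi : 1 ≤ i)
    (hik : i < k) {c : ℝ} (hc : c ∈ Ico (c₀ i) (c₁ i)) : B i c ≤ l (i + 1) := by
  rw [← h.topB i hi hik]
  exact (h.antiB i hi hik).antitoneOn ⟨le_rfl, hc.1.trans_lt hc.2⟩ hc hc.1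

/-- If the mirrored solutions push a chord at least as far down, then they do so with the
next chord: otherwise the increasing difference `Z (i + 1) - Y i` would be nonnegative at the right
end of the chord `cR i` and negative at the left end of the chord `cL (i + 1)`. -/
lemma step (h : IsBalanceSystem T qR qL k l r c₀ c₁ A B β Y Z cR cL x y) {i : ℕ} (hi : 1 ≤ i)
    (hik : i + 1 < k) (hle : cR i ≤ cL i) : cR (i + 1) ≤ cL (i + 1) := by
  by_contra! hlt
  have hi' : i < k := by omega
  have hi1 : 1 ≤ i + 1 := by omega
  have hR := h.memR i hi hi'
  have hL' := h.memL (i + 1) hi1 hik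
  have hB := h.B_le_l hi hi' hR
  have hA := h.r_le_A hi1 hik hL'
  have hm := h.le (i + 1) hi1 hik.le
  have hY : ∀ t ∈ Icc (B i (cR i)) (A (i + 1) (cL (i + 1))), T t < Y i t := fun t ht => by
    rcases le_total t (l (i + 1)) with h1 | h1
    · exact h.leftY i hi hi' t ⟨ht.1, h1⟩
    rcases le_total t (r (i + 1)) with h2 | h2
    · exact h.midY (i + 1) hi1 hik.le t ⟨h1, h2⟩
    · exact h.rightY (i + 1) hi1 hik t ⟨h2, ht.2.trans ((h.monoA (i + 1) hi1 hik).monotoneOn hL'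
        (h.memR (i + 1) hi1 hik) hlt.le)⟩
  have hZ : ∀ t ∈ Icc (B i (cR i)) (A (i + 1) (cL (i + 1))), T t < Z (i + 1) t := fun t ht => by
    rcases le_total t (l (i + 1)) with h1 | h1
    · exact h.leftZ i hi hi' t ⟨((h.antiB i hi hi').antitoneOn hR (h.memL i hi hi') hle).trans ht.1,
        h1⟩
    rcases le_total t (r (i + 1)) with h2 | h2
    · exact h.midZ (i + 1) hi1 hik.le t ⟨h1, h2⟩
    · exact h.rightZ (i + 1) hi1 hik t ⟨h2, ht.2⟩
  have hmono := (h.relax i hi').monotoneOn_sub (h.rise (i + 1) hi1 hik.le) h.qR_pos h.qL_pos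
    (fun t ht => (hY t (Ioo_subset_Icc_self ht)).le)
    (fun t ht => (hZ t (Ioo_subset_Icc_self ht)).le)
  have hab : B i (cR i) ≤ A (i + 1) (cL (i + 1)) := hB.trans (hm.trans hA)
  have h1 := hmono (left_mem_Icc.2 hab) (right_mem_Icc.2 hab) hab
  have h2 := h.signY (i + 1) hi1 hik _ ⟨hL'.1, hlt⟩
  have h3 := h.ZA (i + 1) hi1 hik
  have h4 := h.YB i hi hi'
  have h5 : β i (cR i) ≤ Z (i + 1) (B i (cR i)) := by
    rcases hle.eq_or_lt with e | e
    · rw [e]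
      exact (h.ZB i hi hi').ge
    · exact (h.signZB i hi hi' _ ⟨hR.1, e⟩).le
  simp only [Nat.add_sub_cancel] at h1 h2
  linarith

/-- There is an interval `[l j, r j]` and a point `u` around it such that the solution
`Y (j - 1)`, continued to the right, meets the solution `Z j`, continued to the left, and the
chords before this interval are pushed further by the solutions `Y`, and the chords after it at
least as far by the solutions `Z`. -/
theorem exists_balance (h : IsBalanceSystem T qR qL k l r c₀ c₁ A B β Y Z cR cL x y) :
    ∃ j, 1 ≤ j ∧ j ≤ k ∧ (∀ i, 1 ≤ i → i < j → cL i < cR i) ∧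
      (∀ i, j ≤ i → i < k → cR i ≤ cL i) ∧ ∃ u, Y (j - 1) u = Z j u ∧
      (if j = 1 then x ≤ u else B (j - 1) (cR (j - 1)) < u) ∧
      (if j = k then u ≤ y else u ≤ A j (cL j)) ∧
      (∀ t ∈ Ico (l j) u, T t < Y (j - 1) t) ∧ ∀ t ∈ Ioc u (r j), T t < Z j t := by
  classical
  have hex : ∃ j, 1 ≤ j ∧ (j < k → cR j ≤ cL j) := ⟨k, h.one_le, fun h => absurd h (lt_irrefl _)⟩
  set j := Nat.find hex with hj
  obtain ⟨hj1, hj2⟩ := Nat.find_spec hex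
  have hjk : j ≤ k := Nat.find_min' hex ⟨h.one_le, fun h => absurd h (lt_irrefl _)⟩
  have hbefore : ∀ i, 1 ≤ i → i < j → cL i < cR i := fun i hi hij => by
    have := Nat.find_min hex hij
    by_contra! hle
    exact this ⟨hi, fun _ => hle⟩
  have hafter : ∀ i, j ≤ i → i < k → cR i ≤ cL i := fun i hji => by
    induction i, hji using Nat.le_induction with
    | base => exact hj2
    | succ i hji ih => exact fun hik => h.step (hj1.trans hji) hik (ih (by omega))
  refine ⟨j, hj1, hjk, hbefore, hafter, ?_⟩
  have hrel := h.relax (j - 1) (by omega)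
  have hris := h.rise j hj1 hjk
  have hdc : Continuous fun t => Z j t - Y (j - 1) t := hris.continuous.sub hrel.continuous
  have hlr := h.le j hj1 hjk
  have hj1' : j - 1 + 1 = j := by omega
  rcases le_total (Z j (l j) - Y (j - 1) (l j)) 0 with h0 | h0
  · -- the balance point lies to the right of `l j`
    obtain ⟨w, hw, hmem⟩ : ∃ w, (if j = k then w ≤ y else w ≤ A j (cR j)) ∧
        ∃ t ∈ Icc (l j) w, 0 ≤ Z j t - Y (j - 1) t := by
      by_cases hk : j = k
      · refine ⟨y, by simp [hk], ?_⟩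
        by_contra! hneg
        have hry : r j < y := hk ▸ h.lt_y
        have hT : ∀ t ∈ Icc (l j) y, T t < Y (j - 1) t := fun t ht => by
          refine lt_of_lt_of_le ?_ (sub_neg.1 (hneg t ht)).le
          rcases le_total t (r j) with h1 | h1
          · exact h.midZ j hj1 hjk t ⟨ht.1, h1⟩
          · rw [hk] at h1 ⊢
            exact h.endZ t ⟨h1, ht.2⟩
        have hanti : AntitoneOn (Y (j - 1)) (Icc (l j) y) := by
          refine antitoneOn_of_deriv_nonpos (convex_Icc _ _) hrel.continuous.continuousOn
            (fun t _ => (hrel t).differentiableAt.differentiableWithinAt) fun t ht => ?_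
          rw [interior_Icc] at ht
          rw [(hrel t).deriv]
          exact mul_nonpos_of_nonneg_of_nonpos (h.qR_pos t).le
            (sub_nonpos.2 (hT t (Ioo_subset_Icc_self ht)).le)
        have h1 := hanti ⟨hlr, hry.le⟩ ⟨hlr.trans hry.le, le_rfl⟩ hry.le
        have h2 := hneg y ⟨hlr.trans hry.le, le_rfl⟩
        have h3 := h.endy
        rw [← hk] at h3
        linarith
      · have hk' : j < k := lt_of_le_of_ne hjk hk
        have hm := h.memR j hj1 hk'
        refine ⟨A j (cR j), by simp [hk], A j (cR j), ⟨hlr.trans (h.r_le_A hj1 hk' hm), le_rfl⟩, ?_⟩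
        rw [h.YA j hj1 hk', sub_nonneg]
        rcases (hj2 hk').eq_or_lt with e | e
        · rw [e]
          exact (h.ZA j hj1 hk').ge
        · exact (h.signZA j hj1 hk' _ ⟨hm.1, e⟩).le
    obtain ⟨u, hu, hu0, hneg⟩ := exists_first_zero hdc h0 hmem
    have hZu : ∀ t ∈ Ico (l j) u, T t < Z j t := fun t ht => by
      rcases le_total t (r j) with h1 | h1
      · exact h.midZ j hj1 hjk t ⟨ht.1, h1⟩
      by_cases hk : j = k
      · rw [if_pos hk] at hw
        rw [hk] at h1 ⊢
        exact h.endZ t ⟨h1, ht.2.le.trans (hu.2.trans hw)⟩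
      · rw [if_neg hk] at hw
        have hk' : j < k := lt_of_le_of_ne hjk hk
        exact h.rightZ j hj1 hk' t ⟨h1, (ht.2.le.trans (hu.2.trans hw)).trans
          ((h.monoA j hj1 hk').monotoneOn (h.memR j hj1 hk') (h.memL j hj1 hk') (hj2 hk'))⟩
    refine ⟨u, (sub_eq_zero.1 hu0).symm, ?_, ?_,
      fun t ht => (hZu t ht).trans (sub_neg.1 (hneg t ht)),
      fun t ht => h.midZ j hj1 hjk t ⟨hu.1.trans ht.1.le, ht.2⟩⟩
    · split_ifs with hk
      · have := h.x_lt
        rw [← hk] at this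
        exact this.le.trans hu.1
      · have h1 : 1 ≤ j - 1 := by omega
        have h2 : j - 1 < k := by omega
        have hm := h.memR (j - 1) h1 h2
        have hlt := hbefore (j - 1) h1 (by omega)
        have hmL := h.memL (j - 1) h1 h2
        have h3 := (h.antiB (j - 1) h1 h2) hmL hm hlt
        have h4 := h.B_le_l h1 h2 hmL
        rw [hj1'] at h4
        exact (h3.trans_le h4).trans_le hu.1
    · split_ifs with hk
      · rw [if_pos hk] at hw
        exact hu.2.trans hw
      · rw [if_neg hk] at hw
        have hk' : j < k := lt_of_le_of_ne hjk hk
        exact (hu.2.trans hw).trans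
          ((h.monoA j hj1 hk').monotoneOn (h.memR j hj1 hk') (h.memL j hj1 hk') (hj2 hk'))
  · -- the balance point lies to the left of `l j`
    obtain ⟨w, hw, hmem⟩ : ∃ w, (if j = 1 then x ≤ w else B (j - 1) (cL (j - 1)) ≤ w) ∧
        ∃ t ∈ Icc w (l j), Z j t - Y (j - 1) t ≤ 0 := by
      by_cases hk : j = 1
      · refine ⟨x, by simp [hk], ?_⟩
        by_contra! hpos
        have hxl := h.x_lt
        rw [hk] at hpos hris
        have hT : ∀ t ∈ Icc x (l 1), T t < Z 1 t := fun t ht =>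
          (h.endY t ht).trans (sub_pos.1 (hpos t ht))
        have hmono : MonotoneOn (Z 1) (Icc x (l 1)) := by
          refine monotoneOn_of_deriv_nonneg (convex_Icc _ _) hris.continuous.continuousOn
            (fun t _ => (hris t).differentiableAt.differentiableWithinAt) fun t ht => ?_
          rw [interior_Icc] at ht
          rw [(hris t).deriv]
          exact mul_nonneg (h.qL_pos t).le (sub_nonneg.2 (hT t (Ioo_subset_Icc_self ht)).le)
        have h1 := hmono (left_mem_Icc.2 hxl.le) (right_mem_Icc.2 hxl.le) hxl.le
        have h2 := hpos x (left_mem_Icc.2 hxl.le)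
        have h3 := h.endx
        simp only [Nat.sub_self] at h2
        linarith
      · have h1 : 1 ≤ j - 1 := by omega
        have h2 : j - 1 < k := by omega
        have hm := h.memL (j - 1) h1 h2
        have hBl := h.B_le_l h1 h2 hm
        rw [hj1'] at hBl
        refine ⟨B (j - 1) (cL (j - 1)), by simp [hk], _, ⟨le_rfl, hBl⟩, ?_⟩
        have h3 := h.ZB (j - 1) h1 h2
        rw [hj1'] at h3
        rw [h3, sub_nonpos]
        exact (h.signYB (j - 1) h1 h2 _ ⟨hm.1, hbefore (j - 1) h1 (by omega)⟩).le
    obtain ⟨u, hu, hu0, hpos⟩ := exists_last_zero hdc h0 hmem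
    refine ⟨u, (sub_eq_zero.1 hu0).symm, ?_, ?_,
      fun t ht => absurd (ht.1.trans_lt ht.2) hu.2.not_gt,
      fun t ht => ?_⟩
    · split_ifs with hk
      · rw [if_pos hk] at hw
        exact hw.trans hu.1
      · rw [if_neg hk] at hw
        have h1 : 1 ≤ j - 1 := by omega
        have h2 : j - 1 < k := by omega
        exact ((h.antiB (j - 1) h1 h2) (h.memL (j - 1) h1 h2) (h.memR (j - 1) h1 h2)
          (hbefore (j - 1) h1 (by omega))).trans_le (hw.trans hu.1)
    · split_ifs with hk
      · rw [hk] at hu hlr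
        exact hu.2.trans (hlr.trans h.lt_y.le)
      · have hk' : j < k := lt_of_le_of_ne hjk hk
        exact hu.2.trans (hlr.trans (h.r_le_A hj1 hk' (h.memL j hj1 hk')))
    · rcases le_total (l j) t with h1 | h1
      · exact h.midZ j hj1 hjk t ⟨h1, ht.2⟩
      by_cases hk : j = 1
      · rw [if_pos hk] at hw
        have h2 := hpos t ⟨ht.1, h1⟩
        rw [hk] at h1 h2 ⊢
        exact (h.endY t ⟨hw.trans (hu.1.trans ht.1.le), h1⟩).trans (sub_pos.1 h2)
      · rw [if_neg hk] at hw
        have h3 := h.leftZ (j - 1) (by omega) (by omega) t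
        rw [hj1'] at h3
        exact h3 ⟨hw.trans (hu.1.trans ht.1.le), h1⟩

end IsBalanceSystem

/-- What a chain of chords and solutions says for a single parameter. -/
lemma IsRelaxChain.pointwise {T : ℝ → ℝ} {q : ℝ → ℝ → ℝ} {k : ℕ} {l r : ℕ → ℝ} {b : ℝ}
    {c₀ c₁ : ℕ → ℝ} {A B β : ℕ → ℝ → ℝ} {η₁ η ε : ℝ} {Cs cs : ℕ → ℝ → ℝ}
    (h : IsRelaxChain T q k l r b c₀ c₁ A B β) (hε : ε ∈ Ioc η₁ η)
    (hT : ∀ i, 1 ≤ i → i ≤ k → ∀ t ∈ Icc (l i) (r i), T t ≤ b)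
    (h1 : ∀ i < k, IsBase T q (l (i + 1)) b η₁ η (Cs i))
    (h2 : ∀ i, 1 ≤ i → i < k → IsDescent (c₀ i) (c₁ i) η₁ η (cs i) ∧
        (∀ ε ∈ Icc η₁ η, relaxSol T q ε (Cs (i - 1) ε) (A i (cs i ε)) = β i (cs i ε)) ∧
        Cs i = fun ε => relaxConst T q ε (B i (cs i ε)) (β i (cs i ε))) :
    (∀ i, 1 ≤ i → i < k → relaxSol T q ε (Cs i ε) (B i (cs i ε)) = β i (cs i ε)) ∧
    (∀ i, 1 ≤ i → i < k → ∀ c ∈ Ico (c₀ i) (cs i ε),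
      β i c < relaxSol T q ε (Cs (i - 1) ε) (A i c)) ∧
    (∀ i, 1 ≤ i → i < k → ∀ c ∈ Ico (c₀ i) (cs i ε), β i c < relaxSol T q ε (Cs i ε) (B i c)) ∧
    (∀ i, 1 ≤ i → i ≤ k → ∀ t ∈ Icc (l i) (r i), T t < relaxSol T q ε (Cs (i - 1) ε) t) ∧
    (∀ i, 1 ≤ i → i < k → ∀ t ∈ Icc (r i) (A i (cs i ε)),
      T t < relaxSol T q ε (Cs (i - 1) ε) t) ∧
    (∀ i, 1 ≤ i → i < k → ∀ t ∈ Icc (B i (cs i ε)) (l (i + 1)),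
      T t < relaxSol T q ε (Cs i ε) t) := by
  have hε' := Ioc_subset_Icc_self hε
  have hy : ∀ i, IsRelax T (fun t => q t ε) (relaxSol T q ε (Cs i ε)) := fun i =>
    h.coeff.isRelax_relaxSol ε (Cs i ε)
  have hYB : ∀ i, 1 ≤ i → i < k → relaxSol T q ε (Cs i ε) (B i (cs i ε)) = β i (cs i ε) :=
    fun i hi hik => by
      rw [(h2 i hi hik).2.2]
      exact relaxSol_relaxConst ..
  refine ⟨hYB, fun i hi hik c hc => ?_, fun i hi hik c hc => ?_, fun i hi hik t ht => ?_,
    fun i hi hik t ht => ?_, fun i hi hik t ht => ?_⟩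
  · have hm := (h2 i hi hik).1.mem ε hε'
    by_contra! hle
    exact ((h.chord i hi hik).crossA ε _ (hy (i - 1)) c ⟨hc.1, hc.2.trans hm.2⟩ _ hm hc.2 hle).ne
      ((h2 i hi hik).2.1 ε hε')
  · have hm := (h2 i hi hik).1.mem ε hε'
    exact (h.chord i hi hik).crossB ε _ (hy i) c ⟨hc.1, hc.2.trans hm.2⟩ _ hm hc.2 (hYB i hi hik).ge
  · have hb := h1 (i - 1) (by omega)
    rw [show i - 1 + 1 = i by omega] at hb
    have hlt := hb.mono (left_mem_Icc.2 (hε.1.le.trans hε.2)) hε' hε.1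
    simp only [hb.init] at hlt
    exact (hT i hi hik t ht).trans_lt (h.coeff.const_lt ht.1 (fun s hs => h.flat i hi hik s
      ⟨hs.1.le, hs.2.le.trans ht.2⟩ (hs.1.trans (hs.2.trans_le ht.2))) (hy (i - 1)) hlt)
  · have hm := (h2 i hi hik).1.mem_Ioo hε
    have hroot := (h2 i hi hik).2.1 ε hε'
    rcases ht.2.eq_or_lt with rfl | hlt
    · rw [hroot]
      exact (h.chord i hi hik).forceA _ hm
    · rw [← h.topA i hi hik] at ht
      exact (h.chord i hi hik).lt_of_mem_A (hy (i - 1)) (Ioo_subset_Ico_self hm) hroot.ge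
        ⟨ht.1, hlt⟩
  · have hm := (h2 i hi hik).1.mem_Ioo hε
    rcases ht.1.eq_or_lt with rfl | hlt
    · rw [hYB i hi hik]
      exact (h.chord i hi hik).forceB _ hm
    · rw [← h.topB i hi hik] at ht
      exact (h.chord i hi hik).lt_of_mem_B (hy i) (Ioo_subset_Ico_self hm) (hYB i hi hik).ge
        ⟨hlt, ht.2⟩

/-! ### Implicit functions of one variable -/

/-- A continuous solution `s` of `H (x, s x) = 0` has the derivative of the implicit function
theorem; as `s` is given, the differentiability of `H` at one point is enough. -/
lemma hasDerivAt_of_implicit {H : ℝ × ℝ → ℝ} {s : ℝ → ℝ} {t Ha Hb : ℝ}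
    (hH : HasFDerivAt H (Ha • ContinuousLinearMap.fst ℝ ℝ ℝ + Hb • ContinuousLinearMap.snd ℝ ℝ ℝ)
      (t, s t)) (hb : Hb ≠ 0) (hs : ContinuousAt s t) (h0 : ∀ᶠ x in 𝓝 t, H (x, s x) = 0) :
    HasDerivAt s (-Ha / Hb) t := by
  have hc : Tendsto (fun x => (x, s x)) (𝓝 t) (𝓝 (t, s t)) := tendsto_id.prodMk_nhds hs
  have ho := (hasFDerivAt_iff_isLittleO.1 hH).comp_tendsto hc
  have h00 := h0.self_of_nhds
  have ho' : (fun x => Ha * (x - t) + Hb * (s x - s t)) =o[𝓝 t]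
      fun x => ((x - t, s x - s t) : ℝ × ℝ) := by
    refine (ho.neg_left).congr' ?_ (Eventually.of_forall fun x => rfl)
    filter_upwards [h0] with x hx
    simp [hx, h00]
  have hlin : ∀ x, s x - s t - (x - t) • (-Ha / Hb) = Hb⁻¹ * (Ha * (x - t) + Hb * (s x - s t)) :=
    fun x => by
      rw [smul_eq_mul]
      field_simp
      ring
  have ho2 : (fun x => s x - s t - (x - t) • (-Ha / Hb)) =o[𝓝 t]
      fun x => ((x - t, s x - s t) : ℝ × ℝ) := by
    simp only [hlin]
    exact ho'.const_mul_left _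
  refine hasDerivAt_iff_isLittleO.2 (ho2.trans_isBigO ?_)
  refine Asymptotics.IsBigO.of_bound (2 * (1 + |-Ha / Hb|)) ?_
  filter_upwards [ho2.bound (show (0 : ℝ) < 1 / 2 by norm_num)] with x hx
  rw [Prod.norm_def] at hx ⊢
  simp only [Real.norm_eq_abs, smul_eq_mul] at hx ⊢
  have h1 : |s x - s t| ≤ |s x - s t - (x - t) * (-Ha / Hb)| + |x - t| * |-Ha / Hb| := by
    rw [← abs_mul]
    simpa using abs_add_le (s x - s t - (x - t) * (-Ha / Hb)) ((x - t) * (-Ha / Hb))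
  have h2 : max |x - t| |s x - s t| ≤ |x - t| + |s x - s t| :=
    max_le_add_of_nonneg (abs_nonneg _) (abs_nonneg _)
  nlinarith [abs_nonneg (x - t), abs_nonneg (-Ha / Hb),
    mul_nonneg (abs_nonneg (x - t)) (abs_nonneg (-Ha / Hb))]

/-- A family of shrinking chords whose values satisfy relaxation equations at both ends, with a rate
at the ends `B` that is larger than the given one, is a family of chords in the abstract sense. -/
lemma IsRelaxChord.of_hasDerivAt {T : ℝ → ℝ} {q : ℝ → ℝ → ℝ} (hq : RelaxCoeff T q) {c₀ c₁ : ℝ}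
    {A B β : ℝ → ℝ} {A' B' rA rB : ℝ → ℝ} (hlt : c₀ < c₁)
    (contA : ContinuousOn A (Ico c₀ c₁)) (contB : ContinuousOn B (Ico c₀ c₁))
    (contβ : ContinuousOn β (Ico c₀ c₁)) (monoA : StrictMonoOn A (Ico c₀ c₁))
    (antiB : StrictAntiOn B (Ico c₀ c₁)) (forceA : ∀ c ∈ Ioo c₀ c₁, T (A c) < β c)
    (forceB : ∀ c ∈ Ioo c₀ c₁, T (B c) < β c)
    (forceA₀ : T (A c₀) ≤ β c₀) (forceB₀ : T (B c₀) ≤ β c₀)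
    (hA : ∀ c ∈ Ioo c₀ c₁, HasDerivAt A (A' c) c) (hB : ∀ c ∈ Ioo c₀ c₁, HasDerivAt B (B' c) c)
    (hβA : ∀ c ∈ Ioo c₀ c₁, HasDerivAt β (-(A' c * (rA c * (T (A c) - β c)))) c)
    (hβB : ∀ c ∈ Ioo c₀ c₁, HasDerivAt β (B' c * (rB c * (T (B c) - β c))) c)
    (hA' : ∀ c ∈ Ioo c₀ c₁, 0 < A' c) (hB' : ∀ c ∈ Ioo c₀ c₁, B' c < 0)
    (hrA : ∀ c ∈ Ioo c₀ c₁, 0 < rA c) (hrB : ∀ c ∈ Ioo c₀ c₁, ∀ ε, q (B c) ε < rB c) :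
    IsRelaxChord T q c₀ c₁ A B β := by
  refine ⟨hlt, contA, contB, contβ, monoA, antiB, forceA, forceB, forceA₀, forceB₀,
    fun ε y hy => ?_, fun ε y hy => ?_⟩
  · have hEc : Continuous fun t => relaxExp q t ε :=
      continuous_iff_continuousAt.2 fun t => (hq.hasDerivAt_relaxExp t ε).continuousAt
    have hanti : StrictAntiOn (fun c => (y (A c) - β c) * Real.exp (relaxExp q (A c) ε))
        (Ico c₀ c₁) := by
      refine strictAntiOn_of_deriv_neg (convex_Ico c₀ c₁)
        (((hy.continuous.comp_continuousOn contA).sub contβ).mul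
          (hEc.comp_continuousOn contA).rexp) fun c hc => ?_
      rw [interior_Ico] at hc
      have hd : HasDerivAt (fun c => (y (A c) - β c) * Real.exp (relaxExp q (A c) ε)) _ c :=
        (((hy (A c)).comp c (hA c hc)).sub (hβA c hc)).mul
          ((hq.hasDerivAt_relaxExp (A c) ε).comp c (hA c hc)).exp
      rw [hd.deriv]
      have e : ∀ E : ℝ,
          (q (A c) ε * (T (A c) - y (A c)) * A' c - -(A' c * (rA c * (T (A c) - β c))))
            * E + (y (A c) - β c) * (E * (q (A c) ε * A' c)) =
          -((β c - T (A c)) * A' c * (q (A c) ε + rA c) * E) := fun E => by ring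
      refine (e _).trans_lt (neg_neg_of_pos ?_)
      exact mul_pos (mul_pos (mul_pos (sub_pos.2 (forceA c hc)) (hA' c hc))
        (add_pos (hq.pos _ _) (hrA c hc))) (Real.exp_pos _)
    intro c hc c' hc' hcc hle
    have h1 := hanti hc hc' hcc
    have h2 : (y (A c) - β c) * Real.exp (relaxExp q (A c) ε) ≤ 0 :=
      mul_nonpos_of_nonpos_of_nonneg (sub_nonpos.2 hle) (Real.exp_pos _).le
    exact sub_neg.1 (neg_of_mul_neg_left (h1.trans_le h2) (Real.exp_pos _).le)
  · have hEc : Continuous fun t => relaxExp q t ε :=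
      continuous_iff_continuousAt.2 fun t => (hq.hasDerivAt_relaxExp t ε).continuousAt
    have hanti : StrictAntiOn (fun c => (y (B c) - β c) * Real.exp (relaxExp q (B c) ε))
        (Ico c₀ c₁) := by
      refine strictAntiOn_of_deriv_neg (convex_Ico c₀ c₁)
        (((hy.continuous.comp_continuousOn contB).sub contβ).mul
          (hEc.comp_continuousOn contB).rexp) fun c hc => ?_
      rw [interior_Ico] at hc
      have hd : HasDerivAt (fun c => (y (B c) - β c) * Real.exp (relaxExp q (B c) ε)) _ c :=
        (((hy (B c)).comp c (hB c hc)).sub (hβB c hc)).mul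
          ((hq.hasDerivAt_relaxExp (B c) ε).comp c (hB c hc)).exp
      rw [hd.deriv]
      have e : ∀ E : ℝ, (q (B c) ε * (T (B c) - y (B c)) * B' c - B' c * (rB c * (T (B c) - β c)))
          * E + (y (B c) - β c) * (E * (q (B c) ε * B' c)) =
          -((β c - T (B c)) * (-B' c) * (rB c - q (B c) ε) * E) := fun E => by ring
      refine (e _).trans_lt (neg_neg_of_pos ?_)
      exact mul_pos (mul_pos (mul_pos (sub_pos.2 (forceB c hc)) (neg_pos.2 (hB' c hc)))
        (sub_pos.2 (hrB c hc ε))) (Real.exp_pos _)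
    intro c hc c' hc' hcc hle
    have h1 := hanti hc hc' hcc
    have h2 : 0 ≤ (y (B c') - β c') * Real.exp (relaxExp q (B c') ε) :=
      mul_nonneg (sub_nonneg.2 hle) (Real.exp_pos _).le
    exact sub_pos.1 (pos_of_mul_pos_left (h2.trans_lt h1) (Real.exp_pos _).le)

namespace CurveFamily

variable {D : CurveFamily} {f : ℝ → ℝ} {ε ε' s σ t t' a b : ℝ}

/-! ### The slopes of the boundary curve and of the boundary value -/

namespace IsAdmissible

lemma hasDerivAt_g₁ (hD : D.IsAdmissible) (t : ℝ) : HasDerivAt D.g₁ (deriv D.g₁ t) t :=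
  hD.smooth₁.hasDerivAt hD.zero_mem t

lemma deriv_g₁_pos (hD : D.IsAdmissible) (t : ℝ) : 0 < deriv D.g₁ t :=
  hD.deriv_pos 0 hD.zero_mem t

lemma hasDerivAt_g₂ (hD : D.IsAdmissible) (t : ℝ) :
    HasDerivAt D.g₂ (D.κ₂ t * deriv D.g₁ t) t :=
  (hD.smooth₂.hasDerivAt hD.zero_mem t).congr_deriv (hD.deriv_G₂ hD.zero_mem t)

lemma deriv_g₂ (hD : D.IsAdmissible) (t : ℝ) : deriv D.g₂ t = D.κ₂ t * deriv D.g₁ t :=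
  (hD.hasDerivAt_g₂ t).deriv

lemma hasDerivAt_κ₂ (hD : D.IsAdmissible) (t : ℝ) : HasDerivAt D.κ₂ (deriv D.κ₂ t) t :=
  (hD.hasDerivAt_slopeAt hD.zero_mem t).differentiableAt.hasDerivAt

lemma deriv_κ₂_pos (hD : D.IsAdmissible) (t : ℝ) : 0 < deriv D.κ₂ t :=
  hD.deriv_slopeAt_pos hD.zero_mem t

lemma κ₂_strictMono (hD : D.IsAdmissible) : StrictMono D.κ₂ := hD.slopeAt_strictMono hD.zero_mem

lemma continuous_κ₂ (hD : D.IsAdmissible) : Continuous D.κ₂ :=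
  continuous_iff_continuousAt.2 fun t => (hD.hasDerivAt_κ₂ t).continuousAt

lemma hasDerivAt_deriv_g₁ (hD : D.IsAdmissible) (t : ℝ) :
    HasDerivAt (deriv D.g₁) (deriv (deriv D.g₁) t) t :=
  hD.smooth₁.hasDerivAt_deriv hD.zero_mem t

lemma continuous_deriv_κ₂ (hD : D.IsAdmissible) : Continuous (deriv D.κ₂) := by
  have h : deriv D.κ₂ = fun s => (deriv (deriv D.g₂) s * deriv D.g₁ s
      - deriv D.g₂ s * deriv (deriv D.g₁) s) / deriv D.g₁ s ^ 2 :=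
    funext fun s => (hD.hasDerivAt_slopeAt hD.zero_mem s).deriv
  rw [h]
  have h1 : Continuous (deriv D.g₁) :=
    continuous_iff_continuousAt.2 fun t => (hD.hasDerivAt_deriv_g₁ t).continuousAt
  have h2 : Continuous (deriv D.g₂) := continuous_iff_continuousAt.2 fun t =>
    (hD.smooth₂.hasDerivAt_deriv hD.zero_mem t).continuousAt
  exact (((hD.smooth₂.continuous_deriv_deriv hD.zero_mem).mul h1).sub
    (h2.mul (hD.smooth₁.continuous_deriv_deriv hD.zero_mem))).div (h1.pow 2)
    fun t => (pow_pos (hD.deriv_g₁_pos t) 2).ne'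

end IsAdmissible

namespace IsRegular

lemma hasDerivAt (hD : D.IsAdmissible) (hf : D.IsRegular f) (t : ℝ) :
    HasDerivAt f (D.κ₃ f t * deriv D.g₁ t) t := by
  rw [κ₃, div_mul_cancel₀ _ (hD.deriv_g₁_pos t).ne']
  exact (hf.smooth.differentiable (by norm_num) t).hasDerivAt

lemma hasDerivAt_deriv (hf : D.IsRegular f) (t : ℝ) :
    HasDerivAt (deriv f) (deriv (deriv f) t) t :=
  (((contDiff_succ_iff_deriv (n := 1)).1 hf.smooth).2.2.differentiable (by norm_num) t).hasDerivAt

lemma hasDerivAt_κ₃' (hD : D.IsAdmissible) (hf : D.IsRegular f) (t : ℝ) :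
    HasDerivAt (D.κ₃ f) ((deriv (deriv f) t * deriv D.g₁ t - deriv f t * deriv (deriv D.g₁) t) /
      deriv D.g₁ t ^ 2) t :=
  (hf.hasDerivAt_deriv t).div (hD.hasDerivAt_deriv_g₁ t) (hD.deriv_g₁_pos t).ne'

lemma continuous_deriv_κ₃ (hD : D.IsAdmissible) (hf : D.IsRegular f) :
    Continuous (deriv (D.κ₃ f)) := by
  rw [show deriv (D.κ₃ f) = _ from funext fun t => (hasDerivAt_κ₃' hD hf t).deriv]
  have h1 : Continuous (deriv D.g₁) :=
    continuous_iff_continuousAt.2 fun t => (hD.hasDerivAt_deriv_g₁ t).continuousAt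
  have h2 : Continuous (deriv f) :=
    continuous_iff_continuousAt.2 fun t => (hf.hasDerivAt_deriv t).continuousAt
  have h3 : Continuous (deriv (deriv f)) :=
    ((contDiff_succ_iff_deriv (n := 1)).1 hf.smooth).2.2.continuous_deriv (by norm_num)
  exact ((h3.mul h1).sub (h2.mul (hD.smooth₁.continuous_deriv_deriv hD.zero_mem))).div (h1.pow 2)
    fun t => (pow_pos (hD.deriv_g₁_pos t) 2).ne'

lemma deriv_κ₃ (hD : D.IsAdmissible) (t : ℝ) :
    deriv (D.κ₃ f) t = deriv D.κ₂ t * D.tors f t :=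
  (mul_div_cancel₀ _ (hD.deriv_κ₂_pos t).ne').symm

lemma hasDerivAt_κ₃ (hD : D.IsAdmissible) (hf : D.IsRegular f) (t : ℝ) :
    HasDerivAt (D.κ₃ f) (deriv D.κ₂ t * D.tors f t) t := by
  rw [← deriv_κ₃ hD]
  exact (hasDerivAt_κ₃' hD hf t).differentiableAt.hasDerivAt

lemma continuous_tors (hD : D.IsAdmissible) (hf : D.IsRegular f) : Continuous (D.tors f) :=
  (hf.continuous_deriv_κ₃ hD).div hD.continuous_deriv_κ₂ fun t => (hD.deriv_κ₂_pos t).ne'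

lemma deriv_eq (hD : D.IsAdmissible) (t : ℝ) : deriv f t = D.κ₃ f t * deriv D.g₁ t :=
  (div_mul_cancel₀ _ (hD.deriv_g₁_pos t).ne').symm

lemma deriv_deriv (hD : D.IsAdmissible) (hf : D.IsRegular f) (t : ℝ) :
    deriv (deriv f) t =
      deriv D.κ₂ t * D.tors f t * deriv D.g₁ t + D.κ₃ f t * deriv (deriv D.g₁) t := by
  have h := (hasDerivAt_κ₃' hD hf t).deriv
  have hg := (hD.deriv_g₁_pos t).ne'
  rw [deriv_κ₃ hD, eq_div_iff (pow_ne_zero 2 hg), deriv_eq (f := f) hD t] at h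
  refine mul_right_cancel₀ hg ?_
  linear_combination -h

end IsRegular

lemma IsAdmissible.deriv_deriv_g₂ (hD : D.IsAdmissible) (t : ℝ) :
    deriv (deriv D.g₂) t = deriv D.κ₂ t * deriv D.g₁ t + D.κ₂ t * deriv (deriv D.g₁) t := by
  have h : deriv D.κ₂ t = _ := (hD.hasDerivAt_slopeAt hD.zero_mem t).deriv
  have hg := (hD.deriv_g₁_pos t).ne'
  change deriv D.κ₂ t = (deriv (deriv D.g₂) t * deriv D.g₁ t
      - deriv D.g₂ t * deriv (deriv D.g₁) t) / deriv D.g₁ t ^ 2 at h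
  rw [eq_div_iff (pow_ne_zero 2 hg), hD.deriv_g₂ t] at h
  refine mul_right_cancel₀ hg ?_
  linear_combination -h

/-! ### Chords of the fixed boundary -/

/-- The slope of the chord `[g a, g b]`. -/
def chordSlope (D : CurveFamily) (a b : ℝ) : ℝ := (D.g₂ b - D.g₂ a) / (D.g₁ b - D.g₁ a)

/-- The height of `x` over the line through `g a` and `g b`. -/
def chordHgt (D : CurveFamily) (a b : ℝ) (x : ℝ × ℝ) : ℝ :=
  x.2 - D.g₂ a - D.chordSlope a b * (x.1 - D.g₁ a)

lemma mem_aboveChord {x : ℝ × ℝ} : x ∈ D.aboveChord a b ↔ 0 ≤ D.chordHgt a b x := by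
  simp only [aboveChord, chordHgt, chordSlope, mem_ofPred_eq]
  constructor <;> intro h <;> linarith

namespace IsAdmissible

lemma g₁_sub_pos (hD : D.IsAdmissible) (hab : a < b) : 0 < D.g₁ b - D.g₁ a :=
  sub_pos.2 (hD.g₁_strictMono hab)

lemma chordHgt_left (D : CurveFamily) (a b : ℝ) : D.chordHgt a b (D.g a) = 0 := by
  simp [chordHgt, g]

lemma chordHgt_eq (hD : D.IsAdmissible) (hab : a < b) (x : ℝ × ℝ) :
    D.chordHgt a b x = x.2 - D.g₂ b - D.chordSlope a b * (x.1 - D.g₁ b) := by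
  have := div_mul_cancel₀ (D.g₂ b - D.g₂ a) (hD.g₁_sub_pos hab).ne'
  simp only [chordHgt, chordSlope]
  linear_combination -this

lemma chordHgt_right (hD : D.IsAdmissible) (hab : a < b) : D.chordHgt a b (D.g b) = 0 := by
  rw [hD.chordHgt_eq hab]
  simp [g]

lemma κ₂_lt_chordSlope (hD : D.IsAdmissible) (hab : a < b) : D.κ₂ a < D.chordSlope a b := by
  rw [chordSlope, lt_div_iff₀ (hD.g₁_sub_pos hab)]
  linarith [hD.g_above_tangent hab.ne']

lemma chordSlope_lt_κ₂ (hD : D.IsAdmissible) (hab : a < b) : D.chordSlope a b < D.κ₂ b := by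
  rw [chordSlope, div_lt_iff₀ (hD.g₁_sub_pos hab)]
  linarith [hD.g_above_tangent hab.ne]

lemma chordHgt_g_pos_right (hD : D.IsAdmissible) (hab : a < b) (ht : b < t) :
    0 < D.chordHgt a b (D.g t) := by
  rw [hD.chordHgt_eq hab]
  have h1 := hD.g_above_tangent ht.ne'
  have h2 := mul_pos (sub_pos.2 (hD.chordSlope_lt_κ₂ hab)) (hD.g₁_sub_pos ht)
  simp only [g]
  linarith

lemma chordHgt_g_pos_left (hD : D.IsAdmissible) (hab : a < b) (ht : t < a) :
    0 < D.chordHgt a b (D.g t) := by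
  have h1 := hD.g_above_tangent ht.ne
  have h2 := mul_pos (sub_pos.2 (hD.κ₂_lt_chordSlope hab)) (hD.g₁_sub_pos ht)
  simp only [g, chordHgt]
  linarith

lemma chordHgt_g_neg (hD : D.IsAdmissible) (ht : t ∈ Ioo a b) : D.chordHgt a b (D.g t) < 0 := by
  have hab := ht.1.trans ht.2
  have h1 := hD.κ₂_lt_chordSlope ht.2
  have h2 := hD.chordSlope_lt_κ₂ ht.1
  have h3 : D.chordSlope a t < D.chordSlope t b := h2.trans h1
  rw [chordSlope, chordSlope, div_lt_div_iff₀ (hD.g₁_sub_pos ht.1) (hD.g₁_sub_pos ht.2)] at h3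
  have h4 := div_mul_cancel₀ (D.g₂ b - D.g₂ a) (hD.g₁_sub_pos hab).ne'
  have h5 : D.chordHgt a b (D.g t) * (D.g₁ b - D.g₁ a) < 0 := by
    simp only [chordHgt, chordSlope, g]
    linear_combination h3 - (D.g₁ t - D.g₁ a) * h4
  exact neg_of_mul_neg_left h5 (hD.g₁_sub_pos hab).le

/-- Points of the curves with positive index over the complement of a chord are above its line. -/
lemma chordHgt_pt_pos_of_notMem (hD : D.IsAdmissible) (hε : ε ∈ D.posParams) (hab : a < b)
    (h : D.G₁ s ε ∉ Icc (D.g₁ a) (D.g₁ b)) : 0 < D.chordHgt a b (D.pt s ε) := by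
  obtain ⟨τ, h1, h2⟩ := hD.pt_mem_Xi hD.zero_mem (params_of_posParams hε) hε.1 s
  simp only [pt] at h1 h2
  change _ = D.g₁ τ at h1
  change D.g₂ τ < _ at h2
  have h3 : 0 < D.chordHgt a b (D.g τ) := by
    rcases lt_or_ge τ a with h' | h'
    · exact hD.chordHgt_g_pos_left hab h'
    rcases lt_or_ge b τ with h'' | h''
    · exact hD.chordHgt_g_pos_right hab h''
    · rw [h1] at h
      exact absurd ⟨hD.g₁_strictMono.monotone h', hD.g₁_strictMono.monotone h''⟩ h
  simp only [chordHgt, pt, g, h1] at *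
  linarith

/-- If the chord does not meet `Xi`, then the curve lies above the line of the chord. -/
lemma chordHgt_pt_nonneg (hD : D.IsAdmissible) (hε : ε ∈ D.posParams) (hab : a < b)
    (h : Disjoint (segment ℝ (D.g a) (D.g b)) (D.Xi ε)) (s : ℝ) :
    0 ≤ D.chordHgt a b (D.pt s ε) := by
  by_cases hs : D.G₁ s ε ∈ Icc (D.g₁ a) (D.g₁ b)
  · by_contra! hneg
    have hpos := hD.g₁_sub_pos hab
    set θ := (D.G₁ s ε - D.g₁ a) / (D.g₁ b - D.g₁ a) with hθ
    have hmul : θ * (D.g₁ b - D.g₁ a) = D.G₁ s ε - D.g₁ a := div_mul_cancel₀ _ hpos.ne'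
    have hk : D.chordSlope a b * (D.g₁ b - D.g₁ a) = D.g₂ b - D.g₂ a := div_mul_cancel₀ _ hpos.ne'
    have hθ0 : 0 ≤ θ := div_nonneg (sub_nonneg.2 hs.1) hpos.le
    have hθ1 : θ ≤ 1 := (div_le_one hpos).2 (by linarith [hs.2])
    have hx : (1 - θ) • D.g a + θ • D.g b ∈ segment ℝ (D.g a) (D.g b) :=
      ⟨1 - θ, θ, by linarith, hθ0, by ring, rfl⟩
    refine disjoint_left.1 h hx ⟨s, ?_, ?_⟩
    · simp only [g, Prod.fst_add, Prod.smul_fst, smul_eq_mul]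
      linear_combination hmul
    · simp only [g, Prod.snd_add, Prod.smul_snd, smul_eq_mul]
      simp only [chordHgt, pt] at hneg
      linear_combination hneg - D.chordSlope a b * hmul + θ * hk
  · exact (hD.chordHgt_pt_pos_of_notMem hε hab hs).le

/-- Chords strictly under a chord that does not meet `Xi ε` stay away from the curve with
index `ε`. -/
lemma chordHgt_pt_pos (hD : D.IsAdmissible) (hε : ε ∈ D.posParams) {a₀ b₀ : ℝ} (ha : a₀ < a)
    (hab : a < b) (hb : b < b₀) (h : ∀ s, 0 ≤ D.chordHgt a₀ b₀ (D.pt s ε)) (s : ℝ) :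
    0 < D.chordHgt a b (D.pt s ε) := by
  by_cases hs : D.G₁ s ε ∈ Icc (D.g₁ a) (D.g₁ b)
  · have h1 := hD.chordHgt_g_neg (a := a₀) (b := b₀) (t := a) ⟨ha, hab.trans hb⟩
    have h2 := hD.chordHgt_g_neg (a := a₀) (b := b₀) (t := b) ⟨ha.trans hab, hb⟩
    have h3 := h s
    have hpos := hD.g₁_sub_pos hab
    have hk : D.chordSlope a b * (D.g₁ b - D.g₁ a) = D.g₂ b - D.g₂ a := div_mul_cancel₀ _ hpos.ne'
    have h4 : 0 < D.chordHgt a b (D.pt s ε) * (D.g₁ b - D.g₁ a) := by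
      simp only [chordHgt, pt, g] at *
      have e1 := mul_nonneg h3 hpos.le
      have e2 := mul_nonneg (sub_nonneg.2 hs.1) (neg_nonneg.2 h2.le)
      have e3 := mul_nonneg (sub_nonneg.2 hs.2) (neg_nonneg.2 h1.le)
      rcases hs.1.eq_or_lt with h' | h'
      · rw [← h'] at h3 ⊢
        rw [sub_self, mul_zero, sub_zero]
        exact mul_pos (by linarith) hpos
      · have e2' := mul_pos (sub_pos.2 h') (neg_pos.2 h2)
        nlinarith
    exact pos_of_mul_pos_left h4 hpos.le
  · exact hD.chordHgt_pt_pos_of_notMem hε hab hs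

lemma chordHgt_pt_mono (hD : D.IsAdmissible) (hε : ε ∈ D.posParams) (hε' : ε' ∈ D.posParams)
    (h : ε ≤ ε') (hpos : ∀ s, 0 < D.chordHgt a b (D.pt s ε)) (s : ℝ) :
    0 < D.chordHgt a b (D.pt s ε') := by
  rcases h.eq_or_lt with rfl | h
  · exact hpos s
  · obtain ⟨τ, h1, h2⟩ := hD.pt_mem_Xi (params_of_posParams hε) (params_of_posParams hε') h s
    have := hpos τ
    simp only [chordHgt, pt] at *
    rw [h1]
    linarith

lemma disjoint_of_chordHgt_pos (hD : D.IsAdmissible) (hab : a < b)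
    (hpos : ∀ s, 0 < D.chordHgt a b (D.pt s ε)) :
    Disjoint (segment ℝ (D.g a) (D.g b)) (D.Xi ε) := by
  refine disjoint_left.2 ?_
  rintro _ ⟨θ, θ', h0, h0', h1, rfl⟩ ⟨s, h2, h3⟩
  have := hpos s
  have hk : D.chordSlope a b * (D.g₁ b - D.g₁ a) = D.g₂ b - D.g₂ a :=
    div_mul_cancel₀ _ (hD.g₁_sub_pos hab).ne'
  simp only [chordHgt, pt, g, Prod.fst_add, Prod.smul_fst, smul_eq_mul, Prod.snd_add,
    Prod.smul_snd] at *
  rw [← h2] at this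
  obtain rfl : θ = 1 - θ' := by linarith
  nlinarith

lemma κR_lt_chordSlope (hD : D.IsAdmissible) (hε : ε ∈ D.posParams) (hab : a < b)
    (hpos : ∀ s, 0 < D.chordHgt a b (D.pt s ε)) : D.κR b ε < D.chordSlope a b := by
  have h := hpos (D.tR b ε)
  rw [hD.chordHgt_eq hab] at h
  have h' := hD.wR_lt hε b
  rw [κR, div_lt_iff_of_neg (by linarith)]
  simp only [wR, pt] at *
  linarith

lemma chordSlope_lt_κL (hD : D.IsAdmissible) (hε : ε ∈ D.posParams)
    (hpos : ∀ s, 0 < D.chordHgt a b (D.pt s ε)) : D.chordSlope a b < D.κL a ε := by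
  have h := hpos (D.tL a ε)
  rw [chordHgt] at h
  have h' := hD.lt_wL hε a
  rw [κL, lt_div_iff₀ (by linarith)]
  simp only [wL, pt] at *
  linarith

end IsAdmissible

/-! ### The plane of a chord -/

/-- The derivative in `x₂` of the affine function whose graph contains the directions `γ'(a)` and
`γ'(b)`. -/
def chordβ (D : CurveFamily) (f : ℝ → ℝ) (a b : ℝ) : ℝ :=
  (D.κ₃ f b - D.κ₃ f a) / (D.κ₂ b - D.κ₂ a)

/-- The derivative in `x₁` of that affine function. -/
def chordα (D : CurveFamily) (f : ℝ → ℝ) (a b : ℝ) : ℝ := D.κ₃ f a - D.chordβ f a b * D.κ₂ a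

lemma chordβ_comm (D : CurveFamily) (f : ℝ → ℝ) (a b : ℝ) : D.chordβ f a b = D.chordβ f b a := by
  rw [chordβ, chordβ, ← neg_sub (D.κ₃ f a), ← neg_sub (D.κ₂ a), neg_div_neg_eq]

namespace IsAdmissible

lemma κ₂_sub_ne (hD : D.IsAdmissible) (hab : a ≠ b) : D.κ₂ b - D.κ₂ a ≠ 0 :=
  sub_ne_zero.2 fun h => hab (hD.κ₂_strictMono.injective h.symm)

lemma chordβ_mul (hD : D.IsAdmissible) (hab : a ≠ b) :
    D.chordβ f a b * (D.κ₂ b - D.κ₂ a) = D.κ₃ f b - D.κ₃ f a :=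
  div_mul_cancel₀ _ (hD.κ₂_sub_ne hab)

lemma chordα_eq (hD : D.IsAdmissible) (hab : a ≠ b) :
    D.chordα f a b = D.κ₃ f b - D.chordβ f a b * D.κ₂ b := by
  rw [chordα]
  linear_combination hD.chordβ_mul (f := f) hab

/-- The differential of a chord measures the difference between `tors` and the slope of the plane
of the chord. -/
lemma diffQuot_eq (hD : D.IsAdmissible) (hf : D.IsRegular f) {x y : ℝ} (hxy : x ≠ y) :
    D.diffQuot f x y = deriv D.g₁ x * deriv D.κ₂ x * (D.tors f x - D.chordβ f x y) := by
  have hx := (hD.deriv_g₁_pos x).ne'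
  have hy := (hD.deriv_g₁_pos y).ne'
  have hβ := hD.chordβ_mul (f := f) hxy
  have hdet : Matrix.det !![deriv D.g₁ x, deriv D.g₂ x; deriv D.g₁ y, deriv D.g₂ y] =
      deriv D.g₁ x * deriv D.g₁ y * (D.κ₂ y - D.κ₂ x) := by
    rw [Matrix.det_fin_two_of, hD.deriv_g₂, hD.deriv_g₂]
    ring
  rw [diffQuot, hdet, div_eq_iff (mul_ne_zero (mul_ne_zero hx hy) (hD.κ₂_sub_ne hxy)),
    Matrix.det_fin_three]
  simp only [Matrix.of_apply, Matrix.cons_val', Matrix.cons_val_zero, Matrix.cons_val_one,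
    Matrix.cons_val_fin_one, Matrix.cons_val]
  rw [hD.deriv_g₂ x, hD.deriv_g₂ y, hD.deriv_deriv_g₂, hf.deriv_deriv hD,
    IsRegular.deriv_eq (f := f) hD x, IsRegular.deriv_eq (f := f) hD y]
  linear_combination (deriv D.g₁ x * deriv D.g₁ y * deriv D.g₁ x * deriv D.κ₂ x) * hβ

lemma chordForceR_eq (hD : D.IsAdmissible) (hf : D.IsRegular f) (hab : a ≠ b) :
    D.chordForceR f a b = D.tors f b - D.chordβ f a b := by
  have h1 := (hD.deriv_g₁_pos b).ne'
  have h2 := (hD.deriv_κ₂_pos b).ne'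
  rw [chordForceR, DR, hD.diffQuot_eq hf hab.symm, mul_div_cancel_left₀ _ (mul_ne_zero h1 h2),
    chordβ_comm]

lemma chordForceL_eq (hD : D.IsAdmissible) (hf : D.IsRegular f) (hab : a ≠ b) :
    D.chordForceL f a b = D.tors f a - D.chordβ f a b := by
  have h1 := (hD.deriv_g₁_pos a).ne'
  have h2 := (hD.deriv_κ₂_pos a).ne'
  rw [chordForceL, DL, hD.diffQuot_eq hf hab, mul_div_cancel_left₀ _ (mul_ne_zero h1 h2)]

lemma DR_neg_iff (hD : D.IsAdmissible) (hf : D.IsRegular f) (hab : a ≠ b) :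
    D.DR f a b < 0 ↔ D.tors f b < D.chordβ f a b := by
  rw [DR, hD.diffQuot_eq hf hab.symm, chordβ_comm,
    ← sub_neg (b := D.chordβ f a b)]
  have h := mul_pos (hD.deriv_g₁_pos b) (hD.deriv_κ₂_pos b)
  exact ⟨fun h' => neg_of_mul_neg_right h' h.le, fun h' => mul_neg_of_pos_of_neg h h'⟩

lemma DL_neg_iff (hD : D.IsAdmissible) (hf : D.IsRegular f) (hab : a ≠ b) :
    D.DL f a b < 0 ↔ D.tors f a < D.chordβ f a b := by
  rw [DL, hD.diffQuot_eq hf hab,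
    ← sub_neg (b := D.chordβ f a b)]
  have h := mul_pos (hD.deriv_g₁_pos a) (hD.deriv_κ₂_pos a)
  exact ⟨fun h' => neg_of_mul_neg_right h' h.le, fun h' => mul_neg_of_pos_of_neg h h'⟩

end IsAdmissible

/-- The cup equation divided by the lengths of the tangent vectors. -/
def cupFun (D : CurveFamily) (f : ℝ → ℝ) (x : ℝ × ℝ) : ℝ :=
  (f x.2 - f x.1) * (D.κ₂ x.2 - D.κ₂ x.1) - (D.g₂ x.2 - D.g₂ x.1) * (D.κ₃ f x.2 - D.κ₃ f x.1) +
    (D.g₁ x.2 - D.g₁ x.1) * (D.κ₂ x.1 * D.κ₃ f x.2 - D.κ₃ f x.1 * D.κ₂ x.2)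

namespace IsAdmissible

lemma cupFun_eq_zero (hD : D.IsAdmissible) (h : D.cupDet f a b = 0) : D.cupFun f (a, b) = 0 := by
  have h' : D.cupDet f a b = deriv D.g₁ a * deriv D.g₁ b * D.cupFun f (a, b) := by
    rw [cupDet, Matrix.det_fin_three]
    simp only [Matrix.of_apply, Matrix.cons_val', Matrix.cons_val_zero, Matrix.cons_val_one,
      Matrix.cons_val_fin_one, Matrix.cons_val, cupFun]
    rw [hD.deriv_g₂, hD.deriv_g₂, IsRegular.deriv_eq (f := f) hD a,
      IsRegular.deriv_eq (f := f) hD b]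
    ring
  rw [h'] at h
  exact (mul_eq_zero.1 h).resolve_left
    (mul_ne_zero (hD.deriv_g₁_pos a).ne' (hD.deriv_g₁_pos b).ne')

/-- By the cup equation, the plane of the chord contains both its ends. -/
lemma f_right_eq (hD : D.IsAdmissible) (hab : a ≠ b) (h : D.cupFun f (a, b) = 0) :
    f b = f a + D.chordα f a b * (D.g₁ b - D.g₁ a) + D.chordβ f a b * (D.g₂ b - D.g₂ a) := by
  have hβ := hD.chordβ_mul (f := f) hab
  have hne := hD.κ₂_sub_ne hab
  refine mul_right_cancel₀ hne ?_
  simp only [cupFun, chordα] at *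
  linear_combination h + (D.g₁ b - D.g₁ a) * D.κ₂ a * hβ - (D.g₂ b - D.g₂ a) * hβ

lemma hasFDerivAt_cupFun (hD : D.IsAdmissible) (hf : D.IsRegular f) (hab : a ≠ b)
    (h : D.cupFun f (a, b) = 0) : HasFDerivAt (D.cupFun f)
      ((deriv D.κ₂ a * (D.g₂ b - D.g₂ a - D.κ₂ b * (D.g₁ b - D.g₁ a)) *
        (D.tors f a - D.chordβ f a b)) • ContinuousLinearMap.fst ℝ ℝ ℝ +
      (deriv D.κ₂ b * (D.g₂ b - D.g₂ a - D.κ₂ a * (D.g₁ b - D.g₁ a)) *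
        (D.chordβ f a b - D.tors f b)) • ContinuousLinearMap.snd ℝ ℝ ℝ) (a, b) := by
  have l : ∀ {φ : ℝ → ℝ} {φ' : ℝ}, HasDerivAt φ φ' a → HasFDerivAt (fun x : ℝ × ℝ => φ x.1)
      (φ' • ContinuousLinearMap.fst ℝ ℝ ℝ) (a, b) := fun h =>
    h.comp_hasFDerivAt (a, b) hasFDerivAt_fst
  have r : ∀ {φ : ℝ → ℝ} {φ' : ℝ}, HasDerivAt φ φ' b → HasFDerivAt (fun x : ℝ × ℝ => φ x.2)
      (φ' • ContinuousLinearMap.snd ℝ ℝ ℝ) (a, b) := fun h =>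
    h.comp_hasFDerivAt (a, b) hasFDerivAt_snd
  have hF := ((((r (hf.hasDerivAt hD b)).sub (l (hf.hasDerivAt hD a))).mul
    ((r (hD.hasDerivAt_κ₂ b)).sub (l (hD.hasDerivAt_κ₂ a)))).sub
    (((r (hD.hasDerivAt_g₂ b)).sub (l (hD.hasDerivAt_g₂ a))).mul
    ((r (hf.hasDerivAt_κ₃ hD b)).sub (l (hf.hasDerivAt_κ₃ hD a))))).add
    (((r (hD.hasDerivAt_g₁ b)).sub (l (hD.hasDerivAt_g₁ a))).mul
    (((l (hD.hasDerivAt_κ₂ a)).mul (r (hf.hasDerivAt_κ₃ hD b))).sub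
      ((l (hf.hasDerivAt_κ₃ hD a)).mul (r (hD.hasDerivAt_κ₂ b)))))
  have hfb := hD.f_right_eq hab h
  have hα := hD.chordα_eq (f := f) hab
  refine HasFDerivAt.congr_fderiv hF ?_
  ext
  · simp
    rw [hfb, hα]
    ring
  · simp
    rw [hfb, chordα]
    ring

end IsAdmissible

namespace IsChordal

variable {p : ℝ} {S : ℝ → ℝ}

lemma lt_right (h : D.IsChordal f a p S) (ht : t ∈ Ico a p) : t < S t :=
  ht.2.trans_le (h.le.trans (h.anti.antitoneOn (Ico_subset_Icc_self ht) (right_mem_Icc.2 h.lt.le)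
    ht.2.le))

/-- The right end of a chord and the slope of its plane are differentiable in the left end; the
slope satisfies a relaxation equation with respect to either end. -/
lemma exists_hasDerivAt (hD : D.IsAdmissible) (hf : D.IsRegular f) (h : D.IsChordal f a p S)
    (ht : t ∈ Ioo a p) : ∃ S' < 0, HasDerivAt S S' t ∧
      HasDerivAt (fun t => D.chordβ f t (S t))
        (-(1 * (deriv D.κ₂ t / (D.chordSlope t (S t) - D.κ₂ t)
          * (D.tors f t - D.chordβ f t (S t))))) t ∧
      HasDerivAt (fun t => D.chordβ f t (S t)) (S' * (deriv D.κ₂ (S t) /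
        (D.κ₂ (S t) - D.chordSlope t (S t)) * (D.tors f (S t) - D.chordβ f t (S t)))) t := by
  have hlt := h.lt_right (Ioo_subset_Ico_self ht)
  have hcup := hD.cupFun_eq_zero (h.cup t (Ioo_subset_Icc_self ht))
  have hFL := (hD.DL_neg_iff hf hlt.ne).1 (h.DL_neg t ht)
  have hFR := (hD.DR_neg_iff hf hlt.ne).1 (h.DR_neg t ht)
  have hk1 := hD.κ₂_lt_chordSlope hlt
  have hk2 := hD.chordSlope_lt_κ₂ hlt
  have hg := hD.g₁_sub_pos hlt
  have hw1 := hD.deriv_κ₂_pos t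
  have hw2 := hD.deriv_κ₂_pos (S t)
  have hκ := hk1.trans hk2
  have hk : D.g₂ (S t) - D.g₂ t = D.chordSlope t (S t) * (D.g₁ (S t) - D.g₁ t) :=
    (div_mul_cancel₀ _ hg.ne').symm
  have hF := hD.hasFDerivAt_cupFun hf hlt.ne hcup
  rw [hk] at hF
  have hHb : 0 < deriv D.κ₂ (S t) * (D.chordSlope t (S t) * (D.g₁ (S t) - D.g₁ t) -
      D.κ₂ t * (D.g₁ (S t) - D.g₁ t)) * (D.chordβ f t (S t) - D.tors f (S t)) := by
    rw [← sub_mul]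
    exact mul_pos (mul_pos hw2 (mul_pos (sub_pos.2 hk1) hg)) (sub_pos.2 hFR)
  have hHa : 0 < deriv D.κ₂ t * (D.chordSlope t (S t) * (D.g₁ (S t) - D.g₁ t) -
      D.κ₂ (S t) * (D.g₁ (S t) - D.g₁ t)) * (D.tors f t - D.chordβ f t (S t)) := by
    rw [← sub_mul]
    exact mul_pos_of_neg_of_neg (mul_neg_of_pos_of_neg hw1 (mul_neg_of_neg_of_pos
      (sub_neg.2 hk2) hg)) (sub_neg.2 hFL)
  have hnhds : Icc a p ∈ 𝓝 t := Icc_mem_nhds ht.1 ht.2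
  have hS := hasDerivAt_of_implicit hF hHb.ne' (h.cont.continuousAt hnhds) (by
    filter_upwards [hnhds] with x hx
    exact hD.cupFun_eq_zero (h.cup x hx))
  have hβ : HasDerivAt (fun t => D.chordβ f t (S t)) _ t :=
    (((hf.hasDerivAt_κ₃ hD (S t)).comp t hS).sub (hf.hasDerivAt_κ₃ hD t)).div
    (((hD.hasDerivAt_κ₂ (S t)).comp t hS).sub (hD.hasDerivAt_κ₂ t)) (hD.κ₂_sub_ne hlt.ne)
  have hβm := hD.chordβ_mul (f := f) hlt.ne
  refine ⟨_, div_neg_of_neg_of_pos (neg_neg_of_pos hHa) hHb, hS, hβ.congr_deriv ?_,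
    hβ.congr_deriv ?_⟩
  all_goals
    simp only [Function.comp_apply, Pi.sub_apply]
    generalize D.chordβ f t (S t) = β at *
    generalize D.chordSlope t (S t) = k at *
    generalize D.g₁ (S t) - D.g₁ t = d at *
    rw [← hβm]
    have e1 : k - D.κ₂ t ≠ 0 := by linarith
    have e2 : D.κ₂ (S t) - k ≠ 0 := by linarith
    have e3 : D.κ₂ (S t) - D.κ₂ t ≠ 0 := by linarith
    have e4 : β - D.tors f (S t) ≠ 0 := by linarith
    rw [← sub_mul, ← sub_mul]
    field_simp
    ring

end IsChordal

end CurveFamily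

/-! ### Tails -/

/-- The supremum of the points up to which `y` stays above `T` to the right of `b`. -/
def relaxTail (T y : ℝ → ℝ) (b : ℝ) : EReal :=
  sSup {τ : EReal | ∃ v : ℝ, τ = v ∧ b ≤ v ∧ (∀ t ∈ Icc b v, T t ≤ y t) ∧ ∀ t ∈ Ioo b v, T t < y t}

section Tail

variable {T y : ℝ → ℝ} {b t v : ℝ}

lemma le_relaxTail_of (h : b ≤ v) (h1 : ∀ t ∈ Icc b v, T t ≤ y t) (h2 : ∀ t ∈ Ioo b v, T t < y t) :
    (v : EReal) ≤ relaxTail T y b :=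
  le_sSup ⟨v, rfl, h, h1, h2⟩

lemma le_relaxTail (h : T b ≤ y b) : (b : EReal) ≤ relaxTail T y b :=
  le_relaxTail_of le_rfl (fun t ht => by rwa [le_antisymm ht.2 ht.1])
    fun t ht => absurd ht.2 ht.1.not_gt

lemma lt_of_lt_relaxTail (hbt : b < t) (ht : (t : EReal) < relaxTail T y b) : T t < y t := by
  obtain ⟨_, ⟨v, rfl, -, -, h⟩, htv⟩ := lt_sSup_iff.1 ht
  exact h t ⟨hbt, EReal.coe_lt_coe_iff.1 htv⟩

lemma le_of_le_relaxTail (hT : Continuous T) (hy : Continuous y) (hb : T b ≤ y b) (hbt : b ≤ t)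
    (ht : (t : EReal) ≤ relaxTail T y b) : T t ≤ y t := by
  rcases hbt.eq_or_lt with rfl | hbt
  · exact hb
  · refine ContinuousWithinAt.closure_le (s := Ioo b t) ?_ hT.continuousWithinAt
      hy.continuousWithinAt fun s hs => (lt_of_lt_relaxTail hs.1
        ((EReal.coe_lt_coe_iff.2 hs.2).trans_le ht)).le
    rw [closure_Ioo hbt.ne]
    exact right_mem_Icc.2 hbt.le

/-- The solution meets `T` at the end of its tail. -/
lemma eq_of_relaxTail_eq (hT : Continuous T) (hy : Continuous y) (hb : T b ≤ y b)
    (hv : relaxTail T y b = v) : T v = y v := by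
  have hbv : b ≤ v := EReal.coe_le_coe_iff.1 (hv ▸ le_relaxTail hb)
  refine le_antisymm (le_of_le_relaxTail hT hy hb hbv hv.ge) ?_
  by_contra! hlt
  obtain ⟨w, hvw, hw⟩ := (mem_nhdsGE_iff_exists_Icc_subset).1
    (nhdsWithin_le_nhds ((hT.tendsto v).eventually_lt (hy.tendsto v) hlt))
  have key : ∀ s ∈ Ioc b w, T s < y s := fun s hs => by
    rcases lt_or_ge s v with h | h
    · exact lt_of_lt_relaxTail hs.1 (hv ▸ EReal.coe_lt_coe_iff.2 h)
    · exact hw ⟨h, hs.2⟩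
  have := le_relaxTail_of (T := T) (y := y) (hbv.trans (le_of_lt hvw)) (fun s hs => by
    rcases hs.1.eq_or_lt with rfl | h
    · exact hb
    · exact (key s ⟨h, hs.2⟩).le) (fun s hs => key s ⟨hs.1, hs.2.le⟩)
  rw [hv, EReal.coe_le_coe_iff] at this
  exact this.not_gt hvw

end Tail

namespace IsRelaxChord

variable {T : ℝ → ℝ} {q : ℝ → ℝ → ℝ} {c₀ c₁ η₁ η ε ε' v : ℝ} {A B β : ℝ → ℝ} {c : ℝ → ℝ}

/-- The solution that starts at the right end of the chord with the value of the chord. -/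
def tailSol (T : ℝ → ℝ) (q : ℝ → ℝ → ℝ) (B β c : ℝ → ℝ) (ε : ℝ) : ℝ → ℝ :=
  relaxSol T q ε (relaxConst T q ε (B (c ε)) (β (c ε)))

lemma tailSol_start : tailSol T q B β c ε (B (c ε)) = β (c ε) := relaxSol_relaxConst ..

lemma isRelax_tailSol (hq : RelaxCoeff T q) (B β c : ℝ → ℝ) (ε : ℝ) :
    IsRelax T (fun t => q t ε) (tailSol T q B β c ε) := hq.isRelax_relaxSol _ _

lemma start_le (h : IsRelaxChord T q c₀ c₁ A B β) (hc : IsDescent c₀ c₁ η₁ η c)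
    (hε : ε ∈ Icc η₁ η) : T (B (c ε)) ≤ tailSol T q B β c ε (B (c ε)) := by
  rw [tailSol_start]
  exact h.forceB_le (hc.mem ε hε)

/-- The solutions starting from descending chords grow with the parameter. -/
lemma tailSol_lt (h : IsRelaxChord T q c₀ c₁ A B β) (hq : RelaxCoeff T q)
    (hc : IsDescent c₀ c₁ η₁ η c) (hε : ε ∈ Icc η₁ η) (hε' : ε' ∈ Icc η₁ η) (hlt : ε < ε')
    (hv : B (c ε) ≤ v) (hv' : (v : EReal) ≤ relaxTail T (tailSol T q B β c ε) (B (c ε))) :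
    tailSol T q B β c ε v < tailSol T q B β c ε' v := by
  refine hq.lt_of_lt hlt.le hv (isRelax_tailSol hq _ _ _ _) (isRelax_tailSol hq _ _ _ _)
    (fun t ht => (lt_of_lt_relaxTail ht.1 ((EReal.coe_lt_coe_iff.2 ht.2).trans_le hv')).le) ?_
  rw [tailSol_start]
  exact h.crossB ε' _ (isRelax_tailSol hq _ _ _ _) _ (hc.mem ε hε) _ (hc.mem ε' hε')
    (hc.mono hε hε' hlt) tailSol_start.ge

lemma relaxTail_mono (h : IsRelaxChord T q c₀ c₁ A B β) (hq : RelaxCoeff T q)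
    (hc : IsDescent c₀ c₁ η₁ η c) :
    MonotoneOn (fun ε => relaxTail T (tailSol T q B β c ε) (B (c ε))) (Icc η₁ η) := by
  intro ε hε ε' hε' hle
  rcases hle.eq_or_lt with rfl | hlt
  · exact le_rfl
  refine sSup_le ?_
  rintro _ ⟨v, rfl, hbv, h1, h2⟩
  have hvt := le_relaxTail_of hbv h1 h2
  have hB := h.antiB (hc.mem ε hε) (hc.mem ε' hε') (hc.mono hε hε' hlt)
  have key : ∀ t ∈ Ioc (B (c ε')) v, T t < tailSol T q B β c ε' t := fun t ht => by
    rcases le_total t (B (c ε)) with h3 | h3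
    · exact h.lt_of_mem_B (isRelax_tailSol hq _ _ _ _) (hc.mem ε' hε') tailSol_start.ge
        ⟨ht.1, h3.trans (h.antiB.antitoneOn ⟨le_rfl, h.lt⟩ (hc.mem ε hε) (hc.mem ε hε).1)⟩
    · exact (h1 t ⟨h3, ht.2⟩).trans_lt (h.tailSol_lt hq hc hε hε' hlt h3
        ((EReal.coe_le_coe_iff.2 ht.2).trans hvt))
  refine le_relaxTail_of (hB.le.trans hbv) (fun t ht => ?_) fun t ht => key t ⟨ht.1, ht.2.le⟩
  rcases ht.1.eq_or_lt with rfl | h'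
  · exact h.start_le hc hε'
  · exact (key t ⟨h', ht.2⟩).le

end IsRelaxChord

/-! ### Intervals with extended endpoints -/

section eIcc

variable {p q p' q' : EReal} {a b t : ℝ}

lemma eIcc_coe (a b : ℝ) : eIcc a b = Icc a b := by
  ext t
  simp [eIcc, EReal.coe_le_coe_iff]

lemma ordConnected_eIcc (p q : EReal) : (eIcc p q).OrdConnected :=
  ⟨fun _ hx _ hy z hz => show p ≤ (z : EReal) ∧ (z : EReal) ≤ q from
    ⟨hx.1.trans (EReal.coe_le_coe_iff.2 hz.1), (EReal.coe_le_coe_iff.2 hz.2).trans hy.2⟩⟩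

lemma isClosed_eIcc (p q : EReal) : IsClosed (eIcc p q) :=
  (isClosed_Icc (a := p) (b := q)).preimage continuous_coe_real_ereal

lemma eIcc_subset (hp : p ≤ p') (hq : q' ≤ q) : eIcc p' q' ⊆ eIcc p q :=
  fun t h => show p ≤ (t : EReal) ∧ (t : EReal) ≤ q from ⟨hp.trans h.1, h.2.trans hq⟩

lemma mem_interior_eIcc : t ∈ interior (eIcc p q) ↔ p < t ∧ (t : EReal) < q := by
  constructor
  · intro h
    have h' := interior_subset h
    obtain ⟨u, v, ht, hsub⟩ := mem_nhds_iff_exists_Ioo_subset.1 (mem_interior_iff_mem_nhds.1 h)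
    obtain ⟨x, hx1, hx2⟩ := exists_between ht.1
    obtain ⟨y, hy1, hy2⟩ := exists_between ht.2
    exact ⟨(show p ≤ (x : EReal) ∧ (x : EReal) ≤ q from hsub ⟨hx1, hx2.trans ht.2⟩).1.trans_lt
        (EReal.coe_lt_coe_iff.2 hx2),
      (EReal.coe_lt_coe_iff.2 hy1).trans_le
        (show p ≤ (y : EReal) ∧ (y : EReal) ≤ q from hsub ⟨ht.1.trans hy1, hy2⟩).2⟩
  · rintro ⟨h1, h2⟩
    have ho : IsOpen ((fun t : ℝ => (t : EReal)) ⁻¹' Ioo p q) :=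
      isOpen_Ioo.preimage continuous_coe_real_ereal
    have hsub : (fun t : ℝ => (t : EReal)) ⁻¹' Ioo p q ⊆ eIcc p q := fun s hs =>
      show p ≤ (s : EReal) ∧ (s : EReal) ≤ q from ⟨hs.1.le, hs.2.le⟩
    exact interior_maximal hsub ho ⟨h1, h2⟩

end eIcc

/-- The nearest point of `[a, b]`. -/
def clampTo (a b x : ℝ) : ℝ := max a (min x b)

lemma clampTo_mem {a b : ℝ} (h : a ≤ b) (x : ℝ) : clampTo a b x ∈ Icc a b :=
  ⟨le_max_left _ _, max_le h (min_le_right _ _)⟩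

lemma clampTo_of_mem {a b x : ℝ} (h : x ∈ Icc a b) : clampTo a b x = x := by
  rw [clampTo, min_eq_left h.2, max_eq_right h.1]

lemma clampTo_mono (a b : ℝ) : Monotone (clampTo a b) := fun _ _ h =>
  max_le_max le_rfl (min_le_min h le_rfl)

lemma continuous_clampTo (a b : ℝ) : Continuous (clampTo a b) := by
  unfold clampTo
  fun_prop

namespace CurveFamily

variable {D : CurveFamily} {f : ℝ → ℝ} {η₁ η₃ η ε ε' s t a b : ℝ} {p q : EReal}
  {β β' y : ℝ → ℝ}

/-! ### The equations of tangent domains as relaxation equations -/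

/-- The rate of the equation for right tangents. The index is clamped to `[η₁, η₃]`, so that the
rate is a continuous function on the whole plane. -/
def rateR (D : CurveFamily) (η₁ η₃ t ε : ℝ) : ℝ :=
  deriv D.κ₂ t / (D.κ₂ t - D.κR t (clampTo η₁ η₃ ε))

/-- The rate of the equation for left tangents. -/
def rateL (D : CurveFamily) (η₁ η₃ t ε : ℝ) : ℝ :=
  deriv D.κ₂ t / (D.κL t (clampTo η₁ η₃ ε) - D.κ₂ t)

namespace IsAdmissible

lemma κR_anti (hD : D.IsAdmissible) (hε : ε ∈ D.posParams) (hε' : ε' ∈ D.posParams) (h : ε ≤ ε')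
    (t : ℝ) : D.κR t ε' ≤ D.κR t ε := by
  rcases h.eq_or_lt with rfl | h
  · exact le_rfl
  · exact (hD.κR_lt_κR hε hε' h t).le

lemma κL_mono (hD : D.IsAdmissible) (hε : ε ∈ D.posParams) (hε' : ε' ∈ D.posParams) (h : ε ≤ ε')
    (t : ℝ) : D.κL t ε ≤ D.κL t ε' := by
  rcases h.eq_or_lt with rfl | h
  · exact le_rfl
  · exact (hD.κL_lt_κL hε hε' h t).le

lemma relaxCoeff_rateR (hD : D.IsAdmissible) (hf : D.IsRegular f)
    (hE : Icc η₁ η₃ ⊆ D.posParams) (hη : η₁ ≤ η₃) :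
    RelaxCoeff (D.tors f) (D.rateR η₁ η₃) where
  contT := hf.continuous_tors hD
  contq := by
    have hκ : Continuous fun x : ℝ × ℝ => D.κR x.1 (clampTo η₁ η₃ x.2) := continuousOn_univ.1 <|
      hD.continuousOn_κR.comp (f := fun x : ℝ × ℝ => (x.1, clampTo η₁ η₃ x.2))
        (continuous_fst.prodMk ((continuous_clampTo _ _).comp continuous_snd)).continuousOn
        fun x _ => ⟨trivial, hE (clampTo_mem hη _)⟩
    exact (hD.continuous_deriv_κ₂.comp continuous_fst).div
      ((hD.continuous_κ₂.comp continuous_fst).sub hκ) fun x =>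
        (sub_pos.2 (hD.κR_lt_κ₂ (hE (clampTo_mem hη _)) _)).ne'
  pos := fun t ε => div_pos (hD.deriv_κ₂_pos t)
    (sub_pos.2 (hD.κR_lt_κ₂ (hE (clampTo_mem hη _)) _))
  anti := fun t ε ε' h => div_le_div_of_nonneg_left (hD.deriv_κ₂_pos t).le
    (sub_pos.2 (hD.κR_lt_κ₂ (hE (clampTo_mem hη _)) _))
    (sub_le_sub_left (hD.κR_anti (hE (clampTo_mem hη _)) (hE (clampTo_mem hη _))
      (clampTo_mono _ _ h) t) _)

lemma relaxCoeff_rateL (hD : D.IsAdmissible) (hf : D.IsRegular f)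
    (hE : Icc η₁ η₃ ⊆ D.posParams) (hη : η₁ ≤ η₃) :
    RelaxCoeff (fun t => D.tors f (-t)) (fun t ε => D.rateL η₁ η₃ (-t) ε) where
  contT := (hf.continuous_tors hD).comp continuous_neg
  contq := by
    have hκ : Continuous fun x : ℝ × ℝ => D.κL x.1 (clampTo η₁ η₃ x.2) := continuousOn_univ.1 <|
      hD.continuousOn_κL.comp (f := fun x : ℝ × ℝ => (x.1, clampTo η₁ η₃ x.2))
        (continuous_fst.prodMk ((continuous_clampTo _ _).comp continuous_snd)).continuousOn
        fun x _ => ⟨trivial, hE (clampTo_mem hη _)⟩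
    have h : Continuous fun x : ℝ × ℝ => D.rateL η₁ η₃ x.1 x.2 :=
      (hD.continuous_deriv_κ₂.comp continuous_fst).div
        (hκ.sub (hD.continuous_κ₂.comp continuous_fst)) fun x =>
          (sub_pos.2 (hD.κ₂_lt_κL (hE (clampTo_mem hη _)) _)).ne'
    exact h.comp (by fun_prop : Continuous fun x : ℝ × ℝ => (-x.1, x.2))
  pos := fun t ε => div_pos (hD.deriv_κ₂_pos _)
    (sub_pos.2 (hD.κ₂_lt_κL (hE (clampTo_mem hη _)) _))
  anti := fun t ε ε' h => div_le_div_of_nonneg_left (hD.deriv_κ₂_pos _).le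
    (sub_pos.2 (hD.κ₂_lt_κL (hE (clampTo_mem hη _)) _))
    (sub_le_sub_right (hD.κL_mono (hE (clampTo_mem hη _)) (hE (clampTo_mem hη _))
      (clampTo_mono _ _ h) _) _)

end IsAdmissible

lemma force_eq_of_ode (hD : D.IsAdmissible) {κ : ℝ → ℝ}
    (h : (D.κ₂ t - κ t) * β' t + deriv D.κ₂ t * β t = deriv (D.κ₃ f) t) :
    D.force κ β' t = D.tors f t - β t := by
  have hw := (hD.deriv_κ₂_pos t).ne'
  rw [IsRegular.deriv_κ₃ hD] at h
  rw [force, div_mul_eq_mul_div, div_eq_iff hw]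
  linear_combination h

lemma odeR_iff (hD : D.IsAdmissible) (hE : Icc η₁ η₃ ⊆ D.posParams) (hε : ε ∈ Icc η₁ η₃)
    {B B' : ℝ} : (D.κ₂ t - D.κR t ε) * B' + deriv D.κ₂ t * B = deriv (D.κ₃ f) t ↔
      B' = D.rateR η₁ η₃ t ε * (D.tors f t - B) := by
  have h := sub_pos.2 (hD.κR_lt_κ₂ (hE hε) t)
  rw [IsRegular.deriv_κ₃ hD, rateR, clampTo_of_mem hε, div_mul_eq_mul_div, eq_div_iff h.ne']
  constructor <;> intro e <;> linear_combination e

lemma odeL_iff (hD : D.IsAdmissible) (hE : Icc η₁ η₃ ⊆ D.posParams) (hε : ε ∈ Icc η₁ η₃)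
    {B B' : ℝ} : (D.κ₂ t - D.κL t ε) * B' + deriv D.κ₂ t * B = deriv (D.κ₃ f) t ↔
      B' = D.rateL η₁ η₃ t ε * (B - D.tors f t) := by
  have h := sub_pos.2 (hD.κ₂_lt_κL (hE hε) t)
  rw [IsRegular.deriv_κ₃ hD, rateL, clampTo_of_mem hε, div_mul_eq_mul_div, eq_div_iff h.ne']
  constructor <;> intro e <;> linear_combination -e

lemma rateR_pos (hD : D.IsAdmissible) (hE : Icc η₁ η₃ ⊆ D.posParams) (hη : η₁ ≤ η₃) (t ε : ℝ) :
    0 < D.rateR η₁ η₃ t ε :=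
  div_pos (hD.deriv_κ₂_pos t) (sub_pos.2 (hD.κR_lt_κ₂ (hE (clampTo_mem hη _)) _))

lemma rateL_pos (hD : D.IsAdmissible) (hE : Icc η₁ η₃ ⊆ D.posParams) (hη : η₁ ≤ η₃) (t ε : ℝ) :
    0 < D.rateL η₁ η₃ t ε :=
  div_pos (hD.deriv_κ₂_pos t) (sub_pos.2 (hD.κ₂_lt_κL (hE (clampTo_mem hη _)) _))

namespace IsStdR

lemma mono (h : D.IsStdR f ε p q β β') {p' q' : EReal} (hp : p ≤ p') (hq : q' ≤ q) :
    D.IsStdR f ε p' q' β β' where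
  hasDeriv := fun t ht => (h.hasDeriv t (eIcc_subset hp hq ht)).mono (eIcc_subset hp hq)
  ode := fun t ht => h.ode t (eIcc_subset hp hq ht)
  nonpos := fun t ht => h.nonpos t (eIcc_subset hp hq ht)
  neg := fun t ht => h.neg t (interior_mono (eIcc_subset hp hq) ht)
  infinite := fun h' t ht => h.infinite (le_bot_iff.1 (h' ▸ hp)) t (eIcc_subset hp hq ht)

lemma force_eq (hD : D.IsAdmissible) (h : D.IsStdR f ε p q β β') (ht : t ∈ eIcc p q) :
    D.force (fun τ => D.κR τ ε) β' t = D.tors f t - β t :=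
  force_eq_of_ode hD (h.ode t ht)

lemma tors_le (hD : D.IsAdmissible) (hε : ε ∈ D.posParams) (h : D.IsStdR f ε p q β β')
    (ht : t ∈ eIcc p q) : D.tors f t ≤ β t := by
  have h1 := force_eq hD h ht
  have h2 : D.force (fun τ => D.κR τ ε) β' t ≤ 0 := mul_nonpos_of_nonneg_of_nonpos
    (div_nonneg (sub_nonneg.2 (hD.κR_lt_κ₂ hε t).le) (hD.deriv_κ₂_pos t).le) (h.nonpos t ht)
  linarith

lemma tors_lt (hD : D.IsAdmissible) (hε : ε ∈ D.posParams) (h : D.IsStdR f ε p q β β')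
    (h1 : p < t) (h2 : (t : EReal) < q) : D.tors f t < β t := by
  have ht := mem_interior_eIcc.2 ⟨h1, h2⟩
  have h3 := force_eq hD h (interior_subset ht)
  have h4 : D.force (fun τ => D.κR τ ε) β' t < 0 := mul_neg_of_pos_of_neg
    (div_pos (sub_pos.2 (hD.κR_lt_κ₂ hε t)) (hD.deriv_κ₂_pos t)) (h.neg t ht)
  linarith

lemma eqOn (hD : D.IsAdmissible) (hf : D.IsRegular f) (hE : Icc η₁ η₃ ⊆ D.posParams)
    (hη : η₁ ≤ η₃) (hε : ε ∈ Icc η₁ η₃) (h : D.IsStdR f ε p q β β')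
    (hy : IsRelax (D.tors f) (fun t => D.rateR η₁ η₃ t ε) y) (ha : a ∈ eIcc p q) (hya : β a = y a) :
    EqOn β y (eIcc p q) :=
  (hD.relaxCoeff_rateR hf hE hη).eqOn (ε := ε) (ordConnected_eIcc p q)
    (fun t ht => (odeR_iff hD hE hε).1 (h.ode t ht) ▸ h.hasDeriv t ht)
    (fun t _ => (hy t).hasDerivWithinAt) ha hya

/-- A solution above `tors` generates a standard candidate, if `p ≠ ⊥`. For `p = ⊥` the
constant of integration at `-∞` would have to vanish, too. -/
lemma of_isRelax (hD : D.IsAdmissible) (hE : Icc η₁ η₃ ⊆ D.posParams)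
    (hη : η₁ ≤ η₃) (hε : ε ∈ Icc η₁ η₃)
    (hy : IsRelax (D.tors f) (fun t => D.rateR η₁ η₃ t ε) y) (hp : p ≠ ⊥)
    (hle : ∀ t ∈ eIcc p q, D.tors f t ≤ y t)
    (hlt : ∀ t : ℝ, p < t → (t : EReal) < q → D.tors f t < y t) :
    D.IsStdR f ε p q y fun t => D.rateR η₁ η₃ t ε * (D.tors f t - y t) where
  hasDeriv := fun t _ => (hy t).hasDerivWithinAt
  ode := fun _ _ => (odeR_iff hD hE hε).2 rfl
  nonpos := fun t ht => mul_nonpos_of_nonneg_of_nonpos (rateR_pos hD hE hη t ε).le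
    (sub_nonpos.2 (hle t ht))
  neg := fun t ht => mul_neg_of_pos_of_neg (rateR_pos hD hE hη t ε)
    (sub_neg.2 (hlt t (mem_interior_eIcc.1 ht).1 (mem_interior_eIcc.1 ht).2))
  infinite := fun h => absurd h hp

end IsStdR

namespace IsStdL

lemma mono (h : D.IsStdL f ε p q β β') {p' q' : EReal} (hp : p ≤ p') (hq : q' ≤ q) :
    D.IsStdL f ε p' q' β β' where
  hasDeriv := fun t ht => (h.hasDeriv t (eIcc_subset hp hq ht)).mono (eIcc_subset hp hq)
  ode := fun t ht => h.ode t (eIcc_subset hp hq ht)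
  nonneg := fun t ht => h.nonneg t (eIcc_subset hp hq ht)
  pos := fun t ht => h.pos t (interior_mono (eIcc_subset hp hq) ht)
  infinite := fun h' t ht => h.infinite (top_le_iff.1 (h' ▸ hq)) t (eIcc_subset hp hq ht)

lemma force_eq (hD : D.IsAdmissible) (h : D.IsStdL f ε p q β β') (ht : t ∈ eIcc p q) :
    D.force (fun τ => D.κL τ ε) β' t = D.tors f t - β t :=
  force_eq_of_ode hD (h.ode t ht)

lemma tors_le (hD : D.IsAdmissible) (hε : ε ∈ D.posParams) (h : D.IsStdL f ε p q β β')
    (ht : t ∈ eIcc p q) : D.tors f t ≤ β t := by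
  have h1 := force_eq hD h ht
  have h2 : D.force (fun τ => D.κL τ ε) β' t ≤ 0 := mul_nonpos_of_nonpos_of_nonneg
    (div_nonpos_of_nonpos_of_nonneg (sub_nonpos.2 (hD.κ₂_lt_κL hε t).le) (hD.deriv_κ₂_pos t).le)
    (h.nonneg t ht)
  linarith

lemma tors_lt (hD : D.IsAdmissible) (hε : ε ∈ D.posParams) (h : D.IsStdL f ε p q β β')
    (h1 : p < t) (h2 : (t : EReal) < q) : D.tors f t < β t := by
  have ht := mem_interior_eIcc.2 ⟨h1, h2⟩
  have h3 := force_eq hD h (interior_subset ht)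
  have h4 : D.force (fun τ => D.κL τ ε) β' t < 0 := mul_neg_of_neg_of_pos
    (div_neg_of_neg_of_pos (sub_neg.2 (hD.κ₂_lt_κL hε t)) (hD.deriv_κ₂_pos t)) (h.pos t ht)
  linarith

lemma eqOn (hD : D.IsAdmissible) (hf : D.IsRegular f) (hE : Icc η₁ η₃ ⊆ D.posParams)
    (hη : η₁ ≤ η₃) (hε : ε ∈ Icc η₁ η₃) (h : D.IsStdL f ε p q β β')
    (hy : IsRise (D.tors f) (fun t => D.rateL η₁ η₃ t ε) y) (ha : a ∈ eIcc p q) (hya : β a = y a) :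
    EqOn β y (eIcc p q) := by
  have hord : (Neg.neg ⁻¹' eIcc p q).OrdConnected := ⟨fun x hx z hz w hw =>
    (ordConnected_eIcc p q).out hz hx ⟨neg_le_neg hw.2, neg_le_neg hw.1⟩⟩
  have h1 : EqOn (fun t => β (-t)) (fun t => y (-t)) (Neg.neg ⁻¹' eIcc p q) := by
    refine (hD.relaxCoeff_rateL hf hE hη).eqOn (ε := ε) (a := -a) hord (fun t ht => ?_)
      (fun t _ => (hy.isRelax t).hasDerivWithinAt) (by simpa using ha) (by simpa using hya)
    have h2 := h.hasDeriv (-t) ht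
    rw [(odeL_iff hD hE hε).1 (h.ode (-t) ht)] at h2
    refine (h2.scomp t (hasDerivAt_neg t).hasDerivWithinAt (fun s hs => hs)).congr_deriv ?_
    simp only [smul_eq_mul]
    ring
  intro t ht
  have := h1 (x := -t) (by simpa using ht)
  simpa using this

/-- A solution above `tors` generates a standard candidate, if `q ≠ ⊤`. For `q = ⊤` the
constant of integration at `+∞` would have to vanish, too. -/
lemma of_isRise (hD : D.IsAdmissible) (hE : Icc η₁ η₃ ⊆ D.posParams)
    (hη : η₁ ≤ η₃) (hε : ε ∈ Icc η₁ η₃)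
    (hy : IsRise (D.tors f) (fun t => D.rateL η₁ η₃ t ε) y) (hq : q ≠ ⊤)
    (hle : ∀ t ∈ eIcc p q, D.tors f t ≤ y t)
    (hlt : ∀ t : ℝ, p < t → (t : EReal) < q → D.tors f t < y t) :
    D.IsStdL f ε p q y fun t => D.rateL η₁ η₃ t ε * (y t - D.tors f t) where
  hasDeriv := fun t _ => (hy t).hasDerivWithinAt
  ode := fun _ _ => (odeL_iff hD hE hε).2 rfl
  nonneg := fun t ht => mul_nonneg (rateL_pos hD hE hη t ε).le (sub_nonneg.2 (hle t ht))
  pos := fun t ht => mul_pos (rateL_pos hD hE hη t ε)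
    (sub_pos.2 (hlt t (mem_interior_eIcc.1 ht).1 (mem_interior_eIcc.1 ht).2))
  infinite := fun h => absurd h hq

end IsStdL

/-! ### The forces of chords -/

lemma betaSol_self (κ : ℝ → ℝ) (t₀ c : ℝ) : D.betaSol f κ t₀ c t₀ = c := by simp [betaSol]

lemma hasDerivAt_betaSol (hD : D.IsAdmissible) (hf : D.IsRegular f) {κ : ℝ → ℝ}
    (hκ : Continuous κ) (hne : ∀ t, D.κ₂ t - κ t ≠ 0) (t₀ c t : ℝ) :
    HasDerivAt (D.betaSol f κ t₀ c)
      (deriv D.κ₂ t / (D.κ₂ t - κ t) * (D.tors f t - D.betaSol f κ t₀ c t)) t := by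
  have hq : Continuous fun t => deriv D.κ₂ t / (D.κ₂ t - κ t) :=
    hD.continuous_deriv_κ₂.div (hD.continuous_κ₂.sub hκ) hne
  have hp : Continuous fun t => deriv (D.κ₃ f) t / (D.κ₂ t - κ t) :=
    (hf.continuous_deriv_κ₃ hD).div (hD.continuous_κ₂.sub hκ) hne
  have h1 : ∀ t, HasDerivAt (fun t => ∫ τ in t₀..t, deriv D.κ₂ τ / (D.κ₂ τ - κ τ))
      (deriv D.κ₂ t / (D.κ₂ t - κ t)) t := fun t =>
    (hq.integral_hasStrictDerivAt t₀ t).hasDerivAt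
  have hc : Continuous fun t => ∫ τ in t₀..t, deriv D.κ₂ τ / (D.κ₂ τ - κ τ) :=
    continuous_iff_continuousAt.2 fun t => (h1 t).continuousAt
  have h2 : HasDerivAt (fun t => ∫ τ in t₀..t, Real.exp (∫ σ in t₀..τ, deriv D.κ₂ σ /
      (D.κ₂ σ - κ σ)) * (deriv (D.κ₃ f) τ / (D.κ₂ τ - κ τ)))
      (Real.exp (∫ σ in t₀..t, deriv D.κ₂ σ / (D.κ₂ σ - κ σ)) *
        (deriv (D.κ₃ f) t / (D.κ₂ t - κ t))) t :=
    ((hc.rexp.mul hp).integral_hasStrictDerivAt t₀ t).hasDerivAt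
  refine ((h1 t).neg.exp.mul (h2.add_const c)).congr_deriv ?_
  have e : ∀ E : ℝ, Real.exp (-E) * (Real.exp E * (deriv (D.κ₃ f) t / (D.κ₂ t - κ t))) =
      deriv D.κ₂ t / (D.κ₂ t - κ t) * D.tors f t := fun E => by
    rw [← mul_assoc, ← Real.exp_add, neg_add_cancel, Real.exp_zero, one_mul,
      IsRegular.deriv_κ₃ hD]
    ring
  simp only [Pi.neg_apply, betaSol]
  rw [e]
  ring

lemma IsAdmissible.continuous_κR (hD : D.IsAdmissible) (hε : ε ∈ D.posParams) :
    Continuous fun t => D.κR t ε := continuousOn_univ.1 <|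
  hD.continuousOn_κR.comp (f := fun t : ℝ => (t, ε)) (by fun_prop) fun t _ => ⟨trivial, hε⟩

lemma IsAdmissible.continuous_κL (hD : D.IsAdmissible) (hε : ε ∈ D.posParams) :
    Continuous fun t => D.κL t ε := continuousOn_univ.1 <|
  hD.continuousOn_κL.comp (f := fun t : ℝ => (t, ε)) (by fun_prop) fun t _ => ⟨trivial, hε⟩

/-- The force `FR` of a chord belongs to the solution that starts at its right end with the slope of
the chord. -/
lemma FR_eq (hD : D.IsAdmissible) (hf : D.IsRegular f) (hE : Icc η₁ η₃ ⊆ D.posParams)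
    (hη : η₁ ≤ η₃) (hε : ε ∈ Icc η₁ η₃) (hab : a ≠ b)
    (hy : IsRelax (D.tors f) (fun t => D.rateR η₁ η₃ t ε) y) (hyb : y b = D.chordβ f a b) (t : ℝ) :
    D.FR f a b ε t = D.tors f t - y t := by
  have hq := hD.relaxCoeff_rateR hf hE hη
  rw [FR, hD.chordForceR_eq hf hab, sub_sub_cancel]
  congr 1
  have hb := hasDerivAt_betaSol hD hf (hD.continuous_κR (hE hε))
    (fun t => (sub_pos.2 (hD.κR_lt_κ₂ (hE hε) t)).ne') b (D.chordβ f a b)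
  refine hq.eqOn (ε := ε) ordConnected_univ (fun t _ => (hb t).hasDerivWithinAt.congr_deriv ?_)
    (fun t _ => (hy t).hasDerivWithinAt) (mem_univ b) (by rw [betaSol_self, hyb]) (mem_univ t)
  rw [rateR, clampTo_of_mem hε]

/-- The force `FL` of a chord belongs to the solution that starts at its left end with the slope of
the chord. -/
lemma FL_eq (hD : D.IsAdmissible) (hf : D.IsRegular f) (hE : Icc η₁ η₃ ⊆ D.posParams)
    (hη : η₁ ≤ η₃) (hε : ε ∈ Icc η₁ η₃) (hab : a ≠ b)
    (hy : IsRise (D.tors f) (fun t => D.rateL η₁ η₃ t ε) y) (hya : y a = D.chordβ f a b) (t : ℝ) :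
    D.FL f a b ε t = D.tors f t - y t := by
  have hq := hD.relaxCoeff_rateL hf hE hη
  rw [FL, hD.chordForceL_eq hf hab, sub_sub_cancel]
  congr 1
  have hb := hasDerivAt_betaSol hD hf (hD.continuous_κL (hE hε))
    (fun t => (sub_neg.2 (hD.κ₂_lt_κL (hE hε) t)).ne) a (D.chordβ f a b)
  have hrise : IsRise (D.tors f) (fun t => D.rateL η₁ η₃ t ε)
      (D.betaSol f (fun τ => D.κL τ ε) a (D.chordβ f a b)) := fun t => (hb t).congr_deriv (by
    simp only [rateL, clampTo_of_mem hε]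
    rw [← neg_sub (D.κL t ε), div_neg]
    ring)
  have := hq.eqOn (ε := ε) (a := -a) (y := fun t => D.betaSol f (fun τ => D.κL τ ε) a
    (D.chordβ f a b) (-t)) (z := fun t => y (-t)) ordConnected_univ
    (fun t _ => (hrise.isRelax t).hasDerivWithinAt) (fun t _ => (hy.isRelax t).hasDerivWithinAt)
    (mem_univ _) (by rw [neg_neg, betaSol_self, hya]) (mem_univ (-t))
  simpa using this

lemma tailR_eq (hD : D.IsAdmissible) (hf : D.IsRegular f) (hE : Icc η₁ η₃ ⊆ D.posParams)
    (hη : η₁ ≤ η₃) (hε : ε ∈ Icc η₁ η₃) (hab : a ≠ b)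
    (hy : IsRelax (D.tors f) (fun t => D.rateR η₁ η₃ t ε) y) (hyb : y b = D.chordβ f a b) :
    D.tailR f a b ε = relaxTail (D.tors f) y b := by
  rw [tailR, relaxTail]
  congr 1
  ext τ
  constructor
  · rintro ⟨v, rfl, hbv, β, β', h, hforce⟩
    have hb : b ∈ eIcc b v := by rw [eIcc_coe]; exact left_mem_Icc.2 hbv
    have hβb : β b = y b := by
      rw [h.force_eq hD hb, hD.chordForceR_eq hf hab] at hforce
      linarith
    have heq := h.eqOn hD hf hE hη hε hy hb hβb
    refine ⟨v, rfl, hbv, fun t ht => ?_, fun t ht => ?_⟩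
    · rw [← eIcc_coe] at ht
      rw [← heq ht]
      exact h.tors_le hD (hE hε) ht
    · have ht' := Ioo_subset_Icc_self ht
      rw [← eIcc_coe] at ht'
      rw [← heq ht']
      exact h.tors_lt hD (hE hε) (EReal.coe_lt_coe_iff.2 ht.1) (EReal.coe_lt_coe_iff.2 ht.2)
  · rintro ⟨v, rfl, hbv, h1, h2⟩
    have h := IsStdR.of_isRelax (f := f) (p := b) (q := v) hD hE hη hε hy (EReal.coe_ne_bot b)
      (fun t ht => h1 t (by rwa [eIcc_coe] at ht))
      fun t ht ht' => h2 t ⟨EReal.coe_lt_coe_iff.1 ht, EReal.coe_lt_coe_iff.1 ht'⟩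
    refine ⟨v, rfl, hbv, _, _, h, ?_⟩
    rw [h.force_eq hD (by rw [eIcc_coe]; exact left_mem_Icc.2 hbv), hD.chordForceR_eq hf hab, hyb]

lemma tailL_eq (hD : D.IsAdmissible) (hf : D.IsRegular f) (hE : Icc η₁ η₃ ⊆ D.posParams)
    (hη : η₁ ≤ η₃) (hε : ε ∈ Icc η₁ η₃) (hab : a ≠ b)
    (hy : IsRise (D.tors f) (fun t => D.rateL η₁ η₃ t ε) y) (hya : y a = D.chordβ f a b) :
    D.tailL f a b ε = -relaxTail (fun t => D.tors f (-t)) (fun t => y (-t)) (-a) := by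
  refine le_antisymm (EReal.le_neg_of_le_neg (sSup_le ?_)) (le_sInf ?_)
  · rintro _ ⟨v, rfl, hbv, h1, h2⟩
    have h := IsStdL.of_isRise (f := f) (p := (-v : ℝ)) (q := a) hD hE hη hε hy (EReal.coe_ne_top a)
      (fun t ht => by
        rw [eIcc_coe] at ht
        simpa using h1 (-t) ⟨by linarith [ht.2], by linarith [ht.1]⟩)
      fun t ht ht' => by
        have e1 := EReal.coe_lt_coe_iff.1 ht
        have e2 := EReal.coe_lt_coe_iff.1 ht'
        simpa using h2 (-t) ⟨by linarith, by linarith⟩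
    refine EReal.le_neg_of_le_neg (sInf_le ⟨-v, by simp, by linarith, _, _, h, ?_⟩)
    rw [h.force_eq hD (by rw [eIcc_coe]; exact right_mem_Icc.2 (by linarith)),
      hD.chordForceL_eq hf hab, hya]
  · rintro _ ⟨v, rfl, hbv, β, β', h, hforce⟩
    have hb : a ∈ eIcc v a := by rw [eIcc_coe]; exact right_mem_Icc.2 hbv
    have hβb : β a = y a := by
      rw [h.force_eq hD hb, hD.chordForceL_eq hf hab] at hforce
      linarith
    have heq := h.eqOn hD hf hE hη hε hy hb hβb
    refine EReal.neg_le_of_neg_le (le_sSup ⟨-v, by simp, neg_le_neg hbv, fun t ht => ?_,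
      fun t ht => ?_⟩)
    · have ht' : -t ∈ eIcc v a := by
        rw [eIcc_coe]; exact ⟨by linarith [ht.2], by linarith [ht.1]⟩
      exact (h.tors_le hD (hE hε) ht').trans_eq (heq ht')
    · have ht' : -t ∈ eIcc v a := by
        rw [eIcc_coe]; exact ⟨by linarith [ht.2], by linarith [ht.1]⟩
      exact (h.tors_lt hD (hE hε) (EReal.coe_lt_coe_iff.2 (by linarith [ht.2]))
        (EReal.coe_lt_coe_iff.2 (by linarith [ht.1]))).trans_eq (heq ht')

end CurveFamily

namespace CurveFamily

variable {D : CurveFamily} {f : ℝ → ℝ} {η₁ η₃ η ε ε' r p t a b : ℝ} {S c : ℝ → ℝ}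

/-! ### Chordal domains as families of chords -/

namespace IsChordal

lemma continuousOn_chordβ (hD : D.IsAdmissible) (hf : D.IsRegular f) (h : D.IsChordal f r p S) :
    ContinuousOn (fun c => D.chordβ f c (S c)) (Ico r p) := by
  have hS := h.cont.mono Ico_subset_Icc_self
  have hκ₃ : Continuous (D.κ₃ f) :=
    continuous_iff_continuousAt.2 fun t => (hf.hasDerivAt_κ₃ hD t).continuousAt
  exact ((hκ₃.comp_continuousOn hS).sub hκ₃.continuousOn).div
    ((hD.continuous_κ₂.comp_continuousOn hS).sub hD.continuous_κ₂.continuousOn)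
    fun c hc => hD.κ₂_sub_ne (h.lt_right hc).ne

/-- Chords under the top chord stay under all curves with larger index. -/
lemma chordHgt_pt_pos {c : ℝ} (hD : D.IsAdmissible) (hE : Icc η₁ η₃ ⊆ D.posParams)
    (h : D.IsChordal f r p S) (hdisj : Disjoint (segment ℝ (D.g r) (D.g (S r))) (D.Xi η₁))
    (hc : c ∈ Ioo r p) (hε : ε ∈ Icc η₁ η₃) (s : ℝ) :
    0 < D.chordHgt c (S c) (D.pt s ε) := by
  have h₁ : η₁ ∈ D.posParams := hE ⟨le_rfl, hε.1.trans hε.2⟩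
  have h₀ : r ∈ Ico r p := left_mem_Ico.2 h.lt
  exact hD.chordHgt_pt_mono h₁ (hE hε) hε.1 (fun s => hD.chordHgt_pt_pos h₁ hc.1
    (h.lt_right (Ioo_subset_Ico_self hc))
    (h.anti (Ico_subset_Icc_self h₀) (Ioo_subset_Icc_self hc) hc.1)
    (fun s => hD.chordHgt_pt_nonneg h₁ (h.lt_right h₀) hdisj s) s) s

lemma tors_left_lt {c : ℝ} (hD : D.IsAdmissible) (hf : D.IsRegular f) (h : D.IsChordal f r p S)
    (hc : c ∈ Ioo r p) : D.tors f c < D.chordβ f c (S c) :=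
  (hD.DL_neg_iff hf (h.lt_right (Ioo_subset_Ico_self hc)).ne).1 (h.DL_neg c hc)

lemma tors_right_lt {c : ℝ} (hD : D.IsAdmissible) (hf : D.IsRegular f) (h : D.IsChordal f r p S)
    (hc : c ∈ Ioo r p) : D.tors f (S c) < D.chordβ f c (S c) :=
  (hD.DR_neg_iff hf (h.lt_right (Ioo_subset_Ico_self hc)).ne).1 (h.DR_neg c hc)

lemma tors_left_le (hD : D.IsAdmissible) (hf : D.IsRegular f) (h : D.IsChordal f r p S) :
    D.tors f r ≤ D.chordβ f r (S r) := by
  have h₀ : r ∈ Ico r p := left_mem_Ico.2 h.lt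
  refine ContinuousWithinAt.closure_le (s := Ioo r p) ?_
    (hf.continuous_tors hD).continuousWithinAt
    ((h.continuousOn_chordβ hD hf r h₀).mono Ioo_subset_Ico_self)
    fun c hc => (h.tors_left_lt hD hf hc).le
  rw [closure_Ioo h.lt.ne]
  exact left_mem_Icc.2 h.lt.le

lemma tors_right_le (hD : D.IsAdmissible) (hf : D.IsRegular f) (h : D.IsChordal f r p S) :
    D.tors f (S r) ≤ D.chordβ f r (S r) := by
  have h₀ : r ∈ Ico r p := left_mem_Ico.2 h.lt
  refine ContinuousWithinAt.closure_le (s := Ioo r p) (f := fun c => D.tors f (S c)) ?_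
    ((hf.continuous_tors hD).comp_continuousOn (h.cont.mono Ico_subset_Icc_self) r h₀ |>.mono
      Ioo_subset_Ico_self)
    ((h.continuousOn_chordβ hD hf r h₀).mono Ioo_subset_Ico_self)
    fun c hc => (h.tors_right_lt hD hf hc).le
  rw [closure_Ioo h.lt.ne]
  exact left_mem_Icc.2 h.lt.le

/-- The rate at the right ends of the chords exceeds the rate of the right tangents, since the
chords are steeper than these tangents. -/
lemma isRelaxChord_right (hD : D.IsAdmissible) (hf : D.IsRegular f)
    (hE : Icc η₁ η₃ ⊆ D.posParams) (hη : η₁ ≤ η₃) (h : D.IsChordal f r p S)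
    (hdisj : Disjoint (segment ℝ (D.g r) (D.g (S r))) (D.Xi η₁)) :
    IsRelaxChord (D.tors f) (D.rateR η₁ η₃) r p (fun c => c) S fun c => D.chordβ f c (S c) := by
  choose! S' hS' hSd hβA hβB using fun c (hc : c ∈ Ioo r p) => h.exists_hasDerivAt hD hf hc
  refine IsRelaxChord.of_hasDerivAt (hD.relaxCoeff_rateR hf hE hη) h.lt continuousOn_id
    (h.cont.mono Ico_subset_Icc_self) (h.continuousOn_chordβ hD hf) (strictMono_id.strictMonoOn _)
    (h.anti.mono Ico_subset_Icc_self) (fun c hc => h.tors_left_lt hD hf hc)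
    (fun c hc => h.tors_right_lt hD hf hc) (h.tors_left_le hD hf) (h.tors_right_le hD hf)
    (fun c _ => hasDerivAt_id c) hSd hβA hβB (fun _ _ => one_pos) hS' (fun c hc => ?_)
    fun c hc ε => ?_
  · exact div_pos (hD.deriv_κ₂_pos _)
      (sub_pos.2 (hD.κ₂_lt_chordSlope (h.lt_right (Ioo_subset_Ico_self hc))))
  · have hlt := h.lt_right (Ioo_subset_Ico_self hc)
    have hm := clampTo_mem hη ε
    exact div_lt_div_of_pos_left (hD.deriv_κ₂_pos _) (sub_pos.2 (hD.chordSlope_lt_κ₂ hlt))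
      (sub_lt_sub_left (hD.κR_lt_chordSlope (hE hm) hlt
        fun s => h.chordHgt_pt_pos hD hE hdisj hc hm s) _)

/-- Reflection of the line exchanges the ends of the chords and turns left tangents into right
tangents. -/
lemma isRelaxChord_left (hD : D.IsAdmissible) (hf : D.IsRegular f)
    (hE : Icc η₁ η₃ ⊆ D.posParams) (hη : η₁ ≤ η₃) (h : D.IsChordal f r p S)
    (hdisj : Disjoint (segment ℝ (D.g r) (D.g (S r))) (D.Xi η₁)) :
    IsRelaxChord (fun t => D.tors f (-t)) (fun t ε => D.rateL η₁ η₃ (-t) ε) r p (fun c => -S c)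
      (fun c => -c) fun c => D.chordβ f c (S c) := by
  choose! S' hS' hSd hβA hβB using fun c (hc : c ∈ Ioo r p) => h.exists_hasDerivAt hD hf hc
  refine IsRelaxChord.of_hasDerivAt (hD.relaxCoeff_rateL hf hE hη) (A' := fun c => -S' c)
    (B' := fun _ => -1)
    (rA := fun c => deriv D.κ₂ (S c) / (D.κ₂ (S c) - D.chordSlope c (S c)))
    (rB := fun c => deriv D.κ₂ c / (D.chordSlope c (S c) - D.κ₂ c)) h.lt
    (h.cont.mono Ico_subset_Icc_self).neg continuousOn_id.neg (h.continuousOn_chordβ hD hf)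
    (h.anti.mono Ico_subset_Icc_self).neg (strictMono_id.strictMonoOn _).neg
    (fun c hc => ?_) (fun c hc => ?_) ?_ ?_ (fun c hc => (hSd c hc).neg)
    (fun c _ => hasDerivAt_neg c) (fun c hc => (hβB c hc).congr_deriv ?_)
    (fun c hc => (hβA c hc).congr_deriv ?_)
    (fun c hc => neg_pos.2 (hS' c hc)) (fun _ _ => by norm_num) (fun c hc => ?_) fun c hc ε => ?_
  · simpa only [neg_neg] using h.tors_right_lt hD hf hc
  · simpa only [neg_neg] using h.tors_left_lt hD hf hc
  · simpa only [neg_neg] using h.tors_right_le hD hf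
  · simpa only [neg_neg] using h.tors_left_le hD hf
  · simp only [neg_neg]
    ring
  · simp only [neg_neg]
    ring
  · exact div_pos (hD.deriv_κ₂_pos _)
      (sub_pos.2 (hD.chordSlope_lt_κ₂ (h.lt_right (Ioo_subset_Ico_self hc))))
  · have hlt := h.lt_right (Ioo_subset_Ico_self hc)
    have hm := clampTo_mem hη ε
    simp only [rateL, neg_neg]
    exact div_lt_div_of_pos_left (hD.deriv_κ₂_pos _) (sub_pos.2 (hD.κ₂_lt_chordSlope hlt))
      (sub_lt_sub_right (hD.chordSlope_lt_κL (hE hm)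
        fun s => h.chordHgt_pt_pos hD hE hdisj hc hm s) _)

end IsChordal

/-! ### The force flows of descending chords -/

/-- The forces of a chord that moves down form a right flow on its tail. -/
lemma isRightFlow_of_descent (hD : D.IsAdmissible) (hf : D.IsRegular f)
    (hE : Icc η₁ η₃ ⊆ D.posParams) (hη : η₁ < η) (hη₃ : η ≤ η₃) (h : D.IsChordal f r p S)
    (hdisj : Disjoint (segment ℝ (D.g r) (D.g (S r))) (D.Xi η₁)) (hc : IsDescent r p η₁ η c) :
    D.IsRightFlow f η₁ η (fun ε => (S (c ε) : EReal)) (fun ε => D.tailR f (c ε) (S (c ε)) ε)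
      fun t ε => D.FR f (c ε) (S (c ε)) ε t := by
  have hη' := hη.le.trans hη₃
  have hch := h.isRelaxChord_right hD hf hE hη' hdisj
  have hq := hD.relaxCoeff_rateR hf hE hη'
  set y := IsRelaxChord.tailSol (D.tors f) (D.rateR η₁ η₃) S (fun c => D.chordβ f c (S c)) c
    with hydef
  have hsub : ∀ ε ∈ Icc η₁ η, ε ∈ Icc η₁ η₃ := fun ε hε => ⟨hε.1, hε.2.trans hη₃⟩
  have hy : ∀ ε, IsRelax (D.tors f) (fun t => D.rateR η₁ η₃ t ε) (y ε) := fun ε =>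
    IsRelaxChord.isRelax_tailSol hq _ _ _ _
  have hy0 : ∀ ε, y ε (S (c ε)) = D.chordβ f (c ε) (S (c ε)) := fun ε =>
    IsRelaxChord.tailSol_start
  have hne : ∀ ε ∈ Icc η₁ η, c ε ≠ S (c ε) := fun ε hε => (h.lt_right (hc.mem ε hε)).ne
  have hF : ∀ ε ∈ Icc η₁ η, ∀ t, D.FR f (c ε) (S (c ε)) ε t = D.tors f t - y ε t :=
    fun ε hε t => FR_eq hD hf hE hη' (hsub ε hε) (hne ε hε) (hy ε) (hy0 ε) t
  have htail : ∀ ε ∈ Icc η₁ η, D.tailR f (c ε) (S (c ε)) ε =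
      relaxTail (D.tors f) (y ε) (S (c ε)) := fun ε hε =>
    tailR_eq hD hf hE hη' (hsub ε hε) (hne ε hε) (hy ε) (hy0 ε)
  have hT := hf.continuous_tors hD
  have hstart : ∀ ε ∈ Icc η₁ η, D.tors f (S (c ε)) ≤ y ε (S (c ε)) := fun ε hε =>
    hch.start_le hc hε
  have hle : ∀ ε ∈ Icc η₁ η, (S (c ε) : EReal) ≤ D.tailR f (c ε) (S (c ε)) ε := fun ε hε => by
    rw [htail ε hε]
    exact le_relaxTail (hstart ε hε)
  refine ⟨⟨(hE ⟨le_rfl, hη'⟩).1, hη, (hE ⟨hη.le, hη₃⟩).2⟩, fun ε _ => EReal.coe_ne_top _,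
    fun ε hε => ne_bot_of_le_ne_bot (EReal.coe_ne_bot _) (hle ε hε),
    fun ε hε ε' hε' h' => ?_, fun ε hε ε' hε' h' => ?_, hle, ?_, fun ε hε => ?_,
    fun ε hε v hv => ?_, fun ε ε' h1 h2 h3 v hv1 hv2 => ?_⟩
  · exact EReal.coe_le_coe_iff.2 (hch.antiB.antitoneOn (hc.mem ε hε) (hc.mem ε' hε')
      (hc.mono.monotoneOn hε hε' h'))
  · simp only [htail ε hε, htail ε' hε']
    exact hch.relaxTail_mono hq hc hε hε' h'
  · have hC : ContinuousOn (fun ε => relaxConst (D.tors f) (D.rateR η₁ η₃) ε (S (c ε))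
        (D.chordβ f (c ε) (S (c ε)))) (Icc η₁ η) :=
      hq.continuousOn_relaxConst (hch.contB.comp hc.cont hc.mem)
        (hch.contβ.comp hc.cont hc.mem)
    have hsol : ContinuousOn (fun x : ℝ × ℝ => y x.2 x.1)
        {x | x.2 ∈ Icc η₁ η ∧ x.1 ∈ eIcc (S (c x.2)) (D.tailR f (c x.2) (S (c x.2)) x.2)} :=
      hq.continuousOn_relaxSol (e := fun x : ℝ × ℝ => x.2) (t := fun x => x.1)
        continuous_snd.continuousOn
        (hC.comp continuous_snd.continuousOn fun x hx => hx.1) continuous_fst.continuousOn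
    exact ((hT.comp continuous_fst).continuousOn.sub hsol).congr fun x hx => hF x.2 hx.1 x.1
  · have h1 := IsStdR.of_isRelax (f := f) (p := S (c ε)) (q := D.tailR f (c ε) (S (c ε)) ε) hD hE
      hη' (hsub ε hε) (hy ε) (EReal.coe_ne_bot _)
      (fun t ht => le_of_le_relaxTail hT (hy ε).continuous (hstart ε hε)
        (EReal.coe_le_coe_iff.1 ht.1) (htail ε hε ▸ ht.2))
      fun t ht ht' => lt_of_lt_relaxTail (EReal.coe_lt_coe_iff.1 ht) (htail ε hε ▸ ht')
    exact ⟨_, _, h1, fun u hu => by rw [h1.force_eq hD hu, hF ε hε]⟩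
  · simp only [hF ε hε]
    rw [htail ε hε] at hv
    exact sub_eq_zero.2 (eq_of_relaxTail_eq hT (hy ε).continuous (hstart ε hε) hv)
  · have hε : ε ∈ Icc η₁ η := ⟨h1.le, (h2.trans h3).le⟩
    have hε' : ε' ∈ Icc η₁ η := ⟨(h1.trans h2).le, h3.le⟩
    simp only [hF ε hε, hF ε' hε']
    refine sub_lt_sub_left (hch.tailSol_lt hq hc hε hε' h2 (EReal.coe_lt_coe_iff.1 hv1).le ?_) _
    rw [← htail ε hε]
    exact hv2

/-- The forces of a chord that moves down form a left flow on its tail. -/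
lemma isLeftFlow_of_descent (hD : D.IsAdmissible) (hf : D.IsRegular f)
    (hE : Icc η₁ η₃ ⊆ D.posParams) (hη : η₁ < η) (hη₃ : η ≤ η₃) (h : D.IsChordal f r p S)
    (hdisj : Disjoint (segment ℝ (D.g r) (D.g (S r))) (D.Xi η₁)) (hc : IsDescent r p η₁ η c) :
    D.IsLeftFlow f η₁ η (fun ε => D.tailL f (c ε) (S (c ε)) ε) (fun ε => (c ε : EReal))
      fun t ε => D.FL f (c ε) (S (c ε)) ε t := by
  have hη' := hη.le.trans hη₃
  have hch := h.isRelaxChord_left hD hf hE hη' hdisj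
  have hq := hD.relaxCoeff_rateL hf hE hη'
  set T : ℝ → ℝ := fun t => D.tors f (-t) with hTdef
  set y := IsRelaxChord.tailSol T (fun t ε => D.rateL η₁ η₃ (-t) ε) (fun c => -c)
    (fun c => D.chordβ f c (S c)) c with hydef
  have hsub : ∀ ε ∈ Icc η₁ η, ε ∈ Icc η₁ η₃ := fun ε hε => ⟨hε.1, hε.2.trans hη₃⟩
  have hy : ∀ ε, IsRelax T (fun t => D.rateL η₁ η₃ (-t) ε) (y ε) := fun ε =>
    IsRelaxChord.isRelax_tailSol hq _ _ _ _
  have hz : ∀ ε, IsRise (D.tors f) (fun t => D.rateL η₁ η₃ t ε) (fun t => y ε (-t)) := fun ε =>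
    IsRelax.isRise (hy ε)
  have hy0 : ∀ ε, y ε (-c ε) = D.chordβ f (c ε) (S (c ε)) := fun ε =>
    IsRelaxChord.tailSol_start (B := fun c => -c)
  have hne : ∀ ε ∈ Icc η₁ η, c ε ≠ S (c ε) := fun ε hε => (h.lt_right (hc.mem ε hε)).ne
  have hF : ∀ ε ∈ Icc η₁ η, ∀ t, D.FL f (c ε) (S (c ε)) ε t = D.tors f t - y ε (-t) :=
    fun ε hε t => FL_eq hD hf hE hη' (hsub ε hε) (hne ε hε) (hz ε) (hy0 ε) t
  have htail : ∀ ε ∈ Icc η₁ η, D.tailL f (c ε) (S (c ε)) ε =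
      -relaxTail T (y ε) (-c ε) := fun ε hε => by
    rw [tailL_eq hD hf hE hη' (hsub ε hε) (hne ε hε) (hz ε) (hy0 ε)]
    simp only [neg_neg]
    rfl
  have hT := hf.continuous_tors hD
  have hT' : Continuous T := hT.comp continuous_neg
  have hstart : ∀ ε ∈ Icc η₁ η, T (-c ε) ≤ y ε (-c ε) := fun ε hε => hch.start_le hc hε
  have hle : ∀ ε ∈ Icc η₁ η, D.tailL f (c ε) (S (c ε)) ε ≤ (c ε : EReal) := fun ε hε => by
    rw [htail ε hε]
    exact EReal.neg_le_of_neg_le (le_relaxTail (hstart ε hε))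
  have hlow : ∀ ε ∈ Icc η₁ η, ∀ v : ℝ, D.tailL f (c ε) (S (c ε)) ε ≤ v →
      ((-v : ℝ) : EReal) ≤ relaxTail T (y ε) (-c ε) := fun ε hε v hv => by
    rw [htail ε hε] at hv
    exact EReal.neg_le_of_neg_le hv
  have hlow' : ∀ ε ∈ Icc η₁ η, ∀ v : ℝ, D.tailL f (c ε) (S (c ε)) ε < v →
      ((-v : ℝ) : EReal) < relaxTail T (y ε) (-c ε) := fun ε hε v hv => by
    rw [htail ε hε] at hv
    exact EReal.neg_lt_comm.1 hv
  refine ⟨⟨(hE ⟨le_rfl, hη'⟩).1, hη, (hE ⟨hη.le, hη₃⟩).2⟩,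
    fun ε hε => ne_top_of_le_ne_top (EReal.coe_ne_top _) (hle ε hε), fun ε _ => EReal.coe_ne_bot _,
    fun ε hε ε' hε' h' => ?_, fun ε hε ε' hε' h' => ?_, hle, ?_, fun ε hε => ?_,
    fun ε hε v hv => ?_, fun ε ε' h1 h2 h3 v hv1 hv2 => ?_⟩
  · simp only [htail ε hε, htail ε' hε']
    exact EReal.neg_le_neg_iff.2 (hch.relaxTail_mono hq hc hε hε' h')
  · exact EReal.coe_le_coe_iff.2 (hc.mono.monotoneOn hε hε' h')
  · have hC : ContinuousOn (fun ε => relaxConst T (fun t ε => D.rateL η₁ η₃ (-t) ε) ε (-c ε)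
        (D.chordβ f (c ε) (S (c ε)))) (Icc η₁ η) :=
      hq.continuousOn_relaxConst hc.cont.neg (hch.contβ.comp hc.cont hc.mem)
    have hsol : ContinuousOn (fun x : ℝ × ℝ => y x.2 (-x.1))
        {x | x.2 ∈ Icc η₁ η ∧ x.1 ∈ eIcc (D.tailL f (c x.2) (S (c x.2)) x.2) (c x.2)} :=
      hq.continuousOn_relaxSol (e := fun x : ℝ × ℝ => x.2) (t := fun x => -x.1)
        continuous_snd.continuousOn
        (hC.comp continuous_snd.continuousOn fun x hx => hx.1) continuous_fst.neg.continuousOn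
    exact ((hT.comp continuous_fst).continuousOn.sub hsol).congr fun x hx => hF x.2 hx.1 x.1
  · have h1 := IsStdL.of_isRise (f := f) (p := D.tailL f (c ε) (S (c ε)) ε) (q := c ε) hD hE
      hη' (hsub ε hε) (hz ε) (EReal.coe_ne_top _)
      (fun t ht => by
        have := le_of_le_relaxTail hT' (hy ε).continuous (hstart ε hε)
          (neg_le_neg (EReal.coe_le_coe_iff.1 ht.2)) (hlow ε hε t ht.1)
        simpa only [hTdef, neg_neg] using this)
      fun t ht ht' => by
        have := lt_of_lt_relaxTail (neg_lt_neg (EReal.coe_lt_coe_iff.1 ht')) (hlow' ε hε t ht)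
        simpa only [hTdef, neg_neg] using this
    exact ⟨_, _, h1, fun u hu => by rw [h1.force_eq hD hu, hF ε hε]⟩
  · simp only [hF ε hε]
    have hv' : relaxTail T (y ε) (-c ε) = ((-v : ℝ) : EReal) := by
      rw [EReal.coe_neg, ← hv, htail ε hε, neg_neg]
    have := eq_of_relaxTail_eq hT' (hy ε).continuous (hstart ε hε) hv'
    simp only [hTdef, neg_neg] at this
    exact sub_eq_zero.2 this
  · have hε : ε ∈ Icc η₁ η := ⟨h1.le, (h2.trans h3).le⟩
    have hε' : ε' ∈ Icc η₁ η := ⟨(h1.trans h2).le, h3.le⟩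
    simp only [hF ε hε, hF ε' hε']
    exact sub_lt_sub_left (hch.tailSol_lt hq hc hε hε' h2
      (neg_le_neg (EReal.coe_lt_coe_iff.1 hv2).le) (hlow ε hε v hv1)) _

end CurveFamily

/-! ### Solutions around a multibirdie -/

lemma strictAntiOn_Ico_of_Ioo {φ : ℝ → ℝ} {a b : ℝ} (hc : ContinuousOn φ (Ico a b))
    (h : StrictAntiOn φ (Ioo a b)) : StrictAntiOn φ (Ico a b) := by
  intro x hx y hy hxy
  rcases hx.1.eq_or_lt with rfl | h'
  · obtain ⟨m, hm1, hm2⟩ := exists_between hxy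
    have hm : m ∈ Ioo a b := ⟨hm1, hm2.trans hy.2⟩
    refine (h hm ⟨hxy, hy.2⟩ hm2).trans_le ?_
    refine ContinuousWithinAt.closure_le (s := Ioo a m) ?_ continuousWithinAt_const
      ((hc a hx).mono fun t ht => ⟨ht.1.le, ht.2.trans hm.2⟩)
      fun t ht => (h ⟨ht.1, ht.2.trans hm.2⟩ hm ht.2).le
    rw [closure_Ioo hm1.ne]
    exact left_mem_Icc.2 hm1.le
  · exact h ⟨h', hx.2⟩ ⟨h'.trans hxy, hy.2⟩ hxy

/-- A chain of chords, together with a barrier `m` that separates, uniformly for small parameters,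
the last solution at the end of the last interval from the first solution at `x`. -/
lemma IsRelaxChain.exists_solutions {T : ℝ → ℝ} {q : ℝ → ℝ → ℝ} {k : ℕ} {l r : ℕ → ℝ} {b : ℝ}
    {c₀ c₁ : ℕ → ℝ} {A B β : ℕ → ℝ → ℝ} {η₁ η x : ℝ} {C : ℝ → ℝ}
    (h : IsRelaxChain T q k l r b c₀ c₁ A B β) (hk : 1 ≤ k) (hη : η₁ < η)
    (hb : IsBase T q (l 1) b η₁ η C) (hx : x < l 1)
    (hT : ∀ t ∈ Ioo x (l 1), T t < relaxSol T q η₁ (C η₁) t) :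
    ∃ η' ∈ Ioc η₁ η, ∃ Cs cs : ℕ → ℝ → ℝ, Cs 0 = C ∧
      (∀ i < k, IsBase T q (l (i + 1)) b η₁ η' (Cs i)) ∧
      (∀ i, 1 ≤ i → i < k → IsDescent (c₀ i) (c₁ i) η₁ η' (cs i) ∧
        (∀ ε ∈ Icc η₁ η', relaxSol T q ε (Cs (i - 1) ε) (A i (cs i ε)) = β i (cs i ε)) ∧
        Cs i = fun ε => relaxConst T q ε (B i (cs i ε)) (β i (cs i ε))) ∧
      ∃ m > b, ∀ m', b < m' → m' ≤ m → ∃ η'' > η₁, ∀ ε ∈ Icc η₁ η'', ε ≤ η' →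
        relaxSol T q ε (Cs (k - 1) ε) (r k) < m' ∧ m' < relaxSol T q ε (Cs 0 ε) x := by
  obtain ⟨η', hη', Cs, cs, h0, h1, h2⟩ := h.exists_chain hη hb (k - 1) (by omega)
  have hbx : b < relaxSol T q η₁ (C η₁) x := by
    rw [← hb.init]
    exact h.coeff.strictAntiOn (h.coeff.isRelax_relaxSol _ _) hT (left_mem_Icc.2 hx.le)
      (right_mem_Icc.2 hx.le) hx
  obtain ⟨m, hm1, hm2⟩ := exists_between hbx
  refine ⟨η', hη', Cs, cs, h0, fun i hi => h1 i (by omega), fun i hi hik => h2 i hi (by omega),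
    m, hm1, fun m' hm' hmm => ?_⟩
  have hbase := h1 (k - 1) le_rfl
  rw [Nat.sub_add_cancel hk] at hbase
  have hlast := h.isBase_right hk le_rfl hη'.1.le hbase
  have hmem : η₁ ∈ Icc η₁ η' := left_mem_Icc.2 hη'.1.le
  have hcont : ∀ {C' : ℝ → ℝ} (t : ℝ), ContinuousOn C' (Icc η₁ η') →
      ContinuousWithinAt (fun ε => relaxSol T q ε (C' ε) t) (Icc η₁ η') η₁ := fun t hC =>
    h.coeff.continuousOn_relaxSol continuousOn_id hC continuousOn_const η₁ hmem
  have e1 := (hcont (r k) hlast.cont).eventually_lt_const (hlast.init.trans_lt hm')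
  have e2 := (hcont x (h1 0 (by omega)).cont).eventually_const_lt
    (show m' < relaxSol T q η₁ (Cs 0 η₁) x by rw [h0]; exact hmm.trans_lt hm2)
  have e3 := e1.and e2
  rw [nhdsWithin_Icc_eq_nhdsGE hη'.1] at e3
  obtain ⟨η'', hη'', hsub⟩ := (mem_nhdsGE_iff_exists_Icc_subset).1 e3
  exact ⟨η'', hη'', fun ε hε _ => hsub hε⟩

namespace CurveFamily

variable {D : CurveFamily} {f : ℝ → ℝ} {η₁ η₃ ε t a b : ℝ} {k : ℕ} {l r : ℕ → ℝ} {p : ℕ → ℝ}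
  {s : ℕ → ℝ → ℝ} {uRm uRp uLm uLp um up : ℝ → EReal} {F 𝔉R 𝔉L : ℝ → ℝ → ℝ} {y : ℝ → ℝ}

/-- The relaxation through the values of a right flow is the generator of its candidates. -/
lemma IsRightFlow.exists_eqOn (hD : D.IsAdmissible) (hf : D.IsRegular f)
    (hE : Icc η₁ η₃ ⊆ D.posParams) (h : D.IsRightFlow f η₁ η₃ um up F) (hε : ε ∈ Icc η₁ η₃)
    (hy : IsRelax (D.tors f) (fun t => D.rateR η₁ η₃ t ε) y) (ha : a ∈ eIcc (um ε) (up ε))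
    (hya : y a = D.tors f a - F a ε) :
    ∃ β β', D.IsStdR f ε (um ε) (up ε) β β' ∧ EqOn β y (eIcc (um ε) (up ε)) ∧
      ∀ u ∈ eIcc (um ε) (up ε), F u ε = D.force (fun τ => D.κR τ ε) β' u ∧
        F u ε = D.tors f u - y u := by
  obtain ⟨β, β', h1, h2⟩ := h.isForce ε hε
  have h3 : ∀ u ∈ eIcc (um ε) (up ε), F u ε = D.tors f u - β u := fun u hu => by
    rw [h2 u hu, h1.force_eq hD hu]
  have heq := h1.eqOn hD hf hE (hε.1.trans hε.2) hε hy ha (by rw [hya, h3 a ha, sub_sub_cancel])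
  exact ⟨β, β', h1, heq, fun u hu => ⟨h2 u hu, by rw [h3 u hu, heq hu]⟩⟩

lemma IsLeftFlow.exists_eqOn (hD : D.IsAdmissible) (hf : D.IsRegular f)
    (hE : Icc η₁ η₃ ⊆ D.posParams) (h : D.IsLeftFlow f η₁ η₃ um up F) (hε : ε ∈ Icc η₁ η₃)
    (hy : IsRise (D.tors f) (fun t => D.rateL η₁ η₃ t ε) y) (ha : a ∈ eIcc (um ε) (up ε))
    (hya : y a = D.tors f a - F a ε) :
    ∃ β β', D.IsStdL f ε (um ε) (up ε) β β' ∧ EqOn β y (eIcc (um ε) (up ε)) ∧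
      ∀ u ∈ eIcc (um ε) (up ε), F u ε = D.force (fun τ => D.κL τ ε) β' u ∧
        F u ε = D.tors f u - y u := by
  obtain ⟨β, β', h1, h2⟩ := h.isForce ε hε
  have h3 : ∀ u ∈ eIcc (um ε) (up ε), F u ε = D.tors f u - β u := fun u hu => by
    rw [h2 u hu, h1.force_eq hD hu]
  have heq := h1.eqOn hD hf hE (hε.1.trans hε.2) hε hy ha (by rw [hya, h3 a ha, sub_sub_cancel])
  exact ⟨β, β', h1, heq, fun u hu => ⟨h2 u hu, by rw [h3 u hu, heq hu]⟩⟩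

/-- A multibirdie with flows on both sides and chordal domains under it, such that `b` is the
derivative in `x₂` of the affine candidate on it, and the flows start with the value `b`. -/
structure IsBirdieSystem (D : CurveFamily) (f : ℝ → ℝ) (η₁ η₃ : ℝ) (k : ℕ) (l r : ℕ → ℝ) (b : ℝ)
    (p : ℕ → ℝ) (s : ℕ → ℝ → ℝ) (uRm uRp uLm uLp : ℝ → EReal) (𝔉R 𝔉L : ℝ → ℝ → ℝ) : Prop where
  lt : η₁ < η₃
  sub : Icc η₁ η₃ ⊆ D.posParams
  bird : D.IsMultibirdie k l r η₁
  right : D.IsRightFlow f η₁ η₃ uRm uRp 𝔉R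
  left : D.IsLeftFlow f η₁ η₃ uLm uLp 𝔉L
  hl : uRm η₁ < (l 1 : EReal) ∧ (l 1 : EReal) ≤ uRp η₁
  hr : uLm η₁ ≤ (r k : EReal) ∧ (r k : EReal) < uLp η₁
  top : ∀ i, 1 ≤ i → i < k → s i (r i) = l (i + 1)
  chordal : ∀ i, 1 ≤ i → i < k → D.IsChordal f (r i) (p i) (s i)
  flat : ∀ i, 1 ≤ i → i ≤ k → ∀ t ∈ Icc (l i) (r i), l i < r i → D.tors f t = b
  topβ : ∀ i, 1 ≤ i → i < k → D.chordβ f (r i) (l (i + 1)) = b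
  startR : 𝔉R (l 1) η₁ = D.tors f (l 1) - b
  startL : 𝔉L (r k) η₁ = D.tors f (r k) - b

namespace IsBirdieSystem

lemma disjoint
    (h : D.IsBirdieSystem f η₁ η₃ k l r b p s uRm uRp uLm uLp 𝔉R 𝔉L) {i : ℕ} (hi : 1 ≤ i)
    (hik : i < k) :
    Disjoint (segment ℝ (D.g (r i)) (D.g (s i (r i)))) (D.Xi η₁) := by
  rw [h.top i hi hik]
  exact h.bird.chord i hi hik

lemma mem_right
    (h : D.IsBirdieSystem f η₁ η₃ k l r b p s uRm uRp uLm uLp 𝔉R 𝔉L) (hε : ε ∈ Icc η₁ η₃) :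
    uRm ε < l 1 ∧ (l 1 : EReal) ≤ uRp ε :=
  have h₁ : η₁ ∈ Icc η₁ η₃ := left_mem_Icc.2 h.lt.le
  ⟨(h.right.um_anti h₁ hε hε.1).trans_lt h.hl.1, h.hl.2.trans (h.right.up_mono h₁ hε hε.1)⟩

lemma mem_left
    (h : D.IsBirdieSystem f η₁ η₃ k l r b p s uRm uRp uLm uLp 𝔉R 𝔉L) (hε : ε ∈ Icc η₁ η₃) :
    uLm ε ≤ r k ∧ (r k : EReal) < uLp ε :=
  have h₁ : η₁ ∈ Icc η₁ η₃ := left_mem_Icc.2 h.lt.le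
  ⟨(h.left.um_anti h₁ hε hε.1).trans h.hr.1, h.hr.2.trans_le (h.left.up_mono h₁ hε hε.1)⟩

lemma tors_le (hD : D.IsAdmissible) (hf : D.IsRegular f)
    (h : D.IsBirdieSystem f η₁ η₃ k l r b p s uRm uRp uLm uLp 𝔉R 𝔉L) (i : ℕ) (hi : 1 ≤ i)
    (hik : i ≤ k) (t : ℝ) (ht : t ∈ Icc (l i) (r i)) :
    D.tors f t ≤ b := by
  rcases (h.bird.le i hi hik).eq_or_lt with e | e
  · rcases hik.lt_or_eq with hlt | rfl
    · obtain rfl : t = r i := le_antisymm ht.2 (e ▸ ht.1)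
      have := (h.chordal i hi hlt).tors_left_le hD hf
      rwa [h.top i hi hlt, h.topβ i hi hlt] at this
    · rcases h.bird.nontrivial with h2 | h2
      · obtain rfl : t = l i := le_antisymm (e ▸ ht.2) ht.1
        have h3 : 1 ≤ i - 1 := by omega
        have h4 : i - 1 < i := by omega
        have := (h.chordal (i - 1) h3 h4).tors_right_le hD hf
        rwa [h.top _ h3 h4, h.topβ _ h3 h4, Nat.sub_add_cancel hi] at this
      · rcases hi.eq_or_lt with rfl | h3
        · exact absurd e h2.ne
        · obtain rfl : t = l i := le_antisymm (e ▸ ht.2) ht.1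
          have h3 : 1 ≤ i - 1 := by omega
          have h4 : i - 1 < i := by omega
          have := (h.chordal (i - 1) h3 h4).tors_right_le hD hf
          rwa [h.top _ h3 h4, h.topβ _ h3 h4, Nat.sub_add_cancel hi] at this
  · exact (h.flat i hi hik t ht e).le

lemma chainR (hD : D.IsAdmissible) (hf : D.IsRegular f)
    (h : D.IsBirdieSystem f η₁ η₃ k l r b p s uRm uRp uLm uLp 𝔉R 𝔉L) :
    IsRelaxChain (D.tors f) (D.rateR η₁ η₃) k l r b r p (fun _ c => c) s
      fun i c => D.chordβ f c (s i c) where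
  coeff := hD.relaxCoeff_rateR hf h.sub h.lt.le
  le := h.bird.le
  flat := h.flat
  chord := fun i hi hik => (h.chordal i hi hik).isRelaxChord_right hD hf h.sub h.lt.le
    (h.disjoint hi hik)
  topA := fun _ _ _ => rfl
  topB := h.top
  topβ := fun i hi hik => by rw [h.top i hi hik, h.topβ i hi hik]

/-- Reflection of the line turns the left flows into right flows and reverses the order of the
intervals and of the chords. -/
lemma chainL (hD : D.IsAdmissible) (hf : D.IsRegular f)
    (h : D.IsBirdieSystem f η₁ η₃ k l r b p s uRm uRp uLm uLp 𝔉R 𝔉L) :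
    IsRelaxChain (fun t => D.tors f (-t)) (fun t ε => D.rateL η₁ η₃ (-t) ε) k
    (fun i => -r (k + 1 - i)) (fun i => -l (k + 1 - i)) b (fun i => r (k - i)) (fun i => p (k - i))
    (fun i c => -s (k - i) c) (fun _ c => -c) fun i c => D.chordβ f c (s (k - i) c) where
  coeff := hD.relaxCoeff_rateL hf h.sub h.lt.le
  le := fun i hi hik => neg_le_neg (h.bird.le _ (by omega) (by omega))
  flat := fun i hi hik t ht hlt => h.flat (k + 1 - i) (by omega) (by omega) (-t)
    ⟨by linarith [ht.2], by linarith [ht.1]⟩ (neg_lt_neg_iff.1 hlt)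
  chord := fun i hi hik => (h.chordal (k - i) (by omega) (by omega)).isRelaxChord_left hD hf h.sub
    h.lt.le (h.disjoint (by omega) (by omega))
  topA := fun i hi hik => by
    rw [h.top (k - i) (by omega) (by omega), show k + 1 - i = k - i + 1 by omega]
  topB := fun i hi hik => by rw [show k + 1 - (i + 1) = k - i by omega]
  topβ := fun i hi hik => by
    rw [h.top (k - i) (by omega) (by omega), h.topβ (k - i) (by omega) (by omega)]

/-- The values of the right flow at `l 1` are the initial values of the first right solutions. -/
lemma baseR (hD : D.IsAdmissible) (hf : D.IsRegular f)
    (h : D.IsBirdieSystem f η₁ η₃ k l r b p s uRm uRp uLm uLp 𝔉R 𝔉L) {η : ℝ} (hη : η < η₃) :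
    IsBase (D.tors f) (D.rateR η₁ η₃) (l 1) b η₁ η
    fun ε => relaxConst (D.tors f) (D.rateR η₁ η₃) ε (l 1) (D.tors f (l 1) - 𝔉R (l 1) ε) := by
  have hc : ContinuousOn (fun ε => 𝔉R (l 1) ε) (Icc η₁ η₃) :=
    h.right.cont.comp (f := fun ε : ℝ => (l 1, ε)) (by fun_prop)
      fun ε hε => ⟨hε, (h.mem_right hε).1.le, (h.mem_right hε).2⟩
  have hsub : Icc η₁ η ⊆ Ico η₁ η₃ := Icc_subset_Ico_right hη
  have hanti : StrictAntiOn (fun ε => 𝔉R (l 1) ε) (Ico η₁ η₃) :=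
    strictAntiOn_Ico_of_Ioo (hc.mono Ico_subset_Icc_self) fun ε hε ε' hε' hlt =>
      h.right.mono ε ε' hε.1 hlt hε'.2 _ (h.mem_right (Ioo_subset_Icc_self hε)).1
        (h.mem_right (Ioo_subset_Icc_self hε)).2
  refine ⟨(hD.relaxCoeff_rateR hf h.sub h.lt.le).continuousOn_relaxConst continuousOn_const
    (continuousOn_const.sub (hc.mono (hsub.trans Ico_subset_Icc_self))), ?_, ?_⟩
  · simp only [relaxSol_relaxConst]
    exact fun ε hε ε' hε' hlt => sub_lt_sub_left (hanti (hsub hε) (hsub hε') hlt) _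
  · rw [relaxSol_relaxConst, h.startR, sub_sub_cancel]

/-- The values of the left flow at `r k` are the initial values of the last left solutions. -/
lemma baseL (hD : D.IsAdmissible) (hf : D.IsRegular f)
    (h : D.IsBirdieSystem f η₁ η₃ k l r b p s uRm uRp uLm uLp 𝔉R 𝔉L) {η : ℝ} (hη : η < η₃) :
    IsBase (fun t => D.tors f (-t))
    (fun t ε => D.rateL η₁ η₃ (-t) ε) (-r k) b η₁ η fun ε => relaxConst (fun t => D.tors f (-t))
      (fun t ε => D.rateL η₁ η₃ (-t) ε) ε (-r k) (D.tors f (r k) - 𝔉L (r k) ε) := by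
  have hc : ContinuousOn (fun ε => 𝔉L (r k) ε) (Icc η₁ η₃) :=
    h.left.cont.comp (f := fun ε : ℝ => (r k, ε)) (by fun_prop)
      fun ε hε => ⟨hε, (h.mem_left hε).1, (h.mem_left hε).2.le⟩
  have hsub : Icc η₁ η ⊆ Ico η₁ η₃ := Icc_subset_Ico_right hη
  have hanti : StrictAntiOn (fun ε => 𝔉L (r k) ε) (Ico η₁ η₃) :=
    strictAntiOn_Ico_of_Ioo (hc.mono Ico_subset_Icc_self) fun ε hε ε' hε' hlt =>
      h.left.mono ε ε' hε.1 hlt hε'.2 _ (h.mem_left (Ioo_subset_Icc_self hε)).1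
        (h.mem_left (Ioo_subset_Icc_self hε)).2
  refine ⟨(hD.relaxCoeff_rateL hf h.sub h.lt.le).continuousOn_relaxConst continuousOn_const
    (continuousOn_const.sub (hc.mono (hsub.trans Ico_subset_Icc_self))), ?_, ?_⟩
  · simp only [relaxSol_relaxConst]
    exact fun ε hε ε' hε' hlt => sub_lt_sub_left (hanti (hsub hε) (hsub hε') hlt) _
  · rw [relaxSol_relaxConst, h.startL, sub_sub_cancel]

/-- For all slightly larger indices the solutions and the chords form a balance system. -/
theorem exists_balanceSystem (hD : D.IsAdmissible) (hf : D.IsRegular f)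
    (h : D.IsBirdieSystem f η₁ η₃ k l r b p s uRm uRp uLm uLp 𝔉R 𝔉L) :
    ∃ η₂ ∈ Ioo η₁ η₃, ∃ (cR cL : ℕ → ℝ → ℝ) (Y Z : ℕ → ℝ → ℝ → ℝ) (x y : ℝ),
    uRm η₁ < x ∧ (y : EReal) < uLp η₁ ∧
    (∀ i, 1 ≤ i → i < k → IsDescent (r i) (p i) η₁ η₂ (cR i) ∧
      IsDescent (r i) (p i) η₁ η₂ (cL i)) ∧
    ∀ ε ∈ Ioc η₁ η₂, Y 0 ε (l 1) = D.tors f (l 1) - 𝔉R (l 1) ε ∧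
      Z k ε (r k) = D.tors f (r k) - 𝔉L (r k) ε ∧
      IsBalanceSystem (D.tors f) (fun t => D.rateR η₁ η₃ t ε) (fun t => D.rateL η₁ η₃ t ε) k l r
        r p (fun _ c => c) s (fun i c => D.chordβ f c (s i c)) (fun i => Y i ε) (fun i => Z i ε)
        (fun i => cR i ε) (fun i => cL i ε) x y := by
  obtain ⟨η, hη1, hη2⟩ := exists_between h.lt
  have hk := h.bird.one_le
  have hchR := h.chainR hD hf
  have hchL := h.chainL hD hf
  have hbR := h.baseR hD hf hη2
  have hbL := h.baseL hD hf hη2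
  have h₁ : η₁ ∈ Icc η₁ η₃ := left_mem_Icc.2 h.lt.le
  have hE := h.sub
  -- right of the left end of the right flow its solution is above `tors`
  have hRlt : ∀ ε ∈ Icc η₁ η₃, ∀ y, IsRelax (D.tors f) (fun t => D.rateR η₁ η₃ t ε) y →
      y (l 1) = D.tors f (l 1) - 𝔉R (l 1) ε → ∀ t : ℝ, uRm ε < t → t < l 1 → D.tors f t < y t :=
    fun ε hε y hy hyl t ht ht' => by
      have hm := h.mem_right hε
      have hlt : (t : EReal) < uRp ε := (EReal.coe_lt_coe_iff.2 ht').trans_le hm.2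
      obtain ⟨β, β', h1, h2, -⟩ := h.right.exists_eqOn hD hf hE hε hy
        (show l 1 ∈ eIcc _ _ from ⟨hm.1.le, hm.2⟩) hyl
      rw [← h2 (show t ∈ eIcc _ _ from ⟨ht.le, hlt.le⟩)]
      exact h1.tors_lt hD (hE hε) ht hlt
  have hLlt : ∀ ε ∈ Icc η₁ η₃, ∀ z, IsRise (D.tors f) (fun t => D.rateL η₁ η₃ t ε) z →
      z (r k) = D.tors f (r k) - 𝔉L (r k) ε → ∀ t : ℝ, r k < t → (t : EReal) < uLp ε →
        D.tors f t < z t :=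
    fun ε hε z hz hzr t ht ht' => by
      have hm := h.mem_left hε
      have hlt : uLm ε < (t : EReal) := hm.1.trans_lt (EReal.coe_lt_coe_iff.2 ht)
      obtain ⟨β, β', h1, h2, -⟩ := h.left.exists_eqOn hD hf hE hε hz
        (show r k ∈ eIcc _ _ from ⟨hm.1, hm.2.le⟩) hzr
      rw [← h2 (show t ∈ eIcc _ _ from ⟨hlt.le, ht'.le⟩)]
      exact h1.tors_lt hD (hE hε) hlt ht'
  obtain ⟨x, hx1, hx2⟩ := EReal.lt_iff_exists_real_btwn.1 h.hl.1
  obtain ⟨y, hy1, hy2⟩ := EReal.lt_iff_exists_real_btwn.1 h.hr.2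
  replace hx2 := EReal.coe_lt_coe_iff.1 hx2
  replace hy1 := EReal.coe_lt_coe_iff.1 hy1
  obtain ⟨ηR, hηR, CR, cR, hR0, hRb, hRc, mR, hmR, hRm⟩ := hchR.exists_solutions hk hη1 hbR hx2
    fun t ht => hRlt η₁ h₁ _ (hchR.coeff.isRelax_relaxSol _ _) (relaxSol_relaxConst ..) t
      (hx1.trans (EReal.coe_lt_coe_iff.2 ht.1)) ht.2
  obtain ⟨ηL, hηL, CL, cL, hL0, hLb, hLc, mL, hmL, hLm⟩ := hchL.exists_solutions (x := -y) hk hη1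
    (by simpa only [Nat.add_sub_cancel] using hbL)
    (by simpa only [Nat.add_sub_cancel] using neg_lt_neg hy1) fun t ht => by
    have := hLlt η₁ h₁ _ (hchL.coeff.isRelax_relaxSol η₁ _).isRise
      (by rw [relaxSol_relaxConst]) (-t)
      (by simp only [Nat.add_sub_cancel] at ht; linarith [ht.2])
      ((EReal.coe_lt_coe_iff.2 (by linarith [ht.1])).trans hy2)
    simpa only [neg_neg] using this
  obtain ⟨ηR', hηR', hR'⟩ := hRm (min mR mL) (lt_min hmR hmL) (min_le_left _ _)
  obtain ⟨ηL', hηL', hL'⟩ := hLm (min mR mL) (lt_min hmR hmL) (min_le_right _ _)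
  simp only [Nat.add_sub_cancel_left] at hL'
  set η₂ := min (min ηR ηL) (min ηR' ηL') with hη₂
  have e1 : η₂ ≤ ηR := (min_le_left _ _).trans (min_le_left _ _)
  have e2 : η₂ ≤ ηL := (min_le_left _ _).trans (min_le_right _ _)
  have e3 : η₂ ≤ ηR' := (min_le_right _ _).trans (min_le_left _ _)
  have e4 : η₂ ≤ ηL' := (min_le_right _ _).trans (min_le_right _ _)
  refine ⟨η₂, ⟨lt_min (lt_min hηR.1 hηL.1) (lt_min hηR' hηL'), (e1.trans hηR.2).trans_lt hη2⟩,
    cR, fun i => cL (k - i), fun i ε => relaxSol (D.tors f) (D.rateR η₁ η₃) ε (CR i ε),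
    fun i ε t => relaxSol (fun t => D.tors f (-t)) (fun t ε => D.rateL η₁ η₃ (-t) ε) ε
      (CL (k - i) ε) (-t), x, y, hx1, hy2, fun i hi hik => ?_, fun ε hε => ?_⟩
  · have := (hLc (k - i) (by omega) (by omega)).1
    rw [show k - (k - i) = i by omega] at this
    exact ⟨(hRc i hi hik).1.mono_right e1, this.mono_right e2⟩
  have hε3 : ε ∈ Icc η₁ η₃ := ⟨hε.1.le, (hε.2.trans (e1.trans hηR.2)).trans hη2.le⟩
  obtain ⟨R1, R2, R3, R4, R5, R6⟩ := hchR.pointwise (η := ηR) ⟨hε.1, hε.2.trans e1⟩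
    (h.tors_le hD hf) hRb hRc
  obtain ⟨L1, L2, L3, L4, L5, L6⟩ := hchL.pointwise (η := ηL) ⟨hε.1, hε.2.trans e2⟩
    (fun i hi hik t ht => h.tors_le hD hf (k + 1 - i) (by omega) (by omega) (-t)
      ⟨by linarith [ht.2], by linarith [ht.1]⟩) hLb hLc
  have hεR : ε ∈ Icc η₁ ηR := ⟨hε.1.le, hε.2.trans e1⟩
  have hεL : ε ∈ Icc η₁ ηL := ⟨hε.1.le, hε.2.trans e2⟩
  have hY0 : relaxSol (D.tors f) (D.rateR η₁ η₃) ε (CR 0 ε) (l 1) =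
      D.tors f (l 1) - 𝔉R (l 1) ε := by
    rw [hR0]
    exact relaxSol_relaxConst ..
  have hZk : relaxSol (fun t => D.tors f (-t)) (fun t ε => D.rateL η₁ η₃ (-t) ε) ε
      (CL (k - k) ε) (-r k) = D.tors f (r k) - 𝔉L (r k) ε := by
    rw [Nat.sub_self, hL0]
    exact relaxSol_relaxConst ..
  have hrelax : ∀ i, IsRelax (D.tors f) (fun t => D.rateR η₁ η₃ t ε)
    (relaxSol (D.tors f) (D.rateR η₁ η₃) ε (CR i ε)) := fun i => hchR.coeff.isRelax_relaxSol _ _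
  have hrise : ∀ i, IsRise (D.tors f) (fun t => D.rateL η₁ η₃ t ε) fun t =>
      relaxSol (fun t => D.tors f (-t)) (fun t ε => D.rateL η₁ η₃ (-t) ε) ε (CL (k - i) ε) (-t) :=
    fun i => (hchL.coeff.isRelax_relaxSol ε (CL (k - i) ε)).isRise
  have e5 : ∀ i, 1 ≤ i → i < k → k - (k - i) = i := fun i _ _ => by omega
  have e6 : ∀ i, k - i - 1 = k - (i + 1) := fun i => by omega
  have hmidZ : ∀ i, 1 ≤ i → i ≤ k → ∀ t ∈ Icc (l i) (r i), D.tors f t <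
      relaxSol (fun t => D.tors f (-t)) (fun t ε => D.rateL η₁ η₃ (-t) ε) ε (CL (k - i) ε) (-t) :=
    fun i hi hik t ht => by
    have := L4 (k + 1 - i) (by omega) (by omega) (-t)
    simp only [show k + 1 - (k + 1 - i) = i by omega, show k + 1 - i - 1 = k - i by omega,
      neg_neg] at this
    exact this ⟨neg_le_neg ht.2, neg_le_neg ht.1⟩
  refine ⟨hY0, hZk, ?_⟩
  constructor
  case qR_pos => exact fun t => rateR_pos hD hE h.lt.le t ε
  case qL_pos => exact fun t => rateL_pos hD hE h.lt.le t ε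
  case le => exact h.bird.le
  case topA => exact hchR.topA
  case topB => exact h.top
  case monoA => exact fun i hi hik => (hchR.chord i hi hik).monoA
  case antiB => exact fun i hi hik => (hchR.chord i hi hik).antiB
  case memR => exact fun i hi hik => (hRc i hi hik).1.mem ε hεR
  case memL =>
    intro i hi hik
    have := (hLc (k - i) (by omega) (by omega)).1.mem ε hεL
    rwa [e5 i hi hik] at this
  case relax => exact fun i _ => hrelax i
  case rise => exact fun i _ _ => hrise i
  case YA => exact fun i hi hik => (hRc i hi hik).2.1 ε hεR
  case YB => exact R1
  case ZA =>
    intro i hi hik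
    have := L1 (k - i) (by omega) (by omega)
    rwa [e5 i hi hik] at this
  case ZB =>
    intro i hi hik
    have := (hLc (k - i) (by omega) (by omega)).2.1 ε hεL
    rwa [e5 i hi hik, e6] at this
  case signY => exact R2
  case signZA =>
    intro i hi hik
    have := L3 (k - i) (by omega) (by omega)
    rwa [e5 i hi hik] at this
  case signZB =>
    intro i hi hik
    have := L2 (k - i) (by omega) (by omega)
    rwa [e5 i hi hik, e6] at this
  case signYB => exact R3
  case midY => exact R4
  case midZ => exact hmidZ
  case rightY => exact R5
  case leftY => exact R6
  case rightZ =>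
    intro i hi hik t ht
    have := L6 (k - i) (by omega) (by omega) (-t)
    rw [show k + 1 - (k - i + 1) = i by omega] at this
    simpa only [neg_neg] using this ⟨neg_le_neg ht.2, neg_le_neg ht.1⟩
  case leftZ =>
    intro i hi hik t ht
    have := L5 (k - i) (by omega) (by omega) (-t)
    rw [e5 i hi hik, e6, show k + 1 - (k - i) = i + 1 by omega] at this
    simpa only [neg_neg] using this ⟨neg_le_neg ht.2, neg_le_neg ht.1⟩
  case one_le => exact hk
  case x_lt => exact hx2
  case lt_y => exact hy1
  case endY =>
    intro t ht
    rcases ht.2.eq_or_lt with rfl | h'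
    · exact R4 1 le_rfl hk _ (left_mem_Icc.2 (h.bird.le 1 le_rfl hk))
    · exact hRlt ε hε3 _ (hrelax 0) hY0 t (((h.right.um_anti h₁ hε3 hε3.1).trans_lt hx1).trans_le
        (EReal.coe_le_coe_iff.2 ht.1)) h'
  case endZ =>
    intro t ht
    rcases ht.1.eq_or_lt with rfl | h'
    · exact hmidZ k hk le_rfl _ (right_mem_Icc.2 (h.bird.le k hk le_rfl))
    · exact hLlt ε hε3 _ (hrise k) hZk t h' ((EReal.coe_le_coe_iff.2 ht.2).trans_lt
        (hy2.trans_le (h.left.up_mono h₁ hε3 hε3.1)))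
  case endx =>
    exact (hL' ε ⟨hε.1.le, hε.2.trans e4⟩ hεL.2).1.trans
      (hR' ε ⟨hε.1.le, hε.2.trans e3⟩ hεR.2).2
  case endy =>
    have := (hR' ε ⟨hε.1.le, hε.2.trans e3⟩ hεR.2).1.trans
      (hL' ε ⟨hε.1.le, hε.2.trans e4⟩ hεL.2).2
    simpa only [Nat.sub_self] using this

end IsBirdieSystem

end CurveFamily

namespace CurveFamily

variable {D : CurveFamily} {f : ℝ → ℝ} {η₁ η₃ ε t a b : ℝ} {k : ℕ} {l r : ℕ → ℝ} {p : ℕ → ℝ}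
  {s : ℕ → ℝ → ℝ} {uRm uRp uLm uLp : ℝ → EReal} {𝔉R 𝔉L : ℝ → ℝ → ℝ} {B : ℝ × ℝ → ℝ} {x : ℝ × ℝ}

/-! ### The affine candidate on a multibirdie -/

/-- The affine function whose graph is the plane through `γ(a)` spanned by `γ'(a)` and `γ'(b)`. -/
def chordVal (D : CurveFamily) (f : ℝ → ℝ) (a b : ℝ) (x : ℝ × ℝ) : ℝ :=
  f a + D.chordα f a b * (x.1 - D.g₁ a) + D.chordβ f a b * (x.2 - D.g₂ a)

lemma linEq_iff (hD : D.IsAdmissible) (hab : a ≠ b) {y : ℝ} :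
    D.LinEq f a b x y ↔ y = D.chordVal f a b x := by
  have h1 := (hD.deriv_g₁_pos a).ne'
  have h2 := (hD.deriv_g₁_pos b).ne'
  have h3 := hD.κ₂_sub_ne hab
  have hβ := hD.chordβ_mul (f := f) hab
  have key : Matrix.det !![deriv D.g₁ a, deriv D.g₂ a, deriv f a;
      deriv D.g₁ b, deriv D.g₂ b, deriv f b;
      x.1 - D.g₁ a, x.2 - D.g₂ a, y - f a] =
      deriv D.g₁ a * deriv D.g₁ b * (D.κ₂ b - D.κ₂ a) * (y - D.chordVal f a b x) := by
    rw [Matrix.det_fin_three]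
    simp only [Matrix.of_apply, Matrix.cons_val', Matrix.cons_val_zero, Matrix.cons_val_one,
      Matrix.cons_val_fin_one, Matrix.cons_val, chordVal, chordα]
    rw [hD.deriv_g₂ a, hD.deriv_g₂ b, IsRegular.deriv_eq (f := f) hD a,
      IsRegular.deriv_eq (f := f) hD b]
    linear_combination (deriv D.g₁ a * deriv D.g₁ b * ((x.2 - D.g₂ a) - D.κ₂ a * (x.1 - D.g₁ a)))
      * hβ
  rw [LinEq, key, mul_eq_zero, or_iff_right (mul_ne_zero (mul_ne_zero h1 h2) h3), sub_eq_zero]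

namespace IsMultibirdie

variable {i j : ℕ}

lemma r_lt_l (h : D.IsMultibirdie k l r ε) (hi : 1 ≤ i) (hij : i < j) (hjk : j ≤ k) :
    r i < l j := by
  induction j, hij using Nat.le_induction with
  | base => exact h.lt i hi (by omega)
  | succ j hij ih =>
    exact ((ih (by omega)).trans_le (h.le j (by omega) (by omega))).trans (h.lt j (by omega)
      (by omega))

lemma l_one_lt (h : D.IsMultibirdie k l r ε) : l 1 < r k := by
  rcases h.one_le.eq_or_lt with rfl | hk
  · exact h.nontrivial.resolve_left (by omega)
  · exact (h.le 1 le_rfl h.one_le).trans_lt ((h.r_lt_l le_rfl hk le_rfl).trans_le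
      (h.le k h.one_le le_rfl))

lemma l_one_le (h : D.IsMultibirdie k l r ε) (hj : 1 ≤ j) (hjk : j ≤ k) : l 1 ≤ l j := by
  rcases hj.eq_or_lt with rfl | h'
  · exact le_rfl
  · exact (h.le 1 le_rfl h.one_le).trans (h.r_lt_l le_rfl h' hjk).le

lemma le_r_last (h : D.IsMultibirdie k l r ε) (hj : 1 ≤ j) (hjk : j ≤ k) : r j ≤ r k := by
  rcases hjk.eq_or_lt with rfl | h'
  · exact le_rfl
  · exact (h.r_lt_l hj h' le_rfl).le.trans (h.le k h.one_le le_rfl)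

lemma g_mem (hD : D.IsAdmissible) (h : D.IsMultibirdie k l r ε) (hj : 1 ≤ j) (hjk : j ≤ k)
    (ht : t ∈ Icc (l j) (r j)) : D.g t ∈ D.OmMbird k l r ε := by
  refine ⟨⟨mem_biUnion (x := t) ?_ (left_mem_segment _ _ _),
    mem_biUnion (x := t) ?_ (left_mem_segment _ _ _)⟩, fun i hi hik => mem_aboveChord.2 ?_⟩
  · exact ⟨EReal.coe_le_coe_iff.2 ((h.l_one_le hj hjk).trans ht.1), le_top⟩
  · exact ⟨bot_le, EReal.coe_le_coe_iff.2 (ht.2.trans (h.le_r_last hj hjk))⟩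
  · have hlt := h.lt i hi hik
    rcases Nat.lt_or_ge i j with hij | hij
    · have h1 : l (i + 1) ≤ t := by
        rcases (Nat.succ_le_of_lt hij).eq_or_lt with e | h'
        · rw [← e] at ht
          exact ht.1
        · exact (h.le (i + 1) (by omega) hik).trans ((h.r_lt_l (by omega) h' hjk).le.trans ht.1)
      rcases h1.eq_or_lt with rfl | h1
      · exact (hD.chordHgt_right hlt).ge
      · exact (hD.chordHgt_g_pos_right hlt h1).le
    · have h1 : t ≤ r i := by
        rcases hij.eq_or_lt with rfl | h'
        · exact ht.2
        · exact ht.2.trans ((h.r_lt_l hj h' hik.le).le.trans (h.le i hi hik.le))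
      rcases h1.eq_or_lt with rfl | h1
      · exact (IsAdmissible.chordHgt_left D _ _).ge
      · exact (hD.chordHgt_g_pos_left hlt h1).le

lemma wR_mem (hD : D.IsAdmissible) (hε : ε ∈ D.posParams) (h : D.IsMultibirdie k l r ε) :
    D.wR (l 1) ε ∈ D.OmMbird k l r ε := by
  obtain ⟨t', ht', hw⟩ := hD.exists_wL_eq_wR hε (l 1)
  refine ⟨⟨mem_biUnion (x := l 1) ⟨le_rfl, le_top⟩ (right_mem_segment _ _ _),
    mem_biUnion (x := t') ⟨bot_le, EReal.coe_le_coe_iff.2 (ht'.trans h.l_one_lt).le⟩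
      (hw ▸ right_mem_segment _ _ _)⟩,
    fun i hi hik =>
      mem_aboveChord.2 (hD.chordHgt_pt_nonneg hε (h.lt i hi hik) (h.chord i hi hik) _)⟩

lemma wL_mem (hD : D.IsAdmissible) (hε : ε ∈ D.posParams) (h : D.IsMultibirdie k l r ε) :
    D.wL (r k) ε ∈ D.OmMbird k l r ε := by
  obtain ⟨t', ht', hw⟩ := hD.exists_wR_eq_wL hε (r k)
  refine ⟨⟨mem_biUnion (x := t') ⟨EReal.coe_le_coe_iff.2 (h.l_one_lt.trans ht').le, le_top⟩
      (hw ▸ right_mem_segment _ _ _),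
    mem_biUnion (x := r k) ⟨bot_le, le_rfl⟩ (right_mem_segment _ _ _)⟩,
    fun i hi hik =>
      mem_aboveChord.2 (hD.chordHgt_pt_nonneg hε (h.lt i hi hik) (h.chord i hi hik) _)⟩

end IsMultibirdie

lemma chordVal_sub (x y : ℝ × ℝ) : D.chordVal f a b x - D.chordVal f a b y =
    D.chordα f a b * (x.1 - y.1) + D.chordβ f a b * (x.2 - y.2) := by
  simp only [chordVal]
  ring

/-- All planes that occur in the definition of the candidate on a multibirdie have the same slope,
since the multibirdie contains three points that are not on a line. -/
lemma StdOnMbird.chordβ_eq (hD : D.IsAdmissible) (hε : ε ∈ D.posParams)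
    (h : D.IsMultibirdie k l r ε) (hB : D.StdOnMbird f k l r ε B) {i j : ℕ} (hi : 1 ≤ i)
    (hik : i ≤ k) (ha : a ∈ Icc (l i) (r i)) (hj : 1 ≤ j) (hjk : j ≤ k) (hb : b ∈ Icc (l j) (r j))
    (hab : a ≠ b) : D.chordβ f a b = D.chordβ f (l 1) (r k) := by
  have hk := h.one_le
  have hl : l 1 ∈ Icc (l 1) (r 1) := left_mem_Icc.2 (h.le 1 le_rfl hk)
  have hr : r k ∈ Icc (l k) (r k) := right_mem_Icc.2 (h.le k hk le_rfl)
  have heq : ∀ x ∈ D.OmMbird k l r ε, D.chordVal f a b x = D.chordVal f (l 1) (r k) x :=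
    fun x hx =>
      ((linEq_iff hD hab).1 (hB a b ⟨i, hi, hik, ha⟩ ⟨j, hj, hjk, hb⟩ hab x hx)).symm.trans
      ((linEq_iff hD h.l_one_lt.ne).1 (hB _ _ ⟨1, le_rfl, hk, hl⟩ ⟨k, hk, le_rfl, hr⟩
        h.l_one_lt.ne x hx))
  have h1 := heq _ (h.g_mem hD le_rfl hk hl)
  have h2 := heq _ (h.g_mem hD hk le_rfl hr)
  have h3 := heq _ (h.wR_mem hD hε)
  have e2 : D.chordVal f a b (D.g (r k)) - D.chordVal f a b (D.g (l 1)) =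
    D.chordVal f (l 1) (r k) (D.g (r k)) - D.chordVal f (l 1) (r k) (D.g (l 1)) := by rw [h1, h2]
  have e3 : D.chordVal f a b (D.wR (l 1) ε) - D.chordVal f a b (D.g (l 1)) =
    D.chordVal f (l 1) (r k) (D.wR (l 1) ε) - D.chordVal f (l 1) (r k) (D.g (l 1)) := by
    rw [h1, h3]
  rw [chordVal_sub, chordVal_sub] at e2 e3
  have hs1 := (hD.κR_lt_κ₂ hε (l 1)).trans (hD.κ₂_lt_chordSlope h.l_one_lt)
  have hd2 := hD.g₁_sub_pos h.l_one_lt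
  have hd3 := hD.wR_lt hε (l 1)
  have hk2 : D.chordSlope (l 1) (r k) * (D.g₁ (r k) - D.g₁ (l 1)) = D.g₂ (r k) - D.g₂ (l 1) :=
    div_mul_cancel₀ _ hd2.ne'
  have hk3 : D.κR (l 1) ε * ((D.wR (l 1) ε).1 - D.g₁ (l 1)) = (D.wR (l 1) ε).2 - D.g₂ (l 1) :=
    div_mul_cancel₀ _ (sub_neg.2 hd3).ne
  simp only [g] at e2 e3
  rw [← hk2] at e2
  rw [← hk3] at e3
  have e2' : (D.chordα f a b - D.chordα f (l 1) (r k)) +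
      (D.chordβ f a b - D.chordβ f (l 1) (r k)) * D.chordSlope (l 1) (r k) = 0 :=
    mul_right_cancel₀ hd2.ne' (by linear_combination e2)
  have e3' : (D.chordα f a b - D.chordα f (l 1) (r k)) +
      (D.chordβ f a b - D.chordβ f (l 1) (r k)) * D.κR (l 1) ε = 0 :=
    mul_right_cancel₀ (sub_neg.2 hd3).ne (by linear_combination e3)
  have : (D.chordβ f a b - D.chordβ f (l 1) (r k)) *
      (D.chordSlope (l 1) (r k) - D.κR (l 1) ε) = 0 := by linear_combination e2' - e3'
  exact sub_eq_zero.1 ((mul_eq_zero.1 this).resolve_right (sub_pos.2 hs1).ne')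

/-- If all planes over an interval have the same slope, then `tors` has this value there. -/
lemma tors_eq_of_chordβ (hD : D.IsAdmissible) (hf : D.IsRegular f) {u v c : ℝ} (huv : u < v)
    (h : ∀ a ∈ Icc u v, ∀ b ∈ Icc u v, a ≠ b → D.chordβ f a b = c) (ht : t ∈ Icc u v) :
    D.tors f t = c := by
  have hu : u ∈ Icc u v := left_mem_Icc.2 huv.le
  have heq : ∀ τ ∈ Icc u v, D.κ₃ f τ = c * D.κ₂ τ + (D.κ₃ f u - c * D.κ₂ u) := fun τ hτ => by
    rcases eq_or_ne u τ with rfl | hne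
    · ring
    · have := hD.chordβ_mul (f := f) hne
      rw [h u hu τ hτ hne] at this
      linear_combination -this
  have h1 := (hf.hasDerivAt_κ₃ hD t).hasDerivWithinAt (s := Icc u v)
  have h2 := (((hD.hasDerivAt_κ₂ t).const_mul c).add_const
    (D.κ₃ f u - c * D.κ₂ u)).hasDerivWithinAt (s := Icc u v)
  have h3 := (uniqueDiffOn_Icc huv t ht).eq_deriv _ h1 (h2.congr heq (heq t ht))
  exact mul_left_cancel₀ (hD.deriv_κ₂_pos t).ne' (h3.trans (mul_comm _ _))

/-- If a candidate on right tangents agrees at one tangency point with the plane of a chord from the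
same boundary point, then its slope there is the slope of the plane. -/
lemma HasForceR.force_eq (hD : D.IsAdmissible) (hε : ε ∈ D.posParams) {p q : EReal} {F : ℝ → ℝ}
    (h : D.HasForceR f ε p q B F) (ht : t ∈ eIcc p q)
    (hB : B (D.wR t ε) = D.chordVal f t b (D.wR t ε)) :
    F t = D.tors f t - D.chordβ f t b := by
  obtain ⟨β, β', h1, h2, h3⟩ := h
  rw [h2 t ht, h1.force_eq hD ht]
  have h4 := h3 t ht _ (right_mem_segment ℝ (D.g t) (D.wR t ε))
  rw [hB, chordVal, fenceVal, chordα] at h4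
  have hd := hD.wR_lt hε t
  have hk : D.κR t ε * ((D.wR t ε).1 - D.g₁ t) = (D.wR t ε).2 - D.g₂ t :=
    div_mul_cancel₀ _ (sub_neg.2 hd).ne
  rw [← hk] at h4
  have h5 : (D.κR t ε - D.κ₂ t) * (D.chordβ f t b - β t) = 0 :=
    mul_right_cancel₀ (sub_neg.2 hd).ne (by linear_combination h4)
  rw [(sub_eq_zero.1 ((mul_eq_zero.1 h5).resolve_left (sub_neg.2 (hD.κR_lt_κ₂ hε t)).ne))]

lemma HasForceL.force_eq (hD : D.IsAdmissible) (hε : ε ∈ D.posParams) {p q : EReal} {F : ℝ → ℝ}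
    (h : D.HasForceL f ε p q B F) (ht : t ∈ eIcc p q)
    (hB : B (D.wL t ε) = D.chordVal f t b (D.wL t ε)) :
    F t = D.tors f t - D.chordβ f t b := by
  obtain ⟨β, β', h1, h2, h3⟩ := h
  rw [h2 t ht, h1.force_eq hD ht]
  have h4 := h3 t ht _ (right_mem_segment ℝ (D.g t) (D.wL t ε))
  rw [hB, chordVal, fenceVal, chordα] at h4
  have hd := hD.lt_wL hε t
  have hk : D.κL t ε * ((D.wL t ε).1 - D.g₁ t) = (D.wL t ε).2 - D.g₂ t :=
    div_mul_cancel₀ _ (sub_pos.2 hd).ne'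
  rw [← hk] at h4
  have h5 : (D.κL t ε - D.κ₂ t) * (D.chordβ f t b - β t) = 0 :=
    mul_right_cancel₀ (sub_pos.2 hd).ne' (by linear_combination h4)
  rw [(sub_eq_zero.1 ((mul_eq_zero.1 h5).resolve_left (sub_pos.2 (hD.κ₂_lt_κL hε t)).ne'))]

/-- The candidate on the multibirdie is affine with `x₂`-derivative `b`; its agreement with the
candidates on the neighbouring tangent domains forces both flows to start with the value `b`. -/
theorem isBirdieSystem_of_candidate (hD : D.IsAdmissible) (hf : D.IsRegular f) (hη₁ : 0 < η₁)
    (hη₁₃ : η₁ < η₃) (hη₃ : (η₃ : EReal) < D.epsMax) (hbird : D.IsMultibirdie k l r η₁)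
    (hR : D.IsRightFlow f η₁ η₃ uRm uRp 𝔉R) (hL : D.IsLeftFlow f η₁ η₃ uLm uLp 𝔉L)
    (hl : uRm η₁ < (l 1 : EReal) ∧ (l 1 : EReal) ≤ uRp η₁)
    (hr : uLm η₁ ≤ (r k : EReal) ∧ (r k : EReal) < uLp η₁)
    (htop : ∀ i, 1 ≤ i → i < k → s i (r i) = l (i + 1))
    (hBR : D.HasForceR f η₁ (uRm η₁) (l 1) B (fun t => 𝔉R t η₁))
    (hBL : D.HasForceL f η₁ (r k) (uLp η₁) B (fun t => 𝔉L t η₁))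
    (hBbird : D.StdOnMbird f k l r η₁ B)
    (hch : ∀ i, 1 ≤ i → i < k → D.IsChordal f (r i) (p i) (s i)) :
    D.IsBirdieSystem f η₁ η₃ k l r (D.chordβ f (l 1) (r k)) p s uRm uRp uLm uLp 𝔉R 𝔉L := by
  have hE : Icc η₁ η₃ ⊆ D.posParams := fun ε hε =>
    ⟨hη₁.trans_le hε.1, (EReal.coe_le_coe_iff.2 hε.2).trans_lt hη₃⟩
  have h₁ : η₁ ∈ D.posParams := hE (left_mem_Icc.2 hη₁₃.le)
  have hk := hbird.one_le
  have hlm : l 1 ∈ Icc (l 1) (r 1) := left_mem_Icc.2 (hbird.le 1 le_rfl hk)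
  have hrm : r k ∈ Icc (l k) (r k) := right_mem_Icc.2 (hbird.le k hk le_rfl)
  have hlr := hbird.l_one_lt
  have hβ : ∀ i j, 1 ≤ i → i ≤ k → 1 ≤ j → j ≤ k → ∀ a ∈ Icc (l i) (r i), ∀ b ∈ Icc (l j) (r j),
      a ≠ b → D.chordβ f a b = D.chordβ f (l 1) (r k) := fun i j hi hik hj hjk a ha b hb hab =>
    hBbird.chordβ_eq hD h₁ hbird hi hik ha hj hjk hb hab
  refine ⟨hη₁₃, hE, hbird, hR, hL, hl, hr, htop, hch, fun i hi hik t ht hlt =>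
    tors_eq_of_chordβ hD hf hlt (hβ i i hi hik hi hik) ht, fun i hi hik =>
    hβ i (i + 1) hi hik.le (by omega) hik _ (right_mem_Icc.2 (hbird.le i hi hik.le)) _
      (left_mem_Icc.2 (hbird.le (i + 1) (by omega) hik)) (hbird.lt i hi hik).ne, ?_, ?_⟩
  · exact hBR.force_eq hD h₁ ⟨hl.1.le, le_rfl⟩ ((linEq_iff hD hlr.ne).1
      (hBbird _ _ ⟨1, le_rfl, hk, hlm⟩ ⟨k, hk, le_rfl, hrm⟩ hlr.ne _ (hbird.wR_mem hD h₁)))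
  · rw [chordβ_comm]
    exact hBL.force_eq hD h₁ ⟨le_rfl, hr.2.le⟩ ((linEq_iff hD hlr.ne').1
      (hBbird _ _ ⟨k, hk, le_rfl, hrm⟩ ⟨1, le_rfl, hk, hlm⟩ hlr.ne' _ (hbird.wL_mem hD h₁)))

end CurveFamily

/-! ### Gluing -/

/-- Pieces that are relatively closed in their union can be glued. -/
lemma exists_continuousOn_glue {X ι : Type*} [TopologicalSpace X] [Finite ι] (P : ι → Set X)
    (φ : ι → X → ℝ) (hc : ∀ i, ContinuousOn (φ i) (P i))
    (hcl : ∀ i, closure (P i) ∩ ⋃ j, P j ⊆ P i)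
    (hag : ∀ i j, ∀ x ∈ P i, x ∈ P j → φ i x = φ j x) :
    ∃ B : X → ℝ, (∀ i, EqOn B (φ i) (P i)) ∧ ContinuousOn B (⋃ i, P i) := by
  classical
  have hex : ∀ x, ∃ y, ∀ i, x ∈ P i → y = φ i x := fun x => by
    by_cases h : ∃ i, x ∈ P i
    · obtain ⟨i, hi⟩ := h
      exact ⟨φ i x, fun j hj => hag i j x hi hj⟩
    · exact ⟨0, fun i hi => absurd ⟨i, hi⟩ h⟩
  choose B hB using hex
  have heq : ∀ i, EqOn B (φ i) (P i) := fun i x hx => hB x i hx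
  refine ⟨B, heq, fun x hx => ?_⟩
  rw [ContinuousWithinAt, nhdsWithin_iUnion, tendsto_iSup]
  intro i
  by_cases hi : x ∈ P i
  · exact (hc i x hi).congr (heq i) (heq i hi)
  · have : x ∉ closure (P i) := fun h => hi (hcl i ⟨h, hx⟩)
    exact continuousWithinAt_of_notMem_closure this

/-- Continuity descends along continuous images of compact sets. -/
lemma ContinuousOn.of_comp_of_isCompact {X Y Z : Type*} [TopologicalSpace X] [T2Space X]
    [TopologicalSpace Y] [T2Space Y] [TopologicalSpace Z] {Ψ : X → Y} {h : Y → Z} {K : Set X}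
    (hK : IsCompact K) (hΨ : ContinuousOn Ψ K) (hh : ContinuousOn (h ∘ Ψ) K) :
    ContinuousOn h (Ψ '' K) := by
  refine continuousOn_iff_isClosed.2 fun T hT => ?_
  have hcl := hh.preimage_isClosed_of_isClosed hK.isClosed hT
  have hcomp : IsCompact (K ∩ h ∘ Ψ ⁻¹' T) := hK.of_isClosed_subset hcl inter_subset_left
  refine ⟨Ψ '' (K ∩ h ∘ Ψ ⁻¹' T), (hcomp.image_of_continuousOn
    (hΨ.mono inter_subset_left)).isClosed, ?_⟩
  ext y
  constructor
  · rintro ⟨hy, x, hx, rfl⟩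
    exact ⟨⟨x, ⟨hx, hy⟩, rfl⟩, ⟨x, hx, rfl⟩⟩
  · rintro ⟨⟨x, ⟨hx, hy⟩, rfl⟩, -⟩
    exact ⟨hy, ⟨x, hx, rfl⟩⟩

/-! ### Fans of segments -/

/-- Disjoint segments `[g t, w t]` with separating open sets: `V t'` contains the segments with
`t > t'` and does not meet the others. -/
structure IsFan (g w : ℝ → ℝ × ℝ) (V : ℝ → Set (ℝ × ℝ)) : Prop where
  contg : Continuous g
  contw : Continuous w
  isOpen : ∀ t, IsOpen (V t)
  sub : ∀ t t', t' < t → segment ℝ (g t) (w t) ⊆ V t'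
  disj : ∀ t t', t ≤ t' → Disjoint (segment ℝ (g t) (w t)) (V t')

/-- The function with the values `φ t x` at the points `x` of the segment `[g t, w t]`. -/
def fanVal (g w : ℝ → ℝ × ℝ) (φ : ℝ → ℝ × ℝ → ℝ) (x : ℝ × ℝ) : ℝ :=
  φ (Classical.epsilon fun t => x ∈ segment ℝ (g t) (w t)) x

namespace IsFan

variable {g w : ℝ → ℝ × ℝ} {V : ℝ → Set (ℝ × ℝ)} {φ : ℝ → ℝ × ℝ → ℝ} {I : Set ℝ} {u t t' : ℝ}
  {x : ℝ × ℝ}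

lemma unique (h : IsFan g w V) (ht : x ∈ segment ℝ (g t) (w t))
    (ht' : x ∈ segment ℝ (g t') (w t')) : t = t' := by
  rcases lt_trichotomy t t' with hlt | rfl | hlt
  · exact absurd (h.sub t' t hlt ht') (disjoint_left.1 (h.disj t t le_rfl) ht)
  · rfl
  · exact absurd (h.sub t t' hlt ht) (disjoint_left.1 (h.disj t' t' le_rfl) ht')

lemma fanVal_eq (h : IsFan g w V) (φ : ℝ → ℝ × ℝ → ℝ) (ht : x ∈ segment ℝ (g t) (w t)) :
    fanVal g w φ x = φ t x := by
  have := Classical.epsilon_spec (p := fun t => x ∈ segment ℝ (g t) (w t)) ⟨t, ht⟩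
  rw [fanVal, h.unique this ht]

lemma eq_image (g w : ℝ → ℝ × ℝ) (I : Set ℝ) : ⋃ t ∈ I, segment ℝ (g t) (w t) =
    (fun z : ℝ × ℝ => (1 - z.2) • g z.1 + z.2 • w z.1) '' (I ×ˢ Icc 0 1) := by
  ext x
  simp only [mem_iUnion, segment_eq_image, mem_image, mem_prod, Prod.exists, exists_prop]
  exact ⟨fun ⟨t, ht, θ, hθ, e⟩ => ⟨t, θ, ⟨ht, hθ⟩, e⟩, fun ⟨t, θ, ⟨ht, hθ⟩, e⟩ => ⟨t, ht, θ, hθ, e⟩⟩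

lemma isCompact (h : IsFan g w V) (hI : IsCompact I) :
    IsCompact (⋃ t ∈ I, segment ℝ (g t) (w t)) := by
  have hg := h.contg
  have hw := h.contw
  rw [eq_image]
  exact (hI.prod isCompact_Icc).image (by fun_prop)

lemma continuousOn_of_isCompact (h : IsFan g w V) (hI : IsCompact I)
    (hφ : Continuous fun z : ℝ × ℝ × ℝ => φ z.1 z.2) :
    ContinuousOn (fanVal g w φ) (⋃ t ∈ I, segment ℝ (g t) (w t)) := by
  have hg := h.contg
  have hw := h.contw
  have hΨ : Continuous fun z : ℝ × ℝ => (1 - z.2) • g z.1 + z.2 • w z.1 := by fun_prop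
  rw [eq_image]
  refine ContinuousOn.of_comp_of_isCompact (hI.prod isCompact_Icc) hΨ.continuousOn ?_
  have : Continuous fun z : ℝ × ℝ => φ z.1 ((1 - z.2) • g z.1 + z.2 • w z.1) :=
    hφ.comp (continuous_fst.prodMk hΨ)
  refine this.continuousOn.congr fun z hz => h.fanVal_eq φ ?_
  rw [segment_eq_image]
  exact ⟨z.2, hz.2, rfl⟩

lemma inter_subset (h : IsFan g w V) (hu : I ⊆ Iic u) :
    (⋃ t ∈ I, segment ℝ (g t) (w t)) ∩ V t' ⊆ ⋃ t ∈ I ∩ Icc t' u, segment ℝ (g t) (w t) := by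
  rintro x ⟨hx, hxV⟩
  obtain ⟨t, ht, hxt⟩ := mem_iUnion₂.1 hx
  refine mem_biUnion ⟨ht, ?_, hu ht⟩ hxt
  by_contra! hlt
  exact disjoint_left.1 (h.disj t t' hlt.le) hxt hxV

/-- The union of the segments over a closed set of parameters that is bounded above is closed
relative to the open sets `V t'`. -/
lemma mem_of_mem_closure (h : IsFan g w V) (hI : IsClosed I) (hu : I ⊆ Iic u) (hx : x ∈ V t')
    (hcl : x ∈ closure (⋃ t ∈ I, segment ℝ (g t) (w t))) :
    x ∈ ⋃ t ∈ I, segment ℝ (g t) (w t) := by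
  have hC := h.isCompact (I := I ∩ Icc t' u) (isCompact_Icc.inter_left hI)
  have h1 : x ∈ closure ((⋃ t ∈ I, segment ℝ (g t) (w t)) ∩ V t') := by
    rw [inter_comm]
    exact (h.isOpen t').inter_closure ⟨hx, hcl⟩
  have h2 := hC.isClosed.closure_subset_iff.2 (h.inter_subset hu) h1
  exact biUnion_subset_biUnion_left inter_subset_left h2

lemma continuousOn (h : IsFan g w V) (hI : IsClosed I) (hu : I ⊆ Iic u)
    (hφ : Continuous fun z : ℝ × ℝ × ℝ => φ z.1 z.2) :
    ContinuousOn (fanVal g w φ) (⋃ t ∈ I, segment ℝ (g t) (w t)) := by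
  intro x hx
  obtain ⟨t, ht, hxt⟩ := mem_iUnion₂.1 hx
  have hV : x ∈ V (t - 1) := h.sub t (t - 1) (by linarith) hxt
  refine (continuousWithinAt_inter ((h.isOpen (t - 1)).mem_nhds hV)).1 ?_
  exact (h.continuousOn_of_isCompact (I := I ∩ Icc (t - 1) u) (isCompact_Icc.inter_left hI) hφ).mono
    (h.inter_subset hu) x ⟨hx, hV⟩

end IsFan

/-! ### Functions glued from consecutive pieces -/

/-- The function equal to `gap m` up to `a (m + 1)`, then to `chord i` on `[a i, b i]` and to
`gap i` on `[b i, a (i + 1)]`, for `n` consecutive indices `i` after `m`. -/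
def glueFrom (a b : ℕ → ℝ) (gap chord : ℕ → ℝ → ℝ) (m : ℕ) : ℕ → ℝ → ℝ
  | 0 => gap m
  | n + 1 => fun t => if t ≤ a (m + n + 1) then glueFrom a b gap chord m n t
      else if t ≤ b (m + n + 1) then chord (m + n + 1) t else gap (m + n + 1) t

/-- The pieces of a glued function are in order and fit together. -/
structure IsGluing (a b : ℕ → ℝ) (gap chord : ℕ → ℝ → ℝ) (m n : ℕ) : Prop where
  contGap : ∀ i, m ≤ i → i ≤ m + n → Continuous (gap i)
  contChord : ∀ i, m < i → i ≤ m + n → Continuous (chord i)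
  le : ∀ i, m < i → i ≤ m + n → a i ≤ b i
  lt : ∀ i, m < i → i < m + n → b i < a (i + 1)
  left : ∀ i, m < i → i ≤ m + n → gap (i - 1) (a i) = chord i (a i)
  right : ∀ i, m < i → i ≤ m + n → chord i (b i) = gap i (b i)

namespace IsGluing

variable {a b : ℕ → ℝ} {gap chord : ℕ → ℝ → ℝ} {m n i j : ℕ} {t : ℝ}

lemma of_succ (h : IsGluing a b gap chord m (n + 1)) : IsGluing a b gap chord m n :=
  ⟨fun i h1 h2 => h.contGap i h1 (by omega), fun i h1 h2 => h.contChord i h1 (by omega),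
    fun i h1 h2 => h.le i h1 (by omega), fun i h1 h2 => h.lt i h1 (by omega),
    fun i h1 h2 => h.left i h1 (by omega), fun i h1 h2 => h.right i h1 (by omega)⟩

lemma b_lt_a (h : IsGluing a b gap chord m n) (hi : m < i) (hij : i < j) (hj : j ≤ m + n) :
    b i < a j := by
  induction j, hij using Nat.le_induction with
  | base => exact h.lt i hi (by omega)
  | succ j hij ih =>
    exact ((ih (by omega)).trans_le (h.le j (by omega) (by omega))).trans (h.lt j (by omega)
      (by omega))

lemma glueFrom_gap_last (h : IsGluing a b gap chord m n) (ht : n = 0 ∨ b (m + n) ≤ t) :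
    glueFrom a b gap chord m n t = gap (m + n) t := by
  induction n generalizing t with
  | zero => rfl
  | succ n ih =>
    have hbt : b (m + n + 1) ≤ t := ht.resolve_left (by omega)
    have hle := h.le (m + n + 1) (by omega) le_rfl
    have hr := h.right (m + n + 1) (by omega) le_rfl
    have hl := h.left (m + n + 1) (by omega) le_rfl
    simp only [glueFrom]
    split_ifs with h1 h2
    · obtain rfl : t = b (m + n + 1) := le_antisymm (h1.trans hle) hbt
      have e : a (m + n + 1) = b (m + n + 1) := le_antisymm hle h1
      rw [← e] at hr ⊢
      rw [← add_assoc, ← hr, ← hl, Nat.add_sub_cancel]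
      refine ih h.of_succ ?_
      rcases Nat.eq_zero_or_pos n with hn | hn
      · exact Or.inl hn
      · exact Or.inr (h.lt (m + n) (by omega) (by omega)).le
    · obtain rfl : t = b (m + n + 1) := le_antisymm h2 hbt
      exact hr
    · rfl

lemma glueFrom_gap (h : IsGluing a b gap chord m n) (hi : m ≤ i) (hin : i ≤ m + n)
    (h1 : i = m ∨ b i ≤ t) (h2 : i = m + n ∨ t ≤ a (i + 1)) :
    glueFrom a b gap chord m n t = gap i t := by
  induction n with
  | zero =>
    obtain rfl : i = m := by omega
    rfl
  | succ n ih =>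
    rcases hin.eq_or_lt with rfl | hlt
    · exact h.glueFrom_gap_last (Or.inr (h1.resolve_left (by omega)))
    · have h3 : t ≤ a (i + 1) := h2.resolve_left (by omega)
      have h4 : t ≤ a (m + n + 1) := by
        rcases (show i ≤ m + n by omega).eq_or_lt with rfl | h4
        · exact h3
        · exact h3.trans ((h.le (i + 1) (by omega) (by omega)).trans
            (h.b_lt_a (by omega) (by omega) (by omega)).le)
      simp only [glueFrom, if_pos h4]
      exact ih h.of_succ (by omega) (Or.inr h3)

lemma glueFrom_chord (h : IsGluing a b gap chord m n) (hi : m < i) (hin : i ≤ m + n)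
    (h1 : a i ≤ t) (h2 : t ≤ b i) : glueFrom a b gap chord m n t = chord i t := by
  induction n with
  | zero => omega
  | succ n ih =>
    rcases hin.eq_or_lt with rfl | hlt
    · simp only [glueFrom]
      split_ifs with h3 h4
      · obtain rfl : t = a (m + n + 1) := le_antisymm h3 h1
        rw [← add_assoc, ← h.left (m + n + 1) (by omega) le_rfl, Nat.add_sub_cancel]
        refine of_succ h |>.glueFrom_gap_last ?_
        cases n with
        | zero => exact Or.inl rfl
        | succ n => exact Or.inr (h.lt (m + n + 1) (by omega) (by omega)).le
      · rfl
      · exact absurd h2 h4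
    · have h4 : t ≤ a (m + n + 1) := h2.trans (h.b_lt_a hi (by omega) (by omega)).le
      simp only [glueFrom, if_pos h4]
      exact ih h.of_succ (by omega)

lemma continuous (h : IsGluing a b gap chord m n) : Continuous (glueFrom a b gap chord m n) := by
  induction n with
  | zero => exact h.contGap m le_rfl le_rfl
  | succ n ih =>
    simp only [glueFrom]
    refine Continuous.if_le (ih h.of_succ) (Continuous.if_le (h.contChord _ (by omega) le_rfl)
      (h.contGap _ (by omega) le_rfl) continuous_id continuous_const fun t ht => ?_)
      continuous_id continuous_const fun t ht => ?_
    · rw [ht]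
      exact h.right (m + n + 1) (by omega) le_rfl
    · rw [ht, if_pos (h.le (m + n + 1) (by omega) le_rfl)]
      have := h.glueFrom_chord (t := a (m + n + 1)) (i := m + n + 1) (by omega) le_rfl le_rfl
        (h.le (m + n + 1) (by omega) le_rfl)
      simpa only [glueFrom, if_pos le_rfl] using this

end IsGluing

/-! ### Affine functions in the plane -/

/-- Affine functions of two variables. -/
def IsAffine₂ (φ : ℝ × ℝ → ℝ) : Prop := ∃ α β c : ℝ, ∀ x, φ x = α * x.1 + β * x.2 + c

namespace IsAffine₂

variable {φ : ℝ × ℝ → ℝ} {x y z : ℝ × ℝ}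

lemma combo (h : IsAffine₂ φ) (x y : ℝ × ℝ) {p q : ℝ} (hpq : p + q = 1) :
    φ (p • x + q • y) = p * φ x + q * φ y := by
  obtain ⟨α, β, c, h⟩ := h
  simp only [h, Prod.fst_add, Prod.snd_add, Prod.smul_fst, Prod.smul_snd, smul_eq_mul]
  linear_combination -c * hpq

lemma neg (h : IsAffine₂ φ) : IsAffine₂ fun x => -φ x := by
  obtain ⟨α, β, c, h⟩ := h
  exact ⟨-α, -β, -c, fun x => by simp only [h]; ring⟩

lemma continuous (h : IsAffine₂ φ) : Continuous φ := by
  obtain ⟨α, β, c, h⟩ := h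
  rw [funext h]
  fun_prop

lemma convex_nonneg (h : IsAffine₂ φ) : Convex ℝ {x | 0 ≤ φ x} := fun x hx y hy p q hp hq hpq => by
  simp only [mem_ofPred_eq, h.combo x y hpq] at *
  exact add_nonneg (mul_nonneg hp hx) (mul_nonneg hq hy)

lemma convex_pos (h : IsAffine₂ φ) : Convex ℝ {x | 0 < φ x} := fun x hx y hy p q hp hq hpq => by
  simp only [mem_ofPred_eq, h.combo x y hpq] at *
  rcases hp.eq_or_lt with rfl | hp
  · obtain rfl : q = 1 := by linarith
    simpa using hy
  · exact add_pos_of_pos_of_nonneg (mul_pos hp hx) (mul_nonneg hq hy.le)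

lemma eq_zero (h : IsAffine₂ φ) (hx : φ x = 0) (hy : φ y = 0) (hz : z ∈ segment ℝ x y) :
    φ z = 0 := by
  obtain ⟨p, q, -, -, hpq, rfl⟩ := hz
  rw [h.combo x y hpq, hx, hy, mul_zero, mul_zero, add_zero]

lemma eq_left (h : IsAffine₂ φ) (hx : 0 ≤ φ x) (hy : 0 < φ y) (hz : z ∈ segment ℝ x y)
    (hz0 : φ z ≤ 0) : z = x ∧ φ x = 0 := by
  obtain ⟨p, q, hp, hq, hpq, rfl⟩ := hz
  rw [h.combo x y hpq] at hz0
  have h1 := mul_nonneg hp hx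
  have hq0 : q = 0 := by
    by_contra hne
    have := mul_pos (lt_of_le_of_ne hq (Ne.symm hne)) hy
    linarith
  subst hq0
  obtain rfl : p = 1 := by linarith
  exact ⟨by simp, by linarith⟩

end IsAffine₂

namespace CurveFamily

variable {D : CurveFamily} {f : ℝ → ℝ} {ε σ t t' a b u : ℝ} {x : ℝ × ℝ}

lemma isAffine₂_hgt (D : CurveFamily) (ε σ : ℝ) : IsAffine₂ (D.hgt ε σ) :=
  ⟨-D.slopeAt σ ε, 1, D.slopeAt σ ε * D.G₁ σ ε - D.G₂ σ ε, fun x => by simp only [hgt]; ring⟩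

lemma isAffine₂_chordHgt (D : CurveFamily) (a b : ℝ) : IsAffine₂ (D.chordHgt a b) :=
  ⟨-D.chordSlope a b, 1, D.chordSlope a b * D.g₁ a - D.g₂ a, fun x => by
    simp only [chordHgt]; ring⟩

lemma isAffine₂_fst_sub (c : ℝ) : IsAffine₂ fun x => x.1 - c := ⟨1, 0, -c, fun x => by ring⟩

/-! ### Tangent domains as fans -/

/-- The points strictly to the right of the right tangent from `g t`. -/
def regR (D : CurveFamily) (ε t : ℝ) : Set (ℝ × ℝ) :=
  {x | 0 < x.1 - D.G₁ (D.tR t ε) ε} ∩ {x | 0 < D.hgt ε (D.tR t ε) x}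

/-- The points strictly to the left of the left tangent from `g t`. -/
def regL (D : CurveFamily) (ε t : ℝ) : Set (ℝ × ℝ) :=
  {x | 0 < -(x.1 - D.G₁ (D.tL t ε) ε)} ∩ {x | 0 < D.hgt ε (D.tL t ε) x}

/-- The points not to the left of the right tangent from `g t`. -/
def cregR (D : CurveFamily) (ε t : ℝ) : Set (ℝ × ℝ) :=
  {x | 0 ≤ x.1 - D.G₁ (D.tR t ε) ε} ∩ {x | 0 ≤ D.hgt ε (D.tR t ε) x}

/-- The points not to the right of the left tangent from `g t`. -/
def cregL (D : CurveFamily) (ε t : ℝ) : Set (ℝ × ℝ) :=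
  {x | 0 ≤ -(x.1 - D.G₁ (D.tL t ε) ε)} ∩ {x | 0 ≤ D.hgt ε (D.tL t ε) x}

lemma convex_regR (D : CurveFamily) (ε t : ℝ) : Convex ℝ (D.regR ε t) :=
  (isAffine₂_fst_sub _).convex_pos.inter (D.isAffine₂_hgt _ _).convex_pos

lemma convex_regL (D : CurveFamily) (ε t : ℝ) : Convex ℝ (D.regL ε t) :=
  (isAffine₂_fst_sub _).neg.convex_pos.inter (D.isAffine₂_hgt _ _).convex_pos

lemma convex_cregR (D : CurveFamily) (ε t : ℝ) : Convex ℝ (D.cregR ε t) :=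
  (isAffine₂_fst_sub _).convex_nonneg.inter (D.isAffine₂_hgt _ _).convex_nonneg

lemma convex_cregL (D : CurveFamily) (ε t : ℝ) : Convex ℝ (D.cregL ε t) :=
  (isAffine₂_fst_sub _).neg.convex_nonneg.inter (D.isAffine₂_hgt _ _).convex_nonneg

lemma isOpen_regR (D : CurveFamily) (ε t : ℝ) : IsOpen (D.regR ε t) :=
  (isOpen_lt continuous_const (isAffine₂_fst_sub _).continuous).inter
    (isOpen_lt continuous_const (D.isAffine₂_hgt _ _).continuous)

lemma isOpen_regL (D : CurveFamily) (ε t : ℝ) : IsOpen (D.regL ε t) :=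
  (isOpen_lt continuous_const (isAffine₂_fst_sub _).neg.continuous).inter
    (isOpen_lt continuous_const (D.isAffine₂_hgt _ _).continuous)

lemma regR_subset_cregR (D : CurveFamily) (ε t : ℝ) : D.regR ε t ⊆ D.cregR ε t :=
  inter_subset_inter (ofPred_subset_ofPred.2 fun _ h => h.le)
    (ofPred_subset_ofPred.2 fun _ h => h.le)

lemma regL_subset_cregL (D : CurveFamily) (ε t : ℝ) : D.regL ε t ⊆ D.cregL ε t :=
  inter_subset_inter (ofPred_subset_ofPred.2 fun _ h => h.le)
    (ofPred_subset_ofPred.2 fun _ h => h.le)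

namespace IsAdmissible

lemma g_mem_regR (hD : D.IsAdmissible) (hε : ε ∈ D.posParams) (h : t' < t) :
    D.g t ∈ D.regR ε t' :=
  ⟨sub_pos.2 ((hD.wR_lt hε t').trans (hD.g₁_strictMono h)), hD.hgt_tR_pos hε h⟩

lemma g_mem_regL (hD : D.IsAdmissible) (hε : ε ∈ D.posParams) (h : t < t') :
    D.g t ∈ D.regL ε t' :=
  ⟨neg_pos.2 (sub_neg.2 ((hD.g₁_strictMono h).trans (hD.lt_wL hε t'))), hD.hgt_tL_pos hε h⟩

lemma pt_mem_regR (hD : D.IsAdmissible) (hε : ε ∈ D.posParams) (h : D.tR t' ε < σ) :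
    D.pt σ ε ∈ D.regR ε t' :=
  ⟨sub_pos.2 (hD.G₁_strictMono (params_of_posParams hε) h),
    hD.hgt_pt_pos (params_of_posParams hε) h.ne'⟩

lemma pt_mem_regL (hD : D.IsAdmissible) (hε : ε ∈ D.posParams) (h : σ < D.tL t' ε) :
    D.pt σ ε ∈ D.regL ε t' :=
  ⟨neg_pos.2 (sub_neg.2 (hD.G₁_strictMono (params_of_posParams hε) h)),
    hD.hgt_pt_pos (params_of_posParams hε) h.ne⟩

lemma segR_subset_regR (hD : D.IsAdmissible) (hε : ε ∈ D.posParams) (h : t' < t) :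
    segment ℝ (D.g t) (D.wR t ε) ⊆ D.regR ε t' :=
  (D.convex_regR ε t').segment_subset (hD.g_mem_regR hε h)
    (hD.pt_mem_regR hε (hD.tR_strictMono hε h))

lemma segL_subset_regR (hD : D.IsAdmissible) (hε : ε ∈ D.posParams) (h : t' < t) :
    segment ℝ (D.g t) (D.wL t ε) ⊆ D.regR ε t' :=
  (D.convex_regR ε t').segment_subset (hD.g_mem_regR hε h)
    (hD.pt_mem_regR hε ((hD.tR_strictMono hε h).trans (hD.tR_lt_tL ε hε t)))

lemma segR_subset_regL (hD : D.IsAdmissible) (hε : ε ∈ D.posParams) (h : t < t') :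
    segment ℝ (D.g t) (D.wR t ε) ⊆ D.regL ε t' :=
  (D.convex_regL ε t').segment_subset (hD.g_mem_regL hε h)
    (hD.pt_mem_regL hε ((hD.tR_lt_tL ε hε t).trans (hD.tL_strictMono hε h)))

lemma segL_subset_regL (hD : D.IsAdmissible) (hε : ε ∈ D.posParams) (h : t < t') :
    segment ℝ (D.g t) (D.wL t ε) ⊆ D.regL ε t' :=
  (D.convex_regL ε t').segment_subset (hD.g_mem_regL hε h)
    (hD.pt_mem_regL hε (hD.tL_strictMono hε h))

lemma g_mem_cregR (hD : D.IsAdmissible) (hε : ε ∈ D.posParams) (h : t' ≤ t) :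
    D.g t ∈ D.cregR ε t' := by
  rcases h.eq_or_lt with rfl | h
  · exact ⟨sub_nonneg.2 (hD.wR_lt hε _).le, (hD.hgt_tR hε _).ge⟩
  · exact D.regR_subset_cregR ε t' (hD.g_mem_regR hε h)

lemma g_mem_cregL (hD : D.IsAdmissible) (hε : ε ∈ D.posParams) (h : t ≤ t') :
    D.g t ∈ D.cregL ε t' := by
  rcases h.eq_or_lt with rfl | h
  · exact ⟨neg_nonneg.2 (sub_nonpos.2 (hD.lt_wL hε _).le), (hD.hgt_tL hε _).ge⟩
  · exact D.regL_subset_cregL ε t' (hD.g_mem_regL hε h)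

lemma pt_mem_cregR (hD : D.IsAdmissible) (hε : ε ∈ D.posParams) (h : D.tR t' ε ≤ σ) :
    D.pt σ ε ∈ D.cregR ε t' :=
  ⟨sub_nonneg.2 ((hD.G₁_strictMono (params_of_posParams hε)).monotone h),
    hD.hgt_pt_nonneg (params_of_posParams hε) _ _⟩

lemma pt_mem_cregL (hD : D.IsAdmissible) (hε : ε ∈ D.posParams) (h : σ ≤ D.tL t' ε) :
    D.pt σ ε ∈ D.cregL ε t' :=
  ⟨neg_nonneg.2 (sub_nonpos.2 ((hD.G₁_strictMono (params_of_posParams hε)).monotone h)),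
    hD.hgt_pt_nonneg (params_of_posParams hε) _ _⟩

lemma segL_subset_cregR (hD : D.IsAdmissible) (hε : ε ∈ D.posParams) (h : t' ≤ t) :
    segment ℝ (D.g t) (D.wL t ε) ⊆ D.cregR ε t' :=
  (D.convex_cregR ε t').segment_subset (hD.g_mem_cregR hε h)
    (hD.pt_mem_cregR hε (((hD.tR_strictMono hε).monotone h).trans (hD.tR_lt_tL ε hε t).le))

lemma segR_subset_cregL (hD : D.IsAdmissible) (hε : ε ∈ D.posParams) (h : t ≤ t') :
    segment ℝ (D.g t) (D.wR t ε) ⊆ D.cregL ε t' :=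
  (D.convex_cregL ε t').segment_subset (hD.g_mem_cregL hε h)
    (hD.pt_mem_cregL hε ((hD.tR_lt_tL ε hε t).le.trans ((hD.tL_strictMono hε).monotone h)))

lemma hgt_of_mem_segR (hD : D.IsAdmissible) (hε : ε ∈ D.posParams)
    (hx : x ∈ segment ℝ (D.g t) (D.wR t ε)) : D.hgt ε (D.tR t ε) x = 0 :=
  (D.isAffine₂_hgt _ _).eq_zero (hD.hgt_tR hε t) (by simp [hgt, wR, pt]) hx

lemma hgt_of_mem_segL (hD : D.IsAdmissible) (hε : ε ∈ D.posParams)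
    (hx : x ∈ segment ℝ (D.g t) (D.wL t ε)) : D.hgt ε (D.tL t ε) x = 0 :=
  (D.isAffine₂_hgt _ _).eq_zero (hD.hgt_tL hε t) (by simp [hgt, wL, pt]) hx

lemma snd_of_mem_segR (hD : D.IsAdmissible) (hε : ε ∈ D.posParams)
    (hx : x ∈ segment ℝ (D.g t) (D.wR t ε)) : x.2 - D.g₂ t = D.κR t ε * (x.1 - D.g₁ t) := by
  have := hD.hgt_of_mem_segR hε hx
  rw [hD.hgt_tR_eq hε] at this
  linarith

lemma snd_of_mem_segL (hD : D.IsAdmissible) (hε : ε ∈ D.posParams)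
    (hx : x ∈ segment ℝ (D.g t) (D.wL t ε)) : x.2 - D.g₂ t = D.κL t ε * (x.1 - D.g₁ t) := by
  have := hD.hgt_of_mem_segL hε hx
  rw [hD.hgt_tL_eq hε] at this
  linarith

lemma fst_le_of_mem_segR (hD : D.IsAdmissible) (hε : ε ∈ D.posParams)
    (hx : x ∈ segment ℝ (D.g t) (D.wR t ε)) : x.1 ≤ D.g₁ t :=
  sub_nonneg.1 <| by
    simpa using (isAffine₂_fst_sub (D.g₁ t)).neg.convex_nonneg.segment_subset
      (show (0 : ℝ) ≤ -((D.g t).1 - D.g₁ t) by simp [g])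
      (show (0 : ℝ) ≤ -((D.wR t ε).1 - D.g₁ t) by linarith [hD.wR_lt hε t]) hx

lemma le_fst_of_mem_segL (hD : D.IsAdmissible) (hε : ε ∈ D.posParams)
    (hx : x ∈ segment ℝ (D.g t) (D.wL t ε)) : D.g₁ t ≤ x.1 :=
  sub_nonneg.1 <| by
    simpa using (isAffine₂_fst_sub (D.g₁ t)).convex_nonneg.segment_subset
      (show (0 : ℝ) ≤ (D.g t).1 - D.g₁ t by simp [g])
      (show (0 : ℝ) ≤ (D.wL t ε).1 - D.g₁ t by linarith [hD.lt_wL hε t]) hx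

lemma le_of_mem_cregR (hD : D.IsAdmissible) (hε : ε ∈ D.posParams)
    (hx : x ∈ segment ℝ (D.g t) (D.wR t ε)) (hx' : x ∈ D.cregR ε t') : t' ≤ t := by
  by_contra! hlt
  have h1 := hD.hgt_lt_hgt (params_of_posParams hε) (hD.tR_strictMono hε hlt) (sub_nonneg.1 hx'.1)
  have h2 : 0 ≤ D.hgt ε (D.tR t' ε) x := hx'.2
  linarith [hD.hgt_of_mem_segR hε hx]

lemma le_of_mem_cregL (hD : D.IsAdmissible) (hε : ε ∈ D.posParams)
    (hx : x ∈ segment ℝ (D.g t) (D.wL t ε)) (hx' : x ∈ D.cregL ε t') : t ≤ t' := by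
  by_contra! hlt
  have h1 := hD.hgt_lt_hgt' (params_of_posParams hε) (hD.tL_strictMono hε hlt)
    (sub_nonpos.1 (neg_nonneg.1 hx'.1))
  have h2 : 0 ≤ D.hgt ε (D.tL t' ε) x := hx'.2
  linarith [hD.hgt_of_mem_segL hε hx]

lemma disjoint_segR (hD : D.IsAdmissible) (hε : ε ∈ D.posParams) (h : t ≤ t') :
    Disjoint (segment ℝ (D.g t) (D.wR t ε)) (D.regR ε t') := disjoint_left.2 fun x hx hx' => by
  obtain rfl := le_antisymm h (hD.le_of_mem_cregR hε hx (D.regR_subset_cregR ε t' hx'))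
  exact hx'.2.ne' (hD.hgt_of_mem_segR hε hx)

lemma disjoint_segL (hD : D.IsAdmissible) (hε : ε ∈ D.posParams) (h : t' ≤ t) :
    Disjoint (segment ℝ (D.g t) (D.wL t ε)) (D.regL ε t') := disjoint_left.2 fun x hx hx' => by
  obtain rfl := le_antisymm h (hD.le_of_mem_cregL hε hx (D.regL_subset_cregL ε t' hx'))
  exact hx'.2.ne' (hD.hgt_of_mem_segL hε hx)

lemma isFan_right (hD : D.IsAdmissible) (hε : ε ∈ D.posParams) :
    IsFan D.g (fun t => D.wR t ε) (D.regR ε) :=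
  ⟨hD.continuous_g, hD.continuous_wR hε, D.isOpen_regR ε, fun _ _ h => hD.segR_subset_regR hε h,
    fun _ _ h => hD.disjoint_segR hε h⟩

/-- The left tangents form a fan when the parameter is negated. -/
lemma isFan_left (hD : D.IsAdmissible) (hε : ε ∈ D.posParams) :
    IsFan (fun t => D.g (-t)) (fun t => D.wL (-t) ε) fun t => D.regL ε (-t) :=
  ⟨hD.continuous_g.comp continuous_neg, (hD.continuous_wL hε).comp continuous_neg,
    fun t => D.isOpen_regL ε (-t), fun _ _ h => hD.segL_subset_regL hε (neg_lt_neg h),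
    fun _ _ h => hD.disjoint_segL hε (neg_le_neg h)⟩

lemma notMem_Xi_of_segR (hD : D.IsAdmissible) (hε : ε ∈ D.posParams)
    (hx : x ∈ segment ℝ (D.g t) (D.wR t ε)) : x ∉ D.Xi ε := fun h =>
  (hD.hgt_pos_of_mem_Xi (params_of_posParams hε) h (D.tR t ε)).ne' (hD.hgt_of_mem_segR hε hx)

lemma notMem_Xi_of_segL (hD : D.IsAdmissible) (hε : ε ∈ D.posParams)
    (hx : x ∈ segment ℝ (D.g t) (D.wL t ε)) : x ∉ D.Xi ε := fun h =>
  (hD.hgt_pos_of_mem_Xi (params_of_posParams hε) h (D.tL t ε)).ne' (hD.hgt_of_mem_segL hε hx)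

lemma g_notMem_Xi (hD : D.IsAdmissible) (hε : ε ∈ D.posParams) (t : ℝ) : D.g t ∉ D.Xi ε :=
  hD.notMem_Xi_of_segR hε (left_mem_segment ℝ (D.g t) (D.wR t ε))

end IsAdmissible

/-! ### The angle -/

lemma hull_subset {S : Set (ℝ × ℝ)} (hS : Convex ℝ S) {p q r : ℝ × ℝ} (hp : p ∈ S) (hq : q ∈ S)
    (hr : r ∈ S) : convexHull ℝ {p, q, r} ⊆ S :=
  convexHull_min (by rintro _ (rfl | rfl | rfl) <;> assumption) hS

namespace IsAdmissible

lemma ang_subset_cregR (hD : D.IsAdmissible) (hε : ε ∈ D.posParams) (u : ℝ) :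
    D.OmAng u ε ⊆ D.cregR ε u :=
  sdiff_subset.trans (hull_subset (D.convex_cregR ε u) (hD.g_mem_cregR hε le_rfl)
    (hD.pt_mem_cregR hε le_rfl) (hD.pt_mem_cregR hε (hD.tR_lt_tL ε hε u).le))

lemma ang_subset_cregL (hD : D.IsAdmissible) (hε : ε ∈ D.posParams) (u : ℝ) :
    D.OmAng u ε ⊆ D.cregL ε u :=
  sdiff_subset.trans (hull_subset (D.convex_cregL ε u) (hD.g_mem_cregL hε le_rfl)
    (hD.pt_mem_cregL hε (hD.tR_lt_tL ε hε u).le) (hD.pt_mem_cregL hε le_rfl))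

lemma ang_subset_regR (hD : D.IsAdmissible) (hε : ε ∈ D.posParams) (h : t' < u) :
    D.OmAng u ε ⊆ D.regR ε t' :=
  sdiff_subset.trans (hull_subset (D.convex_regR ε t') (hD.g_mem_regR hε h)
    (hD.pt_mem_regR hε (hD.tR_strictMono hε h))
    (hD.pt_mem_regR hε ((hD.tR_strictMono hε h).trans (hD.tR_lt_tL ε hε u))))

lemma ang_subset_regL (hD : D.IsAdmissible) (hε : ε ∈ D.posParams) (h : u < t') :
    D.OmAng u ε ⊆ D.regL ε t' :=
  sdiff_subset.trans (hull_subset (D.convex_regL ε t') (hD.g_mem_regL hε h)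
    (hD.pt_mem_regL hε ((hD.tR_lt_tL ε hε u).trans (hD.tL_strictMono hε h)))
    (hD.pt_mem_regL hε (hD.tL_strictMono hε h)))

/-- The angle meets a lower half-plane that contains neither tangency point at most in its
vertex. -/
lemma eq_of_mem_ang {φ : ℝ × ℝ → ℝ} (hφ : IsAffine₂ φ) (hg : 0 ≤ φ (D.g u))
    (hR : 0 < φ (D.wR u ε)) (hL : 0 < φ (D.wL u ε)) (hx : x ∈ D.OmAng u ε) (hx0 : φ x ≤ 0) :
    x = D.g u ∧ φ (D.g u) = 0 := by
  have h1 := hx.1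
  rw [convexHull_insert (insert_nonempty _ _), convexHull_pair] at h1
  obtain ⟨p, hp, q, hq, hpq⟩ := mem_convexJoin.1 h1
  obtain rfl : p = D.g u := hp
  exact hφ.eq_left hg (hφ.convex_pos.segment_subset hR hL hq) hpq hx0

/-! ### Positions relative to chords -/

lemma chordHgt_g_nonneg (hD : D.IsAdmissible) (hab : a < b) (ht : t ∉ Ioo a b) :
    0 ≤ D.chordHgt a b (D.g t) ∧ (D.chordHgt a b (D.g t) = 0 → t = a ∨ t = b) := by
  rcases lt_trichotomy t a with h | rfl | h
  · have := hD.chordHgt_g_pos_left hab h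
    exact ⟨this.le, fun e => absurd e this.ne'⟩
  · exact ⟨(chordHgt_left D _ _).ge, fun _ => Or.inl rfl⟩
  · rcases lt_trichotomy t b with h' | rfl | h'
    · exact absurd ⟨h, h'⟩ ht
    · exact ⟨(hD.chordHgt_right hab).ge, fun _ => Or.inr rfl⟩
    · have := hD.chordHgt_g_pos_right hab h'
      exact ⟨this.le, fun e => absurd e this.ne'⟩

/-- A segment from `g t` to a curve above the chord, where `t` is not under the chord. -/
lemma chordHgt_of_mem_segment (hD : D.IsAdmissible) (hab : a < b)
    (hpos : ∀ σ, 0 < D.chordHgt a b (D.pt σ ε)) (ht : t ∉ Ioo a b)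
    (hx : x ∈ segment ℝ (D.g t) (D.pt σ ε)) :
    0 ≤ D.chordHgt a b x ∧ (D.chordHgt a b x ≤ 0 → x = D.g t ∧ (t = a ∨ t = b)) := by
  have h1 := hD.chordHgt_g_nonneg hab ht
  refine ⟨(D.isAffine₂_chordHgt a b).convex_nonneg.segment_subset h1.1 (hpos σ).le hx, fun h => ?_⟩
  have h2 := (D.isAffine₂_chordHgt a b).eq_left h1.1 (hpos σ) hx h
  exact ⟨h2.1, h1.2 h2.2⟩

lemma chordVal_left (D : CurveFamily) (f : ℝ → ℝ) (a b : ℝ) : D.chordVal f a b (D.g a) = f a := by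
  simp [chordVal, g]

lemma isAffine₂_chordVal (D : CurveFamily) (f : ℝ → ℝ) (a b : ℝ) :
    IsAffine₂ (D.chordVal f a b) :=
  ⟨D.chordα f a b, D.chordβ f a b, f a - D.chordα f a b * D.g₁ a - D.chordβ f a b * D.g₂ a,
    fun x => by simp only [chordVal]; ring⟩

lemma chordVal_right (hD : D.IsAdmissible) (hab : a ≠ b) (h : D.cupDet f a b = 0) :
    D.chordVal f a b (D.g b) = f b :=
  (hD.f_right_eq hab (hD.cupFun_eq_zero h)).symm

end IsAdmissible

namespace IsChordal

variable {p τ : ℝ} {S : ℝ → ℝ}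

lemma mono_left (h : D.IsChordal f a p S) {a' : ℝ} (ha : a ≤ a') (hp : a' < p) :
    D.IsChordal f a' p S :=
  have hs := Icc_subset_Icc_left (b := p) ha
  have hs' := Ioo_subset_Ioo_left (b := p) ha
  ⟨hp, h.le, h.anti.mono hs, h.cont.mono hs, fun t ht => h.cup t (hs ht),
    fun t ht => h.DL_neg t (hs' ht), fun t ht => h.DR_neg t (hs' ht)⟩

lemma mem_Ioo (h : D.IsChordal f a p S) (hτ : τ ∈ Ioc a p) :
    τ ∈ Ioo a (S a) ∧ S τ ∈ Ioo a (S a) ∧ τ ≤ S τ := by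
  have h1 := h.anti (left_mem_Icc.2 h.lt.le) (Ioc_subset_Icc_self hτ) hτ.1
  have h2 : p ≤ S τ := h.le.trans (h.anti.antitoneOn (Ioc_subset_Icc_self hτ)
    (right_mem_Icc.2 h.lt.le) hτ.2)
  exact ⟨⟨hτ.1, (hτ.2.trans h2).trans_lt h1⟩, ⟨(hτ.1.trans_le hτ.2).trans_le h2, h1⟩,
    hτ.2.trans h2⟩

/-- Points of a chordal domain lie under the line of its top chord or on the top chord. -/
lemma chordHgt_neg_or (hD : D.IsAdmissible) (h : D.IsChordal f a p S) (hx : x ∈ D.OmCh a p S) :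
    D.chordHgt a (S a) x < 0 ∨ x ∈ segment ℝ (D.g a) (D.g (S a)) := by
  obtain ⟨τ, hτ, hx⟩ := mem_iUnion₂.1 hx
  rcases hτ.1.eq_or_lt with rfl | h'
  · exact Or.inr hx
  · have h1 := h.mem_Ioo ⟨h', hτ.2⟩
    left
    have := (D.isAffine₂_chordHgt a (S a)).neg.convex_pos.segment_subset
      (neg_pos.2 (hD.chordHgt_g_neg h1.1)) (neg_pos.2 (hD.chordHgt_g_neg h1.2.1)) hx
    exact neg_pos.1 this

lemma notMem_Xi (hD : D.IsAdmissible) (hε : ε ∈ D.posParams) (h : D.IsChordal f a p S)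
    (hpos : ∀ σ, 0 < D.chordHgt a (S a) (D.pt σ ε)) (hx : x ∈ D.OmCh a p S) : x ∉ D.Xi ε := by
  obtain ⟨τ, hτ, hx⟩ := mem_iUnion₂.1 hx
  have h₀ := h.lt_right (left_mem_Ico.2 h.lt)
  rcases hτ.1.eq_or_lt with rfl | h'
  · exact disjoint_left.1 (hD.disjoint_of_chordHgt_pos h₀ hpos) hx
  · obtain ⟨h1, h2, h3⟩ := h.mem_Ioo ⟨h', hτ.2⟩
    rcases h3.eq_or_lt with e | h3
    · rw [← e, segment_same, mem_singleton_iff] at hx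
      exact hx ▸ hD.g_notMem_Xi hε τ
    · exact disjoint_left.1 (hD.disjoint_of_chordHgt_pos h3
        (hD.chordHgt_pt_pos hε h1.1 h3 h2.2 fun σ => (hpos σ).le)) hx

lemma isCompact_OmCh (hD : D.IsAdmissible) (h : D.IsChordal f a p S) :
    IsCompact (D.OmCh a p S) := by
  have hg := hD.continuous_g
  have : D.OmCh a p S = (fun z : ℝ × ℝ => (1 - z.2) • D.g z.1 + z.2 • D.g (S z.1)) ''
      (Icc a p ×ˢ Icc 0 1) := IsFan.eq_image D.g (fun t => D.g (S t)) _
  rw [this]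
  refine (isCompact_Icc.prod isCompact_Icc).image_of_continuousOn ?_
  have h1 : ContinuousOn (fun z : ℝ × ℝ => D.g (S z.1)) (Icc a p ×ˢ Icc 0 1) :=
    hg.comp_continuousOn (h.cont.comp continuousOn_fst fun z hz => hz.1)
  have h2 : ContinuousOn (fun z : ℝ × ℝ => (1 - z.2) • D.g z.1) (Icc a p ×ˢ Icc 0 1) :=
    Continuous.continuousOn (by fun_prop)
  exact h2.add (continuousOn_snd.smul h1)

lemma OmCh_subset_regR (hD : D.IsAdmissible) (hε : ε ∈ D.posParams) (h : D.IsChordal f a p S)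
    (ht : t < a) : D.OmCh a p S ⊆ D.regR ε t := iUnion₂_subset fun τ hτ => by
  have h1 : τ ≤ S τ := by
    rcases hτ.2.eq_or_lt with rfl | h'
    · exact h.le
    · exact (h.lt_right ⟨hτ.1, h'⟩).le
  exact (D.convex_regR ε t).segment_subset (hD.g_mem_regR hε (ht.trans_le hτ.1))
    (hD.g_mem_regR hε (ht.trans_le (hτ.1.trans h1)))

lemma OmCh_subset_regL (hD : D.IsAdmissible) (hε : ε ∈ D.posParams) (h : D.IsChordal f a p S)
    (ht : S a < t) : D.OmCh a p S ⊆ D.regL ε t := iUnion₂_subset fun τ hτ => by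
  have h1 : τ ≤ S τ := by
    rcases hτ.2.eq_or_lt with rfl | h'
    · exact h.le
    · exact (h.lt_right ⟨hτ.1, h'⟩).le
  have h2 : S τ ≤ S a := h.anti.antitoneOn (left_mem_Icc.2 h.lt.le) hτ hτ.1
  exact (D.convex_regL ε t).segment_subset (hD.g_mem_regL hε ((h1.trans h2).trans_lt ht))
    (hD.g_mem_regL hε (h2.trans_lt ht))

end IsChordal

/-- On the top chord the candidate agrees with the plane of the chord. -/
lemma StdOnCh.eq_chordVal {p : ℝ} {S : ℝ → ℝ} {B : ℝ × ℝ → ℝ} (hD : D.IsAdmissible)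
    (h : D.StdOnCh f a p S B) (hx : x ∈ segment ℝ (D.g a) (D.g (S a))) :
    B x = D.chordVal f a (S a) x := by
  obtain ⟨α, β, hα, hβ, hαβ, rfl⟩ := hx
  have h₀ := h.1.lt_right (left_mem_Ico.2 h.1.lt)
  have ha := left_mem_Icc.2 h.1.lt.le
  obtain rfl : β = 1 - α := by linarith
  rw [h.2 a ha α ⟨hα, by linarith⟩, (IsAdmissible.isAffine₂_chordVal D f a (S a)).combo _ _ hαβ,
    IsAdmissible.chordVal_left, hD.chordVal_right h₀.ne (h.1.cup a ha)]

end CurveFamily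

namespace CurveFamily

variable {D : CurveFamily} {f κ : ℝ → ℝ} {ε t : ℝ} {x : ℝ × ℝ}

/-! ### Values along consecutive tangent domains and trolleybuses -/

/-- The value at a point `x` of the tangent from `g t` (with slope `κ t`) of the function which is
the candidate with slope `Y i` on the `i`-th tangent domain, and the plane of the chord
`[g (a i), g (b i)]` on the `i`-th trolleybus. -/
def segVal (D : CurveFamily) (f κ : ℝ → ℝ) (a b : ℕ → ℝ) (Y : ℕ → ℝ → ℝ) (m n : ℕ) (t : ℝ)
    (x : ℝ × ℝ) : ℝ :=
  glueFrom a b (fun _ => f) (fun i t => D.chordVal f (a i) (b i) (D.g t)) m n t +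
    (x.1 - D.g₁ t) * glueFrom a b (fun i t => D.κ₃ f t + (κ t - D.κ₂ t) * Y i t)
      (fun i t => D.chordα f (a i) (b i) + D.chordβ f (a i) (b i) * κ t) m n t

/-- The slopes `Y i` on consecutive tangent domains agree with those of the planes of the chords
between them. -/
structure IsSlopeChain (D : CurveFamily) (f : ℝ → ℝ) (a b : ℕ → ℝ) (Y : ℕ → ℝ → ℝ) (m n : ℕ) :
    Prop where
  cont : ∀ i, m ≤ i → i ≤ m + n → Continuous (Y i)
  lt : ∀ i, m < i → i ≤ m + n → a i < b i
  gap : ∀ i, m < i → i < m + n → b i < a (i + 1)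
  cup : ∀ i, m < i → i ≤ m + n → D.cupDet f (a i) (b i) = 0
  left : ∀ i, m < i → i ≤ m + n → Y (i - 1) (a i) = D.chordβ f (a i) (b i)
  right : ∀ i, m < i → i ≤ m + n → Y i (b i) = D.chordβ f (a i) (b i)

lemma fenceVal_self (D : CurveFamily) (f κ y : ℝ → ℝ) (t : ℝ) :
    D.fenceVal f κ y t (D.g t) = f t := by simp [fenceVal, g]

namespace IsSlopeChain

variable {a b : ℕ → ℝ} {Y : ℕ → ℝ → ℝ} {m n i : ℕ}

lemma isGluing_vertex (hD : D.IsAdmissible) (hf : D.IsRegular f) (h : D.IsSlopeChain f a b Y m n) :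
    IsGluing a b (fun _ => f) (fun i t => D.chordVal f (a i) (b i) (D.g t)) m n where
  contGap _ _ _ := hf.smooth.continuous
  contChord _ _ _ := (IsAdmissible.isAffine₂_chordVal D f _ _).continuous.comp hD.continuous_g
  le i h1 h2 := (h.lt i h1 h2).le
  lt := h.gap
  left _ _ _ := (IsAdmissible.chordVal_left D f _ _).symm
  right i h1 h2 := hD.chordVal_right (h.lt i h1 h2).ne (h.cup i h1 h2)

lemma isGluing_slope (hD : D.IsAdmissible) (hf : D.IsRegular f) (hκ : Continuous κ)
    (h : D.IsSlopeChain f a b Y m n) :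
    IsGluing a b (fun i t => D.κ₃ f t + (κ t - D.κ₂ t) * Y i t)
      (fun i t => D.chordα f (a i) (b i) + D.chordβ f (a i) (b i) * κ t) m n where
  contGap i h1 h2 := by
    have h3 : Continuous (D.κ₃ f) :=
      continuous_iff_continuousAt.2 fun t => (hf.hasDerivAt_κ₃ hD t).continuousAt
    exact h3.add ((hκ.sub hD.continuous_κ₂).mul (h.cont i h1 h2))
  contChord _ _ _ := by fun_prop
  le i h1 h2 := (h.lt i h1 h2).le
  lt := h.gap
  left i h1 h2 := by simp only [h.left i h1 h2, chordα]; ring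
  right i h1 h2 := by simp only [h.right i h1 h2, hD.chordα_eq (h.lt i h1 h2).ne]; ring

lemma continuous_segVal (hD : D.IsAdmissible) (hf : D.IsRegular f) (hκ : Continuous κ)
    (h : D.IsSlopeChain f a b Y m n) :
    Continuous fun z : ℝ × ℝ × ℝ => D.segVal f κ a b Y m n z.1 z.2 := by
  have h1 := (h.isGluing_vertex hD hf).continuous
  have h2 := (h.isGluing_slope hD hf hκ).continuous
  have h3 := hD.continuous_g₁
  unfold segVal
  fun_prop

lemma segVal_eq_fenceVal (hD : D.IsAdmissible) (hf : D.IsRegular f) (hκ : Continuous κ)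
    (h : D.IsSlopeChain f a b Y m n) (hi : m ≤ i) (hin : i ≤ m + n) (h1 : i = m ∨ b i ≤ t)
    (h2 : i = m + n ∨ t ≤ a (i + 1)) :
    D.segVal f κ a b Y m n t x = D.fenceVal f κ (Y i) t x := by
  rw [segVal, (h.isGluing_vertex hD hf).glueFrom_gap hi hin h1 h2,
    (h.isGluing_slope hD hf hκ).glueFrom_gap hi hin h1 h2, fenceVal]

lemma segVal_eq_chordVal (hD : D.IsAdmissible) (hf : D.IsRegular f) (hκ : Continuous κ)
    (h : D.IsSlopeChain f a b Y m n) (hi : m < i) (hin : i ≤ m + n) (h1 : a i ≤ t) (h2 : t ≤ b i)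
    (hx : x.2 - D.g₂ t = κ t * (x.1 - D.g₁ t)) :
    D.segVal f κ a b Y m n t x = D.chordVal f (a i) (b i) x := by
  rw [segVal, (h.isGluing_vertex hD hf).glueFrom_chord hi hin h1 h2,
    (h.isGluing_slope hD hf hκ).glueFrom_chord hi hin h1 h2]
  have := D.chordVal_sub (f := f) (a := a i) (b := b i) x (D.g t)
  simp only [g] at this ⊢
  rw [hx] at this
  linarith

end IsSlopeChain

/-! ### Gluing the candidates of a foliation -/

/-- The value on the tangent from `g t` to the left of the angle of a foliation with `j - 1`
trolleybuses there. -/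
abbrev rightVal (D : CurveFamily) (f : ℝ → ℝ) (ε : ℝ) (j : ℕ) (a b : ℕ → ℝ) (Y : ℕ → ℝ → ℝ) (t : ℝ)
    (x : ℝ × ℝ) : ℝ := D.segVal f (fun t => D.κR t ε) a b Y 0 (j - 1) t x

/-- The value on the tangent from `g t` to the right of the angle of a foliation with `k - j`
trolleybuses there. -/
abbrev leftVal (D : CurveFamily) (f : ℝ → ℝ) (ε : ℝ) (k j : ℕ) (a b : ℕ → ℝ) (Z : ℕ → ℝ → ℝ)
    (t : ℝ) (x : ℝ × ℝ) : ℝ :=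
  D.segVal f (fun t => D.κL t ε) a b (fun i => Z (i + 1)) (j - 1) (k - j) t x

/-- The affine function with derivative `c` in `x₂` whose graph is tangent to the boundary curve
at the point over `g u`. -/
def angVal (D : CurveFamily) (f : ℝ → ℝ) (u c : ℝ) (x : ℝ × ℝ) : ℝ :=
  f u + (D.κ₃ f u - c * D.κ₂ u) * (x.1 - D.g₁ u) + c * (x.2 - D.g₂ u)

/-- The right tangent domains and right trolleybuses of a foliation. -/
def rightSide (D : CurveFamily) (j : ℕ) (a b : ℕ → ℝ) (um : EReal) (u ε : ℝ) : Set (ℝ × ℝ) :=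
  D.OmR um u ε ∩ {x | ∀ i, 1 ≤ i → i < j → x ∈ D.aboveChord (a i) (b i)}

/-- The left tangent domains and left trolleybuses of a foliation. -/
def leftSide (D : CurveFamily) (k j : ℕ) (a b : ℕ → ℝ) (up : EReal) (u ε : ℝ) : Set (ℝ × ℝ) :=
  D.OmL u up ε ∩ {x | ∀ i, j ≤ i → i < k → x ∈ D.aboveChord (a i) (b i)}

/-- The chordal domains of a foliation. -/
def chordalPart (D : CurveFamily) (k : ℕ) (a : ℕ → ℝ) (p : ℕ → ℝ) (s : ℕ → ℝ → ℝ) :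
    Set (ℝ × ℝ) :=
  ⋃ i ∈ {i : ℕ | 1 ≤ i ∧ i < k}, D.OmCh (a i) (p i) (s i)

/-- Chords `[g (a i), g (b i)]`, the vertex `g u` of an angle, and slopes of standard candidates
that agree at the common boundaries of the subdomains of the corresponding foliation: `Y i` on the
`i`-th right tangent domain, `Z i` on the left tangent domain that ends at `a i`, and `B` on the
chordal domains. -/
structure IsUnfolding (D : CurveFamily) (f : ℝ → ℝ) (ε : ℝ) (k j : ℕ) (um up : EReal)
    (a b : ℕ → ℝ) (p : ℕ → ℝ) (s : ℕ → ℝ → ℝ) (Y Z : ℕ → ℝ → ℝ) (u : ℝ) (B : ℝ × ℝ → ℝ) :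
    Prop where
  mem : ε ∈ D.posParams
  one_le : 1 ≤ j
  le : j ≤ k
  gap : ∀ i, 1 ≤ i → i + 1 < k → b i < a (i + 1)
  um_le : 1 < j → um ≤ a 1
  le_up : j < k → (b (k - 1) : EReal) ≤ up
  b_lt : 1 < j → b (j - 1) < u
  le_a : j < k → u ≤ a j
  pos : ∀ i, 1 ≤ i → i < k → ∀ σ, 0 < D.chordHgt (a i) (b i) (D.pt σ ε)
  std : ∀ i, 1 ≤ i → i < k → D.StdOnCh f (a i) (p i) (s i) B
  top : ∀ i, 1 ≤ i → i < k → s i (a i) = b i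
  contY : ∀ i, i < j → Continuous (Y i)
  contZ : ∀ i, j ≤ i → i ≤ k → Continuous (Z i)
  Y_left : ∀ i, 1 ≤ i → i < j → Y (i - 1) (a i) = D.chordβ f (a i) (b i)
  Y_right : ∀ i, 1 ≤ i → i < j → Y i (b i) = D.chordβ f (a i) (b i)
  Z_left : ∀ i, j ≤ i → i < k → Z i (a i) = D.chordβ f (a i) (b i)
  Z_right : ∀ i, j ≤ i → i < k → Z (i + 1) (b i) = D.chordβ f (a i) (b i)
  balance : Y (j - 1) u = Z j u
  cont : ContinuousOn B (D.chordalPart k a p s)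

namespace IsUnfolding

variable {k j i i' : ℕ} {um up : EReal} {a b p : ℕ → ℝ} {s Y Z : ℕ → ℝ → ℝ} {u : ℝ}
  {B : ℝ × ℝ → ℝ}

lemma lt (h : D.IsUnfolding f ε k j um up a b p s Y Z u B) (hi : 1 ≤ i) (hik : i < k) :
    a i < b i := by
  have := (h.std i hi hik).1
  rw [← h.top i hi hik]
  exact this.lt_right (left_mem_Ico.2 this.lt)

lemma cup (h : D.IsUnfolding f ε k j um up a b p s Y Z u B) (hi : 1 ≤ i) (hik : i < k) :
    D.cupDet f (a i) (b i) = 0 := by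
  have := (h.std i hi hik).1
  rw [← h.top i hi hik]
  exact this.cup _ (left_mem_Icc.2 this.lt.le)

lemma b_lt_a (h : D.IsUnfolding f ε k j um up a b p s Y Z u B) (hi : 1 ≤ i) (hii : i < i')
    (hk : i' < k) : b i < a i' := by
  induction i', hii using Nat.le_induction with
  | base => exact h.gap i hi hk
  | succ i' hii ih =>
    exact ((ih (by omega)).trans (h.lt (by omega) (by omega))).trans (h.gap i' (by omega) hk)

lemma b_lt_u (h : D.IsUnfolding f ε k j um up a b p s Y Z u B) (hi : 1 ≤ i) (hij : i < j) :
    b i < u := by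
  have hj := h.le
  rcases (show i ≤ j - 1 by omega).eq_or_lt with rfl | h'
  · exact h.b_lt (by omega)
  · exact ((h.b_lt_a hi h' (by omega)).trans (h.lt (by omega) (by omega))).trans
      (h.b_lt (by omega))

lemma u_le_a (h : D.IsUnfolding f ε k j um up a b p s Y Z u B) (hij : j ≤ i) (hik : i < k) :
    u ≤ a i := by
  have hj := h.one_le
  rcases hij.eq_or_lt with rfl | h'
  · exact h.le_a hik
  · exact ((h.le_a (by omega)).trans (h.lt hj (by omega)).le).trans (h.b_lt_a hj h' hik).le

lemma notMem_Ioo (h : D.IsUnfolding f ε k j um up a b p s Y Z u B) (hi : 1 ≤ i) (hik : i < k) :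
    u ∉ Ioo (a i) (b i) := fun hu => by
  rcases lt_or_ge i j with h' | h'
  · exact (h.b_lt_u hi h').not_gt hu.2
  · exact (h.u_le_a h' hik).not_gt hu.1

lemma isSlopeChain_right (h : D.IsUnfolding f ε k j um up a b p s Y Z u B) :
    D.IsSlopeChain f a b Y 0 (j - 1) := by
  have h1 := h.one_le
  have h2 := h.le
  exact ⟨fun i _ h4 => h.contY i (by omega), fun i h3 h4 => h.lt h3 (by omega),
    fun i h3 h4 => h.gap i h3 (by omega), fun i h3 h4 => h.cup h3 (by omega),
    fun i h3 h4 => h.Y_left i h3 (by omega), fun i h3 h4 => h.Y_right i h3 (by omega)⟩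

lemma isSlopeChain_left (h : D.IsUnfolding f ε k j um up a b p s Y Z u B) :
    D.IsSlopeChain f a b (fun i => Z (i + 1)) (j - 1) (k - j) := by
  have h1 := h.one_le
  have h2 := h.le
  refine ⟨fun i _ h4 => h.contZ _ (by omega) (by omega), fun i h3 h4 => h.lt (by omega) (by omega),
    fun i h3 h4 => h.gap i (by omega) (by omega), fun i h3 h4 => h.cup (by omega) (by omega),
    fun i h3 h4 => ?_, fun i h3 h4 => h.Z_right i (by omega) (by omega)⟩
  simpa only [Nat.sub_add_cancel (show 1 ≤ i by omega)] using h.Z_left i (by omega) (by omega)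

lemma rightVal_vertex (hD : D.IsAdmissible) (hf : D.IsRegular f)
    (h : D.IsUnfolding f ε k j um up a b p s Y Z u B) (x : ℝ × ℝ) :
    D.rightVal f ε j a b Y u x = D.fenceVal f (fun t => D.κR t ε) (Y (j - 1)) u x := by
  refine h.isSlopeChain_right.segVal_eq_fenceVal hD hf (hD.continuous_κR h.mem) (Nat.zero_le _)
    (by omega) ?_ (Or.inl (by omega))
  rcases Nat.eq_zero_or_pos (j - 1) with h' | h'
  · exact Or.inl h'
  · exact Or.inr (h.b_lt (by omega)).le

lemma leftVal_vertex (hD : D.IsAdmissible) (hf : D.IsRegular f)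
    (h : D.IsUnfolding f ε k j um up a b p s Y Z u B) (x : ℝ × ℝ) :
    D.leftVal f ε k j a b Z u x = D.fenceVal f (fun t => D.κL t ε) (Z j) u x := by
  have hj := h.one_le
  have hk := h.le
  have e : j - 1 + 1 = j := by omega
  have := h.isSlopeChain_left.segVal_eq_fenceVal (x := x) (t := u) (i := j - 1) hD hf
    (hD.continuous_κL h.mem) le_rfl (by omega) (Or.inl rfl)
    (by rw [e]; rcases hk.eq_or_lt with h' | h'
        · exact Or.inl (by omega)
        · exact Or.inr (h.le_a h'))
  rw [e] at this
  exact this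

/-- Two tangents on different sides that meet start at the vertex of the angle, and they meet
there. -/
lemma eq_u_of_mem (hD : D.IsAdmissible) (hε : ε ∈ D.posParams) {t t' : ℝ} (ht : t ≤ u)
    (ht' : u ≤ t') (hx : x ∈ segment ℝ (D.g t) (D.wR t ε))
    (hx' : x ∈ segment ℝ (D.g t') (D.wL t' ε)) : t = u ∧ t' = u ∧ x = D.g u := by
  obtain rfl := le_antisymm ht (hD.le_of_mem_cregR hε hx (hD.segL_subset_cregR hε ht' hx'))
  obtain rfl := le_antisymm ht' (hD.le_of_mem_cregL hε hx' (hD.segR_subset_cregL hε le_rfl hx))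
  have h1 := le_antisymm (hD.fst_le_of_mem_segR hε hx) (hD.le_fst_of_mem_segL hε hx')
  have h2 := hD.snd_of_mem_segR hε hx
  rw [h1, sub_self, mul_zero, sub_eq_zero] at h2
  exact ⟨rfl, rfl, Prod.ext h1 h2⟩

lemma rightVal_eq_leftVal (hD : D.IsAdmissible) (hf : D.IsRegular f)
    (h : D.IsUnfolding f ε k j um up a b p s Y Z u B) {t t' : ℝ} (ht : t ≤ u)
    (ht' : u ≤ t') (hx : x ∈ segment ℝ (D.g t) (D.wR t ε))
    (hx' : x ∈ segment ℝ (D.g t') (D.wL t' ε)) :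
    D.rightVal f ε j a b Y t x = D.leftVal f ε k j a b Z t' x := by
  obtain ⟨rfl, rfl, rfl⟩ := eq_u_of_mem hD h.mem ht ht' hx hx'
  rw [h.rightVal_vertex hD hf, h.leftVal_vertex hD hf, fenceVal_self, fenceVal_self]

lemma rightVal_eq_angVal (hD : D.IsAdmissible) (hf : D.IsRegular f)
    (h : D.IsUnfolding f ε k j um up a b p s Y Z u B) (ht : t ≤ u)
    (hx : x ∈ segment ℝ (D.g t) (D.wR t ε)) (hx' : x ∈ D.OmAng u ε) :
    D.rightVal f ε j a b Y t x = D.angVal f u (Z j u) x := by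
  obtain rfl := le_antisymm ht (hD.le_of_mem_cregR h.mem hx (hD.ang_subset_cregR h.mem u hx'))
  simp only [h.rightVal_vertex hD hf, angVal, fenceVal, hD.snd_of_mem_segR h.mem hx, h.balance]
  ring

lemma leftVal_eq_angVal (hD : D.IsAdmissible) (hf : D.IsRegular f)
    (h : D.IsUnfolding f ε k j um up a b p s Y Z u B) (ht : u ≤ t)
    (hx : x ∈ segment ℝ (D.g t) (D.wL t ε)) (hx' : x ∈ D.OmAng u ε) :
    D.leftVal f ε k j a b Z t x = D.angVal f u (Z j u) x := by
  obtain rfl := le_antisymm ht (hD.le_of_mem_cregL h.mem hx (hD.ang_subset_cregL h.mem u hx'))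
  simp only [h.leftVal_vertex hD hf, angVal, fenceVal, hD.snd_of_mem_segL h.mem hx]
  ring

/-- A point of a chordal domain that is not under the line of the top chord. -/
lemma top_of_mem (hD : D.IsAdmissible) (h : D.IsUnfolding f ε k j um up a b p s Y Z u B)
    (hi : 1 ≤ i) (hik : i < k) (hx : x ∈ D.OmCh (a i) (p i) (s i))
    (hx0 : 0 ≤ D.chordHgt (a i) (b i) x) :
    D.chordHgt (a i) (b i) x = 0 ∧ B x = D.chordVal f (a i) (b i) x := by
  have hs := h.std i hi hik
  have h1 := hs.1.chordHgt_neg_or hD hx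
  rw [h.top i hi hik] at h1
  have h2 := h1.resolve_left hx0.not_gt
  refine ⟨(D.isAffine₂_chordHgt _ _).eq_zero (IsAdmissible.chordHgt_left D _ _)
    (hD.chordHgt_right (h.lt hi hik)) h2, ?_⟩
  rw [hs.eq_chordVal hD (by rwa [h.top i hi hik]), h.top i hi hik]

lemma chordVal_end (hD : D.IsAdmissible) (h : D.IsUnfolding f ε k j um up a b p s Y Z u B)
    (hi : 1 ≤ i) (hik : i < k) (ht : t = a i ∨ t = b i) :
    D.chordVal f (a i) (b i) (D.g t) = f t := by
  rcases ht with rfl | rfl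
  · exact IsAdmissible.chordVal_left D f _ _
  · exact hD.chordVal_right (h.lt hi hik).ne (h.cup hi hik)

lemma rightVal_eq_of_mem_OmCh (hD : D.IsAdmissible) (hf : D.IsRegular f)
    (h : D.IsUnfolding f ε k j um up a b p s Y Z u B) (ht : t ≤ u)
    (hx : x ∈ segment ℝ (D.g t) (D.wR t ε))
    (hab : ∀ i, 1 ≤ i → i < j → x ∈ D.aboveChord (a i) (b i))
    (hi : 1 ≤ i) (hik : i < k) (hx' : x ∈ D.OmCh (a i) (p i) (s i)) :
    D.rightVal f ε j a b Y t x = B x := by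
  by_cases hI : t ∈ Ioo (a i) (b i)
  · have hij : i < j := by
      by_contra! h'
      exact (ht.trans (h.u_le_a h' hik)).not_gt hI.1
    rw [(h.top_of_mem hD hi hik hx' (mem_aboveChord.1 (hab i hi hij))).2]
    exact h.isSlopeChain_right.segVal_eq_chordVal hD hf (hD.continuous_κR h.mem) hi (by omega)
      hI.1.le hI.2.le (hD.snd_of_mem_segR h.mem hx)
  · have h1 := hD.chordHgt_of_mem_segment (h.lt hi hik) (h.pos i hi hik) hI hx
    obtain ⟨h2, h3⟩ := h.top_of_mem hD hi hik hx' h1.1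
    obtain ⟨rfl, h4⟩ := h1.2 h2.le
    rw [h3]
    rcases lt_or_ge i j with hij | hij
    · have h5 := (h.lt hi hik).le
      exact h.isSlopeChain_right.segVal_eq_chordVal hD hf (hD.continuous_κR h.mem) hi (by omega)
        (by rcases h4 with rfl | rfl <;> simp [h5]) (by rcases h4 with rfl | rfl <;> simp [h5])
        (hD.snd_of_mem_segR h.mem hx)
    · have h5 := h.u_le_a hij hik
      have h6 := h.lt hi hik
      obtain rfl : t = u := by rcases h4 with rfl | rfl <;> linarith
      rw [h.rightVal_vertex hD hf, fenceVal_self, h.chordVal_end hD hi hik h4]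

lemma leftVal_eq_of_mem_OmCh (hD : D.IsAdmissible) (hf : D.IsRegular f)
    (h : D.IsUnfolding f ε k j um up a b p s Y Z u B) (ht : u ≤ t)
    (hx : x ∈ segment ℝ (D.g t) (D.wL t ε))
    (hab : ∀ i, j ≤ i → i < k → x ∈ D.aboveChord (a i) (b i))
    (hi : 1 ≤ i) (hik : i < k) (hx' : x ∈ D.OmCh (a i) (p i) (s i)) :
    D.leftVal f ε k j a b Z t x = B x := by
  have hj := h.one_le
  by_cases hI : t ∈ Ioo (a i) (b i)
  · have hij : j ≤ i := by
      by_contra! h'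
      exact ((h.b_lt_u hi h').le.trans ht).not_gt hI.2
    rw [(h.top_of_mem hD hi hik hx' (mem_aboveChord.1 (hab i hij hik))).2]
    exact h.isSlopeChain_left.segVal_eq_chordVal hD hf (hD.continuous_κL h.mem) (by omega)
      (by omega) hI.1.le hI.2.le (hD.snd_of_mem_segL h.mem hx)
  · have h1 := hD.chordHgt_of_mem_segment (h.lt hi hik) (h.pos i hi hik) hI hx
    obtain ⟨h2, h3⟩ := h.top_of_mem hD hi hik hx' h1.1
    obtain ⟨rfl, h4⟩ := h1.2 h2.le
    rw [h3]
    have h6 := h.lt hi hik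
    have hij : j ≤ i := by
      by_contra! hij
      have h5 := h.b_lt_u hi hij
      rcases h4 with rfl | rfl <;> linarith
    exact h.isSlopeChain_left.segVal_eq_chordVal hD hf (hD.continuous_κL h.mem) (by omega)
      (by omega) (by rcases h4 with rfl | rfl <;> simp [h6.le])
      (by rcases h4 with rfl | rfl <;> simp [h6.le]) (hD.snd_of_mem_segL h.mem hx)

lemma angVal_eq_of_mem_OmCh (hD : D.IsAdmissible) (h : D.IsUnfolding f ε k j um up a b p s Y Z u B)
    (hx : x ∈ D.OmAng u ε) (hi : 1 ≤ i) (hik : i < k) (hx' : x ∈ D.OmCh (a i) (p i) (s i)) :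
    D.angVal f u (Z j u) x = B x := by
  have hI := h.notMem_Ioo hi hik
  have h0 := hD.chordHgt_g_nonneg (h.lt hi hik) hI
  have key := IsAdmissible.eq_of_mem_ang (D.isAffine₂_chordHgt (a i) (b i)) h0.1 (h.pos i hi hik _)
    (h.pos i hi hik _) hx
  have hx0 : 0 ≤ D.chordHgt (a i) (b i) x := by
    by_contra! hlt
    obtain ⟨rfl, h1⟩ := key hlt.le
    exact hlt.ne h1
  obtain ⟨h2, h3⟩ := h.top_of_mem hD hi hik hx' hx0
  obtain ⟨rfl, h4⟩ := key h2.le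
  rw [h3, h.chordVal_end hD hi hik (h0.2 h4)]
  simp [angVal, g]

end IsUnfolding

end CurveFamily

namespace CurveFamily

variable {D : CurveFamily} {f κ : ℝ → ℝ} {ε t : ℝ} {x : ℝ × ℝ}

lemma OmL_eq (D : CurveFamily) (p q : EReal) (ε : ℝ) : D.OmL p q ε =
    ⋃ t ∈ Neg.neg ⁻¹' eIcc p q, segment ℝ (D.g (-t)) (D.wL (-t) ε) := by
  ext x
  simp only [OmL, mem_iUnion, mem_preimage, exists_prop]
  exact ⟨fun ⟨t, h⟩ => ⟨-t, by rwa [neg_neg]⟩, fun ⟨t, h⟩ => ⟨-t, h⟩⟩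

lemma isClosed_aboveChord (D : CurveFamily) (a b : ℝ) : IsClosed (D.aboveChord a b) := by
  have : D.aboveChord a b = {x | 0 ≤ D.chordHgt a b x} := ext fun x => mem_aboveChord
  rw [this]
  exact isClosed_le continuous_const (D.isAffine₂_chordHgt a b).continuous

namespace IsUnfolding

variable {k j i : ℕ} {um up : EReal} {a b p : ℕ → ℝ} {s Y Z : ℕ → ℝ → ℝ} {u : ℝ}
  {B : ℝ × ℝ → ℝ}

lemma isClosed_chordalPart (hD : D.IsAdmissible) (h : D.IsUnfolding f ε k j um up a b p s Y Z u B) :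
    IsClosed (D.chordalPart k a p s) := by
  refine Set.Finite.isClosed_biUnion ((Set.finite_lt_nat k).subset fun i hi => hi.2) fun i hi => ?_
  exact ((h.std i hi.1 hi.2).1.isCompact_OmCh hD).isClosed

lemma closure_rightSide (hD : D.IsAdmissible) (hε : ε ∈ D.posParams)
    (hx : x ∈ closure (D.rightSide j a b um u ε)) (hxV : x ∈ D.regR ε t) :
    x ∈ D.rightSide j a b um u ε := by
  refine ⟨(hD.isFan_right hε).mem_of_mem_closure (isClosed_eIcc _ _) (u := u)
    (fun t ht => EReal.coe_le_coe_iff.1 ht.2) hxV (closure_mono inter_subset_left hx),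
    fun i h1 h2 => ?_⟩
  exact closure_minimal (fun y hy => hy.2 i h1 h2) (D.isClosed_aboveChord _ _) hx

lemma closure_leftSide (hD : D.IsAdmissible) (hε : ε ∈ D.posParams)
    (hx : x ∈ closure (D.leftSide k j a b up u ε)) (hxV : x ∈ D.regL ε t) :
    x ∈ D.leftSide k j a b up u ε := by
  refine ⟨?_, fun i h1 h2 =>
    closure_minimal (fun y hy => hy.2 i h1 h2) (D.isClosed_aboveChord _ _) hx⟩
  have hx' := closure_mono inter_subset_left hx
  rw [OmL_eq] at hx' ⊢
  exact (hD.isFan_left hε).mem_of_mem_closure ((isClosed_eIcc _ _).preimage continuous_neg)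
    (u := -u) (t' := -t) (fun t ht => le_neg_of_le_neg (EReal.coe_le_coe_iff.1 ht.1))
    (by rwa [neg_neg]) hx'

/-- Every point of the foliation is strictly to the right of some right tangent and strictly to
the left of some left tangent, and is not above the free boundary. -/
lemma exists_mem_reg (hD : D.IsAdmissible) (h : D.IsUnfolding f ε k j um up a b p s Y Z u B)
    (hx : x ∈ D.rightSide j a b um u ε ∪ D.OmAng u ε ∪ D.leftSide k j a b up u ε ∪
      D.chordalPart k a p s) :
    (∃ t, x ∈ D.regR ε t) ∧ (∃ t, x ∈ D.regL ε t) ∧ x ∉ D.Xi ε := by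
  have hε := h.mem
  rcases hx with ((hx | hx) | hx) | hx
  · obtain ⟨t, -, ht⟩ := mem_iUnion₂.1 hx.1
    exact ⟨⟨_, hD.segR_subset_regR hε (sub_one_lt t) ht⟩,
      ⟨_, hD.segR_subset_regL hε (lt_add_one t) ht⟩, hD.notMem_Xi_of_segR hε ht⟩
  · exact ⟨⟨_, hD.ang_subset_regR hε (sub_one_lt u) hx⟩,
      ⟨_, hD.ang_subset_regL hε (lt_add_one u) hx⟩, hx.2⟩
  · obtain ⟨t, -, ht⟩ := mem_iUnion₂.1 hx.1
    exact ⟨⟨_, hD.segL_subset_regR hε (sub_one_lt t) ht⟩,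
      ⟨_, hD.segL_subset_regL hε (lt_add_one t) ht⟩, hD.notMem_Xi_of_segL hε ht⟩
  · obtain ⟨i, hi, hx⟩ := mem_iUnion₂.1 hx
    have hs := (h.std i hi.1 hi.2).1
    refine ⟨⟨_, hs.OmCh_subset_regR hD hε (sub_one_lt _) hx⟩,
      ⟨_, hs.OmCh_subset_regL hD hε (lt_add_one _) hx⟩, hs.notMem_Xi hD hε ?_ hx⟩
    rw [h.top i hi.1 hi.2]
    exact h.pos i hi.1 hi.2

/-- The standard candidates on the subdomains of the foliation have a common continuous
extension. -/
lemma exists_glue (hD : D.IsAdmissible) (hf : D.IsRegular f)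
    (h : D.IsUnfolding f ε k j um up a b p s Y Z u B) :
    ∃ Bε : ℝ × ℝ → ℝ,
      ContinuousOn Bε (D.rightSide j a b um u ε ∪ D.OmAng u ε ∪ D.leftSide k j a b up u ε ∪
        D.chordalPart k a p s) ∧
      (∀ x ∈ D.rightSide j a b um u ε, ∀ t, x ∈ segment ℝ (D.g t) (D.wR t ε) →
        Bε x = D.rightVal f ε j a b Y t x) ∧
      (∀ x ∈ D.OmAng u ε, Bε x = D.angVal f u (Z j u) x) ∧
      (∀ x ∈ D.leftSide k j a b up u ε, ∀ t, x ∈ segment ℝ (D.g t) (D.wL t ε) →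
        Bε x = D.leftVal f ε k j a b Z t x) ∧
      ∀ x ∈ D.chordalPart k a p s, Bε x = B x := by
  have hε := h.mem
  have FR := hD.isFan_right hε
  have FL := hD.isFan_left hε
  set φR := fanVal D.g (fun t => D.wR t ε) (D.rightVal f ε j a b Y) with hφR
  set φL := fanVal (fun t => D.g (-t)) (fun t => D.wL (-t) ε)
    (fun t => D.leftVal f ε k j a b Z (-t)) with hφL
  have eR : ∀ x t, x ∈ segment ℝ (D.g t) (D.wR t ε) → φR x = D.rightVal f ε j a b Y t x :=
    fun x t ht => FR.fanVal_eq _ ht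
  have eL : ∀ x t, x ∈ segment ℝ (D.g t) (D.wL t ε) → φL x = D.leftVal f ε k j a b Z t x := by
    intro x t ht
    have := FL.fanVal_eq (t := -t) (x := x) (fun t => D.leftVal f ε k j a b Z (-t))
      (by simpa only [neg_neg] using ht)
    rwa [neg_neg] at this
  set P : Fin 4 → Set (ℝ × ℝ) := ![D.rightSide j a b um u ε, D.OmAng u ε,
    D.leftSide k j a b up u ε, D.chordalPart k a p s] with hP
  set φ : Fin 4 → ℝ × ℝ → ℝ := ![φR, D.angVal f u (Z j u), φL, B] with hφ
  have hU : ⋃ i, P i = D.rightSide j a b um u ε ∪ D.OmAng u ε ∪ D.leftSide k j a b up u ε ∪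
      D.chordalPart k a p s := by
    ext x
    simp [hP, Fin.exists_fin_succ, or_assoc]
  have hc : ∀ i, ContinuousOn (φ i) (P i) := by
    intro i
    fin_cases i
    · exact (FR.continuousOn (isClosed_eIcc _ _) (u := u)
        (fun t ht => EReal.coe_le_coe_iff.1 ht.2) (h.isSlopeChain_right.continuous_segVal hD hf
        (hD.continuous_κR hε))).mono inter_subset_left
    · change ContinuousOn (fun x => D.angVal f u (Z j u) x) _
      unfold angVal
      fun_prop
    · change ContinuousOn φL _
      refine ContinuousOn.mono (s := D.OmL u up ε) ?_ inter_subset_left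
      rw [OmL_eq]
      refine FL.continuousOn ((isClosed_eIcc _ _).preimage continuous_neg) (u := -u)
        (fun t ht => le_neg_of_le_neg (EReal.coe_le_coe_iff.1 ht.1)) ?_
      exact (h.isSlopeChain_left.continuous_segVal hD hf (hD.continuous_κL hε)).comp
        (continuous_fst.neg.prodMk continuous_snd)
    · exact h.cont
  have hcl : ∀ i, closure (P i) ∩ ⋃ j, P j ⊆ P i := by
    rintro i x ⟨hx, hxU⟩
    rw [hU] at hxU
    obtain ⟨⟨t, h1⟩, ⟨t', h2⟩, h3⟩ := h.exists_mem_reg hD hxU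
    fin_cases i
    · exact closure_rightSide hD hε hx h1
    · have hcv : IsClosed (convexHull ℝ ({D.g u, D.wR u ε, D.wL u ε} : Set (ℝ × ℝ))) :=
        (Set.toFinite _).isClosed_convexHull ℝ
      exact ⟨closure_minimal sdiff_subset hcv hx, h3⟩
    · exact closure_leftSide hD hε hx h2
    · exact (h.isClosed_chordalPart hD).closure_subset hx
  have mR : ∀ x ∈ D.rightSide j a b um u ε, ∃ t ≤ u, x ∈ segment ℝ (D.g t) (D.wR t ε) := by
    intro x hx
    obtain ⟨t, ht, hxt⟩ := mem_iUnion₂.1 hx.1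
    exact ⟨t, EReal.coe_le_coe_iff.1 ht.2, hxt⟩
  have mL : ∀ x ∈ D.leftSide k j a b up u ε, ∃ t ≥ u, x ∈ segment ℝ (D.g t) (D.wL t ε) := by
    intro x hx
    obtain ⟨t, ht, hxt⟩ := mem_iUnion₂.1 hx.1
    exact ⟨t, EReal.coe_le_coe_iff.1 ht.1, hxt⟩
  have h01 : ∀ x ∈ D.rightSide j a b um u ε, x ∈ D.OmAng u ε → φR x = D.angVal f u (Z j u) x := by
    intro x hx hx'
    obtain ⟨t, ht, hxt⟩ := mR x hx
    rw [eR x t hxt, h.rightVal_eq_angVal hD hf ht hxt hx']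
  have h02 : ∀ x ∈ D.rightSide j a b um u ε, x ∈ D.leftSide k j a b up u ε → φR x = φL x := by
    intro x hx hx'
    obtain ⟨t, ht, hxt⟩ := mR x hx
    obtain ⟨t', ht', hxt'⟩ := mL x hx'
    rw [eR x t hxt, eL x t' hxt', h.rightVal_eq_leftVal hD hf ht ht' hxt hxt']
  have h03 : ∀ x ∈ D.rightSide j a b um u ε, x ∈ D.chordalPart k a p s → φR x = B x := by
    intro x hx hx'
    obtain ⟨t, ht, hxt⟩ := mR x hx
    obtain ⟨i, hi, hxi⟩ := mem_iUnion₂.1 hx'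
    rw [eR x t hxt, h.rightVal_eq_of_mem_OmCh hD hf ht hxt hx.2 hi.1 hi.2 hxi]
  have h12 : ∀ x ∈ D.OmAng u ε, x ∈ D.leftSide k j a b up u ε → D.angVal f u (Z j u) x = φL x := by
    intro x hx hx'
    obtain ⟨t, ht, hxt⟩ := mL x hx'
    rw [eL x t hxt, h.leftVal_eq_angVal hD hf ht hxt hx]
  have h13 : ∀ x ∈ D.OmAng u ε, x ∈ D.chordalPart k a p s → D.angVal f u (Z j u) x = B x := by
    intro x hx hx'
    obtain ⟨i, hi, hxi⟩ := mem_iUnion₂.1 hx'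
    exact h.angVal_eq_of_mem_OmCh hD hx hi.1 hi.2 hxi
  have h23 : ∀ x ∈ D.leftSide k j a b up u ε, x ∈ D.chordalPart k a p s → φL x = B x := by
    intro x hx hx'
    obtain ⟨t, ht, hxt⟩ := mL x hx
    obtain ⟨i, hi, hxi⟩ := mem_iUnion₂.1 hx'
    rw [eL x t hxt, h.leftVal_eq_of_mem_OmCh hD hf ht hxt hx.2 hi.1 hi.2 hxi]
  obtain ⟨Bε, h1, h2⟩ := exists_continuousOn_glue P φ hc hcl (by
    intro i j x hx hx'
    fin_cases i <;> fin_cases j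
    · rfl
    · exact h01 x hx hx'
    · exact h02 x hx hx'
    · exact h03 x hx hx'
    · exact (h01 x hx' hx).symm
    · rfl
    · exact h12 x hx hx'
    · exact h13 x hx hx'
    · exact (h02 x hx' hx).symm
    · exact (h12 x hx' hx).symm
    · rfl
    · exact h23 x hx hx'
    · exact (h03 x hx' hx).symm
    · exact (h13 x hx' hx).symm
    · exact (h23 x hx' hx).symm
    · rfl)
  rw [hU] at h2
  exact ⟨Bε, h2, fun x hx t ht => (h1 0 hx).trans (eR x t ht), fun x hx => h1 1 hx,
    fun x hx t ht => (h1 2 hx).trans (eL x t ht), fun x hx => h1 3 hx⟩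

lemma mem_rightSide (hD : D.IsAdmissible) (h : D.IsUnfolding f ε k j um up a b p s Y Z u B)
    (ht : t ∈ eIcc um u) (hx : x ∈ segment ℝ (D.g t) (D.wR t ε))
    (hab : ∀ i, 1 ≤ i → i < j → t ∈ Ioo (a i) (b i) → x ∈ D.aboveChord (a i) (b i)) :
    x ∈ D.rightSide j a b um u ε := by
  refine ⟨mem_biUnion ht hx, fun i h1 h2 => ?_⟩
  have h3 := h.le
  by_cases hI : t ∈ Ioo (a i) (b i)
  · exact hab i h1 h2 hI
  · exact mem_aboveChord.2 (hD.chordHgt_of_mem_segment (h.lt h1 (by omega)) (h.pos i h1 (by omega))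
      hI hx).1

lemma mem_leftSide (hD : D.IsAdmissible) (h : D.IsUnfolding f ε k j um up a b p s Y Z u B)
    (ht : t ∈ eIcc u up) (hx : x ∈ segment ℝ (D.g t) (D.wL t ε))
    (hab : ∀ i, j ≤ i → i < k → t ∈ Ioo (a i) (b i) → x ∈ D.aboveChord (a i) (b i)) :
    x ∈ D.leftSide k j a b up u ε := by
  refine ⟨mem_biUnion ht hx, fun i h1 h2 => ?_⟩
  have h3 := h.one_le
  by_cases hI : t ∈ Ioo (a i) (b i)
  · exact hab i h1 h2 hI
  · exact mem_aboveChord.2 (hD.chordHgt_of_mem_segment (h.lt (by omega) h2)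
      (h.pos i (by omega) h2) hI hx).1

/-- The `i`-th interval of right tangents does not meet the open intervals under the chords. -/
lemma notMem_Ioo_of_gap (h : D.IsUnfolding f ε k j um up a b p s Y Z u B) {i' : ℕ}
    (h1 : i = 0 ∨ b i ≤ t) (h2 : i + 1 = k ∨ t ≤ a (i + 1)) (hi : i < k) (hi' : 1 ≤ i')
    (hik' : i' < k) : t ∉ Ioo (a i') (b i') := by
  rintro ⟨h3, h4⟩
  rcases lt_trichotomy i' i with hlt | rfl | hlt
  · have h5 := h1.resolve_left (by omega)
    have h6 := h.b_lt_a hi' hlt hi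
    have h7 := h.lt (i := i) (by omega) hi
    linarith
  · exact (h1.resolve_left (by omega)).not_gt h4
  · have h5 := h2.resolve_left (by omega)
    rcases (show i + 1 ≤ i' by omega).eq_or_lt with rfl | h6
    · linarith
    · have h7 := h.b_lt_a (i := i + 1) (by omega) h6 hik'
      have h8 := h.lt (i := i + 1) (by omega) (by omega)
      linarith

end IsUnfolding

end CurveFamily

namespace CurveFamily

variable {D : CurveFamily} {f κ : ℝ → ℝ} {ε t : ℝ} {x : ℝ × ℝ}

lemma IsStdR.congr {p q : EReal} {y y₁ y' : ℝ → ℝ} (h : D.IsStdR f ε p q y y')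
    (he : EqOn y y₁ (eIcc p q)) : D.IsStdR f ε p q y₁ y' :=
  ⟨fun t ht => (h.hasDeriv t ht).congr (fun _ hv => (he hv).symm) (he ht).symm,
    fun t ht => he ht ▸ h.ode t ht, h.nonpos, h.neg, h.infinite⟩

lemma IsStdL.congr {p q : EReal} {y y₁ y' : ℝ → ℝ} (h : D.IsStdL f ε p q y y')
    (he : EqOn y y₁ (eIcc p q)) : D.IsStdL f ε p q y₁ y' :=
  ⟨fun t ht => (h.hasDeriv t ht).congr (fun _ hv => (he hv).symm) (he ht).symm,
    fun t ht => he ht ▸ h.ode t ht, h.nonneg, h.pos, h.infinite⟩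

namespace IsUnfolding

section

variable {k j i : ℕ} {um up : EReal} {a b p : ℕ → ℝ} {s Y Z : ℕ → ℝ → ℝ} {u : ℝ}
  {B : ℝ × ℝ → ℝ}

lemma rightVal_of_gap (hD : D.IsAdmissible) (hf : D.IsRegular f)
    (h : D.IsUnfolding f ε k j um up a b p s Y Z u B) (hi : i < j)
    (h1 : if i = 0 then um ≤ t else b i ≤ t) (h2 : if i + 1 = j then t ≤ u else t ≤ a (i + 1))
    (hx : x ∈ segment ℝ (D.g t) (D.wR t ε)) :
    x ∈ D.rightSide j a b um u ε ∧
      D.rightVal f ε j a b Y t x = D.fenceVal f (fun τ => D.κR τ ε) (Y i) t x := by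
  have hjk := h.le
  have h1' : i = 0 ∨ b i ≤ t := by
    split_ifs at h1 with h0
    exacts [Or.inl h0, Or.inr h1]
  have h2' : i + 1 = k ∨ t ≤ a (i + 1) := by
    split_ifs at h2 with h0
    · subst h0
      rcases hjk.eq_or_lt with e | hlt
      exacts [Or.inl e, Or.inr (h2.trans (h.le_a hlt))]
    · exact Or.inr h2
  have h3 : um ≤ (t : EReal) := by
    split_ifs at h1 with h0
    · exact h1
    · refine (h.um_le (by omega)).trans (EReal.coe_le_coe_iff.2 (le_trans ?_ h1))
      rcases (show 1 ≤ i by omega).eq_or_lt with rfl | hlt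
      · exact (h.lt le_rfl (by omega)).le
      · exact (((h.lt le_rfl (by omega)).trans (h.b_lt_a le_rfl hlt (by omega))).trans
          (h.lt (by omega) (by omega))).le
  have h4 : t ≤ u := by
    split_ifs at h2 with h0
    · exact h2
    · exact h2.trans ((h.lt (by omega) (by omega)).le.trans (h.b_lt_u (by omega) (by omega)).le)
  refine ⟨h.mem_rightSide hD ⟨h3, EReal.coe_le_coe_iff.2 h4⟩ hx fun i' hi' hij' hI =>
    absurd hI (h.notMem_Ioo_of_gap h1' h2' (by omega) hi' (by omega)), ?_⟩
  refine h.isSlopeChain_right.segVal_eq_fenceVal hD hf (hD.continuous_κR h.mem) (Nat.zero_le _)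
    (by omega) h1' ?_
  split_ifs at h2 with h0
  exacts [Or.inl (by omega), Or.inr h2]

lemma leftVal_of_gap (hD : D.IsAdmissible) (hf : D.IsRegular f)
    (h : D.IsUnfolding f ε k j um up a b p s Y Z u B) (hji : j ≤ i) (hik : i ≤ k)
    (h1 : if i = j then u ≤ t else b (i - 1) ≤ t) (h2 : if i = k then t ≤ up else t ≤ a i)
    (hx : x ∈ segment ℝ (D.g t) (D.wL t ε)) :
    x ∈ D.leftSide k j a b up u ε ∧
      D.leftVal f ε k j a b Z t x = D.fenceVal f (fun τ => D.κL τ ε) (Z i) t x := by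
  have hj := h.one_le
  have hjk := h.le
  obtain ⟨i, rfl⟩ : ∃ m, i = m + 1 := ⟨i - 1, by omega⟩
  rw [Nat.add_sub_cancel] at h1
  have h1' : i = 0 ∨ b i ≤ t := by
    split_ifs at h1 with h0
    · subst h0
      rcases hj.eq_or_lt with e | hlt
      exacts [Or.inl (by omega), Or.inr ((h.b_lt hlt).le.trans h1)]
    · exact Or.inr h1
  have h2' : i + 1 = k ∨ t ≤ a (i + 1) := by
    split_ifs at h2 with h0
    exacts [Or.inl h0, Or.inr h2]
  have h3 : u ≤ t := by
    split_ifs at h1 with h0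
    · exact h1
    · exact ((h.u_le_a (by omega) (by omega)).trans (h.lt (by omega) (by omega)).le).trans h1
  have h4 : (t : EReal) ≤ up := by
    split_ifs at h2 with h0
    · exact h2
    · refine (EReal.coe_le_coe_iff.2 (h2.trans ?_)).trans (h.le_up (by omega))
      rcases (show i + 1 ≤ k - 1 by omega).eq_or_lt with e | hlt
      · rw [← e]
        exact (h.lt (by omega) (by omega)).le
      · exact (((h.lt (by omega) (by omega)).trans (h.b_lt_a (by omega) hlt (by omega))).trans
          (h.lt (by omega) (by omega))).le
  refine ⟨h.mem_leftSide hD ⟨EReal.coe_le_coe_iff.2 h3, h4⟩ hx fun i' hi' hij' hI =>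
    absurd hI (h.notMem_Ioo_of_gap h1' h2' (by omega) (by omega) (by omega)), ?_⟩
  refine h.isSlopeChain_left.segVal_eq_fenceVal hD hf (hD.continuous_κL h.mem) (by omega)
    (by omega) ?_ ?_
  · split_ifs at h1 with h0
    exacts [Or.inl (by omega), Or.inr h1]
  · exact h2'.imp (fun e => by omega) id

lemma rightVal_of_trolleybus (hD : D.IsAdmissible) (hf : D.IsRegular f)
    (h : D.IsUnfolding f ε k j um up a b p s Y Z u B) (hi : 1 ≤ i) (hij : i < j)
    (hx : x ∈ D.OmTrR (a i) (b i) ε) : x ∈ D.rightSide j a b um u ε ∧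
      ∃ t, x ∈ segment ℝ (D.g t) (D.wR t ε) ∧
        D.rightVal f ε j a b Y t x = D.chordVal f (a i) (b i) x := by
  have hjk := h.le
  obtain ⟨hx, hab⟩ := hx
  obtain ⟨t, ht, hx⟩ := mem_iUnion₂.1 hx
  rw [eIcc_coe] at ht
  have h1 := h.lt hi (by omega)
  refine ⟨h.mem_rightSide hD ⟨?_, EReal.coe_le_coe_iff.2 (ht.2.trans (h.b_lt_u hi hij).le)⟩ hx
    fun i' hi' hij' hI => ?_, t, hx, h.isSlopeChain_right.segVal_eq_chordVal hD hf
    (hD.continuous_κR h.mem) hi (by omega) ht.1 ht.2 (hD.snd_of_mem_segR h.mem hx)⟩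
  · refine (h.um_le (by omega)).trans (EReal.coe_le_coe_iff.2 (le_trans ?_ ht.1))
    rcases hi.eq_or_lt with rfl | hlt
    · exact le_rfl
    · exact ((h.lt le_rfl (by omega)).trans (h.b_lt_a le_rfl hlt (by omega))).le
  · rcases lt_trichotomy i i' with hlt | rfl | hlt
    · have := h.b_lt_a hi hlt (by omega)
      linarith [hI.1, ht.2]
    · exact hab
    · have := h.b_lt_a hi' hlt (by omega)
      linarith [hI.2, ht.1]

lemma leftVal_of_trolleybus (hD : D.IsAdmissible) (hf : D.IsRegular f)
    (h : D.IsUnfolding f ε k j um up a b p s Y Z u B) (hji : j ≤ i) (hik : i < k)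
    (hx : x ∈ D.OmTrL (a i) (b i) ε) : x ∈ D.leftSide k j a b up u ε ∧
      ∃ t, x ∈ segment ℝ (D.g t) (D.wL t ε) ∧
        D.leftVal f ε k j a b Z t x = D.chordVal f (a i) (b i) x := by
  have hj := h.one_le
  obtain ⟨hx, hab⟩ := hx
  obtain ⟨t, ht, hx⟩ := mem_iUnion₂.1 hx
  rw [eIcc_coe] at ht
  have h1 := h.lt (by omega) hik
  refine ⟨h.mem_leftSide hD ⟨EReal.coe_le_coe_iff.2 ((h.u_le_a hji hik).trans ht.1), ?_⟩ hx
    fun i' hi' hij' hI => ?_, t, hx, h.isSlopeChain_left.segVal_eq_chordVal hD hf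
    (hD.continuous_κL h.mem) (by omega) (by omega) ht.1 ht.2 (hD.snd_of_mem_segL h.mem hx)⟩
  · refine (EReal.coe_le_coe_iff.2 (ht.2.trans ?_)).trans (h.le_up (by omega))
    rcases (show i ≤ k - 1 by omega).eq_or_lt with rfl | hlt
    · exact le_rfl
    · exact ((h.b_lt_a (by omega) hlt (by omega)).trans (h.lt (by omega) (by omega))).le
  · rcases lt_trichotomy i i' with hlt | rfl | hlt
    · have := h.b_lt_a (by omega) hlt (by omega)
      linarith [hI.1, ht.2]
    · exact hab
    · have := h.b_lt_a (by omega) hlt (by omega)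
      linarith [hI.2, ht.1]

end

variable {k j : ℕ} {um up : ℝ → EReal} {a b : ℕ → ℝ → ℝ} {p : ℕ → ℝ} {s Y Z : ℕ → ℝ → ℝ} {u : ℝ}
  {B : ℝ × ℝ → ℝ}

/-- The glued function is a candidate on the foliation. -/
lemma exists_isFolCandidate (hD : D.IsAdmissible) (hf : D.IsRegular f)
    (h : D.IsUnfolding f ε k j (um ε) (up ε) (fun i => a i ε) (fun i => b i ε) p s Y Z u B)
    (hY : ∀ i < j, ∃ y',
      D.IsStdR f ε (bExt um b i ε) ((if i + 1 = j then u else a (i + 1) ε : ℝ) : EReal) (Y i) y')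
    (hZ : ∀ i, j ≤ i → i ≤ k → ∃ y',
      D.IsStdL f ε ((if i = j then u else b (i - 1) ε : ℝ) : EReal) (aExt k up a i ε) (Z i) y') :
    ∃ Bε, D.IsFolCandidate f k j um up a b p s u ε Bε ∧
      (∀ t : ℝ, um ε ≤ (t : EReal) → (t ≤ if j = 1 then u else a 1 ε) →
        ∀ x ∈ segment ℝ (D.g t) (D.wR t ε),
          Bε x = D.fenceVal f (fun τ => D.κR τ ε) (Y 0) t x) ∧
      (∀ t : ℝ, (t : EReal) ≤ up ε → (if j = k then u else b (k - 1) ε) ≤ t →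
        ∀ x ∈ segment ℝ (D.g t) (D.wL t ε),
          Bε x = D.fenceVal f (fun τ => D.κL τ ε) (Z k) t x) := by
  have hj := h.one_le
  have hjk := h.le
  obtain ⟨Bε, hc, hR, hA, hL, hC⟩ := h.exists_glue hD hf
  have gR : ∀ i < j, ∀ t : ℝ, bExt um b i ε ≤ (t : EReal) →
      (t : EReal) ≤ ((if i + 1 = j then u else a (i + 1) ε : ℝ) : EReal) →
      ∀ x ∈ segment ℝ (D.g t) (D.wR t ε), x ∈ D.rightSide j (fun i => a i ε) (fun i => b i ε)
        (um ε) u ε ∧ Bε x = D.fenceVal f (fun τ => D.κR τ ε) (Y i) t x := by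
    intro i hi t h1 h2 x hx
    have := h.rightVal_of_gap hD hf hi (t := t) (x := x)
      (by rw [bExt] at h1
          split_ifs at h1 ⊢
          exacts [h1, EReal.coe_le_coe_iff.1 h1])
      (by rw [EReal.coe_le_coe_iff] at h2
          split_ifs at h2 ⊢ <;> exact h2) hx
    exact ⟨this.1, (hR x this.1 t hx).trans this.2⟩
  have gL : ∀ i, j ≤ i → i ≤ k → ∀ t : ℝ,
      ((if i = j then u else b (i - 1) ε : ℝ) : EReal) ≤ (t : EReal) →
      (t : EReal) ≤ aExt k up a i ε →
      ∀ x ∈ segment ℝ (D.g t) (D.wL t ε), x ∈ D.leftSide k j (fun i => a i ε) (fun i => b i ε)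
        (up ε) u ε ∧ Bε x = D.fenceVal f (fun τ => D.κL τ ε) (Z i) t x := by
    intro i hi hik t h1 h2 x hx
    have := h.leftVal_of_gap hD hf hi hik (t := t) (x := x)
      (by rw [EReal.coe_le_coe_iff] at h1
          split_ifs at h1 ⊢ <;> exact h1)
      (by rw [aExt] at h2
          split_ifs at h2 ⊢
          exacts [h2, EReal.coe_le_coe_iff.1 h2]) hx
    exact ⟨this.1, (hL x this.1 t hx).trans this.2⟩
  have eR : ∀ i, i + 1 < j →
      aExt k up a (i + 1) ε = ((if i + 1 = j then u else a (i + 1) ε : ℝ) : EReal) := by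
    intro i hi
    rw [aExt, if_neg (by omega), if_neg (by omega)]
  have eR' : ((if j - 1 + 1 = j then u else a (j - 1 + 1) ε : ℝ) : EReal) = u := by
    rw [if_pos (by omega)]
  have eL : ∀ i, j ≤ i →
      bExt um b i ε = ((if i + 1 = j then u else b (i + 1 - 1) ε : ℝ) : EReal) := by
    intro i hi
    rw [bExt, if_neg (by omega), if_neg (by omega), Nat.add_sub_cancel]
  have eL' : ((if j = j then u else b (j - 1) ε : ℝ) : EReal) = u := by rw [if_pos rfl]
  have trR : ∀ i, 1 ≤ i → i < j → ∀ x ∈ D.OmTrR (a i ε) (b i ε) ε,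
      x ∈ D.rightSide j (fun i => a i ε) (fun i => b i ε) (um ε) u ε ∧
        Bε x = D.chordVal f (a i ε) (b i ε) x := by
    intro i h1 h2 x hx
    obtain ⟨h3, t, h4, h5⟩ := h.rightVal_of_trolleybus hD hf h1 h2 hx
    exact ⟨h3, (hR x h3 t h4).trans h5⟩
  have trL : ∀ i, j ≤ i → i < k → ∀ x ∈ D.OmTrL (a i ε) (b i ε) ε,
      x ∈ D.leftSide k j (fun i => a i ε) (fun i => b i ε) (up ε) u ε ∧
        Bε x = D.chordVal f (a i ε) (b i ε) x := by
    intro i h1 h2 x hx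
    obtain ⟨h3, t, h4, h5⟩ := h.leftVal_of_trolleybus hD hf h1 h2 hx
    exact ⟨h3, (hL x h3 t h4).trans h5⟩
  have stdR : ∀ i < j, D.StdOnR f ε (bExt um b i ε)
      ((if i + 1 = j then u else a (i + 1) ε : ℝ) : EReal) Bε := by
    intro i hi
    obtain ⟨y', hy⟩ := hY i hi
    exact ⟨_, Y i, y', hy, fun _ _ => rfl, fun t ht x hx => (gR i hi t ht.1 ht.2 x hx).2⟩
  have stdL : ∀ i, j ≤ i → i ≤ k → D.StdOnL f ε
      ((if i = j then u else b (i - 1) ε : ℝ) : EReal) (aExt k up a i ε) Bε := by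
    intro i hi hik
    obtain ⟨y', hy⟩ := hZ i hi hik
    exact ⟨_, Z i, y', hy, fun _ _ => rfl, fun t ht x hx => (gL i hi hik t ht.1 ht.2 x hx).2⟩
  refine ⟨Bε, ⟨hc.mono ?_, fun i hi => ?_, fun i h1 h2 => ?_, ?_, ?_, ?_, fun i h1 h2 => ?_,
    fun i h1 h2 => ?_, fun i h1 h2 => ⟨(h.std i h1 h2).1, fun t ht α hα => ?_⟩⟩,
    fun t h1 h2 x hx => ?_, fun t h1 h2 x hx => ?_⟩
  · refine union_subset (union_subset (union_subset (union_subset (union_subset (union_subset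
      (union_subset ?_ ?_) ?_) ?_) ?_) ?_) ?_) subset_union_right
    · refine iUnion₂_subset fun i hi => iUnion₂_subset fun t ht x hx => ?_
      rw [eR i hi] at ht
      have hi' : i + 1 < j := hi
      exact Or.inl (Or.inl (Or.inl (gR i (by omega) t ht.1 ht.2 x hx).1))
    · exact iUnion₂_subset fun i hi x hx => Or.inl (Or.inl (Or.inl (trR i hi.1 hi.2 x hx).1))
    · refine iUnion₂_subset fun t ht x hx => ?_
      rw [← eR'] at ht
      exact Or.inl (Or.inl (Or.inl (gR (j - 1) (by omega) t ht.1 ht.2 x hx).1))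
    · exact fun x hx => Or.inl (Or.inl (Or.inr hx))
    · refine iUnion₂_subset fun t ht x hx => ?_
      rw [← eL'] at ht
      exact Or.inl (Or.inr (gL j le_rfl hjk t ht.1 ht.2 x hx).1)
    · exact iUnion₂_subset fun i hi x hx => Or.inl (Or.inr (trL i hi.1 hi.2 x hx).1)
    · refine iUnion₂_subset fun i hi => iUnion₂_subset fun t ht x hx => ?_
      rw [eL i hi.1] at ht
      exact Or.inl (Or.inr (gL (i + 1) (hi.1.trans (Nat.le_succ i)) hi.2 t ht.1 ht.2 x hx).1)
  · rw [eR i hi]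
    exact stdR i (by omega)
  · have h3 := h.lt h1 (by omega)
    exact ⟨h3, hD.disjoint_of_chordHgt_pos h3 (h.pos i h1 (by omega)), fun x hx =>
      (linEq_iff hD h3.ne).2 (trR i h1 h2 x hx).2⟩
  · rw [← eR']
    exact stdR (j - 1) (by omega)
  · refine ⟨D.κ₃ f u - Z j u * D.κ₂ u, Z j u, ?_, fun x hx => hA x hx⟩
    rw [hD.deriv_g₂, IsRegular.deriv_eq (f := f) hD]
    ring
  · rw [← eL']
    exact stdL j le_rfl hjk
  · have h3 := h.lt (hj.trans h1) h2
    exact ⟨h3, hD.disjoint_of_chordHgt_pos h3 (h.pos i (hj.trans h1) h2), fun x hx =>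
      (linEq_iff hD h3.ne).2 (trL i h1 h2 x hx).2⟩
  · rw [eL i h1]
    exact stdL (i + 1) (by omega) h2
  · rw [hC _ (mem_biUnion (show i ∈ {i : ℕ | 1 ≤ i ∧ i < k} from ⟨h1, h2⟩) (mem_biUnion ht
      ⟨α, 1 - α, hα.1, sub_nonneg.2 hα.2, by ring, rfl⟩))]
    exact (h.std i h1 h2).2 t ht α hα
  · refine (gR 0 (by omega) t (by simpa [bExt] using h1) (EReal.coe_le_coe_iff.2 ?_) x hx).2
    simpa [eq_comm] using h2
  · refine (gL k hjk le_rfl t (EReal.coe_le_coe_iff.2 ?_) (by simpa [aExt] using h1) x hx).2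
    simpa [eq_comm] using h2

end IsUnfolding

end CurveFamily

/-! ### The unfolded multibirdie -/

lemma le_on_Icc_of_lt_on_Ico {T y : ℝ → ℝ} {a b : ℝ} (hT : Continuous T) (hy : Continuous y)
    (hab : a < b) (h : ∀ t ∈ Ico a b, T t < y t) : ∀ t ∈ Icc a b, T t ≤ y t := by
  have := closure_minimal (s := Ico a b) (t := {t | T t ≤ y t}) (fun t ht => (h t ht).le)
    (isClosed_le hT hy)
  rwa [closure_Ico hab.ne] at this

lemma le_on_Icc_of_lt_on_Ioc {T y : ℝ → ℝ} {a b : ℝ} (hT : Continuous T) (hy : Continuous y)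
    (hab : a < b) (h : ∀ t ∈ Ioc a b, T t < y t) : ∀ t ∈ Icc a b, T t ≤ y t := by
  have := closure_minimal (s := Ioc a b) (t := {t | T t ≤ y t}) (fun t ht => (h t ht).le)
    (isClosed_le hT hy)
  rwa [closure_Ioc hab.ne] at this

namespace CurveFamily

variable {D : CurveFamily} {f : ℝ → ℝ} {ε η₁ η₃ : ℝ}

section

variable {um up : ℝ → EReal} {F : ℝ → ℝ → ℝ} {y : ℝ → ℝ} {a v : ℝ}

/-- A right flow does not end before its solution meets `tors`, since its force vanishes at a
finite end. -/
lemma IsRightFlow.le_up (hD : D.IsAdmissible) (hf : D.IsRegular f)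
    (hE : Icc η₁ η₃ ⊆ D.posParams) (h : D.IsRightFlow f η₁ η₃ um up F) (hε : ε ∈ Icc η₁ η₃)
    (hy : IsRelax (D.tors f) (fun t => D.rateR η₁ η₃ t ε) y) (ha : a ∈ eIcc (um ε) (up ε))
    (hya : y a = D.tors f a - F a ε) (hlt : ∀ t ∈ Ico a v, D.tors f t < y t) :
    (v : EReal) ≤ up ε := by
  by_contra! hv
  obtain ⟨w, hw⟩ : ∃ w : ℝ, (w : EReal) = up ε :=
    ⟨(up ε).toReal, EReal.coe_toReal (hv.trans_le le_top).ne (h.up_ne_bot ε hε)⟩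
  have h1 := h.zero ε hε w hw.symm
  obtain ⟨_, _, _, _, h2⟩ := h.exists_eqOn hD hf hE hε hy ha hya
  have h3 := (h2 w ⟨hw ▸ h.um_le_up ε hε, hw.le⟩).2
  rw [← hw] at hv
  have h4 := hlt w ⟨EReal.coe_le_coe_iff.1 (hw ▸ ha.2), EReal.coe_lt_coe_iff.1 hv⟩
  linarith

/-- A left flow reaches at least as far as its solution stays above `tors`, since its force
vanishes at a finite end. -/
lemma IsLeftFlow.um_le (hD : D.IsAdmissible) (hf : D.IsRegular f)
    (hE : Icc η₁ η₃ ⊆ D.posParams) (h : D.IsLeftFlow f η₁ η₃ um up F) (hε : ε ∈ Icc η₁ η₃)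
    (hy : IsRise (D.tors f) (fun t => D.rateL η₁ η₃ t ε) y) (ha : a ∈ eIcc (um ε) (up ε))
    (hya : y a = D.tors f a - F a ε) (hlt : ∀ t ∈ Ioc v a, D.tors f t < y t) :
    um ε ≤ (v : EReal) := by
  by_contra! hv
  obtain ⟨w, hw⟩ : ∃ w : ℝ, (w : EReal) = um ε :=
    ⟨(um ε).toReal, EReal.coe_toReal (h.um_ne_top ε hε) (bot_le.trans_lt hv).ne'⟩
  have h1 := h.zero ε hε w hw.symm
  obtain ⟨_, _, _, _, h2⟩ := h.exists_eqOn hD hf hE hε hy ha hya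
  have h3 := (h2 w ⟨hw.ge, hw ▸ h.um_le_up ε hε⟩).2
  rw [← hw] at hv
  have h4 := hlt w ⟨EReal.coe_lt_coe_iff.1 hv, EReal.coe_le_coe_iff.1 (hw ▸ ha.1)⟩
  linarith

end

namespace IsBirdieSystem

variable {k : ℕ} {l r p : ℕ → ℝ} {b₀ : ℝ} {s : ℕ → ℝ → ℝ} {uRm uRp uLm uLp : ℝ → EReal}
  {𝔉R 𝔉L : ℝ → ℝ → ℝ} {Y Z : ℕ → ℝ → ℝ} {cR cL : ℕ → ℝ} {x y : ℝ} {a b : ℕ → ℝ → ℝ}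
  {B : ℝ × ℝ → ℝ}

/-- A solution of the balance equation yields a foliation and a candidate on it. -/
theorem exists_unfolding (hD : D.IsAdmissible) (hf : D.IsRegular f)
    (h : D.IsBirdieSystem f η₁ η₃ k l r b₀ p s uRm uRp uLm uLp 𝔉R 𝔉L) (hε : ε ∈ Icc η₁ η₃)
    (hY₀ : Y 0 (l 1) = D.tors f (l 1) - 𝔉R (l 1) ε)
    (hZk : Z k (r k) = D.tors f (r k) - 𝔉L (r k) ε)
    (bs : IsBalanceSystem (D.tors f) (fun t => D.rateR η₁ η₃ t ε) (fun t => D.rateL η₁ η₃ t ε) k l r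
      r p (fun _ c => c) s (fun i c => D.chordβ f c (s i c)) Y Z cR cL x y)
    (hx : uRm η₁ < x) (hy : (y : EReal) < uLp η₁)
    (hc : ∀ i, 1 ≤ i → i < k → max (cR i) (cL i) ∈ Ioo (r i) (p i))
    (ha : ∀ i, a i ε = max (cR i) (cL i)) (hb : ∀ i, b i ε = s i (a i ε))
    (hstd : ∀ i, 1 ≤ i → i < k → D.StdOnCh f (r i) (p i) (s i) B)
    (hBcont : ContinuousOn B (D.chordalPart k r p s)) :
    ∃ j : ℕ, 1 ≤ j ∧ j ≤ k ∧ ∃ u : ℝ,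
      bExt uRm b (j - 1) ε < (u : EReal) ∧ (u : EReal) ≤ aExt k uLp a j ε ∧
      ((u : EReal) ≤ if j = 1 then uRp ε else D.tailR f (a (j - 1) ε) (b (j - 1) ε) ε) ∧
      ((if j = k then uLm ε else D.tailL f (a j ε) (b j ε) ε) ≤ (u : EReal)) ∧
      ((if j = 1 then 𝔉R u ε else D.FR f (a (j - 1) ε) (b (j - 1) ε) ε u) =
        if j = k then 𝔉L u ε else D.FL f (a j ε) (b j ε) ε u) ∧
      ∃ Bε : ℝ × ℝ → ℝ, D.IsFolCandidate f k j uRm uLp a b p s u ε Bε ∧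
        (∃ c : ℝ, uRm ε < (c : EReal) ∧ (c ≤ if j = 1 then u else a 1 ε) ∧
          D.HasForceR f ε (uRm ε) c Bε (fun t => 𝔉R t ε)) ∧
        (∃ c : ℝ, (c : EReal) < uLp ε ∧ ((if j = k then u else b (k - 1) ε) ≤ c) ∧
          D.HasForceL f ε c (uLp ε) Bε (fun t => 𝔉L t ε)) := by
  have hE := h.sub
  have hεp := hE hε
  have hη := h.lt.le
  have h₁ : η₁ ∈ Icc η₁ η₃ := left_mem_Icc.2 hη
  have hT := hf.continuous_tors hD
  have hx' : uRm ε < x := (h.right.um_anti h₁ hε hε.1).trans_lt hx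
  have hy' : (y : EReal) < uLp ε := hy.trans_le (h.left.up_mono h₁ hε hε.1)
  have hmR := h.mem_right hε
  have hmL := h.mem_left hε
  obtain ⟨j, hj, hjk, hbefore, hafter, u, hbal, hlow, hupp, hltR, hltL⟩ := bs.exists_balance
  -- the positions of the chords
  have haI : ∀ i, 1 ≤ i → i < k → a i ε ∈ Ioo (r i) (p i) := fun i h1 h2 => by
    rw [ha]
    exact hc i h1 h2
  have haR : ∀ i, 1 ≤ i → i < j → a i ε = cR i := fun i h1 h2 => by
    rw [ha, max_eq_left (hbefore i h1 h2).le]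
  have haL : ∀ i, j ≤ i → i < k → a i ε = cL i := fun i h1 h2 => by
    rw [ha, max_eq_right (hafter i h1 h2)]
  have hbl : ∀ i, 1 ≤ i → i < k → b i ε ≤ l (i + 1) := fun i h1 h2 => by
    have h3 := h.chordal i h1 h2
    rw [hb, ← h.top i h1 h2]
    exact h3.anti.antitoneOn (left_mem_Icc.2 h3.lt.le) (Ioo_subset_Icc_self (haI i h1 h2))
      (haI i h1 h2).1.le
  have hab : ∀ i, 1 ≤ i → i < k → a i ε < b i ε := fun i h1 h2 => by
    rw [hb]
    exact (h.chordal i h1 h2).lt_right (Ioo_subset_Ico_self (haI i h1 h2))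
  have hlr := h.bird.le
  have hBj : 1 < j → b (j - 1) ε < u := fun h1 => by
    rw [if_neg (by omega)] at hlow
    rwa [hb, haR _ (by omega) (by omega)]
  have hAj : j < k → u ≤ a j ε := fun h1 => by
    rw [if_neg (by omega)] at hupp
    rwa [haL _ le_rfl h1]
  -- the solutions are above `tors`
  have posY : ∀ i < j, ∀ t ∈ Ico (l (i + 1)) (if i + 1 = j then u else a (i + 1) ε),
      D.tors f t < Y i t := by
    intro i hi t ht
    split_ifs at ht with h0
    · subst h0
      exact hltR t ht
    · rcases le_or_gt t (r (i + 1)) with h1 | h1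
      · exact bs.midY (i + 1) (by omega) (by omega) t ⟨ht.1, h1⟩
      · rw [haR _ (by omega) (by omega)] at ht
        exact bs.rightY (i + 1) (by omega) (by omega) t ⟨h1.le, ht.2.le⟩
  have posY' : ∀ i, 1 ≤ i → i < j → ∀ t ∈ Ico (b i ε) (if i + 1 = j then u else a (i + 1) ε),
      D.tors f t < Y i t := by
    intro i hi hij t ht
    rcases le_or_gt (l (i + 1)) t with h1 | h1
    · exact posY i hij t ⟨h1, ht.2⟩
    · refine bs.leftY i hi (by omega) t ⟨?_, h1.le⟩
      rw [← haR i hi hij, ← hb]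
      exact ht.1
  have posZ : ∀ i, j ≤ i → i ≤ k → ∀ t ∈ Ioc (if i = j then u else b (i - 1) ε) (r i),
      D.tors f t < Z i t := by
    intro i hi hik t ht
    split_ifs at ht with h0
    · subst h0
      exact hltL t ht
    · rcases le_or_gt (l i) t with h1 | h1
      · exact bs.midZ i (by omega) (by omega) t ⟨h1, ht.2⟩
      · have h2 := bs.leftZ (i - 1) (by omega) (by omega) t
        rw [Nat.sub_add_cancel (by omega)] at h2
        refine h2 ⟨?_, h1.le⟩
        rw [← haL _ (by omega) (by omega), ← hb]
        exact ht.1.le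
  have posZ' : ∀ i, j ≤ i → i < k → ∀ t ∈ Ioc (if i = j then u else b (i - 1) ε) (a i ε),
      D.tors f t < Z i t := by
    intro i hi hik t ht
    rcases le_or_gt t (r i) with h1 | h1
    · exact posZ i hi hik.le t ⟨ht.1, h1⟩
    · refine bs.rightZ i (by omega) hik t ⟨h1.le, ?_⟩
      rw [← haL i hi hik]
      exact ht.2
  have hltY : ∀ i, 1 ≤ i → i < j → b i ε < (if i + 1 = j then u else a (i + 1) ε) := by
    intro i hi hij
    split_ifs with h0
    · subst h0
      exact hBj (by omega)
    · exact ((hbl i hi (by omega)).trans (hlr _ (by omega) (by omega))).trans_lt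
        (haI _ (by omega) (by omega)).1
  have hltZ : ∀ i, j < i → i ≤ k → (i = k → b (i - 1) ε ≤ r i) ∧ (i < k → b (i - 1) ε < a i ε) := by
    intro i hi hik
    have h1 := hbl (i - 1) (by omega) (by omega)
    rw [Nat.sub_add_cancel (by omega)] at h1
    have h2 := h1.trans (hlr i (by omega) hik)
    exact ⟨fun _ => h2, fun h3 => h2.trans_lt (haI i (by omega) h3).1⟩
  -- the flows at the two ends
  obtain ⟨β, β', hβ1, hβ2, hβ3⟩ := h.right.exists_eqOn hD hf hE hε (bs.relax 0 (by omega))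
    (show l 1 ∈ eIcc _ _ from ⟨hmR.1.le, hmR.2⟩) hY₀
  obtain ⟨β₂, β₂', hβ₂1, hβ₂2, hβ₂3⟩ := h.left.exists_eqOn hD hf hE hε (bs.rise k (by omega) le_rfl)
    (show r k ∈ eIcc _ _ from ⟨hmL.1, hmL.2.le⟩) hZk
  have hup : ((if 0 + 1 = j then u else a (0 + 1) ε : ℝ) : EReal) ≤ uRp ε :=
    h.right.le_up hD hf hE hε (bs.relax 0 (by omega)) (show l 1 ∈ eIcc _ _ from ⟨hmR.1.le, hmR.2⟩)
      hY₀ (posY 0 (by omega))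
  have hdn : uLm ε ≤ ((if k = j then u else b (k - 1) ε : ℝ) : EReal) :=
    h.left.um_le hD hf hE hε (bs.rise k (by omega) le_rfl)
      (show r k ∈ eIcc _ _ from ⟨hmL.1, hmL.2.le⟩) hZk (posZ k hjk le_rfl)
  have hu0 : uRm ε < ((if 0 + 1 = j then u else a (0 + 1) ε : ℝ) : EReal) := by
    split_ifs with h0
    · rw [if_pos h0.symm] at hlow
      exact hx'.trans_le (EReal.coe_le_coe_iff.2 hlow)
    · exact hmR.1.trans (EReal.coe_lt_coe_iff.2 ((hlr 1 le_rfl (by omega)).trans_lt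
        (haI 1 le_rfl (by omega)).1))
  have huk : ((if k = j then u else b (k - 1) ε : ℝ) : EReal) < uLp ε := by
    split_ifs with h0
    · rw [if_pos h0.symm] at hupp
      exact (EReal.coe_le_coe_iff.2 hupp).trans_lt hy'
    · exact (EReal.coe_le_coe_iff.2 ((hltZ k (by omega) le_rfl).1 rfl)).trans_lt hmL.2
  have hY0std : D.IsStdR f ε (uRm ε) (uRp ε) (Y 0) β' := hβ1.congr hβ2
  have hZkstd : D.IsStdL f ε (uLm ε) (uLp ε) (Z k) β₂' := hβ₂1.congr hβ₂2
  have hYstd : ∀ i < j, ∃ y', D.IsStdR f ε (bExt uRm b i ε)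
      ((if i + 1 = j then u else a (i + 1) ε : ℝ) : EReal) (Y i) y' := by
    intro i hi
    rcases Nat.eq_zero_or_pos i with rfl | h0
    · exact ⟨β', hY0std.mono (by simp [bExt]) hup⟩
    · rw [bExt, if_neg (by omega)]
      refine ⟨_, IsStdR.of_isRelax hD hE hη hε (bs.relax i (by omega)) (EReal.coe_ne_bot _) ?_ ?_⟩
      · rw [eIcc_coe]
        exact le_on_Icc_of_lt_on_Ico hT (bs.relax i (by omega)).continuous (hltY i h0 hi)
          (posY' i h0 hi)
      · exact fun t h1 h2 => posY' i h0 hi t ⟨(EReal.coe_lt_coe_iff.1 h1).le,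
          EReal.coe_lt_coe_iff.1 h2⟩
  have hZstd : ∀ i, j ≤ i → i ≤ k → ∃ y', D.IsStdL f ε
      ((if i = j then u else b (i - 1) ε : ℝ) : EReal) (aExt k uLp a i ε) (Z i) y' := by
    intro i hi hik
    rcases hik.eq_or_lt with rfl | hik'
    · exact ⟨β₂', hZkstd.mono hdn (by simp [aExt])⟩
    · rw [show aExt k uLp a i ε = (a i ε : EReal) from if_neg hik'.ne]
      refine ⟨_, IsStdL.of_isRise hD hE hη hε (bs.rise i (by omega) hik) (EReal.coe_ne_top _) ?_ ?_⟩
      · rw [eIcc_coe]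
        intro t ht
        rcases ht.2.eq_or_lt with rfl | h2
        · refine (haL i hi hik').symm ▸ (bs.rightZ i (by omega) hik' _ ⟨?_, le_rfl⟩).le
          exact (bs.memL i (by omega) hik').1
        · exact le_on_Icc_of_lt_on_Ioc hT (bs.rise i (by omega) hik).continuous
            (ht.1.trans_lt h2) (posZ' i hi hik') t ht
      · exact fun t h1 h2 => posZ' i hi hik' t ⟨EReal.coe_lt_coe_iff.1 h1,
          (EReal.coe_lt_coe_iff.1 h2).le⟩
  -- the foliation
  have hU : D.IsUnfolding f ε k j (uRm ε) (uLp ε) (fun i => a i ε) (fun i => b i ε) p s Y Z u B := {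
    mem := hεp
    one_le := hj
    le := hjk
    gap := fun i h1 h2 => ((hbl i h1 (by omega)).trans (hlr _ (by omega) (by omega))).trans_lt
      (haI _ (by omega) (by omega)).1
    um_le := fun h1 => hmR.1.le.trans (EReal.coe_le_coe_iff.2 ((hlr 1 le_rfl (by omega)).trans
      (haI 1 le_rfl (by omega)).1.le))
    le_up := fun h1 => (EReal.coe_le_coe_iff.2 ((hltZ k h1 le_rfl).1 rfl)).trans hmL.2.le
    b_lt := hBj
    le_a := hAj
    pos := fun i h1 h2 σ => by
      have := (h.chordal i h1 h2).chordHgt_pt_pos hD hE (h.disjoint h1 h2) (haI i h1 h2) hε σ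
      rwa [← hb] at this
    std := fun i h1 h2 => by
      have h3 := haI i h1 h2
      exact ⟨(h.chordal i h1 h2).mono_left h3.1.le h3.2, fun t ht =>
        (hstd i h1 h2).2 t (Icc_subset_Icc_left h3.1.le ht)⟩
    top := fun i _ _ => (hb i).symm
    contY := fun i h1 => (bs.relax i (by omega)).continuous
    contZ := fun i h1 h2 => (bs.rise i (by omega) h2).continuous
    Y_left := fun i h1 h2 => by
      simp only [hb, haR i h1 h2]
      exact bs.YA i h1 (by omega)
    Y_right := fun i h1 h2 => by
      simp only [hb, haR i h1 h2]
      exact bs.YB i h1 (by omega)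
    Z_left := fun i h1 h2 => by
      simp only [hb, haL i h1 h2]
      exact bs.ZA i (by omega) h2
    Z_right := fun i h1 h2 => by
      simp only [hb, haL i h1 h2]
      exact bs.ZB i (by omega) h2
    balance := hbal
    cont := hBcont.mono (iUnion₂_mono fun i hi => biUnion_subset_biUnion_left
      (Icc_subset_Icc_left (haI i hi.1 hi.2).1.le)) }
  obtain ⟨Bε, hB, hBR, hBL⟩ := hU.exists_isFolCandidate hD hf hYstd hZstd
  have eR : (if j = 1 then u else a 1 ε) = if 0 + 1 = j then u else a (0 + 1) ε := by
    simp [eq_comm]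
  have eL : (if j = k then u else b (k - 1) ε) = if k = j then u else b (k - 1) ε := by
    simp [eq_comm]
  refine ⟨j, hj, hjk, u, ?_, ?_, ?_, ?_, ?_, Bε, hB, ⟨_, ?_, le_rfl, Y 0, β', ?_, ?_, ?_⟩,
    ⟨_, ?_, le_rfl, Z k, β₂', ?_, ?_, ?_⟩⟩
  · rcases hj.eq_or_lt with rfl | h1
    · simpa [bExt] using hu0
    · rw [bExt, if_neg (by omega)]
      exact EReal.coe_lt_coe_iff.2 (hBj h1)
  · rcases hjk.eq_or_lt with rfl | h1
    · simpa [aExt] using huk.le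
    · rw [aExt, if_neg (by omega)]
      exact EReal.coe_le_coe_iff.2 (hAj h1)
  · rcases hj.eq_or_lt with rfl | h1
    · simpa using hup
    · have h2 : j - 1 + 1 = j := by omega
      have h3 := posY' (j - 1) (by omega) (by omega)
      rw [if_pos h2] at h3
      rw [if_neg (by omega), tailR_eq hD hf hE hη hε (hab _ (by omega) (by omega)).ne
        (bs.relax (j - 1) (by omega)) (hU.Y_right (j - 1) (by omega) (by omega))]
      exact le_relaxTail_of (hBj h1).le (le_on_Icc_of_lt_on_Ico hT
        (bs.relax (j - 1) (by omega)).continuous (hBj h1) h3) fun t ht => h3 t ⟨ht.1.le, ht.2⟩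
  · rcases hjk.eq_or_lt with rfl | h1
    · simpa using hdn
    · have h3 := posZ' j le_rfl h1
      rw [if_pos rfl] at h3
      rw [if_neg (by omega), tailL_eq hD hf hE hη hε (hab _ hj h1).ne (bs.rise j hj hjk)
        (hU.Z_left j le_rfl h1)]
      refine EReal.neg_le_of_neg_le ?_
      rw [← EReal.coe_neg]
      refine le_relaxTail_of (neg_le_neg (hAj h1)) (fun t ht => ?_)
        fun t ht => h3 (-t) ⟨by linarith [ht.2], by linarith [ht.1]⟩
      rcases ht.1.eq_or_lt with rfl | h4
      · simp only [neg_neg, haL j le_rfl h1]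
        exact (bs.rightZ j hj h1 _ ⟨(bs.memL j hj h1).1, le_rfl⟩).le
      · exact le_on_Icc_of_lt_on_Ioc hT (bs.rise j hj hjk).continuous (by linarith [ht.2]) h3 (-t)
          ⟨by linarith [ht.2], by linarith⟩
  · have e1 : (if j = 1 then 𝔉R u ε else D.FR f (a (j - 1) ε) (b (j - 1) ε) ε u) =
        D.tors f u - Y (j - 1) u := by
      split_ifs with h0
      · subst h0
        exact (hβ3 u ⟨by simpa using hu0.le, by simpa using hup⟩).2
      · exact FR_eq hD hf hE hη hε (hab _ (by omega) (by omega)).ne (bs.relax (j - 1) (by omega))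
          (hU.Y_right (j - 1) (by omega) (by omega)) u
    have e2 : (if j = k then 𝔉L u ε else D.FL f (a j ε) (b j ε) ε u) = D.tors f u - Z j u := by
      split_ifs with h0
      · subst h0
        exact (hβ₂3 u ⟨by simpa using hdn, by simpa using huk.le⟩).2
      · exact FL_eq hD hf hE hη hε (hab _ (by omega) (by omega)).ne (bs.rise j hj hjk)
          (hU.Z_left j le_rfl (by omega)) u
    rw [e1, e2, hbal]
  · rw [eR]
    exact hu0
  · rw [eR]
    exact hY0std.mono le_rfl hup
  · rw [eR]
    exact fun t ht => (hβ3 t ⟨ht.1, ht.2.trans hup⟩).1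
  · exact fun t ht => hBR t ht.1 (EReal.coe_le_coe_iff.1 ht.2)
  · rw [eL]
    exact huk
  · rw [eL]
    exact hZkstd.mono hdn le_rfl
  · rw [eL]
    exact fun t ht => (hβ₂3 t ⟨hdn.trans ht.1, ht.2⟩).1
  · exact fun t ht => hBL t ht.2 (EReal.coe_le_coe_iff.1 ht.1)

end IsBirdieSystem

end CurveFamily

end

theorem mainTheorem12 (D : CurveFamily) (hD : D.IsAdmissible) (f : ℝ → ℝ) (hf : D.IsRegular f)
    (η₁ η₃ : ℝ) (hη₁ : 0 < η₁) (hη₁₃ : η₁ < η₃) (hη₃ : (η₃ : EReal) < D.epsMax)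
    -- the multibirdie over the intervals `[l i, r i]`, `1 ≤ i ≤ k`
    (k : ℕ) (l r : ℕ → ℝ) (hbird : D.IsMultibirdie k l r η₁)
    -- the right and left monotone force flows
    (uRm uRp uLm uLp : ℝ → EReal) (𝔉R 𝔉L : ℝ → ℝ → ℝ)
    (hR : D.IsRightFlow f η₁ η₃ uRm uRp 𝔉R) (hL : D.IsLeftFlow f η₁ η₃ uLm uLp 𝔉L)
    (hl : uRm η₁ < (l 1 : EReal) ∧ (l 1 : EReal) ≤ uRp η₁)
    (hr : uLm η₁ ≤ (r k : EReal) ∧ (r k : EReal) < uLp η₁)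
    -- the chordal domains with top chords `[g (r i), g (l (i + 1))]`
    (p : ℕ → ℝ) (s : ℕ → ℝ → ℝ)
    (htop : ∀ i, 1 ≤ i → i < k → s i (r i) = l (i + 1))
    -- the candidate for `ε = η₁`
    (B : ℝ × ℝ → ℝ)
    (hBcont : ContinuousOn B
      (D.OmR (uRm η₁) (l 1) η₁ ∪ D.OmMbird k l r η₁ ∪ D.OmL (r k) (uLp η₁) η₁ ∪
        ⋃ i ∈ {i : ℕ | 1 ≤ i ∧ i < k}, D.OmCh (r i) (p i) (s i)))
    (hBR : D.HasForceR f η₁ (uRm η₁) (l 1) B (fun t => 𝔉R t η₁))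
    (hBL : D.HasForceL f η₁ (r k) (uLp η₁) B (fun t => 𝔉L t η₁))
    (hBbird : D.StdOnMbird f k l r η₁ B)
    (hBch : ∀ i, 1 ≤ i → i < k → D.StdOnCh f (r i) (p i) (s i) B) :
    ∃ η₂ : ℝ, η₁ < η₂ ∧ η₂ < η₃ ∧ ∃ a b : ℕ → ℝ → ℝ,
      (∀ i, 1 ≤ i → i < k →
        StrictMonoOn (a i) (Icc η₁ η₂) ∧ StrictAntiOn (b i) (Icc η₁ η₂) ∧
        a i η₁ = r i ∧ b i η₁ = l (i + 1) ∧
        ∀ ε ∈ Icc η₁ η₂, a i ε ∈ Ico (r i) (p i) ∧ b i ε = s i (a i ε)) ∧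
      (∀ ε ∈ Ioc η₁ η₂, ∃ j : ℕ, 1 ≤ j ∧ j ≤ k ∧ ∃ u : ℝ,
        CurveFamily.bExt uRm b (j - 1) ε < (u : EReal) ∧
        (u : EReal) ≤ CurveFamily.aExt k uLp a j ε ∧
        -- `u` lies in the domains of the two neighbouring forces and solves the balance equation
        ((u : EReal) ≤ if j = 1 then uRp ε else D.tailR f (a (j - 1) ε) (b (j - 1) ε) ε) ∧
        ((if j = k then uLm ε else D.tailL f (a j ε) (b j ε) ε) ≤ (u : EReal)) ∧
        ((if j = 1 then 𝔉R u ε else D.FR f (a (j - 1) ε) (b (j - 1) ε) ε u) =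
          if j = k then 𝔉L u ε else D.FL f (a j ε) (b j ε) ε u) ∧
        ∃ Bε : ℝ × ℝ → ℝ, D.IsFolCandidate f k j uRm uLp a b p s u ε Bε ∧
          -- the force is `𝔉R` near the left end and `𝔉L` near the right end
          (∃ c : ℝ, uRm ε < (c : EReal) ∧ (c ≤ if j = 1 then u else a 1 ε) ∧
            D.HasForceR f ε (uRm ε) c Bε (fun t => 𝔉R t ε)) ∧
          (∃ c : ℝ, (c : EReal) < uLp ε ∧ ((if j = k then u else b (k - 1) ε) ≤ c) ∧
            D.HasForceL f ε c (uLp ε) Bε (fun t => 𝔉L t ε))) ∧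
      (∀ i, 1 ≤ i → i < k →
        D.IsRightFlow f η₁ η₂ (fun ε => (b i ε : EReal))
          (fun ε => D.tailR f (a i ε) (b i ε) ε)
          (fun t ε => D.FR f (a i ε) (b i ε) ε t) ∧
        D.IsLeftFlow f η₁ η₂ (fun ε => D.tailL f (a i ε) (b i ε) ε)
          (fun ε => (a i ε : EReal))
          (fun t ε => D.FL f (a i ε) (b i ε) ε t)) := by
  have hsys := CurveFamily.isBirdieSystem_of_candidate hD hf hη₁ hη₁₃ hη₃ hbird hR hL hl hr htop hBR
    hBL hBbird fun i h1 h2 => (hBch i h1 h2).1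
  obtain ⟨η₂, hη₂, cR, cL, Y, Z, x, y, hx, hy, hdesc, hbal⟩ := hsys.exists_balanceSystem hD hf
  -- each chord is the lower one of the two chords proposed by the right and by the left solutions
  have hc : ∀ i, 1 ≤ i → i < k → IsDescent (r i) (p i) η₁ η₂ fun ε => max (cR i ε) (cL i ε) :=
    fun i h1 h2 => (hdesc i h1 h2).1.max (hdesc i h1 h2).2
  refine ⟨η₂, hη₂.1, hη₂.2, fun i ε => max (cR i ε) (cL i ε),
    fun i ε => s i (max (cR i ε) (cL i ε)), fun i h1 h2 => ?_, fun ε hε => ?_, fun i h1 h2 => ?_⟩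
  · have h3 := hc i h1 h2
    have h4 : MapsTo (fun ε => max (cR i ε) (cL i ε)) (Icc η₁ η₂) (Icc (r i) (p i)) :=
      fun ε hε => Ico_subset_Icc_self (h3.mem ε hε)
    refine ⟨h3.mono, (hBch i h1 h2).1.anti.comp_strictMonoOn h3.mono h4, h3.init, ?_,
      fun ε hε => ⟨h3.mem ε hε, rfl⟩⟩
    exact (congrArg (s i) h3.init).trans (htop i h1 h2)
  · obtain ⟨hY, hZ, bs⟩ := hbal ε hε
    exact hsys.exists_unfolding hD hf ⟨hε.1.le, hε.2.trans hη₂.2.le⟩ hY hZ bs hx hy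
      (fun i h1 h2 => (hc i h1 h2).mem_Ioo hε) (fun _ => rfl) (fun _ => rfl) hBch
      (hBcont.mono subset_union_right)
  · have h3 := (hBch i h1 h2).1
    exact ⟨CurveFamily.isRightFlow_of_descent hD hf hsys.sub hη₂.1 hη₂.2.le h3 (hsys.disjoint h1 h2)
        (hc i h1 h2),
      CurveFamily.isLeftFlow_of_descent hD hf hsys.sub hη₂.1 hη₂.2.le h3 (hsys.disjoint h1 h2)
        (hc i h1 h2)⟩
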